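/- **Setting.** Let $b,d,\xi>0$, $s>\xi$, $\Omega=\{(x,y,z):|x|,|y|<b,\ -\xi<z<d\}$, $\Gamma=\{|x|,|y|<b,\ z=-\xi\}\subset\partial\Omega$, and $0<\underline k<\overline k$. All functions are complex valued, all Hilbert spaces are regarded as real ones (a complex function is the pair of its real and imaginary parts), and boundary values are understood in the sense of traces. For $m\ge 2$ let $H^m_0(\Omega)=\{f\in H^m(\Omega): f|_{\partial\Omega}=0,\ f_z|_\Gamma=0\}$. For $m\ge1$ let $H_m=L^2([\underline k,\overline k];H^m(\Omega))$, with norm $\|f\|_{H_m}^2=\int_{\underline k}^{\overline k}\|f(\cdot,k)\|^2_{H^m(\Omega)}dk$, and for $m\ge 2$ let $H_m^0$ be the subspace of those $f\in H_m$ with $f(\cdot,k)\in H^m_0(\Omega)$ for a.e. $k$. The scalar product of $H_3$ is $[\cdot,\cdot]$. For $\nu,\lambda>0$ put $\varphi_\lambda(z)=\exp\left[2\lambda(z+s)^{-\nu}\right]$ and $t_\nu=(s-\xi)^{-\nu}-(s+d)^{-\nu}$. **Tail function.** For $\delta\in(0,1)$ and $Q\in H^3(\Omega)$ put $\alpha=\delta$,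 $\mu=\ln(\delta^{-1/(2t_\nu)})$, and let $W$ be the minimizer over $H_0^3(\Omega)$ of $$W\mapsto e^{-2\mu(s+d)^{-\nu}}\int_\Omega|\Delta W+\Delta Q|^2\varphi_\mu(z)\,d\mathbf x+\alpha\|W+Q\|^2_{H^3(\Omega)}.$$ The regularized tail is $V=W+Q$. **Functional.** For $q\in H_3$ let $\nabla v=\nabla V-\int_k^{\overline k}\nabla q(\cdot,\kappa)\,d\kappa$ and $$L(q)=\Delta q+2k\,\nabla v\cdot(k\nabla q+\nabla v)+2i\Big(kq_z+V_z-\int_k^{\overline k}q_z(\cdot,\kappa)\,d\kappa\Big),$$ where the dot is the bilinear product. For $F\in H_4$ and $\lambda,\rho>0$ let, for $p\in H_3^0$, $$J_{\lambda,\rho}(p)=e^{-2\lambda(s+d)^{-\nu}}\int_{\underline k}^{\overline k}\int_\Omega|L(p+F)|^2\varphi_\lambda^2(z)\,d\mathbf x\,dk+\rho\|p\|^2_{H_3}.$$ **Theorem 4.3 (Global strict convexity).** There are numbers $\nu_0,\lambda_0\ge1$, depending only on $\Omega$ and $s$, such that the following holds for every fixed $\nu\ge\nu_0$. (a) There is $C>0$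 such that for all $\lambda\ge\lambda_0$ and all $u\in H_0^2(\Omega)$ $$\int_\Omega|\Delta u|^2\varphi_\lambda\,d\mathbf x\ge\frac C\lambda\sum_{i,j=1}^3\int_\Omega|u_{x_ix_j}|^2\varphi_\lambda\,d\mathbf x+C\lambda\int_\Omega|\nabla u|^2\varphi_\lambda\,d\mathbf x+C\lambda^3\int_\Omega|u|^2\varphi_\lambda\,d\mathbf x .$$ (b) Let $R>0$ and $M_F,M_V\ge 0$. There are $\lambda_1\ge\lambda_0$ and $C_1>0$, depending only on $\Omega,s,\nu,R,M_F,M_V,\underline k,\overline k$, with the following property. Let $\delta\in(0,1)$. Let $Q,Q_*,V_*\in H^3(\Omega)$ satisfy $Q=\psi_0$, $Q_z=\psi_1$ on $\Gamma$; $Q_*=V_*=\psi_{0*}$, $\partial_zQ_*=\partial_zV_*=\psi_{1*}$ on $\Gamma$; $Q=Q_*=V_*=0$ on $\partial\Omega\setminus\Gamma$; $\Delta V_*=0$ in $\Omega$; $\|Q-Q_*\|_{H^3(\Omega)}<\delta$; $\|V_*\|_{H^3(\Omega)}\le M_V$. Let $F,F_*\in H_4$ satisfy, for a.e. $k$, $F=\phi_0$,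 $F_z=\phi_1$ and $F_*=\phi_{0*}$, $\partial_zF_*=\phi_{1*}$ on $\Gamma$, and $F=F_*=0$ on $\partial\Omega\setminus\Gamma$; $\|F-F_*\|_{H_4}<\delta$; $\|F_*\|_{H_4}\le M_F$. (Here $\psi_0,\psi_1,\psi_{0*},\psi_{1*}$ and, for each $k$, $\phi_0,\phi_1,\phi_{0*},\phi_{1*}$ are arbitrary functions in $L^2(\Gamma)$.) Then the minimizer $W$ above exists and is unique, and with the tail $V=W+Q$ one has, for all $\rho>0$: 1. for every $\lambda>0$ the integral in $J_{\lambda,\rho}(p)$ converges for all $p\in H_3^0$, and $J_{\lambda,\rho}$ has a Fréchet derivative at every $p\in H_3^0$, represented by an element $J'_{\lambda,\rho}(p)\in H_3^0$ through $J'_{\lambda,\rho}(p)(h)=[J'_{\lambda,\rho}(p),h]$; 2. for every $\lambda\ge\lambda_1$ the functional $J_{\lambda,\rho}$ is strictly convex on the closed ball $\overline{B(R)}=\{p\in H_3^0:\|p\|_{H_3}\le R\}$, and for all $p_1,p_2\in\overline{B(R)}$ $$J_{\lambda,\rho}(p_2)-J_{\lambda,\rho}(p_1)-J'_{\lambda,\rho}(p_1)(p_2-p_1)\ge\frac{C_1}\lambda\|p_2-p_1\|^2_{H_2}+\rho\|p_2-p_1\|^2_{H_3},$$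 $$J_{\lambda,\rho}(p_2)-J_{\lambda,\rho}(p_1)-J'_{\lambda,\rho}(p_1)(p_2-p_1)\ge C_1\|p_2-p_1\|^2_{H_1}+\rho\|p_2-p_1\|^2_{H_3}.$$ -/

import Mathlib

open Set MeasureTheory
open scoped ContDiff

noncomputable section

namespace ConvexInverseScattering

/-- Points `(x, y, z)` of three-dimensional space, written with coordinates `x 0, x 1, x 2`.
Only the topology, the volume and the coordinate derivatives are used below. -/
abbrev Pt : Type := Fin 3 → ℝ

/-! ### Test functions and coordinate derivatives -/

/-- Smooth compactly supported real functions on the whole space. -/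
def IsTest (φ : Pt → ℝ) : Prop := ContDiff ℝ ∞ φ ∧ HasCompactSupport φ

/-- The classical partial derivative in the `i`-th coordinate. -/
def pd (i : Fin 3) (φ : Pt → ℝ) : Pt → ℝ := fun x => fderiv ℝ φ x (Pi.single i 1)

/-- The classical derivative `∂^α` for a multi-index `α`. -/
def pdMulti (α : Fin 3 → ℕ) (φ : Pt → ℝ) : Pt → ℝ :=
  (pd 0)^[α 0] ((pd 1)^[α 1] ((pd 2)^[α 2] φ))

theorem IsTest.pd {φ : Pt → ℝ} (h : IsTest φ) (i : Fin 3) : IsTest (pd i φ) := by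
  refine ⟨?_, h.2.fderiv_apply (𝕜 := ℝ) _⟩
  have h1 : ContDiff ℝ ∞ (fderiv ℝ φ) := h.1.fderiv_right (by simp)
  exact h1.clm_apply contDiff_const

theorem IsTest.iterate {φ : Pt → ℝ} (h : IsTest φ) (i : Fin 3) (n : ℕ) :
    IsTest ((ConvexInverseScattering.pd i)^[n] φ) := by
  induction n with
  | zero => exact h
  | succ n ih => rw [Function.iterate_succ_apply']; exact ih.pd i

theorem IsTest.pdMulti {φ : Pt → ℝ} (h : IsTest φ) (α : Fin 3 → ℕ) : IsTest (pdMulti α φ) :=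
  ((h.iterate 2 _).iterate 1 _).iterate 0 _

/-- Complex-valued `L²(Ω)`. It is used as a real Hilbert space throughout, a complex function being
identified with the pair of its real and imaginary parts. -/
abbrev L2 (Ω : Set Pt) : Type := Lp ℂ 2 (volume.restrict Ω)

theorem IsTest.integrable {φ : Pt → ℝ} (h : IsTest φ) {Ω : Set Pt} (u : L2 Ω) :
    Integrable (fun x => φ x • u x) (volume.restrict Ω) := by
  have h1 : MemLp φ 2 (volume.restrict Ω) :=
    h.1.continuous.memLp_of_hasCompactSupport h.2
  exact memLp_one_iff_integrable.1 ((Lp.memLp u).smul (r := 1) h1)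

theorem IsTest.integral_add {φ : Pt → ℝ} (h : IsTest φ) {Ω : Set Pt} (u v : L2 Ω) :
    ∫ x in Ω, φ x • (u + v : L2 Ω) x = (∫ x in Ω, φ x • u x) + ∫ x in Ω, φ x • v x := by
  rw [← MeasureTheory.integral_add (h.integrable u) (h.integrable v)]
  refine integral_congr_ae ?_
  filter_upwards [Lp.coeFn_add u v] with x hx
  rw [hx, Pi.add_apply, smul_add]

theorem IsTest.integral_smul {φ : Pt → ℝ} {Ω : Set Pt} (c : ℝ) (u : L2 Ω) :
    ∫ x in Ω, φ x • (c • u : L2 Ω) x = c • ∫ x in Ω, φ x • u x := by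
  rw [← MeasureTheory.integral_smul]
  refine integral_congr_ae ?_
  filter_upwards [Lp.coeFn_smul c u] with x hx
  rw [hx, Pi.smul_apply, smul_comm]

theorem IsTest.integral_zero {φ : Pt → ℝ} {Ω : Set Pt} :
    ∫ x in Ω, φ x • (0 : L2 Ω) x = 0 := by
  have := IsTest.integral_smul (φ := φ) (0 : ℝ) (0 : L2 Ω)
  simpa using this

/-! ### Sobolev spaces `H^m(Ω)` -/

/-- Multi-indices of order at most `m`. -/
def multiIdx (m : ℕ) : Finset (Fin 3 → ℕ) :=
  (Fintype.piFinset fun _ : Fin 3 => Finset.range (m + 1)).filter fun α => ∑ i, α i ≤ m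

theorem mem_multiIdx {m : ℕ} {α : Fin 3 → ℕ} : α ∈ multiIdx m ↔ ∑ i, α i ≤ m := by
  simp only [multiIdx, Finset.mem_filter, Fintype.mem_piFinset, Finset.mem_range,
    and_iff_right_iff_imp]
  intro h i
  exact Nat.lt_succ_of_le ((Finset.single_le_sum (f := α) (fun _ _ => Nat.zero_le _)
    (Finset.mem_univ i)).trans h)

theorem zero_mem_multiIdx (m : ℕ) : (0 : Fin 3 → ℕ) ∈ multiIdx m := by
  simp [mem_multiIdx]

theorem multiIdx_mono {m n : ℕ} (h : m ≤ n) : multiIdx m ⊆ multiIdx n := fun _ hα =>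
  mem_multiIdx.2 ((mem_multiIdx.1 hα).trans h)

/-- `v` is the weak derivative `∂^α u` in `Ω`. -/
def IsWeakDeriv (Ω : Set Pt) (α : Fin 3 → ℕ) (u v : L2 Ω) : Prop :=
  ∀ φ : Pt → ℝ, IsTest φ → tsupport φ ⊆ Ω →
    ∫ x in Ω, pdMulti α φ x • u x = (-1 : ℝ) ^ (∑ i, α i) • ∫ x in Ω, φ x • v x

/-- The families `(∂^α u)_{|α| ≤ m}` in `L²(Ω)` that consist of all the weak derivatives of order
at most `m` of one function `u`. -/
def sobSubmodule (Ω : Set Pt) (m : ℕ) : Submodule ℝ (PiLp 2 fun _ : multiIdx m => L2 Ω) where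
  carrier := {u | ∀ α : multiIdx m, IsWeakDeriv Ω α (u ⟨0, zero_mem_multiIdx m⟩) (u α)}
  add_mem' {u v} hu hv α φ hφ hs := by
    simp only [PiLp.add_apply]
    rw [hφ.integral_add, (hφ.pdMulti α).integral_add, hu α φ hφ hs, hv α φ hφ hs, smul_add]
  zero_mem' α φ hφ hs := by
    simp only [PiLp.zero_apply]
    rw [IsTest.integral_zero, IsTest.integral_zero, smul_zero]
  smul_mem' c u hu α φ hφ hs := by
    simp only [PiLp.smul_apply]
    rw [IsTest.integral_smul, IsTest.integral_smul, hu α φ hφ hs, smul_comm]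

/-- The Sobolev space `H^m(Ω)` of complex-valued functions: a function is stored together with
its weak derivatives of order at most `m`, all in `L²(Ω)`, and
`‖u‖² = ∑_{|α| ≤ m} ‖∂^α u‖²_{L²(Ω)}`. -/
def Sob (Ω : Set Pt) (m : ℕ) : Type := sobSubmodule Ω m

instance (Ω : Set Pt) (m : ℕ) : NormedAddCommGroup (Sob Ω m) :=
  inferInstanceAs (NormedAddCommGroup (sobSubmodule Ω m))

instance (Ω : Set Pt) (m : ℕ) : InnerProductSpace ℝ (Sob Ω m) :=
  inferInstanceAs (InnerProductSpace ℝ (sobSubmodule Ω m))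

/-- The weak derivative `∂^α u` of `u ∈ H^m(Ω)`, for `|α| ≤ m` (and `0` otherwise). -/
def wD {Ω : Set Pt} {m : ℕ} (u : Sob Ω m) (α : Fin 3 → ℕ) : L2 Ω :=
  if h : α ∈ multiIdx m then (show sobSubmodule Ω m from u).1 ⟨α, h⟩ else 0

/-- The first derivative `u_{x_i}`. -/
def wD1 {Ω : Set Pt} {m : ℕ} (u : Sob Ω m) (i : Fin 3) : L2 Ω := wD u (Pi.single i 1)

/-- The second derivative `u_{x_i x_j}`. -/
def wD2 {Ω : Set Pt} {m : ℕ} (u : Sob Ω m) (i j : Fin 3) : L2 Ω :=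
  wD u (Pi.single i 1 + Pi.single j 1)

/-- The Laplacian. -/
def lap {Ω : Set Pt} {m : ℕ} (u : Sob Ω m) : L2 Ω := ∑ i, wD2 u i i

theorem wD_zero {Ω : Set Pt} {m : ℕ} (α : Fin 3 → ℕ) : wD (0 : Sob Ω m) α = 0 := by
  unfold wD; split
  · rfl
  · simp

theorem wD_add {Ω : Set Pt} {m : ℕ} (u v : Sob Ω m) (α : Fin 3 → ℕ) :
    wD (u + v) α = wD u α + wD v α := by
  unfold wD; split
  · rfl
  · simp

theorem wD_smul {Ω : Set Pt} {m : ℕ} (c : ℝ) (u : Sob Ω m) (α : Fin 3 → ℕ) :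
    wD (c • u) α = c • wD u α := by
  unfold wD; split
  · rfl
  · simp

/-- The embedding `H^n(Ω) ⊂ H^m(Ω)` for `m ≤ n`. -/
def incl {Ω : Set Pt} {m n : ℕ} (h : m ≤ n) : Sob Ω n →L[ℝ] Sob Ω m :=
  LinearMap.mkContinuous
    { toFun := fun u => ⟨WithLp.toLp 2 fun α => u.1 ⟨α.1, multiIdx_mono h α.2⟩,
        fun α => u.2 ⟨α.1, multiIdx_mono h α.2⟩⟩
      map_add' := fun _ _ => rfl
      map_smul' := fun _ _ => rfl } 1 fun u => by
    rw [one_mul]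
    refine le_of_sq_le_sq ?_ (norm_nonneg _)
    change ‖WithLp.toLp 2 fun α : multiIdx m => u.1 ⟨α.1, multiIdx_mono h α.2⟩‖ ^ 2 ≤ ‖u.1‖ ^ 2
    rw [PiLp.norm_sq_eq_of_L2, PiLp.norm_sq_eq_of_L2]
    let e : multiIdx m ↪ multiIdx n :=
      ⟨fun α => ⟨α.1, multiIdx_mono h α.2⟩, fun a b hab => Subtype.ext (Subtype.mk.inj hab)⟩
    calc ∑ α : multiIdx m, ‖u.1 (e α)‖ ^ 2
        = ∑ β ∈ Finset.univ.map e, ‖u.1 β‖ ^ 2 := by rw [Finset.sum_map]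
      _ ≤ _ := Finset.sum_le_sum_of_subset_of_nonneg (Finset.subset_univ _)
          fun _ _ _ => sq_nonneg _

/-! ### The domain and the boundary conditions -/

/-- The domain `Ω = {|x|, |y| < b, -ξ < z < d}`. -/
def box (b ξ d : ℝ) : Set Pt := {x | |x 0| < b ∧ |x 1| < b ∧ -ξ < x 2 ∧ x 2 < d}

/-- The backscattering side `Γ = {|x|, |y| < b, z = -ξ}` of the boundary. -/
def Gam (b ξ : ℝ) : Set Pt := {x | |x 0| < b ∧ |x 1| < b ∧ x 2 = -ξ}

/-- The square `{|x|, |y| < b}` that parametrizes `Γ`. -/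
def square (b : ℝ) : Set (Fin 2 → ℝ) := {y | |y 0| < b ∧ |y 1| < b}

/-- `L²(Γ)`. -/
abbrev L2Gam (b : ℝ) : Type := Lp ℂ 2 (volume.restrict (square b))

/-- `∫_Γ φ g dσ`. -/
def gamInt (b ξ : ℝ) (φ : Pt → ℝ) (g : L2Gam b) : ℂ :=
  ∫ y in square b, φ ![y 0, y 1, -ξ] • g y

/-- `∫_Ω (u ∂_i φ + v φ) dx`. For `v = ∂_i u` this is the flux `∫_{∂Ω} u φ n_i dσ`, where `n` is
the outward unit normal. -/
def flux {Ω : Set Pt} (i : Fin 3) (φ : Pt → ℝ) (u v : L2 Ω) : ℂ :=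
  (∫ x in Ω, pd i φ x • u x) + ∫ x in Ω, φ x • v x

/-- The boundary conditions `u = g₀` and `u_z = g₁` on `Γ`, `u = 0` on `∂Ω \ Γ`, for `u ∈ H^m(Ω)`
with `m ≥ 2`, in the sense of traces. A trace is determined by Green's formula
`∫_Ω (u ∂_i φ + u_{x_i} φ) dx = ∫_{∂Ω} u φ n_i dσ`, where `n = (0, 0, -1)` on `Γ`; the condition on
`u_z` concerns `Γ` only, so that its test functions vanish near the rest of the boundary. -/
def HasBoundaryData (b ξ d : ℝ) {m : ℕ} (u : Sob (box b ξ d) m) (g₀ g₁ : L2Gam b) : Prop :=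
  (∀ φ : Pt → ℝ, IsTest φ → ∀ i : Fin 3,
    flux i φ (wD u 0) (wD1 u i) = if i = 2 then -gamInt b ξ φ g₀ else 0) ∧
  (∀ φ : Pt → ℝ, IsTest φ → Disjoint (tsupport φ) (frontier (box b ξ d) \ Gam b ξ) →
    flux 2 φ (wD1 u 2) (wD2 u 2 2) = -gamInt b ξ φ g₁)

theorem gamInt_zero (b ξ : ℝ) (φ : Pt → ℝ) : gamInt b ξ φ 0 = 0 := by
  unfold gamInt
  refine integral_eq_zero_of_ae ?_
  filter_upwards [Lp.coeFn_zero ℂ 2 (volume.restrict (square b))] with y hy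
  rw [hy]; simp

theorem flux_add {Ω : Set Pt} (i : Fin 3) {φ : Pt → ℝ} (h : IsTest φ) (u v u' v' : L2 Ω) :
    flux i φ (u + u') (v + v') = flux i φ u v + flux i φ u' v' := by
  unfold flux
  rw [h.integral_add, (h.pd i).integral_add]; ring

theorem flux_smul {Ω : Set Pt} (i : Fin 3) {φ : Pt → ℝ} (c : ℝ) (u v : L2 Ω) :
    flux i φ (c • u) (c • v) = c • flux i φ u v := by
  unfold flux
  rw [IsTest.integral_smul, IsTest.integral_smul, smul_add]

theorem flux_zero {Ω : Set Pt} (i : Fin 3) {φ : Pt → ℝ} : flux i φ (0 : L2 Ω) 0 = 0 := by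
  unfold flux
  rw [IsTest.integral_zero, IsTest.integral_zero, add_zero]

/-- `H_0^m(Ω) = {u ∈ H^m(Ω) : u = 0 on ∂Ω, u_z = 0 on Γ}`, for `m ≥ 2`. -/
def Sob0 (b ξ d : ℝ) (m : ℕ) : Submodule ℝ (Sob (box b ξ d) m) where
  carrier := {u | HasBoundaryData b ξ d u 0 0}
  add_mem' {u v} hu hv := by
    refine ⟨fun φ hφ i => ?_, fun φ hφ hs => ?_⟩
    · have h1 := hu.1 φ hφ i
      have h2 := hv.1 φ hφ i
      simp only [gamInt_zero, neg_zero, ite_self, wD1] at h1 h2 ⊢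
      rw [wD_add, wD_add, flux_add i hφ, h1, h2, add_zero]
    · have h1 := hu.2 φ hφ hs
      have h2 := hv.2 φ hφ hs
      simp only [gamInt_zero, neg_zero, wD1, wD2] at h1 h2 ⊢
      rw [wD_add, wD_add, flux_add 2 hφ, h1, h2, add_zero]
  zero_mem' := by
    refine ⟨fun φ hφ i => ?_, fun φ hφ hs => ?_⟩ <;>
    simp only [gamInt_zero, neg_zero, ite_self, wD1, wD2, wD_zero, flux_zero]
  smul_mem' c u hu := by
    refine ⟨fun φ hφ i => ?_, fun φ hφ hs => ?_⟩
    · have h1 := hu.1 φ hφ i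
      simp only [gamInt_zero, neg_zero, ite_self, wD1] at h1 ⊢
      rw [wD_smul, wD_smul, flux_smul, h1, smul_zero]
    · have h1 := hu.2 φ hφ hs
      simp only [gamInt_zero, neg_zero, wD1, wD2] at h1 ⊢
      rw [wD_smul, wD_smul, flux_smul, h1, smul_zero]

/-! ### The spaces of functions of `(x, k)` -/

/-- `H_m`, the space `L²` over the wavenumbers `k ∈ [k₀, k₁]` with values in `H^m(Ω)`. -/
abbrev Hk (Ω : Set Pt) (k₀ k₁ : ℝ) (m : ℕ) : Type :=
  Lp (Sob Ω m) 2 (volume.restrict (Icc k₀ k₁))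

/-- The embedding `H_n ⊂ H_m` for `m ≤ n`. -/
def kincl {Ω : Set Pt} {k₀ k₁ : ℝ} {m n : ℕ} (h : m ≤ n) : Hk Ω k₀ k₁ n →L[ℝ] Hk Ω k₀ k₁ m :=
  (incl h).compLpL 2 (volume.restrict (Icc k₀ k₁))

/-- `H_m^0 = {f ∈ H_m : f = 0 on ∂Ω, f_z = 0 on Γ, for almost every k ∈ [k₀, k₁]}`. -/
def Hk0 (b ξ d k₀ k₁ : ℝ) (m : ℕ) : Submodule ℝ (Hk (box b ξ d) k₀ k₁ m) where
  carrier := {f | ∀ᵐ k ∂(volume.restrict (Icc k₀ k₁)), f k ∈ Sob0 b ξ d m}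
  add_mem' {f g} hf hg := by
    filter_upwards [hf, hg, Lp.coeFn_add f g] with k h1 h2 h3
    rw [h3]; exact (Sob0 b ξ d m).add_mem h1 h2
  zero_mem' := by
    filter_upwards [Lp.coeFn_zero (Sob (box b ξ d) m) 2 (volume.restrict (Icc k₀ k₁))] with k h
    rw [h]; exact (Sob0 b ξ d m).zero_mem
  smul_mem' c f hf := by
    filter_upwards [hf, Lp.coeFn_smul c f] with k h1 h3
    rw [h3]; exact (Sob0 b ξ d m).smul_mem c h1

/-! ### Carleman weight, Carleman estimate, tail functional -/

/-- The Carleman weight function `φ_λ(z) = exp(2 λ (z + s)^{-ν})`. -/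
def cwf (s ν lam z : ℝ) : ℝ := Real.exp (2 * lam * (z + s) ^ (-ν))

/-- The Carleman estimate for the Laplacian on `H_0^2(Ω)` with the weight `φ_λ`, for all `λ ≥ λ₀`
with a constant `C` independent of `λ`. -/
def CarlemanEstimate (b ξ d s ν lam₀ : ℝ) : Prop :=
  ∃ C : ℝ, 0 < C ∧ ∀ lam : ℝ, lam₀ ≤ lam → ∀ u ∈ Sob0 b ξ d 2,
    C / lam * ∑ i : Fin 3, ∑ j : Fin 3,
        (∫ x in box b ξ d, ‖wD2 u i j x‖ ^ 2 * cwf s ν lam (x 2)) +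
      C * lam * ∑ i : Fin 3, (∫ x in box b ξ d, ‖wD1 u i x‖ ^ 2 * cwf s ν lam (x 2)) +
      C * lam ^ 3 * (∫ x in box b ξ d, ‖wD u 0 x‖ ^ 2 * cwf s ν lam (x 2)) ≤
    ∫ x in box b ξ d, ‖lap u x‖ ^ 2 * cwf s ν lam (x 2)

/-- `t_ν = (s - ξ)^{-ν} - (s + d)^{-ν}`. -/
def tnu (ξ d s ν : ℝ) : ℝ := (s - ξ) ^ (-ν) - (s + d) ^ (-ν)

/-- The tail functional
`W ↦ exp(-2 μ (s + d)^{-ν}) ∫_Ω |ΔW + ΔQ|² φ_μ dx + α ‖W + Q‖²_{H³(Ω)}` on `H_0^3(Ω)`. -/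
def tailFunctional (b ξ d s ν mu α : ℝ) (Q : Sob (box b ξ d) 3) (W : Sob0 b ξ d 3) : ℝ :=
  Real.exp (-2 * mu * (s + d) ^ (-ν)) *
      (∫ x in box b ξ d, ‖lap W.1 x + lap Q x‖ ^ 2 * cwf s ν mu (x 2)) +
    α * ‖W.1 + Q‖ ^ 2

/-- `W` minimizes the tail functional over `H_0^3(Ω)` with the choice `α = δ`,
`μ = ln(δ^{-1/(2 t_ν)})` of its parameters. The regularized tail is then `V = W + Q`. -/
def IsTailMinimizer (b ξ d s ν δ : ℝ) (Q : Sob (box b ξ d) 3) (W : Sob0 b ξ d 3) : Prop :=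
  IsMinOn (tailFunctional b ξ d s ν (Real.log (δ ^ (-1 / (2 * tnu ξ d s ν)))) δ Q) univ W

/-! ### The nonlinear integro-differential operator and the weighted functional -/

/-- `∇V - ∫_k^{k₁} ∇q(·, κ) dκ`, the `i`-th component, as an element of `L²(Ω)`. -/
def gradv {Ω : Set Pt} {k₀ k₁ : ℝ} (V : Sob Ω 3) (q : Hk Ω k₀ k₁ 3) (k : ℝ) (i : Fin 3) : L2 Ω :=
  wD1 V i - ∫ κ in k..k₁, wD1 (q κ) i

/-- The operator
`L(q) = Δq + 2k (∇V - ∫_k^{k₁} ∇q dκ) · (k ∇q + ∇V - ∫_k^{k₁} ∇q dκ)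
  + 2i (k q_z + V_z - ∫_k^{k₁} q_z dκ)`
at the point `(x, k)`. The dot is the bilinear product of complex vectors. -/
def opL {Ω : Set Pt} {k₀ k₁ : ℝ} (V : Sob Ω 3) (q : Hk Ω k₀ k₁ 3) (k : ℝ) (x : Pt) : ℂ :=
  lap (q k) x +
    2 * (k : ℂ) * ∑ i : Fin 3, gradv V q k i x * ((k : ℂ) * wD1 (q k) i x + gradv V q k i x) +
    2 * Complex.I * ((k : ℂ) * wD1 (q k) 2 x + gradv V q k 2 x)

/-- The integrand `|L(p + F)(x, k)|² φ_λ(z)²` of the weighted functional. -/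
def integrandJ (b ξ d s ν k₀ k₁ lam : ℝ) (V : Sob (box b ξ d) 3) (F : Hk (box b ξ d) k₀ k₁ 4)
    (p : Hk0 b ξ d k₀ k₁ 3) (k : ℝ) (x : Pt) : ℝ :=
  ‖opL V (p.1 + kincl (by norm_num) F) k x‖ ^ 2 * cwf s ν lam (x 2) ^ 2

/-- The weighted Tikhonov-like functional
`J(p) = exp(-2 λ (s + d)^{-ν}) ∫_{k₀}^{k₁} ∫_Ω |L(p + F)|² φ_λ² dx dk + ρ ‖p‖²_{H_3}`
on `H_3^0`. -/
def J (b ξ d s ν k₀ k₁ lam ρ : ℝ) (V : Sob (box b ξ d) 3) (F : Hk (box b ξ d) k₀ k₁ 4)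
    (p : Hk0 b ξ d k₀ k₁ 3) : ℝ :=
  Real.exp (-2 * lam * (s + d) ^ (-ν)) *
      (∫ k in Icc k₀ k₁, ∫ x in box b ξ d, integrandJ b ξ d s ν k₀ k₁ lam V F p k x) +
    ρ * ‖p‖ ^ 2

/-- The double integral in the weighted functional converges. -/
def IntegralConverges (b ξ d s ν k₀ k₁ lam : ℝ) (V : Sob (box b ξ d) 3)
    (F : Hk (box b ξ d) k₀ k₁ 4) (p : Hk0 b ξ d k₀ k₁ 3) : Prop :=
  (∀ᵐ k ∂(volume.restrict (Icc k₀ k₁)),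
    IntegrableOn (integrandJ b ξ d s ν k₀ k₁ lam V F p k) (box b ξ d)) ∧
  IntegrableOn (fun k => ∫ x in box b ξ d, integrandJ b ξ d s ν k₀ k₁ lam V F p k x) (Icc k₀ k₁)

end ConvexInverseScattering

end

open ConvexInverseScattering

noncomputable section

namespace ConvexInverseScattering

open Filter Topology

/-! ### Calculus with coordinate derivatives -/

/-! The theorem rests on a Carleman estimate for the Laplacian, on product estimates in which a
power of λ makes every lower order term small, and on the exact second order expansion of a
functional built from a quadratic map.

Carleman estimate (`carleman_smooth`, `carlemanEstimate_one`). The exponent ψ = (z + s)^(-ν) is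
decreasing and convex for z > -s. Let u be smooth, zero on the faces of a box, with u_z = 0 on the
lower face; put w = e^(λψ) u and a = -ψ'. Then e^(λψ) Δu = Δw + 2λ a w_z + (λ² a² + λ a') w, and its
square is at least 4λ a w_z (Δw + (λ² a² + λ a') w). Divide by a and integrate. The integral of w_z
Δw is nonnegative, because its only boundary term is a square on the upper face. The other product
yields λ³ ∫ w², because the zero order coefficient decreases in z for large λ. Pairing with w then
gives the gradient, and ∫ |D²w|² = ∫ |Δw|² gives the second derivatives. For u in H_0^2 the function
is extended oddly across every face except Γ and by zero beyond Γ, and mollified with an even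
kernel. Oddness makes the mollification vanish on the faces; beyond Γ the bottom of the box is
lowered to a plane near which the mollification is identically zero. Fatou's lemma on the left and
`exists_tendsto_lintegral_moll` on the right give the limit (`carleman_part_lintegral`). Any ν > 0
works, and values of λ below the threshold are covered by comparing weights, so that ν₀ = λ₀ = 1.

Smallness (`exists_theta_mul_grad_bound`, `exists_weighted_bounds`). Let θ be multiplication by φ_λ,
u ∈ H_0^3 and x = ‖θ Δu‖. The Carleman estimate bounds θ∇u by x λ^(-1/2) in L² and, through the
Sobolev inequality, by x λ^(1/2) in L⁶. Interpolation gives x λ^(-1/4) in L^(12/5) and x in L³.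
Since ∇a ∈ L¹² and Δa ∈ L⁶ for a ∈ H³, the product ∇a · θ∇u is small in L², and Δa · θ∇u is bounded
there. In the quadratic remainder the background appears without any smallness of its own. There the
two weights are redistributed, one to each of the two increments, which leaves a factor λ^(-1/2)
without an exponentially large constant.

Expansion (`exists_gradient_quad`, `opAt_lower_bound`, `remainder_lower_bound`). The functional is c
‖Θ Φ(p + F)‖² + ρ ‖p‖² with Φ quadratic, so for q = p + F the first order remainder is exactly c
(‖Θ(Φ(q + h) - Φ(q))‖² + 2 ⟨ΘΦ(q), Θβ(h, h)⟩) + ρ ‖h‖². The principal part of the increment is Δh;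
everything else contains ∇h or ∇∫_k h. The weight does not depend on k, so the Volterra integral
costs only √(k₁ - k₀) in the weighted norm. For large λ a quarter of ‖θΔh‖² survives. A second use
of the Carleman estimate, together with exp(-2λ(s + d)^(-ν)) φ_λ² ≥ 1, turns it into the H_2 and H_1
bounds (`exists_norm_kincl_le`).

Tail (`existsUnique_tail`, `norm_tail_sq_le`). The tail functional is the squared norm of a coercive
affine map, so its minimizer comes from an orthogonal projection. Comparison with V_* - Q_* and the
choice of α and μ bound the tail in H³ uniformly in δ. This makes λ₁ and C₁ independent of δ. -/

theorem contDiff_pd {f : Pt → ℝ} (h : ContDiff ℝ ∞ f) (i : Fin 3) : ContDiff ℝ ∞ (pd i f) := by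
  have h1 : ContDiff ℝ ∞ (fderiv ℝ f) := h.fderiv_right (by simp)
  exact h1.clm_apply contDiff_const

theorem differentiable_of_smooth {f : Pt → ℝ} (h : ContDiff ℝ ∞ f) : Differentiable ℝ f :=
  h.differentiable (by simp)

theorem pd_add {f g : Pt → ℝ} (hf : Differentiable ℝ f) (hg : Differentiable ℝ g) (i : Fin 3) :
    pd i (fun x => f x + g x) = fun x => pd i f x + pd i g x := by
  funext x
  simp only [pd]
  rw [fderiv_fun_add (hf x) (hg x)]; rfl

theorem pd_const_mul {f : Pt → ℝ} (hf : Differentiable ℝ f) (c : ℝ) (i : Fin 3) :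
    pd i (fun x => c * f x) = fun x => c * pd i f x := by
  funext x
  simp only [pd]
  rw [fderiv_const_mul (hf x)]; rfl

theorem pd_mul {f g : Pt → ℝ} (hf : Differentiable ℝ f) (hg : Differentiable ℝ g) (i : Fin 3) :
    pd i (fun x => f x * g x) = fun x => pd i f x * g x + f x * pd i g x := by
  funext x
  simp only [pd]
  rw [fderiv_fun_mul (hf x) (hg x)]
  simp [mul_comm]; ring

theorem pd_sq {f : Pt → ℝ} (hf : Differentiable ℝ f) (i : Fin 3) :
    pd i (fun x => f x ^ 2) = fun x => 2 * (f x * pd i f x) := by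
  have : (fun x => f x ^ 2) = fun x => f x * f x := by funext x; ring
  rw [this, pd_mul hf hf]; funext x; ring

theorem pd_comm {f : Pt → ℝ} (hf : ContDiff ℝ ∞ f) (i j : Fin 3) :
    pd i (pd j f) = pd j (pd i f) := by
  funext x
  have h2 : IsSymmSndFDerivAt ℝ f x := by
    have h := hf.contDiffAt (x := x)
    exact h.isSymmSndFDerivAt (by simp; exact WithTop.coe_le_coe.2 (le_top : (2 : ℕ∞) ≤ ⊤))
  have h1 : DifferentiableAt ℝ (fderiv ℝ f) x :=
    ((hf.fderiv_right (m := ∞) (by simp)).differentiable (by simp)) x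
  have key : ∀ i j : Fin 3, pd i (pd j f) x =
      fderiv ℝ (fderiv ℝ f) x (Pi.single i 1) (Pi.single j 1) := by
    intro i j
    unfold pd
    rw [fderiv_clm_apply h1 (differentiableAt_const _)]
    simp
  rw [key, key]
  exact h2 _ _

/-- A function of the single coordinate `j`. -/
theorem pd_comp_apply {g : ℝ → ℝ} (hg : Differentiable ℝ g) (i j : Fin 3) :
    pd i (fun x => g (x j)) = fun x => if i = j then deriv g (x j) else 0 := by
  funext x
  have h : HasFDerivAt (fun x : Pt => g (x j))
      (deriv g (x j) • (ContinuousLinearMap.proj j : Pt →L[ℝ] ℝ)) x :=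
    (hg (x j)).hasDerivAt.comp_hasFDerivAt x
      (ContinuousLinearMap.hasFDerivAt (ContinuousLinearMap.proj j : Pt →L[ℝ] ℝ))
  simp only [pd, h.fderiv]
  by_cases hij : i = j
  · subst hij; simp
  · simp [hij, Ne.symm hij]

/-- A function that vanishes on a plane `x_j = c` has vanishing tangential derivatives there. -/
theorem pd_eq_zero_of_plane {f : Pt → ℝ} (hf : Differentiable ℝ f) {i j : Fin 3} (hij : i ≠ j)
    {c : ℝ} (h : ∀ x, x j = c → f x = 0) (x : Pt) (hx : x j = c) : pd i f x = 0 := by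
  have h1 : HasDerivAt (fun t : ℝ => f (x + t • Pi.single i 1)) (pd i f x) 0 := by
    have h2 : HasDerivAt (fun t : ℝ => x + t • (Pi.single i 1 : Pt)) (Pi.single i 1) 0 := by
      simpa using ((hasDerivAt_id (0 : ℝ)).smul_const (Pi.single i 1 : Pt)).const_add x
    have h3 : HasFDerivAt f (fderiv ℝ f x) (x + (0 : ℝ) • (Pi.single i 1 : Pt)) := by
      simpa using (hf x).hasFDerivAt
    exact h3.comp_hasDerivAt (0 : ℝ) h2
  have h4 : (fun t : ℝ => f (x + t • Pi.single i 1)) = fun _ => 0 := by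
    funext t
    refine h _ ?_
    simp [Ne.symm hij, hx]
  rw [h4] at h1
  exact h1.unique (hasDerivAt_const _ _)

/-! ### Integration by parts on a box -/

/-- The divergence theorem for the vector field with the single nonzero component `f` in direction
`i`; only the two faces orthogonal to that direction contribute. -/
theorem integral_pd_eq {lo hi : Pt} (hle : lo ≤ hi) (i : Fin 3) {f : Pt → ℝ} (hf : ContDiff ℝ 1 f) :
    ∫ x in Icc lo hi, pd i f x =
      (∫ y in Icc (lo ∘ i.succAbove) (hi ∘ i.succAbove), f (i.insertNth (hi i) y)) -
      ∫ y in Icc (lo ∘ i.succAbove) (hi ∘ i.succAbove), f (i.insertNth (lo i) y) := by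
  have hd : Differentiable ℝ f := hf.differentiable (by simp)
  have hc : Continuous (pd i f) := (hf.continuous_fderiv (by simp)).clm_apply continuous_const
  have key := integral_divergence_of_hasFDerivAt_off_countable' lo hi hle
    (fun j x => if j = i then f x else 0) (fun j x => if j = i then fderiv ℝ f x else 0) ∅
    countable_empty
    (fun j => by
      by_cases h : j = i
      · simpa [h] using hf.continuous.continuousOn
      · simpa [h] using continuousOn_const)
    (fun x _ j => by
      by_cases h : j = i
      · simpa [h] using (hd x).hasFDerivAt
      · simpa [h] using hasFDerivAt_const (0 : ℝ) x)
    (by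
      have : (fun x => ∑ j, (if j = i then fderiv ℝ f x else 0) (Pi.single j 1)) = pd i f := by
        funext x
        rw [Finset.sum_eq_single i]
        · simp [pd]
        · intro j _ hj; simp [hj]
        · simp
      rw [this]
      exact hc.integrableOn_Icc)
  have h1 : ∀ x, ∑ j, (if j = i then fderiv ℝ f x else 0) (Pi.single j 1) = pd i f x := by
    intro x
    rw [Finset.sum_eq_single i]
    · simp [pd]
    · intro j _ hj; simp [hj]
    · simp
  simp only [h1] at key
  rw [key, Finset.sum_eq_single i]
  · simp
  · intro j _ hj; simp [hj]
  · simp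

theorem integral_pd_eq_zero {lo hi : Pt} (hle : lo ≤ hi) (i : Fin 3) {f : Pt → ℝ}
    (hf : ContDiff ℝ ∞ f) (h0 : ∀ x, x i = lo i → f x = 0) (h1 : ∀ x, x i = hi i → f x = 0) :
    ∫ x in Icc lo hi, pd i f x = 0 := by
  rw [integral_pd_eq hle i (hf.of_le (by simp))]
  simp [h0, h1]

/-- The upper face enters the flux with a plus sign, so a condition of sign is enough there. -/
theorem integral_pd_nonneg {lo hi : Pt} (hle : lo ≤ hi) (i : Fin 3) {f : Pt → ℝ}
    (hf : ContDiff ℝ ∞ f) (h0 : ∀ x, x i = lo i → f x = 0) (h1 : ∀ x, x i = hi i → 0 ≤ f x) :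
    0 ≤ ∫ x in Icc lo hi, pd i f x := by
  rw [integral_pd_eq hle i (hf.of_le (by simp))]
  have : ∫ y in Icc (lo ∘ i.succAbove) (hi ∘ i.succAbove), f (i.insertNth (lo i) y) = 0 := by
    simp [h0]
  rw [this, sub_zero]
  exact integral_nonneg fun y => h1 _ (by simp)

/-! ### The Carleman estimate for smooth functions -/

/-- Smooth functions that vanish on the planes containing the faces of the box `[lo, hi]`, and
whose normal derivative vanishes on the plane `x 2 = lo 2`. -/
structure VanishesOnFaces (lo hi : Pt) (w : Pt → ℝ) : Prop where
  smooth : ContDiff ℝ ∞ w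
  lower : ∀ i x, x i = lo i → w x = 0
  upper : ∀ i x, x i = hi i → w x = 0
  normal : ∀ x, x 2 = lo 2 → pd 2 w x = 0

section smooth

variable {lo hi : Pt} {w : Pt → ℝ}

theorem integrable_Icc {f : Pt → ℝ} (hf : Continuous f) :
    Integrable f (volume.restrict (Icc lo hi)) := hf.integrableOn_Icc

theorem continuous_pd {f : Pt → ℝ} (hf : ContDiff ℝ ∞ f) (i : Fin 3) : Continuous (pd i f) :=
  (contDiff_pd hf i).continuous

theorem integral_mul_add_mul {f g h k : Pt → ℝ} (hf : Continuous f) (hg : Continuous g)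
    (hh : Continuous h) (hk : Continuous k) :
    ∫ x in Icc lo hi, (f x * g x + h x * k x) =
      (∫ x in Icc lo hi, f x * g x) + ∫ x in Icc lo hi, h x * k x :=
  integral_add (integrable_Icc (hf.mul hg)) (integrable_Icc (hh.mul hk))

theorem VanishesOnFaces.integral_pd_sq (hle : lo ≤ hi) (hw : VanishesOnFaces lo hi w) (i : Fin 3) :
    ∫ x in Icc lo hi, pd i w x ^ 2 = -∫ x in Icc lo hi, w x * pd i (pd i w) x := by
  have h1 := contDiff_pd hw.smooth i
  have h := integral_pd_eq_zero hle i (hw.smooth.mul h1)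
    (fun x hx => by simp [hw.lower i x hx]) (fun x hx => by simp [hw.upper i x hx])
  rw [pd_mul (differentiable_of_smooth hw.smooth) (differentiable_of_smooth h1)] at h
  rw [integral_mul_add_mul h1.continuous h1.continuous hw.smooth.continuous
    (continuous_pd h1 i)] at h
  simp only [sq]
  linarith

/-- For `i = 2` the integrand is half the z-derivative of w_z², which vanishes at the bottom and is
nonnegative at the top. For `i ≠ 2` one integration by parts in direction `i` gives minus half the
z-derivative of w_i², whose flux is zero because w_i is tangential on the horizontal faces. -/
theorem VanishesOnFaces.integral_pd_two_mul (hle : lo ≤ hi) (hw : VanishesOnFaces lo hi w)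
    (i : Fin 3) : 0 ≤ ∫ x in Icc lo hi, pd 2 w x * pd i (pd i w) x := by
  have h2 := contDiff_pd hw.smooth 2
  have hi1 := contDiff_pd hw.smooth i
  by_cases hi2 : i = 2
  · subst hi2
    have h := integral_pd_nonneg hle 2 (h2.pow 2)
      (fun x hx => by simp [hw.normal x hx]) (fun x _ => by positivity)
    rw [pd_sq (differentiable_of_smooth h2), integral_const_mul] at h
    linarith
  · have e1 := integral_pd_eq_zero hle i (h2.mul hi1)
      (fun x hx => by
        simp [pd_eq_zero_of_plane (differentiable_of_smooth hw.smooth) (Ne.symm hi2)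
          (hw.lower i) x hx])
      (fun x hx => by
        simp [pd_eq_zero_of_plane (differentiable_of_smooth hw.smooth) (Ne.symm hi2)
          (hw.upper i) x hx])
    have e2 := integral_pd_eq_zero hle 2 (hi1.pow 2)
      (fun x hx => by
        simp [pd_eq_zero_of_plane (differentiable_of_smooth hw.smooth) hi2 (hw.lower 2) x hx])
      (fun x hx => by
        simp [pd_eq_zero_of_plane (differentiable_of_smooth hw.smooth) hi2 (hw.upper 2) x hx])
    rw [pd_mul (differentiable_of_smooth h2) (differentiable_of_smooth hi1),
      integral_mul_add_mul (continuous_pd h2 i) hi1.continuous h2.continuous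
        (continuous_pd hi1 i)] at e1
    rw [pd_sq (differentiable_of_smooth hi1), integral_const_mul] at e2
    have e3 : ∫ x in Icc lo hi, pd i (pd 2 w) x * pd i w x =
        ∫ x in Icc lo hi, pd i w x * pd 2 (pd i w) x := by
      rw [pd_comm hw.smooth]; simp only [mul_comm]
    linarith

/-- w w_z is half the z-derivative of w², and w vanishes on both horizontal faces. -/
theorem VanishesOnFaces.integral_mul_pd_two (hle : lo ≤ hi) (hw : VanishesOnFaces lo hi w)
    {g : ℝ → ℝ} (hg : ContDiff ℝ ∞ g) :
    ∫ x in Icc lo hi, g (x 2) * (w x * pd 2 w x) =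
      -(1 / 2) * ∫ x in Icc lo hi, deriv g (x 2) * w x ^ 2 := by
  have hg2 : ContDiff ℝ ∞ (fun x : Pt => g (x 2)) := hg.comp (contDiff_apply ℝ ℝ 2)
  have hg' : Continuous (fun x : Pt => deriv g (x 2)) :=
    (hg.continuous_deriv (by simp)).comp (continuous_apply 2)
  have h := integral_pd_eq_zero hle 2 (hg2.mul (hw.smooth.pow 2))
    (fun x hx => by simp [hw.lower 2 x hx]) (fun x hx => by simp [hw.upper 2 x hx])
  rw [pd_mul (differentiable_of_smooth hg2) (differentiable_of_smooth (hw.smooth.pow 2)),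
    pd_comp_apply (hg.differentiable (by simp)), pd_sq (differentiable_of_smooth hw.smooth)] at h
  simp only [if_true] at h
  have cw := hw.smooth.continuous
  have cw2 := continuous_pd hw.smooth 2
  rw [integral_mul_add_mul hg' (h := fun x => g (x 2)) (k := fun x => 2 * (w x * pd 2 w x))
    (g := fun x => w x ^ 2) (by fun_prop) hg2.continuous (by fun_prop)] at h
  have e : ∫ x in Icc lo hi, g (x 2) * (2 * (w x * pd 2 w x)) =
      2 * ∫ x in Icc lo hi, g (x 2) * (w x * pd 2 w x) := by
    rw [← integral_const_mul]; congr 1; funext x; ring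
  linarith

/-- Two integrations by parts, in direction `i` and then in direction `j`. Each boundary term
contains a tangential derivative of `w`, which is zero because `w` vanishes on the whole plane of
the face. -/
theorem VanishesOnFaces.integral_pd_pd (hle : lo ≤ hi) (hw : VanishesOnFaces lo hi w) {i j : Fin 3}
    (hij : i ≠ j) : ∫ x in Icc lo hi, pd i (pd i w) x * pd j (pd j w) x =
      ∫ x in Icc lo hi, pd i (pd j w) x ^ 2 := by
  have hd := differentiable_of_smooth hw.smooth
  have hi1 := contDiff_pd hw.smooth i
  have hj1 := contDiff_pd hw.smooth j
  have hij2 := contDiff_pd hj1 i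
  have hjj := contDiff_pd hj1 j
  have e1 := integral_pd_eq_zero hle i (hi1.mul hjj)
      (fun x hx => by
        simp [pd_eq_zero_of_plane (differentiable_of_smooth hj1) (Ne.symm hij)
          (pd_eq_zero_of_plane hd (Ne.symm hij) (hw.lower i)) x hx])
      (fun x hx => by
        simp [pd_eq_zero_of_plane (differentiable_of_smooth hj1) (Ne.symm hij)
          (pd_eq_zero_of_plane hd (Ne.symm hij) (hw.upper i)) x hx])
  have e2 := integral_pd_eq_zero hle j (hi1.mul hij2)
      (fun x hx => by simp [pd_eq_zero_of_plane hd hij (hw.lower j) x hx])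
      (fun x hx => by simp [pd_eq_zero_of_plane hd hij (hw.upper j) x hx])
  rw [pd_mul (differentiable_of_smooth hi1) (differentiable_of_smooth hjj),
    integral_mul_add_mul (continuous_pd hi1 i) hjj.continuous hi1.continuous
      (continuous_pd hjj i)] at e1
  rw [pd_mul (differentiable_of_smooth hi1) (differentiable_of_smooth hij2),
    integral_mul_add_mul (continuous_pd hi1 j) hij2.continuous hi1.continuous
      (continuous_pd hij2 j)] at e2
  rw [pd_comm hj1 i j] at e1
  rw [pd_comm hw.smooth j i] at e2
  simp only [sq]
  linarith

theorem VanishesOnFaces.integral_hessian (hle : lo ≤ hi) (hw : VanishesOnFaces lo hi w) :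
    ∑ i, ∑ j, ∫ x in Icc lo hi, pd i (pd j w) x ^ 2 =
      ∫ x in Icc lo hi, (∑ i, pd i (pd i w) x) ^ 2 := by
  have hc : ∀ i j, Continuous fun x => pd i (pd i w) x * pd j (pd j w) x := fun i j =>
    (continuous_pd (contDiff_pd hw.smooth i) i).mul (continuous_pd (contDiff_pd hw.smooth j) j)
  have h : ∀ x, (∑ i, pd i (pd i w) x) ^ 2 = ∑ i, ∑ j, pd i (pd i w) x * pd j (pd j w) x := by
    intro x; rw [sq, Finset.sum_mul_sum]
  simp only [h]
  rw [integral_finsetSum _ fun i _ => integrable_finsetSum _ fun j _ => integrable_Icc (hc i j)]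
  refine Finset.sum_congr rfl fun i _ => ?_
  rw [integral_finsetSum _ fun j _ => integrable_Icc (hc i j)]
  refine Finset.sum_congr rfl fun j _ => ?_
  by_cases hij : i = j
  · subst hij; simp only [sq]
  · exact (hw.integral_pd_pd hle hij).symm

/-- The conjugated Laplacian `e^{λψ} Δ e^{-λψ}`, where `a = -ψ'`. -/
def conjLap (a : ℝ → ℝ) (lam : ℝ) (w : Pt → ℝ) (x : Pt) : ℝ :=
  (∑ i, pd i (pd i w) x) + 2 * lam * a (x 2) * pd 2 w x +
    (lam ^ 2 * a (x 2) ^ 2 + lam * deriv a (x 2)) * w x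

theorem continuous_conjLap {a : ℝ → ℝ} (ha : ContDiff ℝ ∞ a) (lam : ℝ) (hw : ContDiff ℝ ∞ w) :
    Continuous (conjLap a lam w) := by
  have h1 : ∀ i, Continuous (pd i (pd i w)) := fun i => continuous_pd (contDiff_pd hw i) i
  have h2 := continuous_pd hw 2
  have h3 : Continuous (fun x : Pt => a (x 2)) := ha.continuous.comp (continuous_apply 2)
  have h4 : Continuous (fun x : Pt => deriv a (x 2)) :=
    (ha.continuous_deriv (by simp)).comp (continuous_apply 2)
  have h5 := hw.continuous
  unfold conjLap
  fun_prop

/-- Lower bound of the conjugated operator by the function itself. -/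
theorem VanishesOnFaces.integral_sq_le (hle : lo ≤ hi) (hw : VanishesOnFaces lo hi w)
    {a : ℝ → ℝ} (ha : ContDiff ℝ ∞ a) {a₀ A lam : ℝ} (ha₀ : 0 < a₀)
    (h1 : ∀ z ∈ Icc (lo 2) (hi 2), a₀ ≤ a z) (h2 : ∀ z ∈ Icc (lo 2) (hi 2), deriv a z ≤ -a₀)
    (h3 : ∀ z ∈ Icc (lo 2) (hi 2), deriv (deriv a) z ≤ A) (hlam : 0 < lam)
    (hA : A ≤ lam * a₀ ^ 2) :
    2 * a₀ ^ 3 * lam ^ 3 * ∫ x in Icc lo hi, w x ^ 2 ≤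
      ∫ x in Icc lo hi, conjLap a lam w x ^ 2 := by
  have ha' : ContDiff ℝ ∞ (deriv a) := by
    simpa using ha.iterate_deriv 1
  have ca : Continuous (fun x : Pt => a (x 2)) := ha.continuous.comp (continuous_apply 2)
  have ca' : Continuous (fun x : Pt => deriv a (x 2)) := ha'.continuous.comp (continuous_apply 2)
  have ca'' : Continuous (fun x : Pt => deriv (deriv a) (x 2)) :=
    (ha'.continuous_deriv (by simp)).comp (continuous_apply 2)
  have cw := hw.smooth.continuous
  have cw2 := continuous_pd hw.smooth 2
  have cwi : ∀ i, Continuous (pd i (pd i w)) := fun i =>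
    continuous_pd (contDiff_pd hw.smooth i) i
  have cP := continuous_conjLap ha lam hw.smooth
  -- The zero order coefficient of the conjugated operator; the proof exploits that it decreases in
  -- z.
  let g : ℝ → ℝ := fun z => lam ^ 2 * a z ^ 2 + lam * deriv a z
  have hg : ContDiff ℝ ∞ g := by fun_prop
  have cg : Continuous (fun x : Pt => g (x 2)) := hg.continuous.comp (continuous_apply 2)
  have hg' : ∀ z, deriv g z = lam ^ 2 * (2 * a z * deriv a z) + lam * deriv (deriv a) z := by
    intro z
    have d1 : HasDerivAt a (deriv a z) z := (ha.differentiable (by simp) z).hasDerivAt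
    have d2 : HasDerivAt (deriv a) (deriv (deriv a) z) z :=
      (ha'.differentiable (by simp) z).hasDerivAt
    have : HasDerivAt g _ z := ((d1.fun_pow 2).const_mul (lam ^ 2)).fun_add (d2.const_mul lam)
    simpa using this.deriv
  have hB : 0 ≤ ∫ x in Icc lo hi, pd 2 w x * ∑ i, pd i (pd i w) x := by
    have : ∀ x, pd 2 w x * ∑ i, pd i (pd i w) x = ∑ i, pd 2 w x * pd i (pd i w) x := fun x =>
      Finset.mul_sum _ _ _
    simp only [this]
    rw [integral_finsetSum (f := fun i x => pd 2 w x * pd i (pd i w) x) _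
      fun i _ => integrable_Icc (cw2.mul (cwi i))]
    exact Finset.sum_nonneg fun i _ => hw.integral_pd_two_mul hle i
  have hC := hw.integral_mul_pd_two hle hg
  have hmem : ∀ x ∈ Icc lo hi, x 2 ∈ Icc (lo 2) (hi 2) := fun x hx => ⟨hx.1 2, hx.2 2⟩
  have hmeas : MeasurableSet (Icc lo hi) := measurableSet_Icc
  have hD : ∫ x in Icc lo hi, 4 * lam * (pd 2 w x * (∑ i, pd i (pd i w) x)) +
      4 * lam * (g (x 2) * (w x * pd 2 w x)) ≤
      ∫ x in Icc lo hi, (1 / a₀) * conjLap a lam w x ^ 2 := by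
    refine setIntegral_mono_on (integrable_Icc (by fun_prop)) (integrable_Icc (by fun_prop)) hmeas
      fun x hx => ?_
    have ha1 := h1 _ (hmem x hx)
    have hapos : 0 < a (x 2) := ha₀.trans_le ha1
    -- With S = Δw + g w and T = λ a w_z this is 4 T S ≤ (S + 2T)². Dividing by a first leaves w_z
    -- Δw without a variable coefficient.
    have key : 4 * lam * (pd 2 w x * (∑ i, pd i (pd i w) x)) +
      4 * lam * (g (x 2) * (w x * pd 2 w x)) ≤ (1 / a (x 2)) * conjLap a lam w x ^ 2 := by
      rw [one_div, ← div_eq_inv_mul, le_div_iff₀ hapos]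
      have e : conjLap a lam w x = (∑ i, pd i (pd i w) x) + 2 * lam * a (x 2) * pd 2 w x +
        g (x 2) * w x := rfl
      rw [e]
      nlinarith [sq_nonneg ((∑ i, pd i (pd i w) x) + g (x 2) * w x),
        sq_nonneg (lam * a (x 2) * pd 2 w x)]
    refine key.trans ?_
    gcongr
  rw [integral_add (integrable_Icc (by fun_prop)) (integrable_Icc (by fun_prop)),
    integral_const_mul, integral_const_mul, integral_const_mul, hC] at hD
  -- -2 g' = 4λ² a (-a') - 2λ a''. The first term is at least 4 λ² a₀², and the threshold on λ lets
  -- the second consume at most half of it.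
  have hE : ∫ x in Icc lo hi, (2 * a₀ ^ 2 * lam ^ 2) * w x ^ 2 ≤
      ∫ x in Icc lo hi, -2 * (deriv g (x 2) * w x ^ 2) := by
    have cg' : Continuous (fun x : Pt => deriv g (x 2)) := by
      simp only [hg']; fun_prop
    refine setIntegral_mono_on (integrable_Icc (by fun_prop)) (integrable_Icc (by fun_prop)) hmeas
      fun x hx => ?_
    have k1 := h1 _ (hmem x hx)
    have k2 := h2 _ (hmem x hx)
    have k3 := h3 _ (hmem x hx)
    have : 2 * a₀ ^ 2 * lam ^ 2 ≤ -2 * deriv g (x 2) := by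
      rw [hg']
      have m1 : a₀ * a₀ ≤ a (x 2) * -deriv a (x 2) :=
        mul_le_mul k1 (by linarith) ha₀.le (ha₀.le.trans k1)
      have m2 : lam ^ 2 * (a₀ * a₀) ≤ lam ^ 2 * (a (x 2) * -deriv a (x 2)) := by gcongr
      have m3 : lam * deriv (deriv a) (x 2) ≤ lam * (lam * a₀ ^ 2) := by
        gcongr; exact k3.trans hA
      nlinarith
    calc _ ≤ (-2 * deriv g (x 2)) * w x ^ 2 := by gcongr
      _ = _ := by ring
  rw [integral_const_mul, integral_const_mul] at hE
  have hF : (1 / a₀) * ∫ x in Icc lo hi, conjLap a lam w x ^ 2 ≥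
      lam * (2 * a₀ ^ 2 * lam ^ 2 * ∫ x in Icc lo hi, w x ^ 2) := by
    have := mul_le_mul_of_nonneg_left hE hlam.le
    have := mul_nonneg hlam.le hB
    nlinarith
  rw [ge_iff_le, one_div, ← div_eq_inv_mul, le_div_iff₀ ha₀] at hF
  calc _ = lam * (2 * a₀ ^ 2 * lam ^ 2 * ∫ x in Icc lo hi, w x ^ 2) * a₀ := by ring
    _ ≤ _ := hF

end smooth

/-! ### Gradient and Hessian bounds, and the return from w to u. -/

section smooth

variable {lo hi : Pt} {w : Pt → ℝ}

/-- Lower bound of the conjugated operator by the gradient. -/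
theorem VanishesOnFaces.integral_grad_le (hle : lo ≤ hi) (hw : VanishesOnFaces lo hi w)
    {a : ℝ → ℝ} (ha : ContDiff ℝ ∞ a) {A lam : ℝ}
    (h1 : ∀ z ∈ Icc (lo 2) (hi 2), |a z| ≤ A) (hlam : 0 < lam) :
    lam * ∑ i, ∫ x in Icc lo hi, pd i w x ^ 2 ≤
      1 / 2 * (∫ x in Icc lo hi, conjLap a lam w x ^ 2) +
        (lam ^ 2 / 2 + lam ^ 3 * A ^ 2) * ∫ x in Icc lo hi, w x ^ 2 := by
  have ca : Continuous (fun x : Pt => a (x 2)) := ha.continuous.comp (continuous_apply 2)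
  have ca' : Continuous (fun x : Pt => deriv a (x 2)) :=
    (ha.continuous_deriv (by simp)).comp (continuous_apply 2)
  have cw := hw.smooth.continuous
  have cw2 := continuous_pd hw.smooth 2
  have cwi : ∀ i, Continuous (pd i (pd i w)) := fun i =>
    continuous_pd (contDiff_pd hw.smooth i) i
  have cP := continuous_conjLap ha lam hw.smooth
  have hS : ∑ i, ∫ x in Icc lo hi, pd i w x ^ 2 =
      -∫ x in Icc lo hi, w x * ∑ i, pd i (pd i w) x := by
    have : ∀ x, w x * ∑ i, pd i (pd i w) x = ∑ i, w x * pd i (pd i w) x := fun x =>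
      Finset.mul_sum _ _ _
    simp only [this]
    rw [integral_finsetSum (f := fun i x => w x * pd i (pd i w) x) _
      fun i _ => integrable_Icc (cw.mul (cwi i)), ← Finset.sum_neg_distrib]
    exact Finset.sum_congr rfl fun i _ => hw.integral_pd_sq hle i
  have hC := hw.integral_mul_pd_two hle ha
  -- Δw is expressed through the conjugated operator, and the first order term is integrated by
  -- parts with `hC`. The two terms with a' then cancel in the final line.
  have e1 : ∫ x in Icc lo hi, w x * ∑ i, pd i (pd i w) x =
      (∫ x in Icc lo hi, w x * conjLap a lam w x - (lam ^ 2 * a (x 2) ^ 2) * w x ^ 2) +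
      ((-2 * lam) * (∫ x in Icc lo hi, a (x 2) * (w x * pd 2 w x)) +
        (-lam) * ∫ x in Icc lo hi, deriv a (x 2) * w x ^ 2) := by
    rw [← integral_const_mul, ← integral_const_mul,
      ← integral_add (integrable_Icc (by fun_prop)) (integrable_Icc (by fun_prop)),
      ← integral_add (integrable_Icc (by fun_prop)) (integrable_Icc (by fun_prop))]
    congr 1; funext x; simp only [conjLap]; ring
  have e2 : ∫ x in Icc lo hi, -lam * (w x * conjLap a lam w x - (lam ^ 2 * a (x 2) ^ 2) * w x ^ 2) ≤
      ∫ x in Icc lo hi, (1 / 2 * conjLap a lam w x ^ 2 +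
        (lam ^ 2 / 2 + lam ^ 3 * A ^ 2) * w x ^ 2) := by
    refine setIntegral_mono_on (integrable_Icc (by fun_prop)) (integrable_Icc (by fun_prop))
      measurableSet_Icc fun x hx => ?_
    have k : a (x 2) ^ 2 ≤ A ^ 2 := sq_le_sq' (by linarith [(abs_le.1 (h1 _ ⟨hx.1 2, hx.2 2⟩)).1])
      (abs_le.1 (h1 _ ⟨hx.1 2, hx.2 2⟩)).2
    have k2 : lam ^ 3 * a (x 2) ^ 2 * w x ^ 2 ≤ lam ^ 3 * A ^ 2 * w x ^ 2 := by gcongr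
    -- Young's inequality in the form -λ w P ≤ P²/2 + λ² w²/2, where P is the conjugated operator.
    nlinarith [sq_nonneg (conjLap a lam w x + lam * w x)]
  rw [integral_const_mul, integral_add (integrable_Icc (by fun_prop)) (integrable_Icc (by fun_prop)),
    integral_const_mul, integral_const_mul] at e2
  rw [hS, e1, hC]
  linarith

/-- Lower bound of the conjugated operator by the second derivatives. -/
theorem VanishesOnFaces.integral_hessian_le (hle : lo ≤ hi) (hw : VanishesOnFaces lo hi w)
    {a : ℝ → ℝ} (ha : ContDiff ℝ ∞ a) {A lam : ℝ} (hA : 1 ≤ A)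
    (h1 : ∀ z ∈ Icc (lo 2) (hi 2), |a z| ≤ A) (h2 : ∀ z ∈ Icc (lo 2) (hi 2), |deriv a z| ≤ A)
    (hlam : 1 ≤ lam) :
    ∑ i, ∑ j, ∫ x in Icc lo hi, pd i (pd j w) x ^ 2 ≤
      3 * (∫ x in Icc lo hi, conjLap a lam w x ^ 2) +
      12 * lam ^ 2 * A ^ 2 * (∑ i, ∫ x in Icc lo hi, pd i w x ^ 2) +
        12 * lam ^ 4 * A ^ 4 * ∫ x in Icc lo hi, w x ^ 2 := by
  have cw := hw.smooth.continuous
  have cwi := continuous_pd hw.smooth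
  have cwii : ∀ i, Continuous (pd i (pd i w)) := fun i =>
    continuous_pd (contDiff_pd hw.smooth i) i
  have cP := continuous_conjLap ha lam hw.smooth
  rw [hw.integral_hessian hle]
  have e2 : ∫ x in Icc lo hi, (∑ i, pd i (pd i w) x) ^ 2 ≤
      ∫ x in Icc lo hi, ((3 * conjLap a lam w x ^ 2 + 12 * lam ^ 2 * A ^ 2 * pd 2 w x ^ 2) +
        12 * lam ^ 4 * A ^ 4 * w x ^ 2) := by
    refine setIntegral_mono_on (integrable_Icc (by fun_prop)) (integrable_Icc (by fun_prop))
      measurableSet_Icc fun x hx => ?_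
    have k1 := h1 _ ⟨hx.1 2, hx.2 2⟩
    have k2 := h2 _ ⟨hx.1 2, hx.2 2⟩
    -- Since the Hessian and the Laplacian have the same L² norm, it suffices to solve the
    -- conjugated operator for Δw.
    have e : (∑ i, pd i (pd i w) x) = conjLap a lam w x + (-(2 * lam * a (x 2) * pd 2 w x)) +
      (-((lam ^ 2 * a (x 2) ^ 2 + lam * deriv a (x 2)) * w x)) := by
      simp only [conjLap]; ring
    have t : ∀ p q r : ℝ, (p + q + r) ^ 2 ≤ 3 * p ^ 2 + 3 * q ^ 2 + 3 * r ^ 2 := fun p q r => by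
      nlinarith [sq_nonneg (p - q), sq_nonneg (q - r), sq_nonneg (p - r)]
    have k3 : a (x 2) ^ 2 ≤ A ^ 2 := sq_le_sq' (by linarith [(abs_le.1 k1).1]) (abs_le.1 k1).2
    have k4 : |lam ^ 2 * a (x 2) ^ 2 + lam * deriv a (x 2)| ≤ 2 * lam ^ 2 * A ^ 2 := by
      refine (abs_add_le _ _).trans ?_
      rw [abs_of_nonneg (by positivity), abs_mul, abs_of_pos (by linarith)]
      have m1 : lam ^ 2 * a (x 2) ^ 2 ≤ lam ^ 2 * A ^ 2 := by gcongr
      have m2 : lam * |deriv a (x 2)| ≤ lam ^ 2 * A ^ 2 := by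
        calc lam * |deriv a (x 2)| ≤ lam * A := by gcongr
          _ ≤ lam ^ 2 * A ^ 2 := by gcongr <;> nlinarith
      linarith
    have k5 : (lam ^ 2 * a (x 2) ^ 2 + lam * deriv a (x 2)) ^ 2 ≤ (2 * lam ^ 2 * A ^ 2) ^ 2 :=
      sq_le_sq' (by linarith [(abs_le.1 k4).1]) (abs_le.1 k4).2
    rw [e]
    refine (t _ _ _).trans ?_
    have m3 : (-(2 * lam * a (x 2) * pd 2 w x)) ^ 2 ≤ 4 * lam ^ 2 * A ^ 2 * pd 2 w x ^ 2 := by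
      calc _ = 4 * lam ^ 2 * a (x 2) ^ 2 * pd 2 w x ^ 2 := by ring
        _ ≤ _ := by gcongr
    have m4 : (-((lam ^ 2 * a (x 2) ^ 2 + lam * deriv a (x 2)) * w x)) ^ 2 ≤
        4 * lam ^ 4 * A ^ 4 * w x ^ 2 := by
      calc _ = (lam ^ 2 * a (x 2) ^ 2 + lam * deriv a (x 2)) ^ 2 * w x ^ 2 := by ring
        _ ≤ (2 * lam ^ 2 * A ^ 2) ^ 2 * w x ^ 2 := by gcongr
        _ = _ := by ring
    linarith
  rw [integral_add (integrable_Icc (by fun_prop)) (integrable_Icc (by fun_prop)),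
    integral_add (integrable_Icc (by fun_prop)) (integrable_Icc (by fun_prop)),
    integral_const_mul, integral_const_mul, integral_const_mul] at e2
  have e3 : ∫ x in Icc lo hi, pd 2 w x ^ 2 ≤ ∑ i, ∫ x in Icc lo hi, pd i w x ^ 2 :=
    Finset.single_le_sum (f := fun i => ∫ x in Icc lo hi, pd i w x ^ 2)
      (fun i _ => integral_nonneg fun x => sq_nonneg _) (Finset.mem_univ 2)
  have : 12 * lam ^ 2 * A ^ 2 * ∫ x in Icc lo hi, pd 2 w x ^ 2 ≤
      12 * lam ^ 2 * A ^ 2 * ∑ i, ∫ x in Icc lo hi, pd i w x ^ 2 := by gcongr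
  linarith

/-- The first derivatives of `e^{-λψ} w`. -/
theorem pd_exp_mul {ψ : ℝ → ℝ} (hψ : ContDiff ℝ ∞ ψ) (lam : ℝ) (hw : ContDiff ℝ ∞ w) (i : Fin 3) :
    pd i (fun x => Real.exp (-lam * ψ (x 2)) * w x) = fun x => Real.exp (-lam * ψ (x 2)) *
      (pd i w x + lam * (if i = 2 then -deriv ψ (x 2) else 0) * w x) := by
  have hE : ContDiff ℝ ∞ (fun z => Real.exp (-lam * ψ z)) := by fun_prop
  rw [pd_mul (f := fun x => Real.exp (-lam * ψ (x 2)))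
    (differentiable_of_smooth (hE.comp (contDiff_apply ℝ ℝ 2))) (differentiable_of_smooth hw),
    pd_comp_apply (g := fun z => Real.exp (-lam * ψ z)) (hE.differentiable (by simp))]
  have hd : ∀ z, deriv (fun z => Real.exp (-lam * ψ z)) z =
      Real.exp (-lam * ψ z) * (-lam * deriv ψ z) := fun z =>
    ((hψ.differentiable (by simp) z).hasDerivAt.const_mul (-lam)).exp.deriv
  funext x
  simp only [hd]
  split_ifs <;> ring

theorem pd_pd_exp_mul {ψ : ℝ → ℝ} (hψ : ContDiff ℝ ∞ ψ) (lam : ℝ) (hw : ContDiff ℝ ∞ w)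
    (i j : Fin 3) :
    pd j (pd i (fun x => Real.exp (-lam * ψ (x 2)) * w x)) = fun x => Real.exp (-lam * ψ (x 2)) *
      (pd j (pd i w) x + lam * (if i = 2 then -deriv ψ (x 2) else 0) * pd j w x +
        lam * (if j = 2 then -deriv ψ (x 2) else 0) * pd i w x +
        (lam ^ 2 * (if i = 2 then -deriv ψ (x 2) else 0) * (if j = 2 then -deriv ψ (x 2) else 0) +
          lam * (if i = 2 ∧ j = 2 then deriv (fun z => -deriv ψ z) (x 2) else 0)) * w x) := by
  have hψ' : ContDiff ℝ ∞ (fun z => -deriv ψ z) := by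
    have : ContDiff ℝ ∞ (deriv ψ) := by simpa using hψ.iterate_deriv 1
    exact this.neg
  have h2 : ContDiff ℝ ∞ (fun x : Pt => -deriv ψ (x 2)) := hψ'.comp (contDiff_apply ℝ ℝ 2)
  rw [pd_exp_mul hψ lam hw]
  have hw1 : ContDiff ℝ ∞
      (fun x => pd i w x + lam * (if i = 2 then -deriv ψ (x 2) else 0) * w x) := by
    have := contDiff_pd hw i
    by_cases hi : i = 2
    · simp only [hi, if_true]; subst hi; fun_prop
    · simp only [hi, if_false]; fun_prop
  rw [pd_exp_mul hψ lam hw1]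
  have e : pd j (fun x => pd i w x + lam * (if i = 2 then -deriv ψ (x 2) else 0) * w x) =
      fun x => pd j (pd i w) x + lam * (if i = 2 then -deriv ψ (x 2) else 0) * pd j w x +
        lam * (if i = 2 ∧ j = 2 then deriv (fun z => -deriv ψ z) (x 2) else 0) * w x := by
    have dw := differentiable_of_smooth hw
    have dw1 := differentiable_of_smooth (contDiff_pd hw i)
    have d2 := differentiable_of_smooth h2
    by_cases hi : i = 2
    · subst hi
      simp only [if_true, true_and]
      rw [pd_add dw1 (by fun_prop), pd_mul (f := fun x : Pt => lam * -deriv ψ (x 2)) (by fun_prop) dw,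
        pd_const_mul (f := fun x : Pt => -deriv ψ (x 2)) d2,
        pd_comp_apply (g := fun z => -deriv ψ z) (hψ'.differentiable (by simp))]
      funext x; ring
    · simp [hi]
  rw [e]
  funext x
  ring

set_option maxHeartbeats 1600000 in
/-- The **Carleman estimate** for smooth functions. -/
theorem carleman_smooth (hle : lo ≤ hi) {ψ : ℝ → ℝ} (hψ : ContDiff ℝ ∞ ψ)
    (h1 : ∀ z ∈ Icc (lo 2) (hi 2), deriv ψ z < 0)
    (h2 : ∀ z ∈ Icc (lo 2) (hi 2), 0 < deriv (deriv ψ) z) :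
    ∃ C Λ : ℝ, 0 < C ∧ 1 ≤ Λ ∧ ∀ lam, Λ ≤ lam → ∀ u, VanishesOnFaces lo hi u →
      C / lam * ∑ i, ∑ j, (∫ x in Icc lo hi, pd i (pd j u) x ^ 2 * Real.exp (2 * lam * ψ (x 2))) +
      C * lam * ∑ i, (∫ x in Icc lo hi, pd i u x ^ 2 * Real.exp (2 * lam * ψ (x 2))) +
      C * lam ^ 3 * (∫ x in Icc lo hi, u x ^ 2 * Real.exp (2 * lam * ψ (x 2))) ≤
      ∫ x in Icc lo hi, (∑ i, pd i (pd i u) x) ^ 2 * Real.exp (2 * lam * ψ (x 2)) := by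
  have hψ1 : ContDiff ℝ ∞ (deriv ψ) := by simpa using hψ.iterate_deriv 1
  set a : ℝ → ℝ := fun z => -deriv ψ z with ha_def
  have ha : ContDiff ℝ ∞ a := hψ1.neg
  have ha1 : ContDiff ℝ ∞ (deriv a) := by simpa using ha.iterate_deriv 1
  have hda : ∀ z, deriv a z = -deriv (deriv ψ) z := fun z => by simp [ha_def]
  have hne : (Icc (lo 2) (hi 2)).Nonempty := nonempty_Icc.2 (hle 2)
  obtain ⟨z1, hz1, hm1⟩ := isCompact_Icc.exists_isMinOn hne ha.continuous.continuousOn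
  obtain ⟨z2, hz2, hm2⟩ := isCompact_Icc.exists_isMaxOn hne ha1.continuous.continuousOn
  obtain ⟨A1, hA1⟩ := (isCompact_Icc (a := lo 2) (b := hi 2)).exists_bound_of_continuousOn ha.continuous.continuousOn
  obtain ⟨A2, hA2⟩ := (isCompact_Icc (a := lo 2) (b := hi 2)).exists_bound_of_continuousOn ha1.continuous.continuousOn
  obtain ⟨A3, hA3⟩ := (isCompact_Icc (a := lo 2) (b := hi 2)).exists_bound_of_continuousOn
    (ha1.continuous_deriv (by simp)).continuousOn
  set a₀ := min (a z1) (-deriv a z2) with ha₀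
  have ha₀pos : 0 < a₀ := by
    refine lt_min (by simpa [ha_def] using h1 z1 hz1) ?_
    rw [hda]; simpa using h2 z2 hz2
  set A := max 1 (max A1 A2)
  have hA : 1 ≤ A := le_max_left _ _
  have b1 : ∀ z ∈ Icc (lo 2) (hi 2), a₀ ≤ a z := fun z hz => (min_le_left _ _).trans (hm1 hz)
  have b2 : ∀ z ∈ Icc (lo 2) (hi 2), deriv a z ≤ -a₀ := fun z hz => by
    have k1 : deriv a z ≤ deriv a z2 := hm2 hz
    have k2 := min_le_right (a z1) (-deriv a z2)
    rw [← ha₀] at k2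
    linarith
  have b3 : ∀ z ∈ Icc (lo 2) (hi 2), deriv (deriv a) z ≤ A3 := fun z hz =>
    (le_abs_self _).trans (hA3 z hz)
  have b4 : ∀ z ∈ Icc (lo 2) (hi 2), |a z| ≤ A := fun z hz =>
    (hA1 z hz).trans ((le_max_left _ _).trans (le_max_right _ _))
  have b5 : ∀ z ∈ Icc (lo 2) (hi 2), |deriv a z| ≤ A := fun z hz =>
    (hA2 z hz).trans ((le_max_right _ _).trans (le_max_right _ _))
  -- `K0`, `K1`, `K2` bound λ³ ∫ w², λ ∫ |∇w|² and λ⁻¹ ∫ |D²w|² by the integral of the squared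
  -- conjugated operator, each using the preceding ones.
  set K0 := 1 / (2 * a₀ ^ 3)
  set K1 := 1 / 2 + (1 / 2 + A ^ 2) * K0
  set K2 := 3 + 12 * A ^ 2 * K1 + 12 * A ^ 4 * K0
  have hK0 : 0 < K0 := by positivity
  have hK1 : 0 < K1 := by positivity
  have hK2 : 0 < K2 := by positivity
  -- `M1` and `M2` play the same role for the derivatives of u. Differentiating e^(-λψ) produces
  -- lower derivatives of w with powers of λ that the bounds above exactly absorb.
  set M1 := 2 * K1 + 6 * A ^ 2 * K0
  set M2 := 4 * K2 + 24 * A ^ 2 * K1 + 144 * A ^ 4 * K0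
  have hM1 : 0 < M1 := by positivity
  have hM2 : 0 < M2 := by positivity
  refine ⟨1 / (M2 + M1 + K0), max 1 (A3 / a₀ ^ 2), by positivity, le_max_left _ _, ?_⟩
  intro lam hlam u hu
  have hl1 : 1 ≤ lam := (le_max_left _ _).trans hlam
  have hl0 : 0 < lam := by linarith
  -- This is where the threshold `A3 / a₀ ^ 2` is spent: λ a'' must not exceed the main part of the
  -- derivative of the zero order coefficient.
  have hl2 : A3 ≤ lam * a₀ ^ 2 := by
    have := (le_max_right _ _).trans hlam
    rwa [div_le_iff₀ (by positivity)] at this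
  set w : Pt → ℝ := fun x => Real.exp (lam * ψ (x 2)) * u x with hw_def
  have hθ : ContDiff ℝ ∞ (fun x : Pt => Real.exp (lam * ψ (x 2))) := by
    have : ContDiff ℝ ∞ (fun z => Real.exp (lam * ψ z)) := by fun_prop
    exact this.comp (contDiff_apply ℝ ℝ 2)
  have hw : VanishesOnFaces lo hi w := by
    refine ⟨hθ.mul hu.smooth, fun i x hx => by simp [hw_def, hu.lower i x hx],
      fun i x hx => by simp [hw_def, hu.upper i x hx], fun x hx => ?_⟩
    rw [hw_def, pd_mul (differentiable_of_smooth hθ) (differentiable_of_smooth hu.smooth)]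
    simp [hu.lower 2 x hx, hu.normal x hx]
  have huw : u = fun x => Real.exp (-lam * ψ (x 2)) * w x := by
    funext x
    simp only [hw_def]
    rw [← mul_assoc, ← Real.exp_add]; simp
  have hexp : ∀ x : Pt, Real.exp (-lam * ψ (x 2)) ^ 2 * Real.exp (2 * lam * ψ (x 2)) = 1 := by
    intro x
    rw [← Real.exp_nat_mul, ← Real.exp_add]
    simp
    ring
  have hconv : ∀ (x : Pt) (r : ℝ),
      (Real.exp (-lam * ψ (x 2)) * r) ^ 2 * Real.exp (2 * lam * ψ (x 2)) = r ^ 2 := by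
    intro x r
    rw [mul_pow, mul_right_comm, hexp, one_mul]
  have e0 : ∀ x, u x ^ 2 * Real.exp (2 * lam * ψ (x 2)) = w x ^ 2 := fun x => by
    rw [huw]; exact hconv x _
  have hmem : ∀ x ∈ Icc lo hi, x 2 ∈ Icc (lo 2) (hi 2) := fun x hx => ⟨hx.1 2, hx.2 2⟩
  have cu := hu.smooth.continuous
  have cui := continuous_pd hu.smooth
  have cuij : ∀ i j, Continuous (pd i (pd j u)) := fun i j =>
    continuous_pd (contDiff_pd hu.smooth j) i
  have cw := hw.smooth.continuous
  have cwi := continuous_pd hw.smooth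
  have cwij : ∀ i j, Continuous (pd i (pd j w)) := fun i j =>
    continuous_pd (contDiff_pd hw.smooth j) i
  have cψ : Continuous (fun x : Pt => ψ (x 2)) := hψ.continuous.comp (continuous_apply 2)
  have hbi : ∀ (i : Fin 3), ∀ x ∈ Icc lo hi, |if i = 2 then -deriv ψ (x 2) else 0| ≤ A := by
    intro i x hx
    split_ifs
    · exact b4 _ (hmem x hx)
    · simp; linarith
  have e1 : ∀ i, ∀ x ∈ Icc lo hi, pd i u x ^ 2 * Real.exp (2 * lam * ψ (x 2)) ≤
      2 * pd i w x ^ 2 + 2 * lam ^ 2 * A ^ 2 * w x ^ 2 := by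
    intro i x hx
    rw [huw, pd_exp_mul hψ lam hw.smooth, hconv]
    have k := hbi i x hx
    set c := if i = 2 then -deriv ψ (x 2) else 0
    have k2 : c ^ 2 ≤ A ^ 2 := sq_le_sq' (by linarith [(abs_le.1 k).1]) (abs_le.1 k).2
    calc _ ≤ 2 * pd i w x ^ 2 + 2 * (lam * c * w x) ^ 2 := by
          nlinarith [sq_nonneg (pd i w x - lam * c * w x)]
      _ = 2 * pd i w x ^ 2 + 2 * lam ^ 2 * c ^ 2 * w x ^ 2 := by ring
      _ ≤ _ := by gcongr
  have e2 : ∀ i j, ∀ x ∈ Icc lo hi, pd i (pd j u) x ^ 2 * Real.exp (2 * lam * ψ (x 2)) ≤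
      4 * pd i (pd j w) x ^ 2 + 4 * lam ^ 2 * A ^ 2 * pd i w x ^ 2 +
        4 * lam ^ 2 * A ^ 2 * pd j w x ^ 2 + 16 * lam ^ 4 * A ^ 4 * w x ^ 2 := by
    intro i j x hx
    rw [huw, pd_pd_exp_mul hψ lam hw.smooth, hconv]
    have k := hbi i x hx
    have k' := hbi j x hx
    have k5 : |if j = 2 ∧ i = 2 then deriv (fun z => -deriv ψ z) (x 2) else 0| ≤ A := by
      split_ifs
      · exact b5 _ (hmem x hx)
      · simp; linarith
    set c := if i = 2 then -deriv ψ (x 2) else 0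
    set c' := if j = 2 then -deriv ψ (x 2) else 0
    set c'' := if j = 2 ∧ i = 2 then deriv (fun z => -deriv ψ z) (x 2) else 0
    have k2 : c ^ 2 ≤ A ^ 2 := sq_le_sq' (by linarith [(abs_le.1 k).1]) (abs_le.1 k).2
    have k2' : c' ^ 2 ≤ A ^ 2 := sq_le_sq' (by linarith [(abs_le.1 k').1]) (abs_le.1 k').2
    have k6 : |lam ^ 2 * c' * c + lam * c''| ≤ 2 * lam ^ 2 * A ^ 2 := by
      refine (abs_add_le _ _).trans ?_
      rw [abs_mul, abs_mul, abs_mul, abs_of_pos hl0, abs_of_nonneg (by positivity : 0 ≤ lam ^ 2)]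
      have m1 : lam ^ 2 * |c'| * |c| ≤ lam ^ 2 * A * A := by gcongr
      have m2 : lam * |c''| ≤ lam ^ 2 * A ^ 2 := by
        calc lam * |c''| ≤ lam * A := by gcongr
          _ ≤ lam ^ 2 * A ^ 2 := by gcongr <;> nlinarith
      linarith
    have k7 : (lam ^ 2 * c' * c + lam * c'') ^ 2 ≤ (2 * lam ^ 2 * A ^ 2) ^ 2 :=
      sq_le_sq' (by linarith [(abs_le.1 k6).1]) (abs_le.1 k6).2
    have t : ∀ p q r s : ℝ, (p + q + r + s) ^ 2 ≤ 4 * p ^ 2 + 4 * q ^ 2 + 4 * r ^ 2 + 4 * s ^ 2 :=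
      fun p q r s => by
        nlinarith [sq_nonneg (p - q), sq_nonneg (q - r), sq_nonneg (p - r), sq_nonneg (p - s),
          sq_nonneg (q - s), sq_nonneg (r - s)]
    refine (t _ _ _ _).trans ?_
    have m1 : (lam * c' * pd i w x) ^ 2 ≤ lam ^ 2 * A ^ 2 * pd i w x ^ 2 := by
      rw [mul_pow, mul_pow]; gcongr
    have m2 : (lam * c * pd j w x) ^ 2 ≤ lam ^ 2 * A ^ 2 * pd j w x ^ 2 := by
      rw [mul_pow, mul_pow]; gcongr
    have m3 : ((lam ^ 2 * c' * c + lam * c'') * w x) ^ 2 ≤ 4 * lam ^ 4 * A ^ 4 * w x ^ 2 := by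
      calc _ = (lam ^ 2 * c' * c + lam * c'') ^ 2 * w x ^ 2 := by ring
        _ ≤ (2 * lam ^ 2 * A ^ 2) ^ 2 * w x ^ 2 := by gcongr
        _ = _ := by ring
    linarith
  have eP : ∀ x, (∑ i, pd i (pd i u) x) ^ 2 * Real.exp (2 * lam * ψ (x 2)) =
      conjLap a lam w x ^ 2 := by
    intro x
    have : ∑ i, pd i (pd i u) x = Real.exp (-lam * ψ (x 2)) * conjLap a lam w x := by
      rw [huw]
      simp only [pd_pd_exp_mul hψ lam hw.smooth, conjLap, Fin.sum_univ_three, ha_def]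
      simp
      ring
    rw [this, hconv]
  simp only [e0, eP]
  set S0 := ∫ x in Icc lo hi, w x ^ 2
  set S1 := ∑ i, ∫ x in Icc lo hi, pd i w x ^ 2 with hS1
  set S2 := ∑ i, ∑ j, ∫ x in Icc lo hi, pd i (pd j w) x ^ 2 with hS2
  set P := ∫ x in Icc lo hi, conjLap a lam w x ^ 2
  have hP0 : 0 ≤ P := integral_nonneg fun x => sq_nonneg _
  have hS00 : 0 ≤ S0 := integral_nonneg fun x => sq_nonneg _
  have r0 : lam ^ 3 * S0 ≤ K0 * P := by
    have := hw.integral_sq_le hle ha ha₀pos b1 b2 b3 hl0 hl2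
    have h3 : 0 < 2 * a₀ ^ 3 := by positivity
    simp only [K0]
    rw [one_div, ← div_eq_inv_mul, le_div_iff₀ h3]
    linarith
  have r1 : lam * S1 ≤ K1 * P := by
    refine (hw.integral_grad_le hle ha b4 hl0).trans ?_
    have : (lam ^ 2 / 2 + lam ^ 3 * A ^ 2) * S0 ≤ (1 / 2 + A ^ 2) * (lam ^ 3 * S0) := by
      have : lam ^ 2 ≤ lam ^ 3 := pow_le_pow_right₀ hl1 (by norm_num)
      nlinarith
    have h4 : (1 / 2 + A ^ 2) * (lam ^ 3 * S0) ≤ (1 / 2 + A ^ 2) * (K0 * P) := by gcongr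
    calc _ ≤ 1 / 2 * P + (1 / 2 + A ^ 2) * (K0 * P) := by linarith
      _ = _ := by simp only [K1]; ring
  have r2 : S2 ≤ lam * (K2 * P) := by
    refine (hw.integral_hessian_le hle ha hA b4 b5 hl1).trans ?_
    have q1 : 12 * lam ^ 2 * A ^ 2 * S1 ≤ 12 * lam * A ^ 2 * (K1 * P) := by
      calc _ = 12 * lam * A ^ 2 * (lam * S1) := by ring
        _ ≤ _ := by gcongr
    have q2 : 12 * lam ^ 4 * A ^ 4 * S0 ≤ 12 * lam * A ^ 4 * (K0 * P) := by
      calc _ = 12 * lam * A ^ 4 * (lam ^ 3 * S0) := by ring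
        _ ≤ _ := by gcongr
    have q3 : 3 * P ≤ lam * (3 * P) := by nlinarith
    calc _ ≤ lam * (3 * P) + 12 * lam * A ^ 2 * (K1 * P) + 12 * lam * A ^ 4 * (K0 * P) := by
          linarith
      _ = _ := by simp only [K2]; ring
  have t1 : lam * ∑ i, (∫ x in Icc lo hi, pd i u x ^ 2 * Real.exp (2 * lam * ψ (x 2))) ≤ M1 * P := by
    have : ∀ i, (∫ x in Icc lo hi, pd i u x ^ 2 * Real.exp (2 * lam * ψ (x 2))) ≤
        2 * (∫ x in Icc lo hi, pd i w x ^ 2) + 2 * lam ^ 2 * A ^ 2 * S0 := by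
      intro i
      rw [← integral_const_mul, ← integral_const_mul,
        ← integral_add (integrable_Icc (by fun_prop)) (integrable_Icc (by fun_prop))]
      exact setIntegral_mono_on (integrable_Icc (by fun_prop)) (integrable_Icc (by fun_prop))
        measurableSet_Icc (e1 i)
    have h3 : ∑ i, (∫ x in Icc lo hi, pd i u x ^ 2 * Real.exp (2 * lam * ψ (x 2))) ≤
        2 * S1 + 6 * lam ^ 2 * A ^ 2 * S0 := by
      refine (Finset.sum_le_sum fun i _ => this i).trans (le_of_eq ?_)
      rw [Finset.sum_add_distrib, ← Finset.mul_sum]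
      simp
      ring
    calc _ ≤ lam * (2 * S1 + 6 * lam ^ 2 * A ^ 2 * S0) := by gcongr
      _ = 2 * (lam * S1) + 6 * A ^ 2 * (lam ^ 3 * S0) := by ring
      _ ≤ 2 * (K1 * P) + 6 * A ^ 2 * (K0 * P) := by gcongr
      _ = _ := by simp only [M1]; ring
  have t2 : ∑ i, ∑ j, (∫ x in Icc lo hi, pd i (pd j u) x ^ 2 * Real.exp (2 * lam * ψ (x 2))) ≤
      lam * (M2 * P) := by
    have : ∀ i j, (∫ x in Icc lo hi, pd i (pd j u) x ^ 2 * Real.exp (2 * lam * ψ (x 2))) ≤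
        4 * (∫ x in Icc lo hi, pd i (pd j w) x ^ 2) +
          4 * lam ^ 2 * A ^ 2 * (∫ x in Icc lo hi, pd i w x ^ 2) +
          4 * lam ^ 2 * A ^ 2 * (∫ x in Icc lo hi, pd j w x ^ 2) + 16 * lam ^ 4 * A ^ 4 * S0 := by
      intro i j
      simp only [S0, ← integral_const_mul]
      rw [← integral_add (integrable_Icc (by fun_prop)) (integrable_Icc (by fun_prop)),
        ← integral_add (integrable_Icc (by fun_prop)) (integrable_Icc (by fun_prop)),
        ← integral_add (integrable_Icc (by fun_prop)) (integrable_Icc (by fun_prop))]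
      exact setIntegral_mono_on (integrable_Icc (by fun_prop)) (integrable_Icc (by fun_prop))
        measurableSet_Icc (e2 i j)
    have h3 : ∑ i, ∑ j, (∫ x in Icc lo hi, pd i (pd j u) x ^ 2 * Real.exp (2 * lam * ψ (x 2))) ≤
        4 * S2 + 24 * lam ^ 2 * A ^ 2 * S1 + 144 * lam ^ 4 * A ^ 4 * S0 := by
      refine (Finset.sum_le_sum fun i _ => Finset.sum_le_sum fun j _ => this i j).trans
        (le_of_eq ?_)
      simp only [hS1, hS2, Fin.sum_univ_three]
      ring
    calc _ ≤ 4 * S2 + 24 * lam ^ 2 * A ^ 2 * S1 + 144 * lam ^ 4 * A ^ 4 * S0 := h3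
      _ = 4 * S2 + 24 * lam * A ^ 2 * (lam * S1) + 144 * lam * A ^ 4 * (lam ^ 3 * S0) := by ring
      _ ≤ 4 * (lam * (K2 * P)) + 24 * lam * A ^ 2 * (K1 * P) + 144 * lam * A ^ 4 * (K0 * P) := by
          gcongr
      _ = _ := by simp only [M2]; ring
  set T1 := ∑ i, (∫ x in Icc lo hi, pd i u x ^ 2 * Real.exp (2 * lam * ψ (x 2)))
  set T2 := ∑ i, ∑ j, (∫ x in Icc lo hi, pd i (pd j u) x ^ 2 * Real.exp (2 * lam * ψ (x 2)))
  have hM : 0 < M2 + M1 + K0 := by positivity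
  clear_value T1 T2 S0 P M1 M2 K0
  have t3 : T2 / lam ≤ M2 * P := by
    rw [div_le_iff₀ hl0]; linarith
  calc _ = (1 / (M2 + M1 + K0)) * (T2 / lam + lam * T1 + lam ^ 3 * S0) := by ring
    _ ≤ (1 / (M2 + M1 + K0)) * (M2 * P + M1 * P + K0 * P) := by gcongr
    _ = P := by rw [← add_mul, ← add_mul, one_div, inv_mul_cancel_left₀ hM.ne']

end smooth


/-! ### Mollification -/

/-- A one-dimensional even bump function, supported in `[-1/(n+1), 1/(n+1)]`. -/
def bump1 (n : ℕ) : ContDiffBump (0 : ℝ) where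
  rIn := 1 / (n + 1) / 2
  rOut := 1 / (n + 1)
  rIn_pos := by positivity
  rIn_lt_rOut := half_lt_self (by positivity)

/-- A product mollifier, even in each coordinate. -/
def molKer (n : ℕ) (x : Pt) : ℝ := ∏ i, (bump1 n).normed volume (x i)

theorem molKer_nonneg (n : ℕ) (x : Pt) : 0 ≤ molKer n x :=
  Finset.prod_nonneg fun _ _ => (bump1 n).nonneg_normed _

theorem molKer_neg (n : ℕ) (x : Pt) : molKer n (-x) = molKer n x := by
  simp [molKer, ContDiffBump.normed_neg]

theorem molKer_update_neg (n : ℕ) (j : Fin 3) (x : Pt) :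
    molKer n (Function.update x j (-x j)) = molKer n x := by
  refine Finset.prod_congr rfl fun i _ => ?_
  by_cases h : i = j
  · subst h; simp [ContDiffBump.normed_neg]
  · simp [h]

theorem molKer_support (n : ℕ) {x : Pt} (h : molKer n x ≠ 0) (i : Fin 3) :
    |x i| < 1 / ((n : ℝ) + 1) := by
  have h1 := Finset.prod_ne_zero_iff.1 h i (Finset.mem_univ i)
  have h2 : x i ∈ Function.support ((bump1 n).normed volume) := h1
  rw [ContDiffBump.support_normed_eq] at h2
  simpa [bump1] using h2

theorem contDiff_molKer (n : ℕ) : ContDiff ℝ ∞ (molKer n) := by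
  unfold molKer
  refine contDiff_prod fun i _ => ?_
  exact ((bump1 n).contDiff_normed (n := ⊤)).comp (contDiff_apply ℝ ℝ i)

theorem molKer_support_subset (n : ℕ) :
    Function.support (molKer n) ⊆ Metric.closedBall 0 (1 / ((n : ℝ) + 1)) := by
  intro x hx
  rw [mem_closedBall_zero_iff, pi_norm_le_iff_of_nonneg (by positivity)]
  exact fun i => (molKer_support n hx i).le

theorem isTest_molKer (n : ℕ) : IsTest (molKer n) :=
  ⟨contDiff_molKer n, HasCompactSupport.of_support_subset_isCompact
    (isCompact_closedBall _ _) (molKer_support_subset n)⟩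

theorem integral_molKer (n : ℕ) : ∫ x, molKer n x = 1 := by
  unfold molKer
  rw [integral_fintype_prod_volume_eq_prod (fun _ : Fin 3 => (bump1 n).normed volume)]
  simp [ContDiffBump.integral_normed]

theorem integrable_molKer (n : ℕ) : Integrable (molKer n) :=
  (contDiff_molKer n).continuous.integrable_of_hasCompactSupport (isTest_molKer n).2

theorem integral_molKer_sub (n : ℕ) (x : Pt) : ∫ y, molKer n (x - y) = 1 := by
  rw [integral_sub_left_eq_self (molKer n) volume x, integral_molKer]

theorem lintegral_molKer_sub (n : ℕ) (x : Pt) : ∫⁻ y, ENNReal.ofReal (molKer n (x - y)) = 1 := by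
  rw [lintegral_sub_left_eq_self (fun y => ENNReal.ofReal (molKer n y)) x,
    ← ofReal_integral_eq_lintegral_ofReal (integrable_molKer n)
      (Eventually.of_forall (molKer_nonneg n)), integral_molKer, ENNReal.ofReal_one]

theorem lintegral_molKer_sub_right (n : ℕ) (y : Pt) :
    ∫⁻ x, ENNReal.ofReal (molKer n (x - y)) = 1 := by
  rw [← lintegral_molKer_sub n y]
  congr 1; funext x
  rw [← molKer_neg, neg_sub]

/-- Lebesgue differentiation needs the kernel to be at most a constant over the volume of its ball.
In the supremum norm the ball is a cube, and each coordinate factor loses 2 because the outer radius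
of the bump is twice the inner one; hence 8. -/
theorem molKer_le (n : ℕ) (x : Pt) :
    |molKer n x| ≤ 8 / volume.real (Metric.closedBall (0 : Pt) (1 / ((n : ℝ) + 1))) := by
  have h1 : ∀ t : ℝ, (bump1 n).normed volume t ≤ 2 / (2 * (1 / ((n : ℝ) + 1))) := by
    intro t
    have := (bump1 n).normed_le_div_measure_closedBall_rOut volume 2 (by simp only [bump1]; linarith) t
    simpa [bump1, Real.volume_closedBall, measureReal_def,
      ENNReal.toReal_ofReal (by positivity : (0 : ℝ) ≤ ((n : ℝ) + 1)⁻¹)] using this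
  have h2 : volume.real (Metric.closedBall (0 : Pt) (1 / ((n : ℝ) + 1))) =
      (2 * (1 / ((n : ℝ) + 1))) ^ 3 := by
    rw [measureReal_def, Real.volume_pi_closedBall _ (by positivity),
      ENNReal.toReal_ofReal (by positivity)]
    simp
  rw [abs_of_nonneg (molKer_nonneg n x), h2]
  calc molKer n x ≤ ∏ _i : Fin 3, 2 / (2 * (1 / ((n : ℝ) + 1))) :=
        Finset.prod_le_prod (fun _ _ => (bump1 n).nonneg_normed _) fun i _ => h1 _
    _ = _ := by simp only [Finset.prod_const, Finset.card_univ, Fintype.card_fin, div_pow]; norm_num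

/-- The mollification of a function. -/
def moll (n : ℕ) (f : Pt → ℝ) (x : Pt) : ℝ := ∫ y, molKer n (x - y) * f y

theorem moll_eq_convolution (n : ℕ) (f : Pt → ℝ) :
    moll n f = convolution (molKer n) f (ContinuousLinearMap.lsmul ℝ ℝ) volume := by
  funext x
  rw [convolution_eq_swap]; rfl

theorem contDiff_moll (n : ℕ) {f : Pt → ℝ} (hf : Integrable f) : ContDiff ℝ ∞ (moll n f) := by
  rw [moll_eq_convolution]
  exact (isTest_molKer n).2.contDiff_convolution_left (n := ⊤) _ (contDiff_molKer n)
    hf.locallyIntegrable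

/-- The derivative falls on the smooth kernel, so `f` only has to be integrable. -/
theorem pd_convolution {φ : Pt → ℝ} (hφ : IsTest φ) {f : Pt → ℝ} (hf : Integrable f) (i : Fin 3)
    (x : Pt) : pd i (fun x => ∫ y, φ (x - y) * f y) x = ∫ y, pd i φ (x - y) * f y := by
  have e : (fun x => ∫ y, φ (x - y) * f y) =
      convolution φ f (ContinuousLinearMap.lsmul ℝ ℝ) volume := by
    funext x
    rw [convolution_eq_swap]; rfl
  have h := hφ.2.hasFDerivAt_convolution_left (ContinuousLinearMap.lsmul ℝ ℝ)
    (hφ.1.of_le (by simp)) hf.locallyIntegrable x (μ := volume)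
  unfold pd
  rw [e, h.fderiv, convolution_eq_swap]
  have hint : Integrable (fun t => ((ContinuousLinearMap.lsmul ℝ ℝ : ℝ →L[ℝ] ℝ →L[ℝ] ℝ).precompL Pt
      (fderiv ℝ φ (x - t))) (f t)) := by
    have := (hφ.2.fderiv (𝕜 := ℝ)).convolutionExists_left
      ((ContinuousLinearMap.lsmul ℝ ℝ : ℝ →L[ℝ] ℝ →L[ℝ] ℝ).precompL Pt)
      (hφ.1.continuous_fderiv (by simp)) hf.locallyIntegrable (μ := volume) x
    exact this.integrable_swap
  rw [ContinuousLinearMap.integral_apply hint]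
  congr 1

theorem pd_moll (n : ℕ) {f : Pt → ℝ} (hf : Integrable f) (i : Fin 3) (x : Pt) :
    pd i (moll n f) x = ∫ y, pd i (molKer n) (x - y) * f y :=
  pd_convolution (isTest_molKer n) hf i x

theorem isTest_comp_sub {φ : Pt → ℝ} (hφ : IsTest φ) (x : Pt) : IsTest (fun y => φ (x - y)) :=
  ⟨hφ.1.comp (contDiff_const.sub contDiff_id),
    hφ.2.comp_homeomorph (Homeomorph.subLeft x)⟩

theorem pd_comp_sub {φ : Pt → ℝ} (hφ : IsTest φ) (x : Pt) (i : Fin 3) (y : Pt) :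
    pd i (fun y => φ (x - y)) y = -pd i φ (x - y) := by
  have h1 : HasFDerivAt φ (fderiv ℝ φ (x - y)) (x - y) :=
    (hφ.1.differentiable (by simp) _).hasFDerivAt
  have h2 : HasFDerivAt (fun y : Pt => x - y) (-ContinuousLinearMap.id ℝ Pt) y := by
    simpa using (hasFDerivAt_id (𝕜 := ℝ) y).const_sub x
  have := h1.comp y h2
  unfold pd
  rw [show (fun y => φ (x - y)) = φ ∘ fun y => x - y from rfl, this.fderiv]
  simp

theorem tsupport_comp_sub_subset (n : ℕ) (x : Pt) :
    tsupport (fun y => molKer n (x - y)) ⊆ Metric.closedBall x (1 / ((n : ℝ) + 1)) := by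
  refine closure_minimal (fun y hy => ?_) Metric.isClosed_closedBall
  have := molKer_support_subset n (show molKer n (x - y) ≠ 0 from hy)
  rw [mem_closedBall_zero_iff] at this
  rwa [Metric.mem_closedBall, dist_comm, dist_eq_norm]

/-- Mollification commutes with weak derivatives. -/
theorem pd_moll_eq (n : ℕ) {f g : Pt → ℝ} (hf : Integrable f) (i : Fin 3) {S : Set Pt}
    (h : ∀ φ, IsTest φ → tsupport φ ⊆ S → ∫ y, pd i φ y * f y = -∫ y, φ y * g y) {x : Pt}
    (hx : Metric.closedBall x (1 / ((n : ℝ) + 1)) ⊆ S) : pd i (moll n f) x = moll n g x := by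
  have := h _ (isTest_comp_sub (isTest_molKer n) x) ((tsupport_comp_sub_subset n x).trans hx)
  rw [pd_moll n hf, moll]
  simp only [pd_comp_sub (isTest_molKer n), neg_mul, integral_neg, neg_inj] at this
  exact this

/-- Second-order version of `pd_moll_eq`. -/
theorem pd_pd_moll_eq (n : ℕ) {f g : Pt → ℝ} (hf : Integrable f) (i j : Fin 3) {S : Set Pt}
    (h : ∀ φ, IsTest φ → tsupport φ ⊆ S → ∫ y, pd i (pd j φ) y * f y = ∫ y, φ y * g y) {x : Pt}
    (hx : Metric.closedBall x (1 / ((n : ℝ) + 1)) ⊆ S) :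
    pd i (pd j (moll n f)) x = moll n g x := by
  have hk := isTest_molKer n
  have e : pd j (moll n f) = fun x => ∫ y, pd j (molKer n) (x - y) * f y := by
    funext x; exact pd_moll n hf j x
  rw [e, pd_convolution (hk.pd j) hf i x, moll,
    ← h _ (isTest_comp_sub hk x) ((tsupport_comp_sub_subset n x).trans hx)]
  have e2 : pd j (fun y => molKer n (x - y)) = fun y => -1 * pd j (molKer n) (x - y) := by
    funext y; rw [pd_comp_sub hk]; ring
  rw [e2, pd_const_mul (differentiable_of_smooth (isTest_comp_sub (hk.pd j) x).1)]
  simp only [pd_comp_sub (hk.pd j)]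
  congr 1; funext y; ring

/-- Convergence holds at the Lebesgue points of `f`, since the kernel has mass one and is dominated
by averages over shrinking balls. -/
theorem ae_tendsto_moll {f : Pt → ℝ} (hf : Integrable f) :
    ∀ᵐ x, Tendsto (fun n => moll n f x) atTop (𝓝 (f x)) := by
  filter_upwards [(Besicovitch.vitaliFamily (volume : Measure Pt)).ae_tendsto_average_norm_sub
    hf.locallyIntegrable] with x h
  have h0 : Tendsto (fun n : ℕ => 1 / ((n : ℝ) + 1)) atTop (𝓝[>] 0) :=
    tendsto_nhdsWithin_iff.2 ⟨tendsto_one_div_add_atTop_nhds_zero_nat,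
      Eventually.of_forall fun n => by simp only [mem_Ioi]; positivity⟩
  have h1 := (h.comp (Besicovitch.tendsto_filterAt volume x)).comp h0
  have key := tendsto_integral_smul_of_tendsto_average_norm_sub
    (g := fun n y => molKer n (x - y)) 8 h1
    (Eventually.of_forall fun n => hf.integrableOn)
    (by simp only [integral_molKer_sub]; exact tendsto_const_nhds)
    (Eventually.of_forall fun n => subset_closure.trans (tsupport_comp_sub_subset n x))
    (Eventually.of_forall fun n y => by
      refine (molKer_le n _).trans (le_of_eq ?_)
      rw [measureReal_def, measureReal_def, Measure.addHaar_closedBall_center volume x])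
  exact key

/-- The support of a mollification. -/
theorem moll_eq_zero {n : ℕ} {f : Pt → ℝ} {x : Pt}
    (h : ∀ y, (∀ i, |x i - y i| < 1 / ((n : ℝ) + 1)) → f y = 0) : moll n f x = 0 := by
  unfold moll
  refine integral_eq_zero_of_ae (Eventually.of_forall fun y => ?_)
  by_cases hy : molKer n (x - y) = 0
  · simp [hy]
  · simp [h y fun i => by simpa using molKer_support n hy i]

/-! ### Reflections -/

/-- The reflection in the plane `x_j = c`. -/
def refl (j : Fin 3) (c : ℝ) (y : Pt) : Pt := Function.update y j (2 * c - y j)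

theorem refl_same (j : Fin 3) (c : ℝ) (y : Pt) : refl j c y j = 2 * c - y j := by simp [refl]

theorem refl_of_ne {i j : Fin 3} (h : i ≠ j) (c : ℝ) (y : Pt) : refl j c y i = y i := by
  simp [refl, h]

theorem refl_refl (j : Fin 3) (c : ℝ) (y : Pt) : refl j c (refl j c y) = y := by simp [refl]

theorem measurePreserving_refl (j : Fin 3) (c : ℝ) : MeasurePreserving (refl j c) := by
  have := volume_preserving_pi (f := fun i : Fin 3 => if i = j then fun t : ℝ => 2 * c - t else id)
    (fun i => by
      split_ifs
      · exact Measure.measurePreserving_sub_left volume (2 * c)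
      · exact MeasurePreserving.id _)
  convert this using 2 with y
  funext i
  by_cases hi : i = j
  · subst hi; simp [refl]
  · simp [hi, refl]

theorem measurableEmbedding_refl (j : Fin 3) (c : ℝ) : MeasurableEmbedding (refl j c) :=
  (MeasurableEquiv.ofInvolutive (refl j c) (refl_refl j c)
    (measurePreserving_refl j c).measurable).measurableEmbedding

/-- A mollification vanishes on a plane with respect to which the function is odd. -/
theorem moll_eq_zero_of_odd {n : ℕ} {f : Pt → ℝ} {x : Pt} (j : Fin 3)
    (h : ∀ y, (∀ i, |x i - y i| < 1 / ((n : ℝ) + 1)) →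
      f (refl j (x j) y) = -f y) : moll n f x = 0 := by
  have hmp := measurePreserving_refl j (x j)
  -- Reflecting the variable of integration preserves the kernel, which is even in each coordinate,
  -- and reverses the sign of `f`; the integral equals its own negative.
  have h1 := hmp.integral_comp (measurableEmbedding_refl j (x j)) (fun y => molKer n (x - y) * f y)
  have h2 : ∀ y : Pt, molKer n (x - refl j (x j) y) = molKer n (x - y) := by
    intro y
    rw [← molKer_update_neg n j (x - y)]
    congr 1
    funext i
    by_cases hi : i = j
    · subst hi; simp [refl]; ring
    · simp [hi, refl]
  have h3 : ∀ y : Pt, molKer n (x - y) * f (refl j (x j) y) =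
      -(molKer n (x - y) * f y) := by
    intro y
    by_cases hy : molKer n (x - y) = 0
    · simp [hy]
    · rw [h y fun i => by simpa using molKer_support n hy i]; ring
  simp only [h2, h3, integral_neg] at h1
  unfold moll
  linarith

/-- Jensen's inequality for mollifications. -/
theorem enorm_moll_rpow_le (n : ℕ) {f : Pt → ℝ} (hf : AEStronglyMeasurable f) {p : ℝ} (hp : 1 ≤ p)
    (x : Pt) : ‖moll n f x‖ₑ ^ p ≤ ∫⁻ y, ENNReal.ofReal (molKer n (x - y)) * ‖f y‖ₑ ^ p := by
  have hm : Measurable fun y => ENNReal.ofReal (molKer n (x - y)) := by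
    have := (contDiff_molKer n).continuous
    exact (by fun_prop : Continuous fun y => molKer n (x - y)).measurable.ennreal_ofReal
  -- The kernel centred at `x` is a probability density, so that Jensen's inequality is the
  -- monotonicity of L^p means.
  let μ : Measure Pt := volume.withDensity fun y => ENNReal.ofReal (molKer n (x - y))
  have : IsProbabilityMeasure μ := ⟨by
    rw [withDensity_apply _ MeasurableSet.univ, Measure.restrict_univ, lintegral_molKer_sub]⟩
  have hf' : AEStronglyMeasurable f μ := hf.mono_ac (withDensity_absolutelyContinuous _ _)
  have hint : ∀ q : ℝ, 0 < q → ∫⁻ y, ‖f y‖ₑ ^ q ∂μ =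
      ∫⁻ y, ENNReal.ofReal (molKer n (x - y)) * ‖f y‖ₑ ^ q := by
    intro q hq
    rw [lintegral_withDensity_eq_lintegral_mul₀ hm.aemeasurable (hf.enorm.pow_const q)]
    rfl
  have h1 : ‖moll n f x‖ₑ ≤ ∫⁻ y, ‖f y‖ₑ ^ (1 : ℝ) ∂μ := by
    rw [hint 1 one_pos]
    refine (enorm_integral_le_lintegral_enorm _).trans (le_of_eq ?_)
    congr 1; funext y
    rw [enorm_mul, ENNReal.rpow_one, Real.enorm_of_nonneg (molKer_nonneg n _)]
  have h2 := eLpNorm'_le_eLpNorm'_of_exponent_le one_pos hp μ hf'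
  simp only [eLpNorm'_eq_lintegral_enorm, one_div, inv_one] at h2
  rw [ENNReal.rpow_one] at h2
  rw [← hint p (by linarith)]
  calc _ ≤ ((∫⁻ y, ‖f y‖ₑ ^ p ∂μ) ^ p⁻¹) ^ p :=
        ENNReal.rpow_le_rpow (h1.trans h2) (by linarith)
    _ = _ := by rw [← ENNReal.rpow_mul, inv_mul_cancel₀ (by linarith), ENNReal.rpow_one]

theorem aemeasurable_prod_molKer (n : ℕ) {g : Pt → ENNReal} (hg : AEMeasurable g) :
    AEMeasurable (fun z : Pt × Pt => ENNReal.ofReal (molKer n (z.1 - z.2)) * g z.2)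
      (volume.prod volume) := by
  have hm : Measurable fun z : Pt × Pt => ENNReal.ofReal (molKer n (z.1 - z.2)) := by
    have := (contDiff_molKer n).continuous
    exact (by fun_prop : Continuous fun z : Pt × Pt => molKer n (z.1 - z.2)).measurable.ennreal_ofReal
  exact hm.aemeasurable.mul hg.comp_snd

/-- Mollification does not increase `L^p` norms. -/
theorem eLpNorm_moll_le (n : ℕ) {f : Pt → ℝ} (hf : AEStronglyMeasurable f) {p : ENNReal}
    (hp : 1 ≤ p) (hp' : p ≠ ⊤) : eLpNorm (moll n f) p ≤ eLpNorm f p := by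
  have h0 : p ≠ 0 := (one_pos.trans_le hp).ne'
  have h1 : 1 ≤ p.toReal := by
    rw [← ENNReal.toReal_one]; exact ENNReal.toReal_mono hp' hp
  rw [eLpNorm_eq_lintegral_rpow_enorm_toReal h0 hp', eLpNorm_eq_lintegral_rpow_enorm_toReal h0 hp']
  refine ENNReal.rpow_le_rpow ?_ (by positivity)
  calc _ ≤ ∫⁻ x, ∫⁻ y, ENNReal.ofReal (molKer n (x - y)) * ‖f y‖ₑ ^ p.toReal :=
        lintegral_mono fun x => enorm_moll_rpow_le n hf h1 x
    _ = ∫⁻ y, ∫⁻ x, ENNReal.ofReal (molKer n (x - y)) * ‖f y‖ₑ ^ p.toReal :=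
        lintegral_lintegral_swap (aemeasurable_prod_molKer n (hf.enorm.pow_const _))
    _ = _ := by
        congr 1; funext y
        rw [lintegral_mul_const'' _ (by
          have := (contDiff_molKer n).continuous
          exact (by fun_prop : Continuous fun x => molKer n (x - y)).measurable.ennreal_ofReal.aemeasurable),
          lintegral_molKer_sub_right, one_mul]

/-- Weighted `L²` norms of mollifications are asymptotically not larger. -/
theorem exists_tendsto_lintegral_moll {f w : Pt → ℝ} (hf : MemLp f 2) (hw : Integrable w)
    (hw0 : ∀ x, 0 ≤ w x) {K : ℝ} (hwK : ∀ x, w x ≤ K) :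
    ∃ a : ℕ → ENNReal, Tendsto a atTop (𝓝 (∫⁻ y, ENNReal.ofReal (w y) * ‖f y‖ₑ ^ (2 : ℝ))) ∧
      ∀ n, ∫⁻ x, ENNReal.ofReal (w x) * ‖moll n f x‖ₑ ^ (2 : ℝ) ≤ a n := by
  have hfm := hf.aestronglyMeasurable
  have hmoll : ∀ n y, ∫⁻ x, ENNReal.ofReal (molKer n (x - y)) * ENNReal.ofReal (w x) =
      ENNReal.ofReal (moll n w y) := by
    intro n y
    unfold moll
    have hi : Integrable fun x => molKer n (y - x) * w x := by
      refine Integrable.bdd_mul hw (c := 8 / volume.real (Metric.closedBall (0 : Pt) (1 / ((n : ℝ) + 1)))) ?_ ?_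
      · have := (contDiff_molKer n).continuous
        exact (by fun_prop : Continuous fun x => molKer n (y - x)).aestronglyMeasurable
      · exact Eventually.of_forall fun x => molKer_le n _
    rw [ofReal_integral_eq_lintegral_ofReal hi
      (Eventually.of_forall fun x => mul_nonneg (molKer_nonneg n _) (hw0 x))]
    congr 1; funext x
    rw [ENNReal.ofReal_mul (molKer_nonneg n _), ← molKer_neg, neg_sub]
  have hle : ∀ n y, moll n w y ≤ K := by
    intro n y
    unfold moll
    have hk : Integrable fun x => molKer n (y - x) := (integrable_molKer n).comp_sub_left y
    calc ∫ x, molKer n (y - x) * w x ≤ ∫ x, molKer n (y - x) * K := by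
          refine integral_mono_of_nonneg
            (Eventually.of_forall fun x => mul_nonneg (molKer_nonneg n _) (hw0 x))
            (hk.mul_const K) (Eventually.of_forall fun x => ?_)
          exact mul_le_mul_of_nonneg_left (hwK x) (molKer_nonneg n _)
      _ = K := by rw [integral_mul_const, integral_molKer_sub, one_mul]
  -- By Jensen and Tonelli the mollifier passes from |f|² to the weight. Only almost everywhere
  -- convergence of the mollified weights is needed in the limit, so the weight may have jumps.
  refine ⟨fun n => ∫⁻ y, ENNReal.ofReal (moll n w y) * ‖f y‖ₑ ^ (2 : ℝ), ?_, fun n => ?_⟩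
  · refine tendsto_lintegral_of_dominated_convergence'
      (fun y => ENNReal.ofReal K * ‖f y‖ₑ ^ (2 : ℝ)) (fun n => ?_) (fun n => ?_) ?_ ?_
    · exact ((contDiff_moll n hw).continuous.measurable.ennreal_ofReal.aemeasurable).mul
        (hfm.enorm.pow_const _)
    · exact Eventually.of_forall fun y =>
        mul_le_mul_left (ENNReal.ofReal_le_ofReal (hle n y)) _
    · rw [lintegral_const_mul'' _ (hfm.enorm.pow_const _)]
      refine ENNReal.mul_ne_top ENNReal.ofReal_ne_top ?_
      have := lintegral_rpow_enorm_lt_top_of_eLpNorm_lt_top (by norm_num) (by norm_num) hf.2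
      simpa using this.ne
    · filter_upwards [ae_tendsto_moll hw] with y hy
      refine ENNReal.Tendsto.mul_const ((ENNReal.continuous_ofReal.tendsto _).comp hy) (Or.inr ?_)
      exact ENNReal.rpow_ne_top_of_nonneg (by norm_num) enorm_ne_top
  · have hwm : AEMeasurable (fun x => ENNReal.ofReal (w x)) :=
      hw.aestronglyMeasurable.aemeasurable.ennreal_ofReal
    calc _ ≤ ∫⁻ x, ENNReal.ofReal (w x) *
          ∫⁻ y, ENNReal.ofReal (molKer n (x - y)) * ‖f y‖ₑ ^ (2 : ℝ) :=
          lintegral_mono fun x =>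
            mul_le_mul_right (enorm_moll_rpow_le n hfm (by norm_num) x) _
      _ = ∫⁻ x, ∫⁻ y, ENNReal.ofReal (w x) *
          (ENNReal.ofReal (molKer n (x - y)) * ‖f y‖ₑ ^ (2 : ℝ)) := by
          congr 1; funext x
          rw [lintegral_const_mul' _ _ ENNReal.ofReal_ne_top]
      _ = ∫⁻ y, ∫⁻ x, ENNReal.ofReal (w x) *
          (ENNReal.ofReal (molKer n (x - y)) * ‖f y‖ₑ ^ (2 : ℝ)) :=
          lintegral_lintegral_swap (hwm.comp_fst.mul
            (aemeasurable_prod_molKer n (hfm.enorm.pow_const _)))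
      _ = _ := by
          congr 1; funext y
          rw [← hmoll, ← lintegral_mul_const' _ _
            (ENNReal.rpow_ne_top_of_nonneg (by norm_num) enorm_ne_top)]
          congr 1; funext x; ring


/-! ### Extension by reflections -/

theorem refl_comm {i j : Fin 3} (h : i ≠ j) (c c' : ℝ) (y : Pt) :
    refl i c (refl j c' y) = refl j c' (refl i c y) := by
  unfold refl
  rw [Function.update_of_ne h, Function.update_of_ne h.symm, Function.update_comm h.symm]

theorem contDiff_refl (j : Fin 3) (c : ℝ) : ContDiff ℝ ∞ (refl j c) := by
  rw [contDiff_pi]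
  intro i
  by_cases h : i = j
  · subst h
    simp only [refl_same]
    exact contDiff_const.sub (contDiff_apply ℝ ℝ i)
  · simp only [refl_of_ne h]
    exact contDiff_apply ℝ ℝ i

theorem pd_comp_refl {φ : Pt → ℝ} (hφ : Differentiable ℝ φ) (i j : Fin 3) (c : ℝ) (x : Pt) :
    pd i (fun x => φ (refl j c x)) x = (if i = j then -1 else 1) * pd i φ (refl j c x) := by
  have h1 : HasDerivAt (fun t : ℝ => x + t • (Pi.single i 1 : Pt)) (Pi.single i 1) 0 := by
    simpa using ((hasDerivAt_id (0 : ℝ)).smul_const (Pi.single i 1 : Pt)).const_add x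
  have hd : Differentiable ℝ (fun x => φ (refl j c x)) :=
    hφ.comp ((contDiff_refl j c).differentiable (by simp))
  have h2 : HasDerivAt (fun t : ℝ => φ (refl j c (x + t • (Pi.single i 1 : Pt))))
      (pd i (fun x => φ (refl j c x)) x) 0 := by
    have : HasFDerivAt (fun x => φ (refl j c x)) (fderiv ℝ (fun x => φ (refl j c x)) x)
        (x + (0 : ℝ) • (Pi.single i 1 : Pt)) := by simpa using (hd x).hasFDerivAt
    exact HasFDerivAt.comp_hasDerivAt (l := fun x => φ (refl j c x)) (0 : ℝ) this h1
  have h3 : ∀ t : ℝ, refl j c (x + t • (Pi.single i 1 : Pt)) =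
      refl j c x + t • ((if i = j then (-1 : ℝ) else 1) • (Pi.single i 1 : Pt)) := by
    intro t
    funext l
    by_cases hl : l = j
    · subst hl
      by_cases hi : i = l
      · subst hi; simp [refl]; ring
      · simp [refl, hi, Ne.symm hi]
    · by_cases hi : i = j
      · subst hi; simp [refl, hl]
      · simp [refl, hl, hi]
  have h4 : HasDerivAt (fun t : ℝ => refl j c x + t • ((if i = j then (-1 : ℝ) else 1) •
      (Pi.single i 1 : Pt))) ((if i = j then (-1 : ℝ) else 1) • (Pi.single i 1 : Pt)) 0 := by
    simpa using ((hasDerivAt_id (0 : ℝ)).smul_const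
      ((if i = j then (-1 : ℝ) else 1) • (Pi.single i 1 : Pt))).const_add (refl j c x)
  have h5 : HasDerivAt (fun t : ℝ => φ (refl j c (x + t • (Pi.single i 1 : Pt))))
      ((if i = j then -1 else 1) * pd i φ (refl j c x)) 0 := by
    simp only [h3]
    have : HasFDerivAt φ (fderiv ℝ φ (refl j c x)) (refl j c x + (0 : ℝ) •
        ((if i = j then (-1 : ℝ) else 1) • (Pi.single i 1 : Pt))) := by
      simpa using (hφ _).hasFDerivAt
    have := this.comp_hasDerivAt (0 : ℝ) h4
    rw [map_smul, smul_eq_mul] at this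
    exact this
  exact h2.unique h5

/-- The extension of `f` across the planes `x_j = a` and `x_j = b` by reflections, with factors
`σ.1` and `σ.2`. -/
def ext1 (j : Fin 3) (a b : ℝ) (σ : ℝ × ℝ) (f : Pt → ℝ) (x : Pt) : ℝ :=
  f x + σ.1 * f (refl j a x) + σ.2 * f (refl j b x)

theorem isTest_ext1 {φ : Pt → ℝ} (hφ : IsTest φ) (j : Fin 3) (a b : ℝ) (σ : ℝ × ℝ) :
    IsTest (ext1 j a b σ φ) := by
  have h : ∀ c, IsTest (fun x => φ (refl j c x)) := fun c =>
    ⟨hφ.1.comp (contDiff_refl j c), by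
      let e : Pt ≃ₜ Pt :=
        { toFun := refl j c
          invFun := refl j c
          left_inv := refl_refl j c
          right_inv := refl_refl j c
          continuous_toFun := (contDiff_refl j c).continuous
          continuous_invFun := (contDiff_refl j c).continuous }
      exact hφ.2.comp_homeomorph e⟩
  exact ⟨(hφ.1.add (contDiff_const.mul (h a).1)).add (contDiff_const.mul (h b).1),
    (hφ.2.add ((h a).2.mul_left (f := fun _ => σ.1))).add ((h b).2.mul_left (f := fun _ => σ.2))⟩

/-- A reflection in a plane orthogonal to direction `i` reverses ∂_i and commutes with the other
derivatives. Odd extensions therefore differentiate to even ones and conversely. -/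
theorem pd_ext1 {φ : Pt → ℝ} (hφ : ContDiff ℝ ∞ φ) (i j : Fin 3) (a b : ℝ) (σ : ℝ × ℝ) :
    pd i (ext1 j a b σ φ) = ext1 j a b (if i = j then -σ else σ) (pd i φ) := by
  have hd := differentiable_of_smooth hφ
  have h : ∀ c, Differentiable ℝ (fun x => φ (refl j c x)) := fun c =>
    hd.comp ((contDiff_refl j c).differentiable (by simp))
  unfold ext1
  rw [pd_add (f := fun x => φ x + σ.1 * φ (refl j a x)) (hd.add ((h a).const_mul _)) ((h b).const_mul _), pd_add hd ((h a).const_mul _),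
    pd_const_mul (h a), pd_const_mul (h b)]
  funext x
  simp only [pd_comp_refl hd]
  split_ifs <;> simp

theorem integrable_comp_refl {f : Pt → ℝ} (hf : Integrable f) (j : Fin 3) (c : ℝ) :
    Integrable (fun x => f (refl j c x)) :=
  (measurePreserving_refl j c).integrable_comp_of_integrable hf

theorem integrable_ext1 {f : Pt → ℝ} (hf : Integrable f) (j : Fin 3) (a b : ℝ) (σ : ℝ × ℝ) :
    Integrable (ext1 j a b σ f) :=
  (hf.add ((integrable_comp_refl hf j a).const_mul _)).add
    ((integrable_comp_refl hf j b).const_mul _)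

theorem memLp_ext1 {f : Pt → ℝ} {p : ENNReal} (hf : MemLp f p) (j : Fin 3) (a b : ℝ) (σ : ℝ × ℝ) :
    MemLp (ext1 j a b σ f) p := by
  have h : ∀ c (s : ℝ), MemLp (fun x => s * f (refl j c x)) p := fun c s =>
    MemLp.const_mul (f := fun x => f (refl j c x))
      (hf.comp_measurePreserving (measurePreserving_refl j c)) s
  exact MemLp.add (f := fun x => f x + σ.1 * f (refl j a x)) (hf.add (h a _)) (h b _)

theorem eLpNorm_ext1_le {f : Pt → ℝ} {p : ENNReal} (hp : 1 ≤ p) (hf : AEStronglyMeasurable f)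
    (j : Fin 3) (a b : ℝ) {σ : ℝ × ℝ} (h1 : |σ.1| ≤ 1) (h2 : |σ.2| ≤ 1) :
    eLpNorm (ext1 j a b σ f) p ≤ 3 * eLpNorm f p := by
  have hm : ∀ c, AEStronglyMeasurable (fun x => f (refl j c x)) := fun c =>
    hf.comp_measurePreserving (measurePreserving_refl j c)
  have key : ∀ c (s : ℝ), |s| ≤ 1 → eLpNorm (fun x => s * f (refl j c x)) p ≤ eLpNorm f p := by
    intro c s hs
    have e : eLpNorm (fun x => f (refl j c x)) p = eLpNorm f p :=
      eLpNorm_comp_measurePreserving (f := refl j c) hf (measurePreserving_refl j c)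
    rw [← e]
    refine eLpNorm_mono fun x => ?_
    rw [norm_mul]
    exact mul_le_of_le_one_left (norm_nonneg _) hs
  have t1 := eLpNorm_add_le (f := fun x => f x + σ.1 * f (refl j a x))
    (g := fun x => σ.2 * f (refl j b x)) (hf.add ((hm a).const_mul _)) ((hm b).const_mul _) hp
  have t2 := eLpNorm_add_le (f := f) (g := fun x => σ.1 * f (refl j a x)) hf
    ((hm a).const_mul _) hp
  have t3 := (t1.trans (add_le_add t2 le_rfl)).trans
    (add_le_add (add_le_add le_rfl (key a _ h1)) (key b _ h2))
  refine t3.trans (le_of_eq ?_)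
  ring

theorem integral_add_const_mul_add_const_mul {f g h : Pt → ℝ} (hf : Integrable f)
    (hg : Integrable g) (hh : Integrable h) (s t : ℝ) :
    ∫ x, (f x + s * g x + t * h x) = (∫ x, f x) + s * (∫ x, g x) + t * ∫ x, h x := by
  rw [integral_add (f := fun x => f x + s * g x) (hf.add (hg.const_mul s)) (hh.const_mul t),
    integral_add hf (hg.const_mul s), integral_const_mul, integral_const_mul]

/-- The extension operator is symmetric. -/
theorem integral_mul_ext1 {φ f : Pt → ℝ} (hφ : IsTest φ) (hf : Integrable f) (j : Fin 3) (a b : ℝ)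
    (σ : ℝ × ℝ) : ∫ x, φ x * ext1 j a b σ f x = ∫ x, ext1 j a b σ φ x * f x := by
  obtain ⟨K, hK⟩ := hφ.2.exists_bound_of_continuous hφ.1.continuous
  have hi : ∀ g : Pt → ℝ, Integrable g → Integrable fun x => φ x * g x := fun g hg =>
    hg.bdd_mul hφ.1.continuous.aestronglyMeasurable (Eventually.of_forall hK)
  have hi2 : ∀ c, Integrable fun x => φ (refl j c x) * f x := fun c =>
    hf.bdd_mul (hφ.1.continuous.comp (contDiff_refl j c).continuous).aestronglyMeasurable
      (Eventually.of_forall fun x => hK _)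
  have hc : ∀ c, ∫ x, φ x * f (refl j c x) = ∫ x, φ (refl j c x) * f x := by
    intro c
    rw [← (measurePreserving_refl j c).integral_comp (measurableEmbedding_refl j c)]
    simp only [refl_refl]
  have e1 : ∫ x, φ x * ext1 j a b σ f x = (∫ x, φ x * f x) + σ.1 * (∫ x, φ x * f (refl j a x)) +
      σ.2 * ∫ x, φ x * f (refl j b x) := by
    rw [← integral_add_const_mul_add_const_mul (hi f hf) (hi _ (integrable_comp_refl hf j a))
      (hi _ (integrable_comp_refl hf j b))]
    congr 1; funext x; simp only [ext1]; ring
  have e2 : ∫ x, ext1 j a b σ φ x * f x = (∫ x, φ x * f x) + σ.1 * (∫ x, φ (refl j a x) * f x) +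
      σ.2 * ∫ x, φ (refl j b x) * f x := by
    rw [← integral_add_const_mul_add_const_mul (hi f hf) (hi2 a) (hi2 b)]
    congr 1; funext x; simp only [ext1]; ring
  rw [e1, e2, hc, hc]

/-- `f x = 0` whenever the coordinate `x i` lies in `T`. -/
def VanishesOn (i : Fin 3) (T : Set ℝ) (f : Pt → ℝ) : Prop := ∀ x : Pt, x i ∈ T → f x = 0

theorem VanishesOn.ext1_of_ne {i j : Fin 3} (h : i ≠ j) {T : Set ℝ} {f : Pt → ℝ}
    (hf : VanishesOn i T f) (a b : ℝ) (σ : ℝ × ℝ) : VanishesOn i T (ext1 j a b σ f) := by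
  intro x hx
  simp [ext1, hf x hx, hf (refl j a x) (by rwa [refl_of_ne h]),
    hf (refl j b x) (by rwa [refl_of_ne h])]

/-- On the plane x_i = a the point and its first reflection coincide and cancel. The second
reflection has coordinate 2b - a, where `f` is zero by assumption. -/
theorem VanishesOn.ext1_lower {i : Fin 3} {a b : ℝ} {σ : ℝ × ℝ} (hσ : σ.1 = -1) {f : Pt → ℝ}
    (hf : VanishesOn i (Ici (2 * b - a)) f) : VanishesOn i {a} (ext1 i a b σ f) := by
  intro x hx
  simp only [mem_singleton_iff] at hx
  have h1 : refl i a x = x := by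
    unfold refl; rw [hx, show 2 * a - a = x i by rw [hx]; ring, Function.update_eq_self]
  have h2 : f (refl i b x) = 0 := hf _ (by rw [refl_same, hx]; exact self_mem_Ici)
  simp [ext1, h1, h2, hσ]

theorem VanishesOn.ext1_upper {i : Fin 3} {a b : ℝ} {σ : ℝ × ℝ} (hσ : σ.2 = -1) {f : Pt → ℝ}
    (hf : VanishesOn i (Iic (2 * a - b)) f) : VanishesOn i {b} (ext1 i a b σ f) := by
  intro x hx
  simp only [mem_singleton_iff] at hx
  have h1 : refl i b x = x := by
    unfold refl; rw [hx, show 2 * b - b = x i by rw [hx]; ring, Function.update_eq_self]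
  have h2 : f (refl i a x) = 0 := hf _ (by rw [refl_same, hx]; exact self_mem_Iic)
  simp [ext1, h1, h2, hσ]

theorem ext1_eq_self {i : Fin 3} {a b : ℝ} {σ : ℝ × ℝ} {f : Pt → ℝ}
    (hf : VanishesOn i (Ioo a b)ᶜ f) {x : Pt} (hx : x i ∈ Ioo a b) : ext1 i a b σ f x = f x := by
  have h1 : f (refl i a x) = 0 := hf _ (by
    rw [refl_same, mem_compl_iff, mem_Ioo]; rintro ⟨h, _⟩; linarith [hx.1])
  have h2 : f (refl i b x) = 0 := hf _ (by
    rw [refl_same, mem_compl_iff, mem_Ioo]; rintro ⟨_, h⟩; linarith [hx.2])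
  simp [ext1, h1, h2]

/-- `f` is odd with respect to the plane `x_i = c`, for the points with `x_i ∈ T`. -/
def OddOn (i : Fin 3) (c : ℝ) (T : Set ℝ) (f : Pt → ℝ) : Prop :=
  ∀ x : Pt, x i ∈ T → f (refl i c x) = -f x

theorem OddOn.ext1_of_ne {i j : Fin 3} (h : i ≠ j) {c : ℝ} {T : Set ℝ} {f : Pt → ℝ}
    (hf : OddOn i c T f) (a b : ℝ) (σ : ℝ × ℝ) : OddOn i c T (ext1 j a b σ f) := by
  intro x hx
  simp only [ext1]
  rw [hf x hx, ← refl_comm h, ← refl_comm h, hf _ (by rwa [refl_of_ne h]),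
    hf _ (by rwa [refl_of_ne h])]
  ring

/-- Within one width of the slab from the upper plane the reflection in the lower plane leaves the
support, so only the antisymmetric pair remains. -/
theorem oddOn_ext1_upper {i : Fin 3} {a b : ℝ} {σ : ℝ × ℝ} (hσ : σ.2 = -1) {f : Pt → ℝ}
    (hf : VanishesOn i (Ioo a b)ᶜ f) : OddOn i b (Ioo a (2 * b - a)) (ext1 i a b σ f) := by
  intro x hx
  have h1 : f (refl i a x) = 0 := hf _ (by
    rw [refl_same, mem_compl_iff, mem_Ioo]; rintro ⟨h, _⟩; linarith [hx.1])
  have h2 : f (refl i a (refl i b x)) = 0 := hf _ (by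
    rw [refl_same, refl_same, mem_compl_iff, mem_Ioo]; rintro ⟨h, _⟩; linarith [hx.2])
  simp only [ext1, refl_refl, h1, h2, hσ]
  ring

theorem oddOn_ext1_lower {i : Fin 3} {a b : ℝ} {σ : ℝ × ℝ} (hσ : σ.1 = -1) {f : Pt → ℝ}
    (hf : VanishesOn i (Ioo a b)ᶜ f) : OddOn i a (Ioo (2 * a - b) b) (ext1 i a b σ f) := by
  intro x hx
  have h1 : f (refl i b x) = 0 := hf _ (by
    rw [refl_same, mem_compl_iff, mem_Ioo]; rintro ⟨_, h⟩; linarith [hx.2])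
  have h2 : f (refl i b (refl i a x)) = 0 := hf _ (by
    rw [refl_same, refl_same, mem_compl_iff, mem_Ioo]; rintro ⟨_, h⟩; linarith [hx.1])
  simp only [ext1, refl_refl, h1, h2, hσ]
  ring

/-! ### Enlarging the class of test functions -/

/-- A smooth cut-off function of one variable, supported in `[a + 1/(n+1), b - 1/(n+1)]`. -/
def cutoff (a b : ℝ) (n : ℕ) (t : ℝ) : ℝ :=
  Real.smoothTransition ((n + 1) * (t - a) - 1) * Real.smoothTransition ((n + 1) * (b - t) - 1)

theorem contDiff_cutoff (a b : ℝ) (n : ℕ) : ContDiff ℝ ∞ (cutoff a b n) := by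
  unfold cutoff
  have h : ContDiff ℝ ∞ Real.smoothTransition := Real.smoothTransition.contDiff
  exact (h.comp (by fun_prop)).mul (h.comp (by fun_prop))

theorem cutoff_nonneg (a b : ℝ) (n : ℕ) (t : ℝ) : 0 ≤ cutoff a b n t :=
  mul_nonneg (Real.smoothTransition.nonneg _) (Real.smoothTransition.nonneg _)

theorem cutoff_le_one (a b : ℝ) (n : ℕ) (t : ℝ) : cutoff a b n t ≤ 1 :=
  mul_le_one₀ (Real.smoothTransition.le_one _) (Real.smoothTransition.nonneg _)
    (Real.smoothTransition.le_one _)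

theorem mem_of_cutoff_ne_zero {a b : ℝ} {n : ℕ} {t : ℝ} (h : cutoff a b n t ≠ 0) :
    t ∈ Icc (a + 1 / ((n : ℝ) + 1)) (b - 1 / ((n : ℝ) + 1)) := by
  have hn : (0 : ℝ) < n + 1 := by positivity
  constructor
  · by_contra! hlt
    refine h (mul_eq_zero_of_left (Real.smoothTransition.zero_of_nonpos ?_) _)
    have : (t - a) < 1 / ((n : ℝ) + 1) := by linarith
    rw [lt_div_iff₀ hn] at this
    linarith
  · by_contra! hlt
    refine h (mul_eq_zero_of_right _ (Real.smoothTransition.zero_of_nonpos ?_))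
    have : (b - t) < 1 / ((n : ℝ) + 1) := by linarith
    rw [lt_div_iff₀ hn] at this
    linarith

theorem deriv_smoothTransition_eq_zero {t : ℝ} (h : t < 0 ∨ 1 < t) :
    deriv Real.smoothTransition t = 0 := by
  rcases h with h | h
  · have : Real.smoothTransition =ᶠ[𝓝 t] fun _ => 0 := by
      filter_upwards [Iio_mem_nhds h] with y hy
      exact Real.smoothTransition.zero_of_nonpos (le_of_lt hy)
    rw [this.deriv_eq, deriv_const]
  · have : Real.smoothTransition =ᶠ[𝓝 t] fun _ => 1 := by
      filter_upwards [Ioi_mem_nhds h] with y hy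
      exact Real.smoothTransition.one_of_one_le (le_of_lt hy)
    rw [this.deriv_eq, deriv_const]

theorem exists_deriv_smoothTransition_le : ∃ M, 0 ≤ M ∧ ∀ t, |deriv Real.smoothTransition t| ≤ M := by
  have h : ContDiff ℝ ∞ Real.smoothTransition := Real.smoothTransition.contDiff
  obtain ⟨M, hM⟩ := (isCompact_Icc (a := (0 : ℝ)) (b := 1)).exists_bound_of_continuousOn
    (h.continuous_deriv (by simp)).continuousOn
  refine ⟨M, (norm_nonneg _).trans (hM 0 (by simp)), fun t => ?_⟩
  by_cases ht : t ∈ Icc (0 : ℝ) 1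
  · exact hM t ht
  · rw [deriv_smoothTransition_eq_zero, abs_zero]
    · exact (norm_nonneg _).trans (hM 0 (by simp))
    · rw [mem_Icc, not_and_or, not_le, not_le] at ht; exact ht

theorem deriv_cutoff (a b : ℝ) (n : ℕ) (t : ℝ) : deriv (cutoff a b n) t =
    deriv Real.smoothTransition ((n + 1) * (t - a) - 1) * (n + 1) *
      Real.smoothTransition ((n + 1) * (b - t) - 1) +
    Real.smoothTransition ((n + 1) * (t - a) - 1) *
      (deriv Real.smoothTransition ((n + 1) * (b - t) - 1) * (-(n + 1))) := by
  have h : Differentiable ℝ Real.smoothTransition :=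
    (Real.smoothTransition.contDiff (n := 1)).differentiable (by simp)
  have d1 : HasDerivAt (fun t : ℝ => ((n : ℝ) + 1) * (t - a) - 1) (n + 1) t := by
    simpa using (((hasDerivAt_id t).sub_const a).const_mul ((n : ℝ) + 1)).sub_const 1
  have d2 : HasDerivAt (fun t : ℝ => ((n : ℝ) + 1) * (b - t) - 1) (-(n + 1)) t := by
    simpa using (((hasDerivAt_id t).const_sub b).const_mul ((n : ℝ) + 1)).sub_const 1
  exact (((h _).hasDerivAt.comp t d1).mul ((h _).hasDerivAt.comp t d2)).deriv

theorem cutoff_eventually {a b t : ℝ} (ht : t ∈ Ioo a b) :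
    ∀ᶠ n in atTop, cutoff a b n t = 1 ∧ deriv (cutoff a b n) t = 0 := by
  have key : ∀ r : ℝ, 0 < r → ∀ᶠ n : ℕ in atTop, 1 < ((n : ℝ) + 1) * r - 1 := by
    intro r hr
    have : Tendsto (fun n : ℕ => ((n : ℝ) + 1) * r) atTop atTop :=
      (tendsto_natCast_atTop_atTop.atTop_add tendsto_const_nhds).atTop_mul_const hr
    filter_upwards [this.eventually_gt_atTop 2] with n hn
    linarith
  filter_upwards [key (t - a) (by linarith [ht.1]), key (b - t) (by linarith [ht.2])] with n h1 h2
  constructor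
  · rw [cutoff, Real.smoothTransition.one_of_one_le h1.le, Real.smoothTransition.one_of_one_le h2.le,
      one_mul]
  · rw [deriv_cutoff, deriv_smoothTransition_eq_zero (Or.inr h1),
      deriv_smoothTransition_eq_zero (Or.inr h2)]
    ring

/-- The derivative of the cut-off has size n + 1 but is nonzero only within 2/(n + 1) of an
endpoint, where `y` is at most a multiple of the distance. The product is therefore bounded
independently of `n`. -/
theorem abs_mul_deriv_cutoff_le {M : ℝ} (hM : ∀ t, |deriv Real.smoothTransition t| ≤ M) {a b t : ℝ}
    {n : ℕ} {y K : ℝ} (h1 : |y| ≤ K * (t - a)) (h2 : |y| ≤ K * (b - t)) (hK : 0 ≤ K) :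
    |y * deriv (cutoff a b n) t| ≤ 4 * K * M := by
  have hM0 : 0 ≤ M := (abs_nonneg _).trans (hM 0)
  have hn : (0 : ℝ) < n + 1 := by positivity
  have key : ∀ r, |y| ≤ K * r → |y| * (|deriv Real.smoothTransition ((n + 1) * r - 1)| * (n + 1)) ≤
      2 * K * M := by
    intro r hr
    by_cases h : (n + 1) * r - 1 ≤ 1
    · calc _ ≤ (K * r) * (M * (n + 1)) := by
            gcongr
            · exact (abs_nonneg _).trans hr
            · exact hM _
        _ = K * M * ((n + 1) * r) := by ring
        _ ≤ K * M * 2 := by gcongr; linarith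
        _ = _ := by ring
    · rw [deriv_smoothTransition_eq_zero (Or.inr (not_le.1 h))]
      simp only [abs_zero, zero_mul, mul_zero]
      positivity
  have hT : ∀ s, |Real.smoothTransition s| ≤ 1 := fun s => by
    rw [abs_of_nonneg (Real.smoothTransition.nonneg _)]; exact Real.smoothTransition.le_one _
  rw [abs_mul, deriv_cutoff]
  calc _ ≤ |y| * (|deriv Real.smoothTransition ((n + 1) * (t - a) - 1)| * (n + 1) * 1 +
        1 * (|deriv Real.smoothTransition ((n + 1) * (b - t) - 1)| * (n + 1))) := by
        gcongr
        refine (abs_add_le _ _).trans ?_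
        rw [abs_mul, abs_mul, abs_mul, abs_mul, abs_neg, abs_of_pos hn]
        gcongr <;> exact hT _
    _ ≤ _ := by linarith [key _ h1, key _ h2]

/-- If an integration by parts formula holds for test functions supported in a slab
`a < x_j < b`, then it holds without this condition, provided that (for `j = i`) the test function
is small near the boundary of the slab. -/
theorem integral_pd_mul_of_slab {i j : Fin 3} {a b : ℝ} {S : Set Pt} {v w : Pt → ℝ}
    (hv : Integrable v) (hw : Integrable w) (hv0 : VanishesOn j (Ioo a b)ᶜ v)
    (hw0 : VanishesOn j (Ioo a b)ᶜ w)
    (h : ∀ φ, IsTest φ → tsupport φ ⊆ S ∩ {x | x j ∈ Ioo a b} →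
      ∫ x, pd i φ x * v x = -∫ x, φ x * w x)
    {Φ : Pt → ℝ} (hΦ : IsTest Φ) (hS : tsupport Φ ⊆ S)
    (hK : i = j → ∃ K, ∀ x, x j ∈ Ioo a b → v x ≠ 0 →
      |Φ x| ≤ K * (x j - a) ∧ |Φ x| ≤ K * (b - x j)) :
    ∫ x, pd i Φ x * v x = -∫ x, Φ x * w x := by
  obtain ⟨M, hM0, hM⟩ := exists_deriv_smoothTransition_le
  obtain ⟨A, hA⟩ := hΦ.2.exists_bound_of_continuous hΦ.1.continuous
  obtain ⟨B, hB⟩ := (hΦ.pd i).2.exists_bound_of_continuous (hΦ.pd i).1.continuous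
  have hc : ∀ n, ContDiff ℝ ∞ (fun x : Pt => cutoff a b n (x j)) := fun n =>
    (contDiff_cutoff a b n).comp (contDiff_apply ℝ ℝ j)
  have ht : ∀ n, IsTest (fun x => cutoff a b n (x j) * Φ x) := fun n =>
    ⟨(hc n).mul hΦ.1, hΦ.2.mul_left (f := fun x : Pt => cutoff a b n (x j))⟩
  have hs : ∀ n, tsupport (fun x => cutoff a b n (x j) * Φ x) ⊆ S ∩ {x | x j ∈ Ioo a b} := by
    intro n
    have h1 : tsupport (fun x => cutoff a b n (x j) * Φ x) ⊆ tsupport Φ :=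
      closure_mono fun x hx => right_ne_zero_of_mul hx
    have h2 : tsupport (fun x => cutoff a b n (x j) * Φ x) ⊆
        {x | x j ∈ Icc (a + 1 / ((n : ℝ) + 1)) (b - 1 / ((n : ℝ) + 1))} :=
      closure_minimal (fun x hx => mem_of_cutoff_ne_zero (left_ne_zero_of_mul hx))
        (isClosed_Icc.preimage (continuous_apply j))
    intro x hx
    have hp : (0 : ℝ) < 1 / ((n : ℝ) + 1) := by positivity
    exact ⟨hS (h1 hx), by have := (h2 hx).1; linarith, by have := (h2 hx).2; linarith⟩
  have e := fun n => h _ (ht n) (hs n)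
  have hpd : ∀ n, pd i (fun x => cutoff a b n (x j) * Φ x) = fun x =>
      (if i = j then deriv (cutoff a b n) (x j) else 0) * Φ x + cutoff a b n (x j) * pd i Φ x := by
    intro n
    rw [pd_mul (differentiable_of_smooth (hc n)) (differentiable_of_smooth hΦ.1),
      pd_comp_apply ((contDiff_cutoff a b n).differentiable (by simp))]
  obtain ⟨K, hK0, hK⟩ : ∃ K, 0 ≤ K ∧ (i = j → ∀ x, x j ∈ Ioo a b → v x ≠ 0 →
      |Φ x| ≤ K * (x j - a) ∧ |Φ x| ≤ K * (b - x j)) := by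
    by_cases hij : i = j
    · obtain ⟨K, hK⟩ := hK hij
      refine ⟨|K|, abs_nonneg _, fun _ x hx hvx => ⟨(hK x hx hvx).1.trans ?_,
        (hK x hx hvx).2.trans ?_⟩⟩
      · exact mul_le_mul_of_nonneg_right (le_abs_self K) (by linarith [hx.1])
      · exact mul_le_mul_of_nonneg_right (le_abs_self K) (by linarith [hx.2])
    · exact ⟨0, le_rfl, fun h => absurd h hij⟩
  have cΦ := hΦ.1.continuous
  have cpd := (hΦ.pd i).1.continuous
  -- In the direction `i = j` the differentiated cut-off is kept bounded by the decay of Φ at the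
  -- faces; in the other directions it does not occur. At each interior point the cut-off is
  -- eventually 1 with derivative 0, and dominated convergence applies.
  have L1 : Tendsto (fun n => ∫ x, pd i (fun x => cutoff a b n (x j) * Φ x) x * v x) atTop
      (𝓝 (∫ x, pd i Φ x * v x)) := by
    refine tendsto_integral_of_dominated_convergence (fun x => (4 * K * M + B) * |v x|)
      (fun n => ?_) (hv.abs.const_mul _) (fun n => Eventually.of_forall fun x => ?_)
      (Eventually.of_forall fun x => ?_)
    · exact ((ht n).pd i).1.continuous.aestronglyMeasurable.mul hv.aestronglyMeasurable
    · rw [norm_mul, Real.norm_eq_abs, Real.norm_eq_abs]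
      by_cases hvx : v x = 0
      · simp [hvx]
      · have hx : x j ∈ Ioo a b := by
          by_contra hx; exact hvx (hv0 x hx)
        gcongr
        rw [hpd]
        refine (abs_add_le _ _).trans (add_le_add ?_ ?_)
        · by_cases hij : i = j
          · simp only [hij, if_true]
            rw [mul_comm]
            exact abs_mul_deriv_cutoff_le hM (hK hij x hx hvx).1 (hK hij x hx hvx).2 hK0
          · simp only [hij, if_false, zero_mul, abs_zero]; positivity
        · rw [abs_mul, abs_of_nonneg (cutoff_nonneg _ _ _ _)]
          exact (mul_le_of_le_one_left (abs_nonneg _) (cutoff_le_one _ _ _ _)).trans (hB x)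
    · by_cases hx : x j ∈ Ioo a b
      · refine tendsto_const_nhds.congr' ?_
        filter_upwards [cutoff_eventually hx] with n hn
        rw [hpd]; simp [hn.1, hn.2]
      · simp only [hv0 x hx, mul_zero]; exact tendsto_const_nhds
  have L2 : Tendsto (fun n => -∫ x, cutoff a b n (x j) * Φ x * w x) atTop
      (𝓝 (-∫ x, Φ x * w x)) := by
    refine (tendsto_integral_of_dominated_convergence (fun x => A * |w x|)
      (fun n => ?_) (hw.abs.const_mul _) (fun n => Eventually.of_forall fun x => ?_)
      (Eventually.of_forall fun x => ?_)).neg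
    · exact (ht n).1.continuous.aestronglyMeasurable.mul hw.aestronglyMeasurable
    · rw [norm_mul, norm_mul, Real.norm_of_nonneg (cutoff_nonneg _ _ _ _), Real.norm_eq_abs (w x)]
      gcongr
      exact (mul_le_of_le_one_left (abs_nonneg _) (cutoff_le_one _ _ _ _)).trans (hA x)
    · by_cases hx : x j ∈ Ioo a b
      · refine tendsto_const_nhds.congr' ?_
        filter_upwards [cutoff_eventually hx] with n hn
        simp [hn.1]
      · simp only [hw0 x hx, mul_zero]; exact tendsto_const_nhds
  exact tendsto_nhds_unique (L1.congr e) L2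


/-- The integration by parts formula for test functions supported in an open box extends to the
test functions that are small near the two faces that are orthogonal to the direction of
differentiation. -/
theorem integral_pd_mul_of_box {i : Fin 3} {A B : Pt} {v w : Pt → ℝ} (hv : Integrable v)
    (hw : Integrable w) (hv0 : ∀ j, VanishesOn j (Ioo (A j) (B j))ᶜ v)
    (hw0 : ∀ j, VanishesOn j (Ioo (A j) (B j))ᶜ w)
    (h : ∀ φ, IsTest φ → tsupport φ ⊆ {x | ∀ j, x j ∈ Ioo (A j) (B j)} →
      ∫ x, pd i φ x * v x = -∫ x, φ x * w x)
    {Φ : Pt → ℝ} (hΦ : IsTest Φ)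
    (hK : ∃ K, ∀ x, v x ≠ 0 → |Φ x| ≤ K * (x i - A i) ∧ |Φ x| ≤ K * (B i - x i)) :
    ∫ x, pd i Φ x * v x = -∫ x, Φ x * w x := by
  obtain ⟨K, hK⟩ := hK
  -- the bound persists only for `Φ` itself, so the direction `i` is treated last
  have two : ∀ j k : Fin 3, j ≠ i → k ≠ i → j ≠ k → ∀ φ, IsTest φ →
      tsupport φ ⊆ {x | x i ∈ Ioo (A i) (B i)} → ∫ x, pd i φ x * v x = -∫ x, φ x * w x := by
    intro j k hj hk hjk φ hφ hs
    refine integral_pd_mul_of_slab (i := i) (j := j) (S := {x | x i ∈ Ioo (A i) (B i)}) hv hw (hv0 j)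
      (hw0 j) (fun φ hφ hs => ?_) hφ hs (fun e => absurd e.symm hj)
    refine integral_pd_mul_of_slab (i := i) (j := k) hv hw (hv0 k) (hw0 k) (fun φ hφ hs => ?_)
      hφ hs (fun e => absurd e.symm hk)
    refine h φ hφ (hs.trans ?_)
    rintro x ⟨⟨h1, h2⟩, h3⟩ l
    have : l = i ∨ l = j ∨ l = k := by omega
    rcases this with rfl | rfl | rfl
    · exact h1
    · exact h2
    · exact h3
  have two' : ∀ φ, IsTest φ → tsupport φ ⊆ {x | x i ∈ Ioo (A i) (B i)} →
      ∫ x, pd i φ x * v x = -∫ x, φ x * w x := by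
    fin_cases i
    · exact two 1 2 (by decide) (by decide) (by decide)
    · exact two 0 2 (by decide) (by decide) (by decide)
    · exact two 0 1 (by decide) (by decide) (by decide)
  exact integral_pd_mul_of_slab (S := univ) hv hw (hv0 i) (hw0 i)
    (fun φ hφ hs => two' φ hφ (by simpa using hs)) hΦ (subset_univ _)
    (fun _ => ⟨K, fun x _ hx => hK x hx⟩)

/-- A test function that vanishes on a plane is bounded by the distance to the plane. -/
theorem IsTest.exists_abs_le {Φ : Pt → ℝ} (hΦ : IsTest Φ) {i : Fin 3} {c : ℝ}
    (h : VanishesOn i {c} Φ) : ∃ K, 0 ≤ K ∧ ∀ x, |Φ x| ≤ K * |x i - c| := by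
  obtain ⟨K, hK⟩ := ContDiff.lipschitzWith_of_hasCompactSupport (𝕂 := ℝ) (n := ∞) hΦ.2 hΦ.1 (by simp)
  refine ⟨K, K.2, fun x => ?_⟩
  have h1 := hK.dist_le_mul x (Function.update x i c)
  rw [h (Function.update x i c) (by simp), Real.dist_eq, sub_zero] at h1
  refine h1.trans ?_
  gcongr
  rw [dist_pi_le_iff (abs_nonneg _)]
  intro j
  by_cases hj : j = i
  · subst hj; simp [Real.dist_eq]
  · simp [hj]

/-! ### Extension across all the faces of a box -/

/-- The extension of a function by reflections in all the faces of a box. -/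
def ext (lo hi : Pt) (σ : Fin 3 → ℝ × ℝ) (f : Pt → ℝ) : Pt → ℝ :=
  ext1 0 (lo 0) (hi 0) (σ 0) (ext1 1 (lo 1) (hi 1) (σ 1) (ext1 2 (lo 2) (hi 2) (σ 2) f))

/-- The transposed extension operator. -/
def extT (lo hi : Pt) (σ : Fin 3 → ℝ × ℝ) (f : Pt → ℝ) : Pt → ℝ :=
  ext1 2 (lo 2) (hi 2) (σ 2) (ext1 1 (lo 1) (hi 1) (σ 1) (ext1 0 (lo 0) (hi 0) (σ 0) f))

section ext

variable {lo hi : Pt} {σ : Fin 3 → ℝ × ℝ}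

theorem isTest_extT {φ : Pt → ℝ} (hφ : IsTest φ) (σ : Fin 3 → ℝ × ℝ) : IsTest (extT lo hi σ φ) :=
  isTest_ext1 (isTest_ext1 (isTest_ext1 hφ _ _ _ _) _ _ _ _) _ _ _ _

theorem integrable_ext {f : Pt → ℝ} (hf : Integrable f) (σ : Fin 3 → ℝ × ℝ) :
    Integrable (ext lo hi σ f) :=
  integrable_ext1 (integrable_ext1 (integrable_ext1 hf _ _ _ _) _ _ _ _) _ _ _ _

theorem memLp_ext {f : Pt → ℝ} {p : ENNReal} (hf : MemLp f p) (σ : Fin 3 → ℝ × ℝ) :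
    MemLp (ext lo hi σ f) p :=
  memLp_ext1 (memLp_ext1 (memLp_ext1 hf _ _ _ _) _ _ _ _) _ _ _ _

theorem eLpNorm_ext_le {f : Pt → ℝ} {p : ENNReal} (hp : 1 ≤ p) (hf : Integrable f)
    (h1 : ∀ i, |(σ i).1| ≤ 1) (h2 : ∀ i, |(σ i).2| ≤ 1) :
    eLpNorm (ext lo hi σ f) p ≤ 27 * eLpNorm f p := by
  have hf2 := integrable_ext1 hf 2 (lo 2) (hi 2) (σ 2)
  have hf1 := integrable_ext1 hf2 1 (lo 1) (hi 1) (σ 1)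
  calc _ ≤ 3 * (3 * (3 * eLpNorm f p)) := by
        refine (eLpNorm_ext1_le hp hf1.1 0 _ _ (h1 0) (h2 0)).trans ?_
        gcongr
        refine (eLpNorm_ext1_le hp hf2.1 1 _ _ (h1 1) (h2 1)).trans ?_
        gcongr
        exact eLpNorm_ext1_le hp hf.1 2 _ _ (h1 2) (h2 2)
    _ = _ := by rw [← mul_assoc, ← mul_assoc]; norm_num

theorem integral_mul_ext {φ f : Pt → ℝ} (hφ : IsTest φ) (hf : Integrable f) :
    ∫ x, φ x * ext lo hi σ f x = ∫ x, extT lo hi σ φ x * f x := by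
  have hf2 := integrable_ext1 hf 2 (lo 2) (hi 2) (σ 2)
  have hf1 := integrable_ext1 hf2 1 (lo 1) (hi 1) (σ 1)
  have hφ0 := isTest_ext1 hφ 0 (lo 0) (hi 0) (σ 0)
  have hφ1 := isTest_ext1 hφ0 1 (lo 1) (hi 1) (σ 1)
  unfold ext extT
  rw [integral_mul_ext1 hφ hf1, integral_mul_ext1 hφ0 hf2, integral_mul_ext1 hφ1 hf]

/-- The signs of the extension of the derivative in direction `i`. -/
def flip (i : Fin 3) (σ : Fin 3 → ℝ × ℝ) : Fin 3 → ℝ × ℝ := fun j => if i = j then -σ j else σ j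

theorem flip_flip (i : Fin 3) (σ : Fin 3 → ℝ × ℝ) : flip i (flip i σ) = σ := by
  funext j; unfold flip; split_ifs <;> simp

/-- Starting from the flipped signs, differentiation restores the original ones: this transfers ∂_i
from the test function to its transposed extension. -/
theorem pd_extT {φ : Pt → ℝ} (hφ : IsTest φ) (i : Fin 3) :
    pd i (extT lo hi (flip i σ) φ) = extT lo hi σ (pd i φ) := by
  have h0 := fun s => isTest_ext1 hφ 0 (lo 0) (hi 0) s
  have h1 := fun s t => isTest_ext1 (h0 s) 1 (lo 1) (hi 1) t
  unfold extT flip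
  rw [pd_ext1 (h1 _ _).1, pd_ext1 (h0 _).1, pd_ext1 hφ.1]
  split_ifs <;> simp

/-- The extension has a weak derivative, given by the extension with the flipped signs. -/
theorem integral_pd_mul_ext {i : Fin 3} {f g φ : Pt → ℝ} (hf : Integrable f) (hg : Integrable g)
    (hφ : IsTest φ) (h : ∫ x, pd i (extT lo hi (flip i σ) φ) x * f x =
      -∫ x, extT lo hi (flip i σ) φ x * g x) :
    ∫ x, pd i φ x * ext lo hi σ f x = -∫ x, φ x * ext lo hi (flip i σ) g x := by
  rw [integral_mul_ext (hφ.pd i) hf, integral_mul_ext hφ hg, ← pd_extT hφ, h]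

/-- Only the reflections in direction `i` create the zero on the face; the reflections in the other
directions preserve a zero set described by the coordinate `x i`. The three cases differ in the
order of these operations. -/
theorem extT_vanishesOn_upper {φ : Pt → ℝ} {i : Fin 3} (hσ : (σ i).2 = -1)
    (h : VanishesOn i (Iic (2 * lo i - hi i)) φ) : VanishesOn i {hi i} (extT lo hi σ φ) := by
  unfold extT
  fin_cases i
  · exact ((h.ext1_upper hσ).ext1_of_ne (by decide) _ _ _).ext1_of_ne (by decide) _ _ _
  · exact ((h.ext1_of_ne (by decide) _ _ _).ext1_upper hσ).ext1_of_ne (by decide) _ _ _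
  · exact ((h.ext1_of_ne (by decide) _ _ _).ext1_of_ne (by decide) _ _ _).ext1_upper hσ

theorem extT_vanishesOn_lower {φ : Pt → ℝ} {i : Fin 3} (hσ : (σ i).1 = -1)
    (h : VanishesOn i (Ici (2 * hi i - lo i)) φ) : VanishesOn i {lo i} (extT lo hi σ φ) := by
  unfold extT
  fin_cases i
  · exact ((h.ext1_lower hσ).ext1_of_ne (by decide) _ _ _).ext1_of_ne (by decide) _ _ _
  · exact ((h.ext1_of_ne (by decide) _ _ _).ext1_lower hσ).ext1_of_ne (by decide) _ _ _
  · exact ((h.ext1_of_ne (by decide) _ _ _).ext1_of_ne (by decide) _ _ _).ext1_lower hσ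

theorem ext_eq_self {f : Pt → ℝ} (hf : ∀ i, VanishesOn i (Ioo (lo i) (hi i))ᶜ f) {x : Pt}
    (hx : ∀ i, x i ∈ Ioo (lo i) (hi i)) : ext lo hi σ f x = f x := by
  unfold ext
  rw [ext1_eq_self (((hf 0).ext1_of_ne (by decide) _ _ _).ext1_of_ne (by decide) _ _ _) (hx 0),
    ext1_eq_self ((hf 1).ext1_of_ne (by decide) _ _ _) (hx 1), ext1_eq_self (hf 2) (hx 2)]

theorem oddOn_ext_upper {f : Pt → ℝ} (hf : ∀ i, VanishesOn i (Ioo (lo i) (hi i))ᶜ f) {i : Fin 3}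
    (hσ : (σ i).2 = -1) : OddOn i (hi i) (Ioo (lo i) (2 * hi i - lo i)) (ext lo hi σ f) := by
  unfold ext
  fin_cases i
  · exact oddOn_ext1_upper hσ (((hf 0).ext1_of_ne (by decide) _ _ _).ext1_of_ne (by decide) _ _ _)
  · exact (oddOn_ext1_upper hσ ((hf 1).ext1_of_ne (by decide) _ _ _)).ext1_of_ne (by decide) _ _ _
  · exact ((oddOn_ext1_upper hσ (hf 2)).ext1_of_ne (by decide) _ _ _).ext1_of_ne (by decide) _ _ _

theorem oddOn_ext_lower {f : Pt → ℝ} (hf : ∀ i, VanishesOn i (Ioo (lo i) (hi i))ᶜ f) {i : Fin 3}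
    (hσ : (σ i).1 = -1) : OddOn i (lo i) (Ioo (2 * lo i - hi i) (hi i)) (ext lo hi σ f) := by
  unfold ext
  fin_cases i
  · exact oddOn_ext1_lower hσ (((hf 0).ext1_of_ne (by decide) _ _ _).ext1_of_ne (by decide) _ _ _)
  · exact (oddOn_ext1_lower hσ ((hf 1).ext1_of_ne (by decide) _ _ _)).ext1_of_ne (by decide) _ _ _
  · exact ((oddOn_ext1_lower hσ (hf 2)).ext1_of_ne (by decide) _ _ _).ext1_of_ne (by decide) _ _ _

end ext

/-! ### The Sobolev inequality on a box -/

/-- The support lies in the box enlarged by its own width on each side, which is where one layer of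
reflections gives a correct weak derivative. -/
theorem exists_box_cutoff {lo hi : Pt} (hlt : ∀ i, lo i < hi i) :
    ∃ χ : Pt → ℝ, IsTest χ ∧
      tsupport χ ⊆ {x | ∀ i, x i ∈ Ioo (2 * lo i - hi i) (2 * hi i - lo i)} ∧
      (∀ x, (∀ i, x i ∈ Ioo (lo i) (hi i)) → χ x = 1) ∧ ∀ x, |χ x| ≤ 1 := by
  obtain ⟨n, hn⟩ : ∃ n : ℕ, ∀ i, 2 ≤ ((n : ℝ) + 1) * (hi i - lo i) := by
    have : ∀ i, ∀ᶠ n : ℕ in atTop, 2 ≤ ((n : ℝ) + 1) * (hi i - lo i) := fun i =>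
      ((tendsto_natCast_atTop_atTop.atTop_add tendsto_const_nhds).atTop_mul_const
        (sub_pos.2 (hlt i))).eventually_ge_atTop 2
    exact (eventually_all.2 this).exists
  let χ : Pt → ℝ := fun x => ∏ i, cutoff (2 * lo i - hi i) (2 * hi i - lo i) n (x i)
  have hp : (0 : ℝ) < 1 / ((n : ℝ) + 1) := by positivity
  have hsupp : Function.support χ ⊆ Icc (fun i => 2 * lo i - hi i + 1 / ((n : ℝ) + 1))
      (fun i => 2 * hi i - lo i - 1 / ((n : ℝ) + 1)) := by
    intro x hx
    have h := fun i => mem_of_cutoff_ne_zero (Finset.prod_ne_zero_iff.1 hx i (Finset.mem_univ i))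
    exact ⟨fun i => (h i).1, fun i => (h i).2⟩
  refine ⟨χ, ⟨?_, HasCompactSupport.of_support_subset_isCompact isCompact_Icc hsupp⟩, ?_, ?_, ?_⟩
  · exact contDiff_prod fun i _ => (contDiff_cutoff _ _ _).comp (contDiff_apply ℝ ℝ i)
  · refine (closure_minimal hsupp isClosed_Icc).trans fun x hx i => ⟨?_, ?_⟩
    · have := hx.1 i; simp only at this; linarith
    · have := hx.2 i; simp only at this; linarith
  · intro x hx
    refine Finset.prod_eq_one fun i _ => ?_
    have h1 : ((n : ℝ) + 1) * (hi i - lo i) ≤ (n + 1) * (x i - (2 * lo i - hi i)) := by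
      exact mul_le_mul_of_nonneg_left (by linarith [(hx i).1]) (by positivity)
    have h2 : ((n : ℝ) + 1) * (hi i - lo i) ≤ (n + 1) * (2 * hi i - lo i - x i) := by
      exact mul_le_mul_of_nonneg_left (by linarith [(hx i).2]) (by positivity)
    have h3 := hn i
    rw [cutoff, Real.smoothTransition.one_of_one_le (by linarith),
      Real.smoothTransition.one_of_one_le (by linarith), one_mul]
  · intro x
    rw [Finset.abs_prod]
    refine Finset.prod_le_one (fun i _ => abs_nonneg _) fun i _ => ?_
    rw [abs_of_nonneg (cutoff_nonneg _ _ _ _)]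
    exact cutoff_le_one _ _ _ _

theorem norm_fderiv_le (f : Pt → ℝ) (x : Pt) : ‖fderiv ℝ f x‖ ≤ ∑ i, |pd i f x| := by
  refine ContinuousLinearMap.opNorm_le_bound _ (Finset.sum_nonneg fun i _ => abs_nonneg _) fun v => ?_
  have e : fderiv ℝ f x v = ∑ i, v i * pd i f x := by
    conv_lhs => rw [← Finset.univ_sum_single v]
    rw [map_sum]
    refine Finset.sum_congr rfl fun i _ => ?_
    have : (Pi.single i (v i) : Pt) = v i • Pi.single i 1 := by
      rw [← Pi.single_smul, smul_eq_mul, mul_one]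
    rw [this, map_smul, smul_eq_mul]; rfl
  rw [e, Finset.sum_mul]
  refine (norm_sum_le _ _).trans (Finset.sum_le_sum fun i _ => ?_)
  rw [norm_mul, mul_comm]
  exact mul_le_mul_of_nonneg_left (norm_le_pi_norm v i) (abs_nonneg _)

theorem eLpNorm_fun_add_le {p : ENNReal} (hp : 1 ≤ p) {f g : Pt → ℝ}
    (hf : AEStronglyMeasurable f) (hg : AEStronglyMeasurable g) :
    eLpNorm (fun x => f x + g x) p ≤ eLpNorm f p + eLpNorm g p :=
  eLpNorm_add_le hf hg hp

theorem eLpNorm_fun_sum_le {p : ENNReal} (hp : 1 ≤ p) {f : Fin 3 → Pt → ℝ}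
    (hf : ∀ i, AEStronglyMeasurable (f i)) :
    eLpNorm (fun x => ∑ i, f i x) p ≤ ∑ i, eLpNorm (f i) p := by
  have := eLpNorm_sum_le (s := Finset.univ) (f := f) (fun i _ => hf i) hp
  rwa [show (∑ i, f i) = fun x => ∑ i, f i x from by funext x; simp] at this

theorem eLpNorm_fderiv_le {p : ENNReal} (hp : 1 ≤ p) {w : Pt → ℝ} (hs : ContDiff ℝ ∞ w) :
    eLpNorm (fderiv ℝ w) p ≤ ∑ i, eLpNorm (pd i w) p := by
  have h1 : eLpNorm (fderiv ℝ w) p ≤ eLpNorm (fun x => ∑ i, |pd i w x|) p :=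
    eLpNorm_mono_real (norm_fderiv_le w)
  have h2 : eLpNorm (fun x => ∑ i, |pd i w x|) p ≤ ∑ i, eLpNorm (fun x => |pd i w x|) p :=
    eLpNorm_fun_sum_le hp fun i => (continuous_pd hs i).abs.aestronglyMeasurable
  have h3 : ∀ i, eLpNorm (fun x => |pd i w x|) p = eLpNorm (pd i w) p := fun i =>
    eLpNorm_norm (pd i w)
  simp only [h3] at h2
  exact h1.trans h2

theorem ennreal_sum_add_le (a : Fin 3 → ENNReal) (K : Fin 3 → ENNReal) (c : ENNReal) :
    ∑ i, (27 * a i + K i * (27 * c)) ≤ (27 * ∑ i, K i + 27) * (c + ∑ i, a i) := by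
  have e : ∑ i, (27 * a i + K i * (27 * c)) = 27 * ∑ i, a i + (27 * ∑ i, K i) * c := by
    rw [Finset.sum_add_distrib, ← Finset.mul_sum, ← Finset.sum_mul]; ring
  rw [e, mul_add, add_comm]
  exact add_le_add (mul_le_mul_left le_self_add _) (mul_le_mul_left le_add_self _)

/-- The **Sobolev inequality** for weakly differentiable functions of compact support. -/
theorem eLpNorm_le_of_weakDeriv {p p' : NNReal} (hp : 1 ≤ p)
    (hp' : (p' : ℝ)⁻¹ = (p : ℝ)⁻¹ - 3⁻¹) :
    ∃ C : NNReal, ∀ (U : Pt → ℝ) (G : Fin 3 → Pt → ℝ), Integrable U → HasCompactSupport U →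
      (∀ i, Integrable (G i)) →
      (∀ i φ, IsTest φ → ∫ x, pd i φ x * U x = -∫ x, φ x * G i x) →
      eLpNorm U p' ≤ C * ∑ i, eLpNorm (G i) p := by
  refine ⟨SNormLESNormFDerivOfEqConst ℝ (volume : Measure Pt) p, fun U G hU hUc hG h => ?_⟩
  have hpe : (1 : ENNReal) ≤ p := by exact_mod_cast hp
  have key : ∀ n, eLpNorm (moll n U) p' ≤
      SNormLESNormFDerivOfEqConst ℝ (volume : Measure Pt) p * ∑ i, eLpNorm (G i) p := by
    intro n
    have hs := contDiff_moll n hU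
    have hc : HasCompactSupport (moll n U) := by
      rw [moll_eq_convolution]
      exact (isTest_molKer n).2.convolution _ hUc
    refine (eLpNorm_le_eLpNorm_fderiv_of_eq volume (hs.of_le (by simp)) hc hp (by simp)
      (by simpa using hp')).trans ?_
    gcongr
    have hpd : ∀ i, pd i (moll n U) = moll n (G i) := by
      intro i; funext x
      exact pd_moll_eq n hU i (S := univ) (fun φ hφ _ => h i φ hφ) (subset_univ _)
    refine (eLpNorm_fderiv_le hpe hs).trans (Finset.sum_le_sum fun i _ => ?_)
    rw [hpd i]
    exact eLpNorm_moll_le n (hG i).1 hpe ENNReal.coe_ne_top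
  -- The classical inequality holds for every mollification with the same bound. Lower
  -- semicontinuity of the L^p' norm under almost everywhere convergence transfers it to `U` without
  -- knowing in advance that `U` lies in L^p'.
  refine (Lp.eLpNorm_lim_le_liminf_eLpNorm (fun n => (contDiff_moll n hU).continuous.aestronglyMeasurable)
    U (ae_tendsto_moll hU)).trans ?_
  exact liminf_le_of_le (by isBoundedDefault) fun b hb => by
    obtain ⟨n, hn⟩ := hb.exists
    exact hn.trans (key n)

theorem eLpNorm_mul_le_of_abs_le {p : ENNReal} {ψ F : Pt → ℝ} {K : NNReal} (h : ∀ x, |ψ x| ≤ K) :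
    eLpNorm (fun x => ψ x * F x) p ≤ K * eLpNorm F p := by
  have := eLpNorm_le_nnreal_smul_eLpNorm_of_ae_le_mul (μ := volume) (c := K)
    (f := fun x => ψ x * F x) (g := F) (Eventually.of_forall fun x => by
      rw [← NNReal.coe_le_coe]
      simp only [coe_nnnorm, NNReal.coe_mul, norm_mul]
      exact mul_le_mul_of_nonneg_right (h x) (norm_nonneg _)) p
  rwa [ENNReal.smul_def, smul_eq_mul] at this

/-- The **Sobolev inequality** on a box. -/
theorem sobolev_box {lo hi : Pt} (hlt : ∀ i, lo i < hi i) {p p' : NNReal} (hp : 1 ≤ p)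
    (hp' : (p' : ℝ)⁻¹ = (p : ℝ)⁻¹ - 3⁻¹) :
    ∃ C : NNReal, ∀ (f : Pt → ℝ) (g : Fin 3 → Pt → ℝ), Integrable f → (∀ i, Integrable (g i)) →
      (∀ j, VanishesOn j (Ioo (lo j) (hi j))ᶜ f) →
      (∀ i j, VanishesOn j (Ioo (lo j) (hi j))ᶜ (g i)) →
      (∀ i φ, IsTest φ → tsupport φ ⊆ {x | ∀ j, x j ∈ Ioo (lo j) (hi j)} →
        ∫ x, pd i φ x * f x = -∫ x, φ x * g i x) →
      eLpNorm f p' ≤ C * (eLpNorm f p + ∑ i, eLpNorm (g i) p) := by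
  obtain ⟨χ, hχ, hχs, hχ1, hχle⟩ := exists_box_cutoff hlt
  obtain ⟨C, hC⟩ := eLpNorm_le_of_weakDeriv hp hp'
  have : ∀ i, ∃ K : NNReal, ∀ x, |pd i χ x| ≤ K := by
    intro i
    obtain ⟨K, hK⟩ := (hχ.pd i).2.exists_bound_of_continuous (hχ.pd i).1.continuous
    exact ⟨⟨K, (abs_nonneg _).trans (hK 0)⟩, hK⟩
  choose K hK using this
  refine ⟨C * (27 * ∑ i, K i + 27), fun f g hf hg hf0 hg0 hfg => ?_⟩
  have hpe : (1 : ENNReal) ≤ p := by exact_mod_cast hp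
  -- Even extension: it keeps a function without boundary conditions weakly differentiable across
  -- the faces.
  let σ : Fin 3 → ℝ × ℝ := fun _ => (1, 1)
  have hσ : ∀ i j, |(flip i σ j).1| ≤ 1 ∧ |(flip i σ j).2| ≤ 1 := by
    intro i j; unfold flip; split_ifs <;> simp [σ]
  have hbdd : ∀ {F φ : Pt → ℝ}, IsTest φ → Integrable F → Integrable fun x => φ x * F x := by
    intro F φ hφ hF
    obtain ⟨A, hA⟩ := hφ.2.exists_bound_of_continuous hφ.1.continuous
    exact hF.bdd_mul hφ.1.continuous.aestronglyMeasurable (Eventually.of_forall hA)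
  have hEf : Integrable (ext lo hi σ f) := integrable_ext hf σ
  have hEg : ∀ i, Integrable (ext lo hi (flip i σ) (g i)) := fun i => integrable_ext (hg i) _
  have hweak : ∀ i φ, IsTest φ →
      tsupport φ ⊆ {x | ∀ i, x i ∈ Ioo (2 * lo i - hi i) (2 * hi i - lo i)} →
      ∫ x, pd i φ x * ext lo hi σ f x = -∫ x, φ x * ext lo hi (flip i σ) (g i) x := by
    intro i φ hφ hs
    refine integral_pd_mul_ext hf (hg i) hφ ?_
    have hout : ∀ x, x i ∉ Ioo (2 * lo i - hi i) (2 * hi i - lo i) → φ x = 0 := fun x hx => by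
      by_contra h0
      exact hx (hs (subset_tsupport _ h0) i)
    have hΦ : IsTest (extT lo hi (flip i σ) φ) := isTest_extT hφ _
    -- The transposed extension of the test function is odd in direction `i`, so it vanishes on the
    -- two faces orthogonal to `i`. Integration by parts in the box then requires no boundary
    -- condition on `f`.
    obtain ⟨K1, hK10, hK1⟩ := hΦ.exists_abs_le (i := i) (c := hi i)
      (extT_vanishesOn_upper (by simp [flip, σ]) fun x hx => hout x fun hx' => by
        simp only [mem_Iic] at hx; linarith [hx'.1])
    obtain ⟨K2, hK20, hK2⟩ := hΦ.exists_abs_le (i := i) (c := lo i)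
      (extT_vanishesOn_lower (by simp [flip, σ]) fun x hx => hout x fun hx' => by
        simp only [mem_Ici] at hx; linarith [hx'.2])
    refine integral_pd_mul_of_box hf (hg i) hf0 (hg0 i) (hfg i) hΦ ⟨K1 + K2, fun x hx => ?_⟩
    have hxi : x i ∈ Ioo (lo i) (hi i) := by
      by_contra h0; exact hx (hf0 i x h0)
    have a1 := hK1 x
    have a2 := hK2 x
    rw [abs_sub_comm, abs_of_pos (sub_pos.2 hxi.2)] at a1
    rw [abs_of_pos (sub_pos.2 hxi.1)] at a2
    constructor
    · nlinarith [mul_nonneg hK10 (sub_pos.2 hxi.1).le]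
    · nlinarith [mul_nonneg hK20 (sub_pos.2 hxi.2).le]
  -- The weak gradient of the truncated extension, by the product rule.
  let G : Fin 3 → Pt → ℝ := fun i x =>
    χ x * ext lo hi (flip i σ) (g i) x + pd i χ x * ext lo hi σ f x
  have hG : ∀ i, Integrable (G i) := fun i => (hbdd hχ (hEg i)).add (hbdd (hχ.pd i) hEf)
  have h1 := hC (fun x => χ x * ext lo hi σ f x) G (hbdd hχ hEf)
    (hχ.2.mul_right (f' := ext lo hi σ f)) hG ?_
  · have h2 : eLpNorm f p' ≤ eLpNorm (fun x => χ x * ext lo hi σ f x) p' := by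
      refine eLpNorm_mono fun x => ?_
      by_cases hx : ∀ i, x i ∈ Ioo (lo i) (hi i)
      · rw [hχ1 x hx, ext_eq_self hf0 hx, one_mul]
      · rw [not_forall] at hx
        obtain ⟨i, hi⟩ := hx
        rw [hf0 i x hi, norm_zero]; exact norm_nonneg _
    refine (h2.trans h1).trans ?_
    have h3 : ∀ i, eLpNorm (G i) p ≤ 27 * eLpNorm (g i) p + K i * (27 * eLpNorm f p) := by
      intro i
      have h5 : eLpNorm (G i) p ≤ eLpNorm (fun x => χ x * ext lo hi (flip i σ) (g i) x) p +
          eLpNorm (fun x => pd i χ x * ext lo hi σ f x) p :=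
        eLpNorm_fun_add_le hpe (hbdd hχ (hEg i)).1 (hbdd (hχ.pd i) hEf).1
      refine h5.trans (add_le_add ?_ ?_)
      · have h4 := eLpNorm_mul_le_of_abs_le (p := p) (F := ext lo hi (flip i σ) (g i)) (K := 1)
          (by simpa using hχle)
        rw [ENNReal.coe_one, one_mul] at h4
        exact h4.trans (eLpNorm_ext_le hpe (hg i) (fun j => (hσ i j).1) (fun j => (hσ i j).2))
      · exact (eLpNorm_mul_le_of_abs_le (hK i)).trans (mul_le_mul_right
          (eLpNorm_ext_le hpe hf (fun j => by simp [σ]) (fun j => by simp [σ])) _)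
    push_cast
    rw [mul_assoc]
    refine mul_le_mul_right ((Finset.sum_le_sum fun i _ => h3 i).trans ?_) _
    exact ennreal_sum_add_le _ _ _
  · intro i φ hφ
    have ht : IsTest (fun x => χ x * φ x) := ⟨hχ.1.mul hφ.1, hχ.2.mul_right (f' := φ)⟩
    have hs : tsupport (fun x => χ x * φ x) ⊆
        {x | ∀ i, x i ∈ Ioo (2 * lo i - hi i) (2 * hi i - lo i)} :=
      (closure_mono fun x hx => left_ne_zero_of_mul hx).trans hχs
    have e := hweak i _ ht hs
    rw [pd_mul (differentiable_of_smooth hχ.1) (differentiable_of_smooth hφ.1)] at e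
    have i1 := hbdd (hφ.pd i) (hbdd hχ hEf)
    have i2 := hbdd hφ (hbdd (hχ.pd i) hEf)
    have i3 := hbdd hφ (hbdd hχ (hEg i))
    have e1 : ∫ x, (pd i χ x * φ x + χ x * pd i φ x) * ext lo hi σ f x =
        (∫ x, φ x * (pd i χ x * ext lo hi σ f x)) + ∫ x, pd i φ x * (χ x * ext lo hi σ f x) := by
      rw [← integral_add i2 i1]; congr 1; funext x; ring
    have e2 : ∫ x, φ x * G i x = (∫ x, φ x * (χ x * ext lo hi (flip i σ) (g i) x)) +
        ∫ x, φ x * (pd i χ x * ext lo hi σ f x) := by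
      rw [← integral_add i3 i2]; congr 1; funext x; simp only [G]; ring
    have e3 : ∫ x, χ x * φ x * ext lo hi (flip i σ) (g i) x =
        ∫ x, φ x * (χ x * ext lo hi (flip i σ) (g i) x) := by
      congr 1; funext x; ring
    rw [e2]
    linarith


/-! ### Real and imaginary parts, extended by zero -/

theorem isOpen_box (b ξ d : ℝ) : IsOpen (box b ξ d) := by
  have h : ∀ i : Fin 3, Continuous fun x : Pt => x i := fun i => continuous_apply i
  unfold box
  simp only [ofPred_and]
  exact (isOpen_lt (h 0).abs continuous_const).inter
    ((isOpen_lt (h 1).abs continuous_const).inter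
      ((isOpen_lt continuous_const (h 2)).inter (isOpen_lt (h 2) continuous_const)))

theorem measurableSet_box (b ξ d : ℝ) : MeasurableSet (box b ξ d) := (isOpen_box b ξ d).measurableSet

/-- The lower corner of the domain. -/
def boxLo (b ξ : ℝ) : Pt := ![-b, -b, -ξ]

/-- The upper corner of the domain. -/
def boxHi (b d : ℝ) : Pt := ![b, b, d]

theorem box_eq (b ξ d : ℝ) :
    box b ξ d = {x | ∀ j, x j ∈ Ioo (boxLo b ξ j) (boxHi b d j)} := by
  ext x
  simp [box, boxLo, boxHi, Fin.forall_fin_succ, abs_lt, and_assoc]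

theorem box_subset_Icc (b ξ d : ℝ) : box b ξ d ⊆ Icc (boxLo b ξ) (boxHi b d) := by
  rw [box_eq]
  exact fun x hx => ⟨fun j => (hx j).1.le, fun j => (hx j).2.le⟩

theorem volume_box_lt_top (b ξ d : ℝ) : volume (box b ξ d) < ⊤ :=
  (measure_mono (box_subset_Icc b ξ d)).trans_lt isCompact_Icc.measure_lt_top

instance (b ξ d : ℝ) : IsFiniteMeasure (volume.restrict (box b ξ d)) :=
  ⟨by simpa using volume_box_lt_top b ξ d⟩

/-- A real component of a complex function on `Ω`, extended by zero. -/
def part {Ω : Set Pt} (ℓ : ℂ →L[ℝ] ℝ) (u : L2 Ω) : Pt → ℝ := Ω.indicator fun x => ℓ (u x)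

theorem part_of_notMem {Ω : Set Pt} (ℓ : ℂ →L[ℝ] ℝ) (u : L2 Ω) {x : Pt} (hx : x ∉ Ω) :
    part ℓ u x = 0 := indicator_of_notMem hx _

theorem part_of_mem {Ω : Set Pt} (ℓ : ℂ →L[ℝ] ℝ) (u : L2 Ω) {x : Pt} (hx : x ∈ Ω) :
    part ℓ u x = ℓ (u x) := indicator_of_mem hx _

theorem vanishesOn_part {b ξ d : ℝ} (ℓ : ℂ →L[ℝ] ℝ) (u : L2 (box b ξ d)) (j : Fin 3) :
    VanishesOn j (Ioo (boxLo b ξ j) (boxHi b d j))ᶜ (part ℓ u) := fun x hx =>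
  part_of_notMem ℓ u fun h => hx (by rw [box_eq] at h; exact h j)

theorem memLp_part {b ξ d : ℝ} (ℓ : ℂ →L[ℝ] ℝ) (u : L2 (box b ξ d)) : MemLp (part ℓ u) 2 :=
  (memLp_indicator_iff_restrict (measurableSet_box b ξ d)).2 (ℓ.comp_memLp' (Lp.memLp u))

theorem integrable_part {b ξ d : ℝ} (ℓ : ℂ →L[ℝ] ℝ) (u : L2 (box b ξ d)) :
    Integrable (part ℓ u) :=
  (integrable_indicator_iff (measurableSet_box b ξ d)).2
    ((ℓ.comp_memLp' (Lp.memLp u)).integrable (by norm_num))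

theorem integral_mul_part {b ξ d : ℝ} (ℓ : ℂ →L[ℝ] ℝ) (u : L2 (box b ξ d)) {φ : Pt → ℝ}
    (hφ : IsTest φ) : ∫ x, φ x * part ℓ u x = ℓ (∫ x in box b ξ d, φ x • u x) := by
  rw [← ℓ.integral_comp_comm (hφ.integrable u), ← integral_indicator (measurableSet_box b ξ d)]
  congr 1; funext x
  by_cases hx : x ∈ box b ξ d
  · rw [part_of_mem ℓ u hx, indicator_of_mem hx, map_smul, smul_eq_mul]
  · rw [part_of_notMem ℓ u hx, indicator_of_notMem hx, mul_zero]

theorem pdMulti_single (i : Fin 3) (φ : Pt → ℝ) : pdMulti (Pi.single i 1) φ = pd i φ := by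
  fin_cases i <;> simp [pdMulti]

theorem pdMulti_single_add_single (i j : Fin 3) {φ : Pt → ℝ} (hφ : ContDiff ℝ ∞ φ) :
    pdMulti (Pi.single i 1 + Pi.single j 1) φ = pd i (pd j φ) := by
  have h := fun i j => pd_comm (i := i) (j := j) hφ
  fin_cases i <;> fin_cases j <;> simp [pdMulti] <;> first | rfl | exact h _ _

theorem mem_multiIdx_single (i : Fin 3) {m : ℕ} (hm : 1 ≤ m) : Pi.single i 1 ∈ multiIdx m := by
  rw [mem_multiIdx]; simpa using hm

theorem mem_multiIdx_single_add_single (i j : Fin 3) {m : ℕ} (hm : 2 ≤ m) :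
    Pi.single i 1 + Pi.single j 1 ∈ multiIdx m := by
  rw [mem_multiIdx]; simpa [Finset.sum_add_distrib] using hm

theorem isWeakDeriv_wD {Ω : Set Pt} {m : ℕ} (u : Sob Ω m) {α : Fin 3 → ℕ} (hα : α ∈ multiIdx m) :
    IsWeakDeriv Ω α (wD u 0) (wD u α) := by
  have := u.2 ⟨α, hα⟩
  unfold wD
  rw [dif_pos hα, dif_pos (zero_mem_multiIdx m)]
  exact this

theorem integral_pdMulti_mul_part {b ξ d : ℝ} {m : ℕ} (ℓ : ℂ →L[ℝ] ℝ) (u : Sob (box b ξ d) m)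
    {α : Fin 3 → ℕ} (hα : α ∈ multiIdx m) {φ : Pt → ℝ} (hφ : IsTest φ)
    (hs : tsupport φ ⊆ box b ξ d) :
    ∫ x, pdMulti α φ x * part ℓ (wD u 0) x =
      (-1) ^ (∑ i, α i) * ∫ x, φ x * part ℓ (wD u α) x := by
  rw [integral_mul_part ℓ _ (hφ.pdMulti α), integral_mul_part ℓ _ hφ, isWeakDeriv_wD u hα φ hφ hs,
    map_smul, smul_eq_mul]

theorem ae_lap_eq {Ω : Set Pt} {m : ℕ} (u : Sob Ω m) :
    ∀ᵐ x ∂(volume.restrict Ω), lap u x = ∑ i, wD2 u i i x := by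
  unfold lap
  simp only [Fin.sum_univ_three]
  filter_upwards [Lp.coeFn_add (wD2 u 0 0 + wD2 u 1 1) (wD2 u 2 2),
    Lp.coeFn_add (wD2 u 0 0) (wD2 u 1 1)] with x h1 h2
  rw [h1, Pi.add_apply, h2, Pi.add_apply]

/-! ### Weak derivatives of functions with homogeneous boundary conditions -/

theorem integral_pd_mul_part_of_flux {b ξ d : ℝ} (ℓ : ℂ →L[ℝ] ℝ) {u v : L2 (box b ξ d)}
    {φ : Pt → ℝ} (hφ : IsTest φ) {i : Fin 3} (h : flux i φ u v = 0) :
    ∫ x, pd i φ x * part ℓ u x = -∫ x, φ x * part ℓ v x := by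
  rw [integral_mul_part ℓ _ (hφ.pd i), integral_mul_part ℓ _ hφ, ← map_neg]
  congr 1
  exact eq_neg_of_add_eq_zero_left h

/-- The zero trace makes Green's formula hold for test functions that need not vanish on the
boundary: the extension of u by zero is weakly differentiable on the whole space. -/
theorem integral_pd_mul_part_of_mem_Sob0 {b ξ d : ℝ} {m : ℕ} (ℓ : ℂ →L[ℝ] ℝ)
    {u : Sob (box b ξ d) m} (hu : u ∈ Sob0 b ξ d m) (i : Fin 3) {φ : Pt → ℝ} (hφ : IsTest φ) :
    ∫ x, pd i φ x * part ℓ (wD u 0) x = -∫ x, φ x * part ℓ (wD1 u i) x := by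
  refine integral_pd_mul_part_of_flux ℓ hφ ?_
  have := hu.1 φ hφ i
  simpa [gamInt_zero] using this

theorem integral_pd_mul_part_deriv {b ξ d : ℝ} {m : ℕ} (hm : 2 ≤ m) (ℓ : ℂ →L[ℝ] ℝ)
    {u : Sob (box b ξ d) m} (hu : u ∈ Sob0 b ξ d m) (i j : Fin 3) {φ : Pt → ℝ} (hφ : IsTest φ)
    (hs : tsupport φ ⊆ box b ξ d) :
    ∫ x, pd i φ x * part ℓ (wD1 u j) x = -∫ x, φ x * part ℓ (wD2 u j i) x := by
  have h1 := integral_pdMulti_mul_part ℓ u (mem_multiIdx_single_add_single j i hm) hφ hs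
  rw [pdMulti_single_add_single j i hφ.1, integral_pd_mul_part_of_mem_Sob0 ℓ hu j (hφ.pd i)] at h1
  have e : (-1 : ℝ) ^ (∑ k, (Pi.single j 1 + Pi.single i 1 : Fin 3 → ℕ) k) = 1 := by
    simp [Finset.sum_add_distrib]
  rw [e, one_mul] at h1
  unfold wD2
  linarith

/-- The condition u_z = 0 on Γ in weak form: the test function may be nonzero on Γ. -/
theorem integral_pd_two_mul_part_deriv {b ξ d : ℝ} {m : ℕ} (ℓ : ℂ →L[ℝ] ℝ)
    {u : Sob (box b ξ d) m} (hu : u ∈ Sob0 b ξ d m) {φ : Pt → ℝ} (hφ : IsTest φ)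
    (hs : Disjoint (tsupport φ) (frontier (box b ξ d) \ Gam b ξ)) :
    ∫ x, pd 2 φ x * part ℓ (wD1 u 2) x = -∫ x, φ x * part ℓ (wD2 u 2 2) x := by
  refine integral_pd_mul_part_of_flux ℓ hφ ?_
  have := hu.2 φ hφ hs
  simpa [gamInt_zero] using this

/-- The parities of the extension of a function in `H_0^2`: odd with respect to all sides except
`Γ`, zero beyond `Γ`. -/
def oddSign : Fin 3 → ℝ × ℝ := ![(-1, -1), (-1, -1), (0, -1)]

theorem oddSign_snd (i : Fin 3) : (oddSign i).2 = -1 := by fin_cases i <;> rfl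

/-- Any choice of signs is allowed for the first derivatives, because the zero trace removes all
conditions on the transposed test function. -/
theorem integral_pd_mul_ext_part {b ξ d : ℝ} {m : ℕ} (ℓ : ℂ →L[ℝ] ℝ) {u : Sob (box b ξ d) m}
    (hu : u ∈ Sob0 b ξ d m) (σ : Fin 3 → ℝ × ℝ) (i : Fin 3) {φ : Pt → ℝ} (hφ : IsTest φ) :
    ∫ x, pd i φ x * ext (boxLo b ξ) (boxHi b d) σ (part ℓ (wD u 0)) x =
      -∫ x, φ x * ext (boxLo b ξ) (boxHi b d) (flip i σ) (part ℓ (wD1 u i)) x :=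
  integral_pd_mul_ext (integrable_part ℓ _) (integrable_part ℓ _) hφ
    (integral_pd_mul_part_of_mem_Sob0 ℓ hu i (isTest_extT hφ _))

theorem mem_box_of_part_ne_zero {b ξ d : ℝ} {ℓ : ℂ →L[ℝ] ℝ} {u : L2 (box b ξ d)} {x : Pt}
    (h : part ℓ u x ≠ 0) (j : Fin 3) : x j ∈ Ioo (boxLo b ξ j) (boxHi b d j) := by
  by_contra h0
  exact h (vanishesOn_part ℓ u j x h0)

/-- The normal derivative is not prescribed on the lateral faces. The test function therefore has to
vanish on the two faces orthogonal to `i`, and then `integral_pd_mul_of_box` removes the conditions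
on all the faces. -/
theorem integral_pd_mul_part_deriv_of_ne {b ξ d : ℝ} {m : ℕ} (hm : 2 ≤ m) (ℓ : ℂ →L[ℝ] ℝ)
    {u : Sob (box b ξ d) m} (hu : u ∈ Sob0 b ξ d m) {i : Fin 3} {Φ : Pt → ℝ} (hΦ : IsTest Φ)
    (h1 : VanishesOn i {boxLo b ξ i} Φ) (h2 : VanishesOn i {boxHi b d i} Φ) :
    ∫ x, pd i Φ x * part ℓ (wD1 u i) x = -∫ x, Φ x * part ℓ (wD2 u i i) x := by
  obtain ⟨K1, hK10, hK1⟩ := hΦ.exists_abs_le h1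
  obtain ⟨K2, hK20, hK2⟩ := hΦ.exists_abs_le h2
  refine integral_pd_mul_of_box (integrable_part ℓ _) (integrable_part ℓ _) (vanishesOn_part ℓ _)
    (vanishesOn_part ℓ _) (fun φ hφ hs => integral_pd_mul_part_deriv hm ℓ hu i i hφ
      (by rwa [box_eq])) hΦ ⟨K1 + K2, fun x hx => ?_⟩
  have hxi := mem_box_of_part_ne_zero hx i
  have a1 := hK1 x
  have a2 := hK2 x
  rw [abs_sub_comm, abs_of_pos (sub_pos.2 hxi.2)] at a2
  rw [abs_of_pos (sub_pos.2 hxi.1)] at a1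
  have b1 := mul_nonneg hK10 (sub_pos.2 hxi.2).le
  have b2 := mul_nonneg hK20 (sub_pos.2 hxi.1).le
  constructor <;> linarith

theorem frontier_box_subset {b ξ d : ℝ} {x : Pt} (hx : x ∈ frontier (box b ξ d))
    (h0 : |x 0| < b) (h1 : |x 1| < b) (h2 : x 2 < d) : x ∈ Gam b ξ := by
  refine ⟨h0, h1, le_antisymm ?_ ?_⟩
  · by_contra! h
    have : x ∈ interior (box b ξ d) := by
      rw [(isOpen_box b ξ d).interior_eq]; exact ⟨h0, h1, h, h2⟩
    exact hx.2 this
  · have := (isClosed_Icc.closure_subset_iff.2 (box_subset_Icc b ξ d)) hx.1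
    simpa [boxLo] using this.1 2

/-- Because u_z vanishes on Γ, its extension by zero below Γ creates no jump. The box can be
prolonged downwards, and the test function need only vanish on the top face. -/
theorem integral_pd_two_mul_part_deriv_of_vanishesOn {b ξ d : ℝ} {m : ℕ} (ℓ : ℂ →L[ℝ] ℝ)
    {u : Sob (box b ξ d) m} (hu : u ∈ Sob0 b ξ d m) {Φ : Pt → ℝ} (hΦ : IsTest Φ)
    (h2 : VanishesOn 2 {boxHi b d 2} Φ) :
    ∫ x, pd 2 Φ x * part ℓ (wD1 u 2) x = -∫ x, Φ x * part ℓ (wD2 u 2 2) x := by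
  obtain ⟨K2, hK20, hK2⟩ := hΦ.exists_abs_le h2
  obtain ⟨K1, hK1⟩ := hΦ.2.exists_bound_of_continuous hΦ.1.continuous
  have hK10 : 0 ≤ K1 := (norm_nonneg _).trans (hK1 0)
  -- The bottom is lowered by one unit, so the distance to the new bottom is at least 1 on Ω and
  -- boundedness of Φ supplies the required estimate there.
  have hle : ∀ j, boxLo b (ξ + 1) j ≤ boxLo b ξ j := by
    intro j; fin_cases j <;> simp [boxLo]
  have hmono : ∀ (v : L2 (box b ξ d)) j,
      VanishesOn j (Ioo (boxLo b (ξ + 1) j) (boxHi b d j))ᶜ (part ℓ v) := fun v j x hx =>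
    vanishesOn_part ℓ v j x fun h => hx ⟨(hle j).trans_lt h.1, h.2⟩
  refine integral_pd_mul_of_box (A := boxLo b (ξ + 1)) (integrable_part ℓ _) (integrable_part ℓ _)
    (hmono _) (hmono _) (fun φ hφ hs => integral_pd_two_mul_part_deriv ℓ hu hφ ?_) hΦ
    ⟨K1 + K2, fun x hx => ?_⟩
  · rw [Set.disjoint_left]
    rintro x hx ⟨hf, hG⟩
    have := hs hx
    rw [← box_eq] at this
    exact hG (frontier_box_subset hf this.1 this.2.1 this.2.2.2)
  have hxi := mem_box_of_part_ne_zero hx 2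
  have a1 := hK1 x
  have a2 := hK2 x
  rw [abs_sub_comm, abs_of_pos (sub_pos.2 hxi.2)] at a2
  rw [Real.norm_eq_abs] at a1
  have e : x 2 - boxLo b (ξ + 1) 2 = x 2 - boxLo b ξ 2 + 1 := by simp [boxLo]; ring
  have b0 : 0 ≤ x 2 - boxLo b ξ 2 := (sub_pos.2 hxi.1).le
  have b1 := mul_nonneg hK10 b0
  have b2 := mul_nonneg hK20 b0
  have b3 := mul_nonneg hK10 (sub_pos.2 hxi.2).le
  rw [e]
  constructor <;> nlinarith

/-- Two differentiations in the same direction restore the signs, so the transposed test function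
vanishes on the side and top faces, where u_z or the lateral normal derivative is unknown; on Γ it
need not vanish, as u_z does. Mixed derivatives across the faces are not needed. -/
theorem integral_pd_pd_mul_ext_part {b ξ d : ℝ} {m : ℕ} (hm : 2 ≤ m) (ℓ : ℂ →L[ℝ] ℝ)
    {u : Sob (box b ξ d) m} (hu : u ∈ Sob0 b ξ d m) (i : Fin 3) {φ : Pt → ℝ} (hφ : IsTest φ)
    (hs : tsupport φ ⊆ {x | ∀ j, x j ∈ Ioo (2 * boxLo b ξ j - boxHi b d j)
      (2 * boxHi b d j - boxLo b ξ j)}) :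
    ∫ x, pd i (pd i φ) x * ext (boxLo b ξ) (boxHi b d) oddSign (part ℓ (wD u 0)) x =
      ∫ x, φ x * ext (boxLo b ξ) (boxHi b d) oddSign (part ℓ (wD2 u i i)) x := by
  rw [integral_pd_mul_ext_part ℓ hu oddSign i (hφ.pd i)]
  have hout : ∀ x, ∀ j, x j ∉ Ioo (2 * boxLo b ξ j - boxHi b d j) (2 * boxHi b d j - boxLo b ξ j) →
      φ x = 0 := fun x j hx => by
    by_contra h0
    exact hx (hs (subset_tsupport _ h0) j)
  have hlow : VanishesOn i (Iic (2 * boxLo b ξ i - boxHi b d i)) φ := fun x hx =>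
    hout x i fun h => not_lt.2 hx h.1
  have hup : VanishesOn i (Ici (2 * boxHi b d i - boxLo b ξ i)) φ := fun x hx =>
    hout x i fun h => not_lt.2 hx h.2
  have key : ∫ x, pd i (extT (boxLo b ξ) (boxHi b d) oddSign φ) x * part ℓ (wD1 u i) x =
      -∫ x, extT (boxLo b ξ) (boxHi b d) oddSign φ x * part ℓ (wD2 u i i) x := by
    have hv2 := extT_vanishesOn_upper (lo := boxLo b ξ) (hi := boxHi b d) (oddSign_snd i) hlow
    by_cases hi : i = 2
    · subst hi
      exact integral_pd_two_mul_part_deriv_of_vanishesOn ℓ hu (isTest_extT hφ _) hv2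
    · refine integral_pd_mul_part_deriv_of_ne hm ℓ hu (isTest_extT hφ _)
        (extT_vanishesOn_lower ?_ hup) hv2
      fin_cases i
      · rfl
      · rfl
      · exact absurd rfl hi
  have := integral_pd_mul_ext (lo := boxLo b ξ) (hi := boxHi b d) (σ := flip i oddSign) (i := i)
    (integrable_part ℓ (wD1 u i)) (integrable_part ℓ (wD2 u i i)) hφ
    (by rw [flip_flip]; exact key)
  rw [flip_flip] at this
  rw [this, neg_neg]


/-! ### The Carleman estimate on `H_0^2` -/

theorem deriv_weight {s ν c : ℝ} {ψ : ℝ → ℝ} (hc : -s ≤ c)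
    (hψ : ∀ z, c < z → ψ z = (z + s) ^ (-ν)) :
    ∀ z, c < z → deriv ψ z = -ν * (z + s) ^ (-ν - 1) := by
  intro z hz
  have h1 : ψ =ᶠ[𝓝 z] fun z => (z + s) ^ (-ν) := by
    filter_upwards [lt_mem_nhds hz] with y hy using hψ y hy
  rw [h1.deriv_eq]
  have h2 := ((hasDerivAt_id z).add_const s).rpow_const (p := -ν) (Or.inl (by simp; linarith))
  simpa using h2.deriv

/-- (z + s)^(-ν) is singular at z = -s, whereas the calculus above uses globally smooth functions.
The base is therefore replaced by a smooth positive function that agrees with z + s near and above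
the relevant range. -/
theorem exists_weight {s ν c : ℝ} (hν : 0 < ν) (hc : -s < c) :
    ∃ ψ : ℝ → ℝ, ContDiff ℝ ∞ ψ ∧ ∀ z, c ≤ z →
      ψ z = (z + s) ^ (-ν) ∧ deriv ψ z < 0 ∧ 0 < deriv (deriv ψ) z := by
  set ε := c + s with hε
  have hε0 : 0 < ε := by linarith
  -- Constant ε/4 for z + s ≤ ε/4 and equal to z + s from ε/2 on, with the smooth transition in
  -- between.
  let h : ℝ → ℝ := fun z => ε / 4 + (z + s - ε / 4) * Real.smoothTransition ((z + s) * (4 / ε) - 1)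
  have hs : ContDiff ℝ ∞ h := by
    refine contDiff_const.add (((contDiff_id.add contDiff_const).sub contDiff_const).mul ?_)
    exact Real.smoothTransition.contDiff.comp
      (((contDiff_id.add contDiff_const).mul contDiff_const).sub contDiff_const)
  have hpos : ∀ z, 0 < h z := by
    intro z
    by_cases hz : z + s ≤ ε / 4
    · have : (z + s) * (4 / ε) - 1 ≤ 0 := by
        rw [sub_nonpos, mul_div_assoc', div_le_one hε0]; linarith
      simp only [h, Real.smoothTransition.zero_of_nonpos this]
      linarith
    · have := mul_nonneg (by linarith : 0 ≤ z + s - ε / 4)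
        (Real.smoothTransition.nonneg ((z + s) * (4 / ε) - 1))
      simp only [h]
      linarith
  have heq : ∀ z, c - ε / 2 < z → h z = z + s := by
    intro z hz
    have : 1 ≤ (z + s) * (4 / ε) - 1 := by
      rw [le_sub_iff_add_le, mul_div_assoc', le_div_iff₀ hε0]; linarith
    simp only [h, Real.smoothTransition.one_of_one_le this]
    ring
  have hψ : ∀ z, c - ε / 2 < z → h z ^ (-ν) = (z + s) ^ (-ν) := fun z hz => by rw [heq z hz]
  have h1 := deriv_weight (ψ := fun z => h z ^ (-ν)) (s := s) (by linarith) hψ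
  -- Up to the factor -ν the derivative is again a power of the same kind, with ν + 1 in place of ν,
  -- so that `deriv_weight` applies a second time.
  have h1' : ∀ z, c - ε / 2 < z → (-ν)⁻¹ * deriv (fun z => h z ^ (-ν)) z = (z + s) ^ (-(ν + 1)) := by
    intro z hz
    rw [h1 z hz, inv_mul_cancel_left₀ (by linarith : -ν ≠ 0), neg_add']
  have h2 := deriv_weight (s := s) (by linarith) h1'
  refine ⟨fun z => h z ^ (-ν), hs.rpow_const_of_ne fun z => (hpos z).ne', fun z hz => ?_⟩
  have hz' : c - ε / 2 < z := by linarith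
  have hzs : 0 < z + s := by linarith
  refine ⟨hψ z hz', ?_, ?_⟩
  · rw [h1 z hz']
    have := Real.rpow_pos_of_pos hzs (-ν - 1)
    nlinarith
  · have h3 := h2 z hz'
    rw [deriv_const_mul_field, inv_mul_eq_iff_eq_mul₀ (by linarith)] at h3
    rw [h3]
    have := Real.rpow_pos_of_pos hzs (-(ν + 1) - 1)
    have h5 : 0 < ν * (ν + 1) := by positivity
    nlinarith

/-- The density on the left-hand side of the Carleman estimate. -/
def carlDens (C lam : ℝ) (H : Fin 3 → Fin 3 → ℝ) (D : Fin 3 → ℝ) (u : ℝ) : ℝ :=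
  C / lam * ∑ i, ∑ j, H i j ^ 2 + C * lam * ∑ i, D i ^ 2 + C * lam ^ 3 * u ^ 2

theorem carlDens_nonneg {C lam : ℝ} (hC : 0 ≤ C) (hlam : 0 ≤ lam) (H : Fin 3 → Fin 3 → ℝ)
    (D : Fin 3 → ℝ) (u : ℝ) : 0 ≤ carlDens C lam H D u := by
  unfold carlDens; positivity

/-- The left-hand side becomes one nonnegative integrand, the form required by Fatou's lemma. -/
theorem integral_carlDens {α : Type*} [MeasurableSpace α] {μ : Measure α} (C lam : ℝ)
    {H : Fin 3 → Fin 3 → α → ℝ} {D : Fin 3 → α → ℝ} {u e : α → ℝ}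
    (hH : ∀ i j, Integrable (fun x => H i j x ^ 2 * e x) μ)
    (hD : ∀ i, Integrable (fun x => D i x ^ 2 * e x) μ)
    (hu : Integrable (fun x => u x ^ 2 * e x) μ) :
    Integrable (fun x => carlDens C lam (fun i j => H i j x) (fun i => D i x) (u x) * e x) μ ∧
    ∫ x, carlDens C lam (fun i j => H i j x) (fun i => D i x) (u x) * e x ∂μ =
      C / lam * ∑ i, ∑ j, (∫ x, H i j x ^ 2 * e x ∂μ) +
        C * lam * ∑ i, (∫ x, D i x ^ 2 * e x ∂μ) + C * lam ^ 3 * (∫ x, u x ^ 2 * e x ∂μ) := by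
  have e0 : (fun x => carlDens C lam (fun i j => H i j x) (fun i => D i x) (u x) * e x) =
      fun x => C / lam * (∑ i, ∑ j, H i j x ^ 2 * e x) + C * lam * (∑ i, D i x ^ 2 * e x) +
        C * lam ^ 3 * (u x ^ 2 * e x) := by
    funext x
    simp only [carlDens, ← Finset.sum_mul]
    ring
  have i1 : Integrable (fun x => ∑ i, ∑ j, H i j x ^ 2 * e x) μ :=
    integrable_finsetSum _ fun i _ => integrable_finsetSum _ fun j _ => hH i j
  have i2 : Integrable (fun x => ∑ i, D i x ^ 2 * e x) μ := integrable_finsetSum _ fun i _ => hD i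
  have i3 : Integrable (fun x => C / lam * (∑ i, ∑ j, H i j x ^ 2 * e x) +
      C * lam * (∑ i, D i x ^ 2 * e x)) μ := (i1.const_mul _).add (i2.const_mul _)
  rw [e0]
  refine ⟨i3.add (hu.const_mul _), ?_⟩
  rw [integral_add i3 (hu.const_mul _), integral_add (i1.const_mul _) (i2.const_mul _), integral_const_mul, integral_const_mul,
    integral_const_mul, integral_finsetSum _ fun i _ => hD i,
    integral_finsetSum _ fun i _ => integrable_finsetSum _ fun j _ => hH i j]
  simp only [integral_finsetSum _ fun j _ => hH _ j]

/-! ### Mollified odd extensions as admissible functions for the smooth estimate. -/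

theorem moll_sum (n : ℕ) {f : Fin 3 → Pt → ℝ} (hf : ∀ i, Integrable (f i)) (x : Pt) :
    moll n (fun y => ∑ i, f i y) x = ∑ i, moll n (f i) x := by
  unfold moll
  rw [← integral_finsetSum]
  · simp only [Finset.mul_sum]
  · intro i _
    have h := (isTest_comp_sub (isTest_molKer n) x)
    obtain ⟨A, hA⟩ := h.2.exists_bound_of_continuous h.1.continuous
    exact (hf i).bdd_mul h.1.continuous.aestronglyMeasurable (Eventually.of_forall hA)

theorem tsupport_pd_subset (i : Fin 3) (φ : Pt → ℝ) : tsupport (pd i φ) ⊆ tsupport φ := by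
  refine closure_minimal (fun x hx => ?_) (isClosed_tsupport φ)
  refine support_fderiv_subset ℝ (f := φ) ?_
  intro h
  exact hx (by simp [pd, h])

section

variable {b ξ d : ℝ}

theorem vanishesOn_ext_oddSign (u : Pt → ℝ)
    (hu : ∀ j, VanishesOn j (Ioo (boxLo b ξ j) (boxHi b d j))ᶜ u) {σ : Fin 3 → ℝ × ℝ}
    (hσ : (σ 2).1 = 0) (hlt : -ξ < d) :
    VanishesOn 2 (Iio (-ξ)) (ext (boxLo b ξ) (boxHi b d) σ u) := by
  have h : VanishesOn 2 (Iio (-ξ))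
      (ext1 2 (boxLo b ξ 2) (boxHi b d 2) (σ 2) u) := by
    intro x hx
    simp only [mem_Iio] at hx
    have h1 : u x = 0 := hu 2 x fun h => by
      have := h.1; simp [boxLo] at this; linarith
    have h2 : u (refl 2 (boxHi b d 2) x) = 0 := hu 2 _ fun h => by
      have := h.2; rw [refl_same] at this; simp [boxHi] at this; linarith
    simp only [ext1, h1, h2, hσ]; ring
  exact (h.ext1_of_ne (by decide) _ _ _).ext1_of_ne (by decide) _ _ _

/-- On the lateral and top faces the extension is odd within the radius of the kernel. On the
lowered bottom plane z = -ξ' the kernel reaches only points below Γ, where the extension and its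
z-derivative are zero; this also gives the condition on the normal derivative. -/
theorem vanishesOnFaces_moll {m : ℕ} (hlt : -ξ < d) {ξ' : ℝ} (ℓ : ℂ →L[ℝ] ℝ)
    {u : Sob (box b ξ d) m} (hu : u ∈ Sob0 b ξ d m) {n : ℕ} (h1 : 1 / ((n : ℝ) + 1) < 2 * b)
    (h2 : 1 / ((n : ℝ) + 1) < ξ + d) (h3 : 1 / ((n : ℝ) + 1) < ξ' - ξ) :
    VanishesOnFaces (boxLo b ξ') (boxHi b d)
      (moll n (ext (boxLo b ξ) (boxHi b d) oddSign (part ℓ (wD u 0)))) := by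
  have hn : 0 < 1 / ((n : ℝ) + 1) := by positivity
  have hv := vanishesOn_part ℓ (wD u 0)
  have hdist : ∀ j : Fin 3, 1 / ((n : ℝ) + 1) < boxHi b d j - boxLo b ξ j := by
    intro j; fin_cases j <;> simp [boxLo, boxHi] <;> simp at h1 h2 <;> linarith
  have hlow : ∀ j : Fin 3, j ≠ 2 → (oddSign j).1 = -1 ∧ boxLo b ξ' j = boxLo b ξ j := by
    intro j hj
    fin_cases j
    · exact ⟨rfl, rfl⟩
    · exact ⟨rfl, rfl⟩
    · exact absurd rfl hj
  have hbelow : ∀ {σ : Fin 3 → ℝ × ℝ} (v : L2 (box b ξ d)) (x : Pt), (σ 2).1 = 0 →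
      x 2 = boxLo b ξ' 2 → moll n (ext (boxLo b ξ) (boxHi b d) σ (part ℓ v)) x = 0 := by
    intro σ v x hσ hx
    refine moll_eq_zero fun y hy => vanishesOn_ext_oddSign _ (vanishesOn_part ℓ v) hσ hlt y ?_
    have := (abs_lt.1 (hy 2)).1
    simp [boxLo] at hx
    simp only [mem_Iio]
    linarith
  refine ⟨contDiff_moll n (integrable_ext (integrable_part ℓ _) _), fun i x hx => ?_,
    fun i x hx => ?_, fun x hx => ?_⟩
  · by_cases hi : i = 2
    · subst hi; exact hbelow _ x rfl hx
    · rw [(hlow i hi).2] at hx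
      refine moll_eq_zero_of_odd i fun y hy => ?_
      rw [hx]
      refine oddOn_ext_lower hv (hlow i hi).1 y ?_
      have h5 := abs_lt.1 (hy i)
      rw [hx] at h5
      have h6 := hdist i
      constructor <;> linarith [h5.1, h5.2]
  · refine moll_eq_zero_of_odd i fun y hy => ?_
    rw [hx]
    refine oddOn_ext_upper hv (oddSign_snd i) y ?_
    have h5 := abs_lt.1 (hy i)
    rw [hx] at h5
    have h6 := hdist i
    constructor <;> linarith [h5.1, h5.2]
  · rw [pd_moll_eq n (integrable_ext (integrable_part ℓ _) _) 2 (S := univ)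
      (fun φ hφ _ => integral_pd_mul_ext_part ℓ hu oddSign 2 hφ) (subset_univ _)]
    exact hbelow _ x (by simp [flip, oddSign]) hx

theorem integral_pd_pd_mul_ext_part_of_subset {m : ℕ} (hm : 2 ≤ m) (ℓ : ℂ →L[ℝ] ℝ)
    (u : Sob (box b ξ d) m) (σ : Fin 3 → ℝ × ℝ) (i j : Fin 3) {φ : Pt → ℝ} (hφ : IsTest φ)
    (hs : tsupport φ ⊆ box b ξ d) :
    ∫ x, pd i (pd j φ) x * ext (boxLo b ξ) (boxHi b d) σ (part ℓ (wD u 0)) x =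
      ∫ x, φ x * part ℓ (wD2 u i j) x := by
  have h1 := integral_pdMulti_mul_part ℓ u (mem_multiIdx_single_add_single i j hm) hφ hs
  rw [pdMulti_single_add_single i j hφ.1] at h1
  have e : (-1 : ℝ) ^ (∑ k, (Pi.single i 1 + Pi.single j 1 : Fin 3 → ℕ) k) = 1 := by
    simp [Finset.sum_add_distrib]
  rw [e, one_mul] at h1
  rw [wD2, ← h1]
  congr 1; funext x
  by_cases hx : x ∈ box b ξ d
  · rw [ext_eq_self (vanishesOn_part ℓ _) (by rwa [box_eq] at hx)]
  · have : pd i (pd j φ) x = 0 := by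
      by_contra h0
      exact hx (hs (tsupport_pd_subset j φ (tsupport_pd_subset i _ (subset_tsupport _ h0))))
    rw [this, zero_mul, zero_mul]

theorem eventually_closedBall_subset {S : Set Pt} (hS : IsOpen S) {x : Pt} (hx : x ∈ S) :
    ∀ᶠ n : ℕ in atTop, Metric.closedBall x (1 / ((n : ℝ) + 1)) ⊆ S := by
  obtain ⟨ε, hε, h⟩ := Metric.isOpen_iff.1 hS x hx
  filter_upwards [(tendsto_one_div_add_atTop_nhds_zero_nat (𝕜 := ℝ)).eventually (gt_mem_nhds hε)]
    with n hn
  exact (Metric.closedBall_subset_ball hn).trans h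

end


/-- The smooth estimate is applied on the box with bottom -ξ', and the left side is then restricted
to Ω. On the right, the Laplacian of the mollification is the mollification of the odd extension of
Δu. -/
theorem carleman_moll {b ξ d s ν : ℝ} (hb : 0 < b) (hlt : -ξ < d) (hs : ξ < s) (hν : 0 < ν) :
    ∃ C Λ : ℝ, 0 < C ∧ 1 ≤ Λ ∧ ∀ lam, Λ ≤ lam → ∀ (ℓ : ℂ →L[ℝ] ℝ) (u : Sob (box b ξ d) 2),
      u ∈ Sob0 b ξ d 2 → ∃ ξ' : ℝ, ξ < ξ' ∧ ξ' < s ∧ ∀ᶠ n in atTop,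
        ∫⁻ x in box b ξ d, ENNReal.ofReal (carlDens C lam
          (fun i j => pd i (pd j (moll n (ext (boxLo b ξ) (boxHi b d) oddSign (part ℓ (wD u 0))))) x)
          (fun i => pd i (moll n (ext (boxLo b ξ) (boxHi b d) oddSign (part ℓ (wD u 0)))) x)
          (moll n (ext (boxLo b ξ) (boxHi b d) oddSign (part ℓ (wD u 0))) x) * cwf s ν lam (x 2)) ≤
        ∫⁻ x, ENNReal.ofReal ((Icc (boxLo b ξ') (boxHi b d)).indicator
            (fun x => cwf s ν lam (x 2)) x) *
          ‖moll n (fun y => ∑ i, ext (boxLo b ξ) (boxHi b d) oddSign (part ℓ (wD2 u i i)) y) x‖ₑ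
            ^ (2 : ℝ) := by
  -- Half of this number keeps -ξ' above the singularity -s and keeps the lowered box, together with
  -- the radius of the kernel, inside the region covered by one layer of reflections.
  set δ := min (s - ξ) (ξ + d) with hδ
  have hδ0 : 0 < δ := lt_min (by linarith) (by linarith)
  have hδ1 : δ ≤ s - ξ := min_le_left _ _
  have hδ2 : δ ≤ ξ + d := min_le_right _ _
  set ξ' := ξ + δ / 2 with hξ'
  obtain ⟨ψ, hψs, hψ⟩ := exists_weight (s := s) (c := -ξ') hν (by linarith)
  have hle : boxLo b ξ' ≤ boxHi b d := by
    intro j; fin_cases j <;> simp [boxLo, boxHi] <;> linarith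
  have hIcc : ∀ {x : Pt}, x ∈ Icc (boxLo b ξ') (boxHi b d) → -ξ' ≤ x 2 := fun hx => by
    simpa [boxLo] using hx.1 2
  have hlo2 : boxLo b ξ' 2 = -ξ' := rfl
  obtain ⟨C, Λ, hC, hΛ, H⟩ := carleman_smooth hle hψs
    (fun z hz => (hψ z (by rw [← hlo2]; exact hz.1)).2.1)
    (fun z hz => (hψ z (by rw [← hlo2]; exact hz.1)).2.2)
  refine ⟨C, Λ, hC, hΛ, fun lam hlam ℓ u hu => ⟨ξ', by linarith, by linarith, ?_⟩⟩
  have hlam0 : 0 < lam := by linarith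
  set U := ext (boxLo b ξ) (boxHi b d) oddSign (part ℓ (wD u 0)) with hU
  set G : Fin 3 → Pt → ℝ := fun i => ext (boxLo b ξ) (boxHi b d) oddSign (part ℓ (wD2 u i i))
    with hGdef
  have hUi : Integrable U := integrable_ext (integrable_part ℓ _) _
  have hGi : ∀ i, Integrable (G i) := fun i => integrable_ext (integrable_part ℓ _) _
  have hn := tendsto_one_div_add_atTop_nhds_zero_nat (𝕜 := ℝ)
  filter_upwards [hn.eventually (gt_mem_nhds (by linarith : 0 < 2 * b)),
    hn.eventually (gt_mem_nhds (by linarith : 0 < ξ + d)),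
    hn.eventually (gt_mem_nhds (by linarith : 0 < ξ' - ξ))] with n h1 h2 h3
  have hv : VanishesOnFaces (boxLo b ξ') (boxHi b d) (moll n U) :=
    vanishesOnFaces_moll hlt ℓ hu h1 h2 h3
  -- The ball of the kernel around each point of the closed box stays in the tripled box, where the
  -- pure second derivatives of the extension are known.
  have hlap : ∀ x ∈ Icc (boxLo b ξ') (boxHi b d), ∀ i, pd i (pd i (moll n U)) x = moll n (G i) x := by
    intro x hx i
    refine pd_pd_moll_eq n hUi i i (fun φ hφ hs => integral_pd_pd_mul_ext_part le_rfl ℓ hu i hφ hs) ?_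
    intro y hy j
    have h5 : |y j - x j| ≤ 1 / ((n : ℝ) + 1) := by
      have := (dist_pi_le_iff (by positivity)).1 (Metric.mem_closedBall.1 hy) j
      rwa [Real.dist_eq] at this
    have h6 := abs_le.1 h5
    have h7 := hx.1 j
    have h8 := hx.2 j
    fin_cases j <;> simp [boxLo, boxHi] at h6 h7 h8 h1 h2 h3 ⊢ <;> constructor <;> linarith
  generalize hw : moll n U = w at hv hlap
  have hws := hv.smooth
  have he : ∀ x : Pt, x ∈ Icc (boxLo b ξ') (boxHi b d) →
      cwf s ν lam (x 2) = Real.exp (2 * lam * ψ (x 2)) := fun x hx => by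
    rw [cwf, (hψ _ (hIcc hx)).1]
  have hec : Continuous fun x : Pt => Real.exp (2 * lam * ψ (x 2)) := by
    have := hψs.continuous
    fun_prop
  have hsub : box b ξ d ⊆ Icc (boxLo b ξ') (boxHi b d) := by
    refine (box_subset_Icc b ξ d).trans (Icc_subset_Icc ?_ le_rfl)
    intro j; fin_cases j <;> simp [boxLo]; linarith
  have cont1 := fun i => continuous_pd hws i
  have cont2 := fun i j => continuous_pd (contDiff_pd hws j) i
  have hdens := integral_carlDens (μ := volume.restrict (Icc (boxLo b ξ') (boxHi b d))) C lam
    (H := fun i j => pd i (pd j w)) (D := fun i => pd i w) (u := w)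
    (e := fun x => Real.exp (2 * lam * ψ (x 2)))
    (fun i j => integrable_Icc (((cont2 i j).pow 2).mul hec))
    (fun i => integrable_Icc (((cont1 i).pow 2).mul hec))
    (integrable_Icc ((hws.continuous.pow 2).mul hec))
  have key := H lam hlam w hv
  rw [← hdens.2] at key
  have hL : Integrable (fun x => (∑ i, pd i (pd i w) x) ^ 2 * Real.exp (2 * lam * ψ (x 2)))
      (volume.restrict (Icc (boxLo b ξ') (boxHi b d))) :=
    integrable_Icc (((continuous_finsetSum _ fun i _ => cont2 i i).pow 2).mul hec)
  calc _ ≤ ∫⁻ x in Icc (boxLo b ξ') (boxHi b d), ENNReal.ofReal (carlDens C lam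
          (fun i j => pd i (pd j w) x) (fun i => pd i w x) (w x) * cwf s ν lam (x 2)) :=
        lintegral_mono_set hsub
    _ = ∫⁻ x in Icc (boxLo b ξ') (boxHi b d), ENNReal.ofReal (carlDens C lam
          (fun i j => pd i (pd j w) x) (fun i => pd i w x) (w x) *
            Real.exp (2 * lam * ψ (x 2))) :=
        setLIntegral_congr_fun measurableSet_Icc fun x hx => by simp only [he x hx]
    _ ≤ ∫⁻ x in Icc (boxLo b ξ') (boxHi b d),
          ENNReal.ofReal ((∑ i, pd i (pd i w) x) ^ 2 * Real.exp (2 * lam * ψ (x 2))) := by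
        rw [← ofReal_integral_eq_lintegral_ofReal hdens.1
          (Eventually.of_forall fun x => mul_nonneg (carlDens_nonneg hC.le hlam0.le _ _ _)
            (Real.exp_pos _).le),
          ← ofReal_integral_eq_lintegral_ofReal hL (Eventually.of_forall fun x => by positivity)]
        exact ENNReal.ofReal_le_ofReal key
    _ = _ := by
        rw [← lintegral_indicator measurableSet_Icc]
        congr 1; funext x
        by_cases hx : x ∈ Icc (boxLo b ξ') (boxHi b d)
        · rw [indicator_of_mem hx, indicator_of_mem hx, moll_sum n hGi, he x hx,
            Finset.sum_congr rfl fun i _ => hlap x hx i, mul_comm,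
            ENNReal.ofReal_mul (Real.exp_pos _).le, ENNReal.rpow_two]
          congr 1
          rw [← sq_abs, ENNReal.ofReal_pow (abs_nonneg _), ← Real.norm_eq_abs, ofReal_norm]
        · rw [indicator_of_notMem hx, indicator_of_notMem hx]; simp


/-! ### Bounds for the weight and passage to the limit in the mollification. -/

theorem cwf_pos (s ν lam z : ℝ) : 0 < cwf s ν lam z := Real.exp_pos _

theorem cwf_le {s ν lam z c : ℝ} (hν : 0 ≤ ν) (hlam : 0 ≤ lam) (hc : 0 < c) (hz : c ≤ z + s) :
    cwf s ν lam z ≤ Real.exp (2 * lam * c ^ (-ν)) := by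
  unfold cwf
  gcongr 1
  gcongr 1
  exact Real.rpow_le_rpow_of_nonpos hc hz (by linarith)

theorem le_cwf {s ν lam z c : ℝ} (hν : 0 ≤ ν) (hlam : 0 ≤ lam) (hc : 0 < z + s) (hz : z + s ≤ c) :
    Real.exp (2 * lam * c ^ (-ν)) ≤ cwf s ν lam z := by
  unfold cwf
  gcongr 1
  gcongr 1
  exact Real.rpow_le_rpow_of_nonpos hc hz (by linarith)

theorem measurable_cwf (s ν lam : ℝ) : Measurable fun x : Pt => cwf s ν lam (x 2) := by
  unfold cwf
  have : Measurable fun x : Pt => x 2 := measurable_pi_apply 2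
  exact (((this.add_const s).pow_const (-ν)).const_mul (2 * lam)).exp

theorem integrable_mul_cwf {b ξ d s ν lam : ℝ} (hs : ξ < s) (hν : 0 ≤ ν) (hlam : 0 ≤ lam)
    {f : Pt → ℝ} (hf : Integrable f (volume.restrict (box b ξ d))) :
    Integrable (fun x => f x * cwf s ν lam (x 2)) (volume.restrict (box b ξ d)) := by
  refine hf.mul_bdd (c := Real.exp (2 * lam * (s - ξ) ^ (-ν)))
    (measurable_cwf s ν lam).aestronglyMeasurable ?_
  filter_upwards [ae_restrict_mem (measurableSet_box b ξ d)] with x hx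
  rw [Real.norm_eq_abs, abs_of_pos (cwf_pos _ _ _ _)]
  exact cwf_le hν hlam (by linarith) (by linarith [hx.2.2.1])

theorem integrable_sq_part {b ξ d : ℝ} (ℓ : ℂ →L[ℝ] ℝ) (u : L2 (box b ξ d)) :
    Integrable (fun x => part ℓ u x ^ 2) (volume.restrict (box b ξ d)) :=
  ((memLp_part ℓ u).restrict _).integrable_sq

/-- On Ω the derivatives of the mollifications converge almost everywhere, which suffices for
Fatou's lemma on the left. The right side is bounded by a sequence converging to an integral over Ω
alone. -/
theorem carleman_part_lintegral {b ξ d s ν : ℝ} (hb : 0 < b) (hlt : -ξ < d) (hs : ξ < s)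
    (hν : 0 < ν) :
    ∃ C Λ : ℝ, 0 < C ∧ 1 ≤ Λ ∧ ∀ lam, Λ ≤ lam → ∀ (ℓ : ℂ →L[ℝ] ℝ) (u : Sob (box b ξ d) 2),
      u ∈ Sob0 b ξ d 2 →
      ∫⁻ x in box b ξ d, ENNReal.ofReal (carlDens C lam (fun i j => part ℓ (wD2 u i j) x)
        (fun i => part ℓ (wD1 u i) x) (part ℓ (wD u 0) x) * cwf s ν lam (x 2)) ≤
      ∫⁻ x in box b ξ d,
        ENNReal.ofReal ((∑ i, part ℓ (wD2 u i i) x) ^ 2 * cwf s ν lam (x 2)) := by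
  obtain ⟨C, Λ, hC, hΛ, H⟩ := carleman_moll (s := s) (ν := ν) hb hlt hs hν
  refine ⟨C, Λ, hC, hΛ, fun lam hlam ℓ u hu => ?_⟩
  have hlam0 : 0 < lam := by linarith
  obtain ⟨ξ', hξ', hs', hle⟩ := H lam hlam ℓ u hu
  set U := ext (boxLo b ξ) (boxHi b d) oddSign (part ℓ (wD u 0)) with hU
  set G : Pt → ℝ := fun y => ∑ i, ext (boxLo b ξ) (boxHi b d) oddSign (part ℓ (wD2 u i i)) y with hG
  set w := (Icc (boxLo b ξ') (boxHi b d)).indicator (fun x => cwf s ν lam (x 2)) with hw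
  set K := Real.exp (2 * lam * (s - ξ') ^ (-ν)) with hK
  have hUi : Integrable U := integrable_ext (integrable_part ℓ _) _
  have hG2 : MemLp G 2 := memLp_finsetSum _ fun i _ => memLp_ext (memLp_part ℓ _) _
  have hcK : ∀ x ∈ Icc (boxLo b ξ') (boxHi b d), cwf s ν lam (x 2) ≤ K := fun x hx => by
    have h1 : -ξ' ≤ x 2 := by simpa [boxLo] using hx.1 2
    exact cwf_le hν.le hlam0.le (by linarith) (by linarith)
  have hwK : ∀ x, w x ≤ K := fun x => indicator_le' (f := fun x : Pt => cwf s ν lam (x 2))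
    (g := fun _ => K) hcK (fun _ _ => (Real.exp_pos _).le) x
  have hw0 : ∀ x, 0 ≤ w x := fun x => indicator_nonneg (fun x _ => (cwf_pos _ _ _ _).le) x
  have hwi : Integrable w := by
    rw [hw, integrable_indicator_iff measurableSet_Icc]
    refine Measure.integrableOn_of_bounded (M := K) isCompact_Icc.measure_lt_top.ne
      (measurable_cwf s ν lam).aestronglyMeasurable ?_
    filter_upwards [ae_restrict_mem measurableSet_Icc] with x hx
    rw [Real.norm_eq_abs, abs_of_pos (cwf_pos _ _ _ _)]
    exact hcK x hx
  obtain ⟨a, ha, hle'⟩ := exists_tendsto_lintegral_moll hG2 hwi hw0 hwK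
  -- The enlarged box adds nothing: the extension is zero below Γ, and the boundary of Ω is a null
  -- set.
  have hub : ∫⁻ y, ENNReal.ofReal (w y) * ‖G y‖ₑ ^ (2 : ℝ) ≤ ∫⁻ x in box b ξ d,
        ENNReal.ofReal ((∑ i, part ℓ (wD2 u i i) x) ^ 2 * cwf s ν lam (x 2)) := by
    rw [← lintegral_indicator (measurableSet_box b ξ d)]
    refine lintegral_mono_ae ?_
    have hae : ∀ᵐ x : Pt, x ∉ Icc (boxLo b ξ) (boxHi b d) \ box b ξ d := by
      have : box b ξ d = Set.pi univ fun i => Ioo (boxLo b ξ i) (boxHi b d i) := by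
        rw [box_eq]; ext x; simp [Set.mem_pi]
      rw [this]
      have h := (Measure.univ_pi_Ioo_ae_eq_Icc (μ := fun _ : Fin 3 => (volume : Measure ℝ))
        (f := boxLo b ξ) (g := boxHi b d)).symm
      rw [← volume_pi] at h
      exact measure_eq_zero_iff_ae_notMem.1 (ae_le_set.1 h.le)
    filter_upwards [hae] with x hx
    by_cases hxb : x ∈ box b ξ d
    · have h1 : G x = ∑ i, part ℓ (wD2 u i i) x := by
        simp only [hG]
        exact Finset.sum_congr rfl fun i _ => ext_eq_self (vanishesOn_part ℓ _)
          (by rwa [box_eq] at hxb)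
      have h2 : w x ≤ cwf s ν lam (x 2) := indicator_le_self' (fun _ _ => (cwf_pos _ _ _ _).le) x
      rw [indicator_of_mem hxb, h1, mul_comm ((∑ i, part ℓ (wD2 u i i) x) ^ 2),
        ENNReal.ofReal_mul (cwf_pos _ _ _ _).le, ENNReal.rpow_two, ← sq_abs,
        ENNReal.ofReal_pow (abs_nonneg _), ← Real.norm_eq_abs, ofReal_norm]
      gcongr
    · by_cases hxI : x ∈ Icc (boxLo b ξ') (boxHi b d)
      · have h1 : x 2 < -ξ := by
          by_contra! h
          refine hx ⟨⟨fun j => ?_, hxI.2⟩, hxb⟩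
          have := hxI.1 j
          fin_cases j
          · exact this
          · exact this
          · exact h
        have h2 : G x = 0 := by
          simp only [hG]
          exact Finset.sum_eq_zero fun i _ => vanishesOn_ext_oddSign _ (vanishesOn_part ℓ _)
            rfl hlt x h1
        rw [h2]; simp
      · rw [hw, indicator_of_notMem hxI]; simp
  refine le_trans ?_ hub
  have hlim : ∀ᵐ x ∂(volume.restrict (box b ξ d)),
      Tendsto (fun n => ENNReal.ofReal (carlDens C lam
          (fun i j => pd i (pd j (moll n U)) x) (fun i => pd i (moll n U) x)
          (moll n U x) * cwf s ν lam (x 2))) atTop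
        (𝓝 (ENNReal.ofReal (carlDens C lam (fun i j => part ℓ (wD2 u i j) x)
        (fun i => part ℓ (wD1 u i) x) (part ℓ (wD u 0) x) * cwf s ν lam (x 2)))) := by
    have c0 := ae_restrict_of_ae (s := box b ξ d) (ae_tendsto_moll hUi)
    have c1 : ∀ᵐ x ∂(volume.restrict (box b ξ d)), ∀ i, Tendsto (fun n => moll n
        (ext (boxLo b ξ) (boxHi b d) (flip i oddSign) (part ℓ (wD1 u i))) x) atTop
        (𝓝 (ext (boxLo b ξ) (boxHi b d) (flip i oddSign) (part ℓ (wD1 u i)) x)) :=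
      ae_all_iff.2 fun i => ae_restrict_of_ae (ae_tendsto_moll (integrable_ext (integrable_part ℓ _) _))
    have c2 : ∀ᵐ x ∂(volume.restrict (box b ξ d)), ∀ i j, Tendsto (fun n => moll n
        (part ℓ (wD2 u i j)) x) atTop (𝓝 (part ℓ (wD2 u i j) x)) :=
      ae_all_iff.2 fun i => ae_all_iff.2 fun j =>
        ae_restrict_of_ae (ae_tendsto_moll (integrable_part ℓ _))
    filter_upwards [c0, c1, c2, ae_restrict_mem (measurableSet_box b ξ d)] with x h0 h1 h2 hx
    have hx' := hx
    rw [box_eq] at hx'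
    have t0 : Tendsto (fun n => moll n U x) atTop (𝓝 (part ℓ (wD u 0) x)) := by
      rwa [hU, ext_eq_self (vanishesOn_part ℓ _) hx'] at h0
    have t1 : ∀ i, Tendsto (fun n => pd i (moll n U) x) atTop (𝓝 (part ℓ (wD1 u i) x)) := by
      intro i
      have h3 := h1 i
      rw [ext_eq_self (vanishesOn_part ℓ _) hx'] at h3
      refine h3.congr fun n => ?_
      exact (pd_moll_eq n hUi i (S := univ)
        (fun φ hφ _ => integral_pd_mul_ext_part ℓ hu oddSign i hφ) (subset_univ _)).symm
    -- Mixed second derivatives of the extension are known only inside Ω. The identity therefore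
    -- holds only once the ball of the kernel lies in Ω, which is enough for a pointwise limit.
    have t2 : ∀ i j, Tendsto (fun n => pd i (pd j (moll n U)) x) atTop
        (𝓝 (part ℓ (wD2 u i j) x)) := by
      intro i j
      refine (h2 i j).congr' ?_
      filter_upwards [eventually_closedBall_subset (isOpen_box b ξ d) hx] with n hn
      exact (pd_pd_moll_eq n hUi i j (fun φ hφ hs =>
        integral_pd_pd_mul_ext_part_of_subset le_rfl ℓ u oddSign i j hφ hs) hn).symm
    refine ENNReal.tendsto_ofReal (Tendsto.mul_const _ ?_)
    unfold carlDens
    refine ((tendsto_const_nhds.mul (tendsto_finsetSum _ fun i _ => tendsto_finsetSum _ fun j _ =>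
      (t2 i j).pow 2)).add (tendsto_const_nhds.mul (tendsto_finsetSum _ fun i _ =>
      (t1 i).pow 2))).add (tendsto_const_nhds.mul (t0.pow 2))
  have hmeas : ∀ n, AEMeasurable (fun x => ENNReal.ofReal (carlDens C lam
          (fun i j => pd i (pd j (moll n U)) x) (fun i => pd i (moll n U) x)
          (moll n U x) * cwf s ν lam (x 2))) (volume.restrict (box b ξ d)) := by
    intro n
    have hs := contDiff_moll n hUi
    generalize moll n U = v at hs
    have c0 := hs.continuous
    have c1 := fun i => continuous_pd hs i
    have c2 := fun i j => continuous_pd (contDiff_pd hs j) i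
    have hc : Continuous fun x => carlDens C lam
          (fun i j => pd i (pd j v) x) (fun i => pd i v x) (v x) := by
      unfold carlDens; fun_prop
    exact (hc.measurable.mul (measurable_cwf s ν lam)).ennreal_ofReal.aemeasurable
  calc _ = ∫⁻ x in box b ξ d, liminf (fun n => ENNReal.ofReal (carlDens C lam
          (fun i j => pd i (pd j (moll n U)) x) (fun i => pd i (moll n U) x)
          (moll n U x) * cwf s ν lam (x 2))) atTop := by
        refine lintegral_congr_ae ?_
        filter_upwards [hlim] with x hx
        exact hx.liminf_eq.symm
    _ ≤ liminf (fun n => ∫⁻ x in box b ξ d, ENNReal.ofReal (carlDens C lam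
          (fun i j => pd i (pd j (moll n U)) x) (fun i => pd i (moll n U) x)
          (moll n U x) * cwf s ν lam (x 2))) atTop := lintegral_liminf_le' hmeas
    _ ≤ liminf a atTop := liminf_le_liminf (by
        filter_upwards [hle] with n hn
        exact hn.trans (hle' n))
    _ = _ := ha.liminf_eq

theorem carleman_part {b ξ d s ν : ℝ} (hb : 0 < b) (hlt : -ξ < d) (hs : ξ < s)
    (hν : 0 < ν) :
    ∃ C Λ : ℝ, 0 < C ∧ 1 ≤ Λ ∧ ∀ lam, Λ ≤ lam → ∀ (ℓ : ℂ →L[ℝ] ℝ) (u : Sob (box b ξ d) 2),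
      u ∈ Sob0 b ξ d 2 →
      C / lam * ∑ i, ∑ j, (∫ x in box b ξ d, part ℓ (wD2 u i j) x ^ 2 * cwf s ν lam (x 2)) +
      C * lam * ∑ i, (∫ x in box b ξ d, part ℓ (wD1 u i) x ^ 2 * cwf s ν lam (x 2)) +
      C * lam ^ 3 * (∫ x in box b ξ d, part ℓ (wD u 0) x ^ 2 * cwf s ν lam (x 2)) ≤
      ∫ x in box b ξ d, part ℓ (lap u) x ^ 2 * cwf s ν lam (x 2) := by
  obtain ⟨C, Λ, hC, hΛ, H⟩ := carleman_part_lintegral (s := s) (ν := ν) hb hlt hs hν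
  refine ⟨C, Λ, hC, hΛ, fun lam hlam ℓ u hu => ?_⟩
  have hlam0 : 0 < lam := by linarith
  have hint : ∀ v : L2 (box b ξ d), Integrable (fun x => part ℓ v x ^ 2 * cwf s ν lam (x 2))
      (volume.restrict (box b ξ d)) := fun v =>
    integrable_mul_cwf hs hν.le hlam0.le (integrable_sq_part ℓ v)
  have hd := integral_carlDens C lam (fun i j => hint (wD2 u i j)) (fun i => hint (wD1 u i))
    (hint (wD u 0))
  rw [← hd.2]
  have hlap : (fun x => (∑ i, part ℓ (wD2 u i i) x) ^ 2 * cwf s ν lam (x 2)) =ᵐ[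
      volume.restrict (box b ξ d)] fun x => part ℓ (lap u) x ^ 2 * cwf s ν lam (x 2) := by
    filter_upwards [ae_lap_eq u, ae_restrict_mem (measurableSet_box b ξ d)] with x hx hxb
    rw [part_of_mem ℓ _ hxb, hx, map_sum]
    simp only [part_of_mem ℓ _ hxb]
  rw [← integral_congr_ae hlap]
  have hR := (hint (lap u)).congr hlap.symm
  have h := H lam hlam ℓ u hu
  rwa [← ofReal_integral_eq_lintegral_ofReal hd.1 (Eventually.of_forall fun x =>
      mul_nonneg (carlDens_nonneg hC.le hlam0.le _ _ _) (cwf_pos _ _ _ _).le),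
    ← ofReal_integral_eq_lintegral_ofReal hR (Eventually.of_forall fun x =>
      mul_nonneg (sq_nonneg _) (cwf_pos _ _ _ _).le),
    ENNReal.ofReal_le_ofReal_iff (integral_nonneg fun x =>
      mul_nonneg (sq_nonneg _) (cwf_pos _ _ _ _).le)] at h

theorem integral_norm_sq_mul_cwf {b ξ d s ν lam : ℝ} (hs : ξ < s) (hν : 0 ≤ ν) (hlam : 0 ≤ lam)
    (u : L2 (box b ξ d)) : ∫ x in box b ξ d, ‖u x‖ ^ 2 * cwf s ν lam (x 2) =
      (∫ x in box b ξ d, part Complex.reCLM u x ^ 2 * cwf s ν lam (x 2)) +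
        ∫ x in box b ξ d, part Complex.imCLM u x ^ 2 * cwf s ν lam (x 2) := by
  rw [← integral_add (integrable_mul_cwf hs hν hlam (integrable_sq_part _ u))
    (integrable_mul_cwf hs hν hlam (integrable_sq_part _ u))]
  refine setIntegral_congr_fun (measurableSet_box b ξ d) fun x hx => ?_
  simp only [part_of_mem _ _ hx, Complex.reCLM_apply, Complex.imCLM_apply]
  rw [← Complex.normSq_eq_norm_sq, Complex.normSq_apply]
  ring

theorem carlemanEstimate_of_large {b ξ d s ν : ℝ} (hb : 0 < b) (hlt : -ξ < d) (hs : ξ < s)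
    (hν : 0 < ν) : ∃ Λ, 1 ≤ Λ ∧ CarlemanEstimate b ξ d s ν Λ := by
  obtain ⟨C, Λ, hC, hΛ, H⟩ := carleman_part (s := s) (ν := ν) hb hlt hs hν
  refine ⟨Λ, hΛ, C, hC, fun lam hlam u hu => ?_⟩
  have h1 := H lam hlam Complex.reCLM u hu
  have h2 := H lam hlam Complex.imCLM u hu
  simp only [integral_norm_sq_mul_cwf hs hν.le (by linarith : 0 ≤ lam), Finset.sum_add_distrib]
  linarith

/-- For 1 ≤ λ ≤ Λ, on Ω, one has φ_λ ≤ φ_Λ ≤ M ≤ M φ_λ, so the estimate at Λ implies the one at λ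
with the constant divided by ΛM. The threshold therefore need not depend on ν. -/
theorem carlemanEstimate_one {b ξ d s ν : ℝ} (hb : 0 < b) (hlt : -ξ < d) (hs : ξ < s)
    (hν : 0 < ν) : CarlemanEstimate b ξ d s ν 1 := by
  obtain ⟨Λ, hΛ, C, hC, H⟩ := carlemanEstimate_of_large (s := s) (ν := ν) hb hlt hs hν
  set M := Real.exp (2 * Λ * (s - ξ) ^ (-ν)) with hM
  have hM1 : 1 ≤ M := by
    rw [hM]; refine Real.one_le_exp ?_
    have := Real.rpow_nonneg (by linarith : 0 ≤ s - ξ) (-ν)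
    positivity
  refine ⟨C / (Λ * M), by positivity, fun lam hlam u hu => ?_⟩
  have hC' : C / (Λ * M) ≤ C := div_le_self hC.le (by nlinarith)
  have hlam0 : 0 < lam := by linarith
  have hint : ∀ (v : L2 (box b ξ d)) (t : ℝ), 0 ≤ t →
      Integrable (fun x => ‖v x‖ ^ 2 * cwf s ν t (x 2)) (volume.restrict (box b ξ d)) :=
    fun v t ht => integrable_mul_cwf hs hν.le ht (Lp.memLp v).norm.integrable_sq
  have hnn : ∀ (v : L2 (box b ξ d)) (t : ℝ), 0 ≤ ∫ x in box b ξ d, ‖v x‖ ^ 2 * cwf s ν t (x 2) :=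
    fun v t => integral_nonneg fun x => mul_nonneg (sq_nonneg _) (cwf_pos _ _ _ _).le
  by_cases hcase : Λ ≤ lam
  · refine le_trans ?_ (H lam hcase u hu)
    have n1 := Finset.sum_nonneg fun i (_ : i ∈ Finset.univ) => Finset.sum_nonneg
      fun j (_ : j ∈ Finset.univ) => hnn (wD2 u i j) lam
    have n2 := Finset.sum_nonneg fun i (_ : i ∈ Finset.univ) => hnn (wD1 u i) lam
    have n3 := hnn (wD u 0) lam
    exact add_le_add (add_le_add
      (mul_le_mul_of_nonneg_right (div_le_div_of_nonneg_right hC' hlam0.le) n1)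
      (mul_le_mul_of_nonneg_right (mul_le_mul_of_nonneg_right hC' hlam0.le) n2))
      (mul_le_mul_of_nonneg_right (mul_le_mul_of_nonneg_right hC' (by positivity)) n3)
  · have hlt' : lam ≤ Λ := (not_le.1 hcase).le
    have hmono : ∀ v : L2 (box b ξ d), ∫ x in box b ξ d, ‖v x‖ ^ 2 * cwf s ν lam (x 2) ≤
        ∫ x in box b ξ d, ‖v x‖ ^ 2 * cwf s ν Λ (x 2) := fun v =>
      setIntegral_mono_on (hint v lam hlam0.le) (hint v Λ (by linarith)) (measurableSet_box b ξ d)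
        fun x hx => by
          refine mul_le_mul_of_nonneg_left ?_ (sq_nonneg _)
          unfold cwf
          have := Real.rpow_nonneg (by linarith [hx.2.2.1] : 0 ≤ x 2 + s) (-ν)
          gcongr
    have hback : ∫ x in box b ξ d, ‖lap u x‖ ^ 2 * cwf s ν Λ (x 2) ≤
        M * ∫ x in box b ξ d, ‖lap u x‖ ^ 2 * cwf s ν lam (x 2) := by
      rw [← integral_const_mul]
      refine setIntegral_mono_on (hint _ Λ (by linarith)) ((hint _ lam hlam0.le).const_mul _)
        (measurableSet_box b ξ d) fun x hx => ?_
      have h1 : cwf s ν Λ (x 2) ≤ M := cwf_le hν.le (by linarith) (by linarith)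
        (by linarith [hx.2.2.1])
      have h2 : 1 ≤ cwf s ν lam (x 2) := by
        unfold cwf
        refine Real.one_le_exp ?_
        have := Real.rpow_nonneg (by linarith [hx.2.2.1] : 0 ≤ x 2 + s) (-ν)
        positivity
      have h3 : cwf s ν Λ (x 2) ≤ M * cwf s ν lam (x 2) := by nlinarith
      nlinarith [mul_le_mul_of_nonneg_left h3 (sq_nonneg ‖lap u x‖)]
    have hH := (H Λ le_rfl u hu).trans hback
    have m1 := Finset.sum_le_sum fun i (_ : i ∈ Finset.univ) => Finset.sum_le_sum
      fun j (_ : j ∈ Finset.univ) => hmono (wD2 u i j)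
    have m2 := Finset.sum_le_sum fun i (_ : i ∈ Finset.univ) => hmono (wD1 u i)
    have m3 := hmono (wD u 0)
    have n1 := Finset.sum_nonneg fun i (_ : i ∈ Finset.univ) => Finset.sum_nonneg
      fun j (_ : j ∈ Finset.univ) => hnn (wD2 u i j) lam
    have n2 := Finset.sum_nonneg fun i (_ : i ∈ Finset.univ) => hnn (wD1 u i) lam
    have n3 := hnn (wD u 0) lam
    have M0 : 0 < M := by linarith
    have Λ0 : 0 < Λ := by linarith
    refine le_of_mul_le_mul_left (le_trans ?_ hH) M0
    have k1 : M * (C / (Λ * M) / lam) ≤ C / Λ := by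
      rw [show M * (C / (Λ * M) / lam) = C / Λ / lam by field_simp]
      exact div_le_self (by positivity) hlam
    have k2 : M * (C / (Λ * M) * lam) ≤ C * Λ := by
      rw [show M * (C / (Λ * M) * lam) = C * (lam / Λ) by field_simp]
      have : lam / Λ ≤ Λ := by rw [div_le_iff₀ Λ0]; nlinarith
      exact mul_le_mul_of_nonneg_left this hC.le
    have k3 : M * (C / (Λ * M) * lam ^ 3) ≤ C * Λ ^ 3 := by
      rw [show M * (C / (Λ * M) * lam ^ 3) = C * (lam ^ 3 / Λ) by field_simp]
      have h1 : lam ^ 3 ≤ Λ ^ 3 := pow_le_pow_left₀ hlam0.le hlt' 3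
      have : lam ^ 3 / Λ ≤ Λ ^ 3 := by rw [div_le_iff₀ Λ0]; nlinarith [pow_pos Λ0 3]
      exact mul_le_mul_of_nonneg_left this hC.le
    rw [mul_add, mul_add]
    exact add_le_add (add_le_add
      ((mul_assoc _ _ _).symm.trans_le (mul_le_mul k1 m1 n1 (by positivity)))
      ((mul_assoc _ _ _).symm.trans_le (mul_le_mul k2 m2 n2 (by positivity))))
      ((mul_assoc _ _ _).symm.trans_le (mul_le_mul k3 m3 n3 (by positivity)))


/-! ### Completeness of the function spaces -/

theorem IsTest.continuous_integral {φ : Pt → ℝ} (hφ : IsTest φ) (Ω : Set Pt) :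
    Continuous fun u : L2 Ω => ∫ x in Ω, φ x • u x := by
  have h1 : MemLp (fun x => (φ x : ℂ)) 2 (volume.restrict Ω) :=
    ((hφ.1.continuous.memLp_of_hasCompactSupport hφ.2).ofReal)
  have : (fun u : L2 Ω => ∫ x in Ω, φ x • u x) = fun u => inner ℂ h1.toLp u := by
    funext u
    rw [L2.inner_def]
    refine integral_congr_ae ?_
    filter_upwards [h1.coeFn_toLp] with x hx
    rw [hx]
    simp [mul_comm]
  rw [this]
  exact continuous_const.inner continuous_id

/-- Each defining identity equates two continuous functionals of the stored family of derivatives.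
-/
theorem isClosed_sobSubmodule (Ω : Set Pt) (m : ℕ) :
    IsClosed (sobSubmodule Ω m : Set (PiLp 2 fun _ : multiIdx m => L2 Ω)) := by
  have : (sobSubmodule Ω m : Set (PiLp 2 fun _ : multiIdx m => L2 Ω)) =
      ⋂ (α : multiIdx m) (φ : Pt → ℝ) (_ : IsTest φ) (_ : tsupport φ ⊆ Ω),
        {u | ∫ x in Ω, pdMulti α φ x • u ⟨0, zero_mem_multiIdx m⟩ x =
          (-1 : ℝ) ^ (∑ i, α.1 i) • ∫ x in Ω, φ x • u α x} := by
    ext u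
    simp only [mem_iInter]
    rfl
  rw [this]
  refine isClosed_iInter fun α => isClosed_iInter fun φ => isClosed_iInter fun hφ =>
    isClosed_iInter fun _ => isClosed_eq ?_ ?_
  · exact ((hφ.pdMulti α).continuous_integral Ω).comp (PiLp.continuous_apply 2 _ _)
  · have h : Continuous fun u : PiLp 2 fun _ : multiIdx m => L2 Ω => u α :=
      PiLp.continuous_apply 2 _ α
    exact ((hφ.continuous_integral Ω).comp h).const_smul ((-1 : ℝ) ^ (∑ i, α.1 i))

instance (Ω : Set Pt) (m : ℕ) : CompleteSpace (Sob Ω m) :=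
  (isClosed_sobSubmodule Ω m).completeSpace_coe

theorem sob_norm_sq {Ω : Set Pt} {m : ℕ} (u : Sob Ω m) :
    ‖u‖ ^ 2 = ∑ α ∈ multiIdx m, ‖wD u α‖ ^ 2 := by
  have h : ‖u‖ ^ 2 = ∑ α : multiIdx m, ‖u.1 α‖ ^ 2 := PiLp.norm_sq_eq_of_L2 _ u.1
  rw [h, ← Finset.sum_coe_sort (multiIdx m) fun α => ‖wD u α‖ ^ 2]
  refine Finset.sum_congr rfl fun α _ => ?_
  unfold wD
  rw [dif_pos α.2]

theorem norm_wD_le {Ω : Set Pt} {m : ℕ} (u : Sob Ω m) (α : Fin 3 → ℕ) : ‖wD u α‖ ≤ ‖u‖ := by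
  by_cases hα : α ∈ multiIdx m
  · refine le_of_sq_le_sq ?_ (norm_nonneg _)
    rw [sob_norm_sq]
    exact Finset.single_le_sum (f := fun α => ‖wD u α‖ ^ 2) (fun _ _ => sq_nonneg _) hα
  · unfold wD; rw [dif_neg hα, norm_zero]; exact norm_nonneg _

/-- Weak derivatives as bounded operators. -/
def wDL (Ω : Set Pt) (m : ℕ) (α : Fin 3 → ℕ) : Sob Ω m →L[ℝ] L2 Ω :=
  LinearMap.mkContinuous
    { toFun := fun u => wD u α
      map_add' := fun u v => wD_add u v α
      map_smul' := fun c u => wD_smul c u α } 1 fun u => by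
    rw [one_mul]; exact norm_wD_le u α

theorem wDL_apply {Ω : Set Pt} {m : ℕ} (α : Fin 3 → ℕ) (u : Sob Ω m) : wDL Ω m α u = wD u α := rfl

/-- The Laplacian as a bounded operator. -/
def lapL (Ω : Set Pt) (m : ℕ) : Sob Ω m →L[ℝ] L2 Ω :=
  ∑ i : Fin 3, wDL Ω m (Pi.single i 1 + Pi.single i 1)

theorem lapL_apply {Ω : Set Pt} {m : ℕ} (u : Sob Ω m) : lapL Ω m u = lap u := by
  simp [lapL, lap, wD2, wDL_apply]

theorem wD_incl {Ω : Set Pt} {m n : ℕ} (h : m ≤ n) (u : Sob Ω n) {α : Fin 3 → ℕ}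
    (hα : α ∈ multiIdx m) : wD (incl h u) α = wD u α := by
  unfold wD
  rw [dif_pos hα, dif_pos (multiIdx_mono h hα)]
  rfl

theorem norm_incl_le {Ω : Set Pt} {m n : ℕ} (h : m ≤ n) (u : Sob Ω n) : ‖incl h u‖ ≤ ‖u‖ := by
  refine le_of_sq_le_sq ?_ (norm_nonneg _)
  rw [sob_norm_sq, sob_norm_sq]
  calc _ = ∑ α ∈ multiIdx m, ‖wD u α‖ ^ 2 :=
        Finset.sum_congr rfl fun α hα => by rw [wD_incl h u hα]
    _ ≤ _ := Finset.sum_le_sum_of_subset_of_nonneg (multiIdx_mono h) fun _ _ _ => sq_nonneg _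

theorem incl_mem_Sob0 {b ξ d : ℝ} {m n : ℕ} (hm : 2 ≤ m) (h : m ≤ n) {u : Sob (box b ξ d) n}
    (hu : u ∈ Sob0 b ξ d n) : incl h u ∈ Sob0 b ξ d m := by
  refine ⟨fun φ hφ i => ?_, fun φ hφ hs => ?_⟩
  · have := hu.1 φ hφ i
    unfold wD1 at this ⊢
    rwa [wD_incl h u (zero_mem_multiIdx m), wD_incl h u (mem_multiIdx_single i (by omega))]
  · have := hu.2 φ hφ hs
    unfold wD1 wD2 at this ⊢
    rwa [wD_incl h u (mem_multiIdx_single 2 (by omega)),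
      wD_incl h u (mem_multiIdx_single_add_single 2 2 hm)]

theorem continuous_flux {Ω : Set Pt} {m : ℕ} (i : Fin 3) {φ : Pt → ℝ} (hφ : IsTest φ)
    (α β : Fin 3 → ℕ) : Continuous fun u : Sob Ω m => flux i φ (wD u α) (wD u β) :=
  (((hφ.pd i).continuous_integral Ω).comp (wDL Ω m α).continuous).add
    ((hφ.continuous_integral Ω).comp (wDL Ω m β).continuous)

theorem isClosed_Sob0 (b ξ d : ℝ) (m : ℕ) :
    IsClosed (Sob0 b ξ d m : Set (Sob (box b ξ d) m)) := by
  have : (Sob0 b ξ d m : Set (Sob (box b ξ d) m)) =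
      (⋂ (φ : Pt → ℝ) (_ : IsTest φ) (i : Fin 3), {u | flux i φ (wD u 0) (wD1 u i) =
        if i = 2 then -gamInt b ξ φ 0 else 0}) ∩
      ⋂ (φ : Pt → ℝ) (_ : IsTest φ) (_ : Disjoint (tsupport φ) (frontier (box b ξ d) \ Gam b ξ)),
        {u | flux 2 φ (wD1 u 2) (wD2 u 2 2) = -gamInt b ξ φ 0} := by
    ext u
    simp only [mem_inter_iff, mem_iInter]
    rfl
  rw [this]
  refine IsClosed.inter (isClosed_iInter fun φ => isClosed_iInter fun hφ => isClosed_iInter fun i =>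
    isClosed_eq (continuous_flux i hφ _ _) continuous_const) (isClosed_iInter fun φ =>
    isClosed_iInter fun hφ => isClosed_iInter fun _ =>
    isClosed_eq (continuous_flux 2 hφ _ _) continuous_const)

instance (b ξ d : ℝ) (m : ℕ) : CompleteSpace (Sob0 b ξ d m) :=
  (isClosed_Sob0 b ξ d m).completeSpace_coe

/-- Membership in the subspace becomes an equation for a bounded operator, which commutes with
Bochner integrals and acts pointwise in k. -/
theorem exists_clm_ker_eq {E : Type*} [NormedAddCommGroup E] [InnerProductSpace ℝ E]
    (K : Submodule ℝ E) [K.HasOrthogonalProjection] :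
    ∃ T : E →L[ℝ] E, ∀ x, T x = 0 ↔ x ∈ K := by
  refine ⟨ContinuousLinearMap.id ℝ E - K.starProjection, fun x => ?_⟩
  rw [sub_apply, ContinuousLinearMap.id_apply, sub_eq_zero, eq_comm,
    Submodule.starProjection_eq_self_iff]

theorem isClosed_Hk0 (b ξ d k₀ k₁ : ℝ) (m : ℕ) :
    IsClosed (Hk0 b ξ d k₀ k₁ m : Set (Hk (box b ξ d) k₀ k₁ m)) := by
  obtain ⟨T, hT⟩ := exists_clm_ker_eq (Sob0 b ξ d m)
  have : (Hk0 b ξ d k₀ k₁ m : Set (Hk (box b ξ d) k₀ k₁ m)) =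
      {f | T.compLpL 2 (volume.restrict (Icc k₀ k₁)) f = 0} := by
    ext f
    change (∀ᵐ k ∂_, f k ∈ Sob0 b ξ d m) ↔ T.compLpL 2 _ f = 0
    rw [Lp.eq_zero_iff_ae_eq_zero]
    have h := T.coeFn_compLpL (p := 2) (μ := volume.restrict (Icc k₀ k₁)) f
    constructor
    · intro hf
      filter_upwards [hf, h] with k h1 h2
      rw [h2, Pi.zero_apply, (hT _).2 h1]
    · intro hf
      filter_upwards [hf, h] with k h1 h2
      rw [← hT, ← h2, h1, Pi.zero_apply]
  rw [this]
  exact isClosed_eq (ContinuousLinearMap.continuous _) continuous_const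

instance (b ξ d k₀ k₁ : ℝ) (m : ℕ) : CompleteSpace (Hk0 b ξ d k₀ k₁ m) :=
  (isClosed_Hk0 b ξ d k₀ k₁ m).completeSpace_coe

theorem integral_mem_Sob0 {b ξ d : ℝ} {m : ℕ} {α : Type*} [MeasurableSpace α] {μ : Measure α}
    {f : α → Sob (box b ξ d) m} (hf : Integrable f μ) (h : ∀ᵐ a ∂μ, f a ∈ Sob0 b ξ d m) :
    ∫ a, f a ∂μ ∈ Sob0 b ξ d m := by
  obtain ⟨T, hT⟩ := exists_clm_ker_eq (Sob0 b ξ d m)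
  rw [← hT, ← T.integral_comp_comm hf]
  refine integral_eq_zero_of_ae ?_
  filter_upwards [h] with a ha
  rw [Pi.zero_apply, hT]; exact ha

theorem Lp_norm_sq_eq_integral {α E : Type*} [MeasurableSpace α] {μ : Measure α}
    [NormedAddCommGroup E] (f : Lp E 2 μ) : ‖f‖ ^ 2 = ∫ x, ‖f x‖ ^ 2 ∂μ := by
  have h := (Lp.memLp f).eLpNorm_eq_integral_rpow_norm (by norm_num) (by norm_num)
  rw [Lp.norm_def, h, ENNReal.toReal_ofReal (by positivity), ← Real.rpow_natCast,
    ← Real.rpow_mul (by positivity)]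
  simp

/-! ### Multiplication by bounded functions -/

section mulOp

variable {α E : Type*} [MeasurableSpace α] {μ : Measure α} [NormedAddCommGroup E]
  [NormedSpace ℝ E]

theorem memLp_bdd_smul {g : α → ℝ} (hg : AEStronglyMeasurable g μ) {M : ℝ}
    (hM : ∀ᵐ x ∂μ, |g x| ≤ M) {f : α → E} (hf : MemLp f 2 μ) : MemLp (fun x => g x • f x) 2 μ := by
  refine hf.of_le_mul (c := M) (hg.smul hf.1) ?_
  filter_upwards [hM] with x hx
  rw [norm_smul, Real.norm_eq_abs]
  exact mul_le_mul_of_nonneg_right hx (norm_nonneg _)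

/-- Multiplication by an essentially bounded real function on `L²`. -/
def mulOp (g : α → ℝ) (hg : AEStronglyMeasurable g μ) {M : ℝ} (hM : ∀ᵐ x ∂μ, |g x| ≤ M) :
    Lp E 2 μ →L[ℝ] Lp E 2 μ :=
  LinearMap.mkContinuous
    { toFun := fun f => (memLp_bdd_smul hg hM (Lp.memLp f)).toLp
      map_add' := fun f h => by
        rw [← MemLp.toLp_add]
        refine MemLp.toLp_congr _ _ ?_
        filter_upwards [Lp.coeFn_add f h] with x hx
        rw [hx, Pi.add_apply, Pi.add_apply, smul_add]
      map_smul' := fun c f => by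
        rw [RingHom.id_apply, ← MemLp.toLp_const_smul]
        refine MemLp.toLp_congr _ _ ?_
        filter_upwards [Lp.coeFn_smul c f] with x hx
        rw [hx, Pi.smul_apply, Pi.smul_apply, smul_comm] } M fun f => by
    refine Lp.norm_le_mul_norm_of_ae_le_mul ?_
    filter_upwards [(memLp_bdd_smul hg hM (Lp.memLp f)).coeFn_toLp, hM] with x hx h
    rw [LinearMap.coe_mk, AddHom.coe_mk, hx, norm_smul, Real.norm_eq_abs]
    exact mul_le_mul_of_nonneg_right h (norm_nonneg _)

theorem coeFn_mulOp (g : α → ℝ) (hg : AEStronglyMeasurable g μ) {M : ℝ}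
    (hM : ∀ᵐ x ∂μ, |g x| ≤ M) (f : Lp E 2 μ) : mulOp g hg hM f =ᵐ[μ] fun x => g x • f x :=
  (memLp_bdd_smul hg hM (Lp.memLp f)).coeFn_toLp

end mulOp


/-! ### Interpolation and Sobolev inequalities in `L^p(Ω)` -/

theorem holderTriple_coe {p q r : NNReal} (hp : 0 < p) (hq : 0 < q) (hr : 0 < r)
    (h : (p : ℝ)⁻¹ + (q : ℝ)⁻¹ = (r : ℝ)⁻¹) : ENNReal.HolderTriple p q r := by
  refine ⟨?_⟩
  rw [← ENNReal.coe_inv hp.ne', ← ENNReal.coe_inv hq.ne', ← ENNReal.coe_inv hr.ne',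
    ← ENNReal.coe_add, ENNReal.coe_inj, ← NNReal.coe_inj]
  push_cast
  exact h

section

variable {α E : Type*} [MeasurableSpace α] {μ : Measure α} [NormedAddCommGroup E]

/-- Hölder's inequality for |A| = |A|^(1-t) |A|^t with the exponents p₀/(1-t) and p₁/t. -/
theorem eLpNorm_interpolate {p₀ p₁ q : NNReal} (h0 : 0 < p₀) (h1 : 0 < p₁) (hq : 0 < q) {t : ℝ}
    (ht0 : 0 < t) (ht1 : t < 1) (h : (1 - t) * (p₀ : ℝ)⁻¹ + t * (p₁ : ℝ)⁻¹ = (q : ℝ)⁻¹) {A : α → E}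
    (hA : AEStronglyMeasurable A μ) :
    eLpNorm A q μ ≤ eLpNorm A p₀ μ ^ (1 - t) * eLpNorm A p₁ μ ^ t := by
  have hs : 0 < 1 - t := by linarith
  let r₀ : NNReal := p₀ / ⟨1 - t, hs.le⟩
  let r₁ : NNReal := p₁ / ⟨t, ht0.le⟩
  have hs' : (0 : NNReal) < ⟨1 - t, hs.le⟩ := hs
  have ht' : (0 : NNReal) < ⟨t, ht0.le⟩ := ht0
  have hr₀ : 0 < r₀ := div_pos h0 hs'
  have hr₁ : 0 < r₁ := div_pos h1 ht'
  have c0 : (r₀ : ℝ) = p₀ / (1 - t) := NNReal.coe_div _ _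
  have c1 : (r₁ : ℝ) = p₁ / t := NNReal.coe_div _ _
  have : ENNReal.HolderTriple r₀ r₁ q := by
    refine holderTriple_coe hr₀ hr₁ hq ?_
    rw [← h, c0, c1, inv_div, inv_div]
    ring
  have e0 : eLpNorm (fun x => ‖A x‖ ^ (1 - t)) r₀ μ = eLpNorm A p₀ μ ^ (1 - t) := by
    rw [eLpNorm_norm_rpow A hs]
    congr 2
    rw [ENNReal.ofReal, ← ENNReal.coe_mul, ENNReal.coe_inj, ← NNReal.coe_inj]
    rw [NNReal.coe_mul, c0, Real.coe_toNNReal _ hs.le, div_mul_cancel₀ _ hs.ne']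
  have e1 : eLpNorm (fun x => ‖A x‖ ^ t) r₁ μ = eLpNorm A p₁ μ ^ t := by
    rw [eLpNorm_norm_rpow A ht0]
    congr 2
    rw [ENNReal.ofReal, ← ENNReal.coe_mul, ENNReal.coe_inj, ← NNReal.coe_inj]
    rw [NNReal.coe_mul, c1, Real.coe_toNNReal _ ht0.le, div_mul_cancel₀ _ ht0.ne']
  rw [← e0, ← e1]
  have hm : ∀ s : ℝ, AEStronglyMeasurable (fun x => ‖A x‖ ^ s) μ := fun s =>
    (hA.norm.aemeasurable.pow_const s).aestronglyMeasurable
  refine le_trans (eLpNorm_mono fun x => ?_)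
    (eLpNorm_smul_le_mul_eLpNorm (μ := μ) (p := r₀) (q := r₁) (r := q) (hm t) (hm (1 - t)))
  rw [Pi.smul_apply', smul_eq_mul, ← Real.rpow_add_of_nonneg (norm_nonneg _) hs.le ht0.le,
    sub_add_cancel, Real.rpow_one, norm_norm]

/-- 1/2 = 1/12 + 5/12, and 5/12 = (3/4)(1/2) + (1/4)(1/6). With more weight on L² than on L⁶ a
negative power of λ is left over. -/
theorem eLpNorm_mul_le_twelve {f A : α → ℂ} (hf : AEStronglyMeasurable f μ)
    (hA : AEStronglyMeasurable A μ) : eLpNorm (fun x => f x * A x) 2 μ ≤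
      eLpNorm f 12 μ * (eLpNorm A 2 μ ^ (3 / 4 : ℝ) * eLpNorm A 6 μ ^ (1 / 4 : ℝ)) := by
  have h : ENNReal.HolderTriple ((12 : NNReal) : ENNReal) ((12 / 5 : NNReal) : ENNReal)
      ((2 : NNReal) : ENNReal) :=
    holderTriple_coe (by norm_num) (by norm_num) (by norm_num) (by push_cast; norm_num)
  have h1 := eLpNorm_smul_le_mul_eLpNorm (μ := μ) hA hf (hpqr := h)
  have h2 := eLpNorm_interpolate (p₀ := 2) (p₁ := 6) (q := 12 / 5) (t := 1 / 4) (by norm_num)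
    (by norm_num) (by norm_num) (by norm_num) (by norm_num) (by push_cast; norm_num) hA
  have e : (1 - 1 / 4 : ℝ) = 3 / 4 := by norm_num
  rw [e] at h2
  exact h1.trans (mul_le_mul_right h2 _)

/-- 1/2 = 1/6 + 1/3, and L³ is the midpoint of L² and L⁶. This is the case of a factor that is only
in L⁶, such as a second derivative of an H³ function; the powers of λ balance. -/
theorem eLpNorm_mul_le_six {f A : α → ℂ} (hf : AEStronglyMeasurable f μ)
    (hA : AEStronglyMeasurable A μ) : eLpNorm (fun x => f x * A x) 2 μ ≤
      eLpNorm f 6 μ * (eLpNorm A 2 μ ^ (1 / 2 : ℝ) * eLpNorm A 6 μ ^ (1 / 2 : ℝ)) := by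
  have h : ENNReal.HolderTriple ((6 : NNReal) : ENNReal) ((3 : NNReal) : ENNReal)
      ((2 : NNReal) : ENNReal) :=
    holderTriple_coe (by norm_num) (by norm_num) (by norm_num) (by push_cast; norm_num)
  have h1 := eLpNorm_smul_le_mul_eLpNorm (μ := μ) hA hf (hpqr := h)
  have h2 := eLpNorm_interpolate (p₀ := 2) (p₁ := 6) (q := 3) (t := 1 / 2) (by norm_num)
    (by norm_num) (by norm_num) (by norm_num) (by norm_num) (by push_cast; norm_num) hA
  have e : (1 - 1 / 2 : ℝ) = 1 / 2 := by norm_num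
  rw [e] at h2
  exact h1.trans (mul_le_mul_right h2 _)

end

/-! ### Relations between successive weak derivatives, and Sobolev embeddings. -/

theorem pd_iterate_comm {φ : Pt → ℝ} (hφ : ContDiff ℝ ∞ φ) (i j : Fin 3) (n : ℕ) :
    ContDiff ℝ ∞ ((pd j)^[n] φ) ∧ (pd j)^[n] (pd i φ) = pd i ((pd j)^[n] φ) := by
  induction n with
  | zero => exact ⟨hφ, rfl⟩
  | succ n ih =>
    rw [Function.iterate_succ_apply', Function.iterate_succ_apply', ih.2, pd_comm ih.1]
    exact ⟨contDiff_pd ih.1 j, rfl⟩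

theorem pdMulti_pd (α : Fin 3 → ℕ) (i : Fin 3) {φ : Pt → ℝ} (hφ : ContDiff ℝ ∞ φ) :
    pdMulti α (pd i φ) = pdMulti (α + Pi.single i 1) φ := by
  have h2 := pd_iterate_comm hφ i 2 (α 2)
  have h1 := pd_iterate_comm h2.1 i 1 (α 1)
  unfold pdMulti
  fin_cases i
  · simp only [Fin.zero_eta] at h1 h2 ⊢
    rw [h2.2, h1.2]
    simp [Function.iterate_succ_apply]
  · simp only [Fin.mk_one] at h1 h2 ⊢
    rw [h2.2]
    simp [Function.iterate_succ_apply]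
  · simp [Function.iterate_succ_apply]

/-- All the derivatives are stored relative to u itself; testing the relation for ∂^α with ∂_i φ
yields the relation between neighbouring ones. -/
theorem isWeakDeriv_wD_succ {Ω : Set Pt} {m : ℕ} (u : Sob Ω m) {α : Fin 3 → ℕ} {i : Fin 3}
    (h : α + Pi.single i 1 ∈ multiIdx m) :
    IsWeakDeriv Ω (Pi.single i 1) (wD u α) (wD u (α + Pi.single i 1)) := by
  have hs : ∑ j, (α + Pi.single i 1 : Fin 3 → ℕ) j = ∑ j, α j + 1 := by simp [Finset.sum_add_distrib]
  have hα : α ∈ multiIdx m := by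
    rw [mem_multiIdx] at h ⊢; omega
  intro φ hφ hsupp
  have h1 := isWeakDeriv_wD u h φ hφ hsupp
  have h2 := isWeakDeriv_wD u hα (pd i φ) (hφ.pd i) ((tsupport_pd_subset i φ).trans hsupp)
  rw [pdMulti_pd α i hφ.1, h1, hs, pow_succ, mul_smul] at h2
  rw [pdMulti_single]
  have h3 := smul_right_injective ℂ (pow_ne_zero (∑ j, α j) (by norm_num : (-1 : ℝ) ≠ 0)) h2
  rw [← h3]
  simp

theorem eLpNorm_part {b ξ d : ℝ} (ℓ : ℂ →L[ℝ] ℝ) (u : L2 (box b ξ d)) (p : ENNReal) :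
    eLpNorm (part ℓ u) p = eLpNorm (fun x => ℓ (u x)) p (volume.restrict (box b ξ d)) :=
  eLpNorm_indicator_eq_eLpNorm_restrict (measurableSet_box b ξ d)

theorem sobolev_L2 {b ξ d : ℝ} (hb : 0 < b) (hlt : -ξ < d) {p p' : NNReal} (hp : 1 ≤ p)
    (hp' : (p' : ℝ)⁻¹ = (p : ℝ)⁻¹ - 3⁻¹) (hp1 : 1 ≤ p') :
    ∃ C : NNReal, ∀ (f : L2 (box b ξ d)) (g : Fin 3 → L2 (box b ξ d)),
      (∀ i, IsWeakDeriv (box b ξ d) (Pi.single i 1) f (g i)) →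
      eLpNorm f p' (volume.restrict (box b ξ d)) ≤
        C * (eLpNorm f p (volume.restrict (box b ξ d)) +
          ∑ i, eLpNorm (g i) p (volume.restrict (box b ξ d))) := by
  obtain ⟨C, hC⟩ := sobolev_box (lo := boxLo b ξ) (hi := boxHi b d)
    (by intro i; fin_cases i <;> simp [boxLo, boxHi] <;> linarith) hp hp'
  refine ⟨C + C, fun f g hfg => ?_⟩
  have hpart : ∀ ℓ : ℂ →L[ℝ] ℝ, (∀ z, |ℓ z| ≤ ‖z‖) →
      eLpNorm (fun x => ℓ (f x)) p' (volume.restrict (box b ξ d)) ≤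
        C * (eLpNorm f p (volume.restrict (box b ξ d)) +
          ∑ i, eLpNorm (g i) p (volume.restrict (box b ξ d))) := by
    intro ℓ hℓ
    have h := hC (part ℓ f) (fun i => part ℓ (g i)) (integrable_part ℓ f)
      (fun i => integrable_part ℓ (g i)) (vanishesOn_part ℓ f) (fun i => vanishesOn_part ℓ (g i))
      (fun i φ hφ hs => by
        rw [← box_eq] at hs
        have h := hfg i φ hφ hs
        rw [pdMulti_single] at h
        rw [integral_mul_part ℓ _ (hφ.pd i), integral_mul_part ℓ _ hφ, h]
        simp)
    simp only [eLpNorm_part] at h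
    refine h.trans (mul_le_mul_right (add_le_add ?_ (Finset.sum_le_sum fun i _ => ?_)) _)
    · exact eLpNorm_mono fun x => hℓ _
    · exact eLpNorm_mono fun x => hℓ _
  have h1 := hpart Complex.reCLM Complex.abs_re_le_norm
  have h2 := hpart Complex.imCLM Complex.abs_im_le_norm
  have hm : ∀ ℓ : ℂ →L[ℝ] ℝ, AEStronglyMeasurable (fun x => |ℓ (f x)|)
      (volume.restrict (box b ξ d)) := fun ℓ =>
    (ℓ.continuous.comp_aestronglyMeasurable (Lp.aestronglyMeasurable f)).norm
  have h3 : eLpNorm f p' (volume.restrict (box b ξ d)) ≤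
      eLpNorm (fun x => |Complex.reCLM (f x)| + |Complex.imCLM (f x)|) p'
        (volume.restrict (box b ξ d)) :=
    eLpNorm_mono_real fun x => Complex.norm_le_abs_re_add_abs_im _
  have h4 := eLpNorm_add_le (hm Complex.reCLM) (hm Complex.imCLM)
    (p := p') (by exact_mod_cast hp1)
  have e : ∀ ℓ : ℂ →L[ℝ] ℝ, eLpNorm (fun x => |ℓ (f x)|) p' (volume.restrict (box b ξ d)) =
      eLpNorm (fun x => ℓ (f x)) p' (volume.restrict (box b ξ d)) := fun ℓ =>
    eLpNorm_norm (fun x => ℓ (f x))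
  rw [e, e] at h4
  refine h3.trans (h4.trans ((add_le_add h1 h2).trans ?_))
  rw [ENNReal.coe_add, add_mul]

theorem sobolev_six {b ξ d : ℝ} (hb : 0 < b) (hlt : -ξ < d) :
    ∃ C : NNReal, ∀ (f : L2 (box b ξ d)) (g : Fin 3 → L2 (box b ξ d)),
      (∀ i, IsWeakDeriv (box b ξ d) (Pi.single i 1) f (g i)) →
      eLpNorm f 6 (volume.restrict (box b ξ d)) ≤ C * ENNReal.ofReal (‖f‖ + ∑ i, ‖g i‖) := by
  obtain ⟨C, hC⟩ := sobolev_L2 (p := 2) (p' := 6) hb hlt (by norm_num) (by push_cast; norm_num)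
    (by norm_num)
  refine ⟨C, fun f g hfg => ?_⟩
  have h := hC f g hfg
  have e : ∀ v : L2 (box b ξ d), eLpNorm v (2 : NNReal) (volume.restrict (box b ξ d)) =
      ENNReal.ofReal ‖v‖ := fun v => by
    rw [Lp.norm_def, ENNReal.ofReal_toReal (Lp.eLpNorm_ne_top v)]; rfl
  rw [e, Finset.sum_congr rfl fun i _ => e (g i), ← ENNReal.ofReal_sum_of_nonneg
    fun i _ => norm_nonneg _, ← ENNReal.ofReal_add (norm_nonneg _)
    (Finset.sum_nonneg fun i _ => norm_nonneg _)] at h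
  exact h

theorem exists_eLpNorm_six_le {b ξ d : ℝ} (hb : 0 < b) (hlt : -ξ < d) :
    ∃ C : NNReal, ∀ (m : ℕ) (u : Sob (box b ξ d) m) (α : Fin 3 → ℕ), ∑ i, α i + 1 ≤ m →
      eLpNorm (wD u α) 6 (volume.restrict (box b ξ d)) ≤ C * ENNReal.ofReal ‖u‖ := by
  obtain ⟨C, hC⟩ := sobolev_six hb hlt
  refine ⟨C * 4, fun m u α hα => ?_⟩
  have h := hC (wD u α) (fun i => wD u (α + Pi.single i 1)) fun i => isWeakDeriv_wD_succ u (by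
    rw [mem_multiIdx]; simpa [Finset.sum_add_distrib] using hα)
  refine h.trans ?_
  rw [ENNReal.coe_mul, mul_assoc]
  refine mul_le_mul_right ?_ _
  rw [show ((4 : NNReal) : ENNReal) = ENNReal.ofReal 4 by simp, ← ENNReal.ofReal_mul (by norm_num)]
  refine ENNReal.ofReal_le_ofReal ?_
  have := Finset.sum_le_sum fun i (_ : i ∈ (Finset.univ : Finset (Fin 3))) =>
    norm_wD_le u (α + Pi.single i 1)
  simp only [Finset.sum_const, Finset.card_univ, Fintype.card_fin, nsmul_eq_mul] at this
  push_cast at this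
  linarith [norm_wD_le u α]

/-- 12 is the Sobolev exponent of 12/5, since 5/12 - 1/3 = 1/12. On a domain of finite measure
L^(12/5) is controlled by L⁶, which uses one more derivative. This replaces an embedding into
bounded functions. -/
theorem exists_eLpNorm_twelve_le {b ξ d : ℝ} (hb : 0 < b) (hlt : -ξ < d) :
    ∃ C : NNReal, ∀ (m : ℕ) (u : Sob (box b ξ d) m) (α : Fin 3 → ℕ), ∑ i, α i + 2 ≤ m →
      eLpNorm (wD u α) 12 (volume.restrict (box b ξ d)) ≤ C * ENNReal.ofReal ‖u‖ := by
  obtain ⟨C, hC⟩ := sobolev_L2 (p := 12 / 5) (p' := 12) hb hlt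
    (by rw [← NNReal.coe_le_coe]; push_cast; norm_num) (by push_cast; norm_num) (by norm_num)
  obtain ⟨C6, hC6⟩ := exists_eLpNorm_six_le hb hlt
  set μ := volume.restrict (box b ξ d) with hμ
  obtain ⟨D, hD⟩ : ∃ D : NNReal, μ univ ^ (1 / ((12 / 5 : NNReal) : ENNReal).toReal -
      1 / ((6 : NNReal) : ENNReal).toReal) ≤ D := by
    have : μ univ ^ (1 / ((12 / 5 : NNReal) : ENNReal).toReal -
      1 / ((6 : NNReal) : ENNReal).toReal) ≠ ⊤ := by
      refine ENNReal.rpow_ne_top_of_nonneg ?_ (measure_ne_top μ _)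
      norm_num
    exact ⟨_, (ENNReal.coe_toNNReal this).ge⟩
  refine ⟨C * (4 * (C6 * D)), fun m u α hα => ?_⟩
  have key : ∀ β : Fin 3 → ℕ, ∑ i, β i + 1 ≤ m → eLpNorm (wD u β) (12 / 5 : NNReal) μ ≤
      C6 * D * ENNReal.ofReal ‖u‖ := by
    intro β hβ
    have h := eLpNorm_le_eLpNorm_mul_rpow_measure_univ (μ := μ) (p := (12 / 5 : NNReal))
      (q := (6 : NNReal)) (by rw [ENNReal.coe_le_coe, ← NNReal.coe_le_coe]; push_cast; norm_num)
      (Lp.aestronglyMeasurable (wD u β))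
    refine h.trans ((mul_le_mul' (hC6 m u β hβ) hD).trans (le_of_eq ?_))
    ring
  have hsum : ∀ i : Fin 3, ∑ j, (α + Pi.single i 1 : Fin 3 → ℕ) j = ∑ j, α j + 1 := fun i => by
    simp [Finset.sum_add_distrib]
  have h := hC (wD u α) (fun i => wD u (α + Pi.single i 1)) fun i => isWeakDeriv_wD_succ u (by
    rw [mem_multiIdx, hsum]; omega)
  refine h.trans ?_
  push_cast
  rw [mul_assoc]
  refine mul_le_mul_right ?_ _
  refine (add_le_add (key α (by omega)) (Finset.sum_le_sum fun i _ =>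
    key (α + Pi.single i 1) (by rw [hsum]; omega))).trans (le_of_eq ?_)
  simp only [Finset.sum_const, Finset.card_univ, Fintype.card_fin, nsmul_eq_mul]
  push_cast
  ring


/-! ### Products in `L²(Ω)` -/

open Classical in
/-- The product of two functions of `L²(Ω)`, if it belongs to `L²(Ω)` (and `0` otherwise). -/
def mulL {Ω : Set Pt} (f g : L2 Ω) : L2 Ω :=
  if h : MemLp (fun x => f x * g x) 2 (volume.restrict Ω) then h.toLp else 0

theorem coeFn_mulL {Ω : Set Pt} {f g : L2 Ω}
    (h : MemLp (fun x => f x * g x) 2 (volume.restrict Ω)) :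
    mulL f g =ᵐ[volume.restrict Ω] fun x => f x * g x := by
  unfold mulL
  rw [dif_pos h]
  exact h.coeFn_toLp

theorem mulL_add_left {Ω : Set Pt} {f f' g : L2 Ω}
    (h : MemLp (fun x => f x * g x) 2 (volume.restrict Ω))
    (h' : MemLp (fun x => f' x * g x) 2 (volume.restrict Ω)) :
    mulL (f + f') g = mulL f g + mulL f' g := by
  have e : (fun x => (f + f' : L2 Ω) x * g x) =ᵐ[volume.restrict Ω]
      fun x => f x * g x + f' x * g x := by
    filter_upwards [Lp.coeFn_add f f'] with x hx
    rw [hx, Pi.add_apply, add_mul]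
  have hs : MemLp (fun x => (f + f' : L2 Ω) x * g x) 2 (volume.restrict Ω) :=
    (memLp_congr_ae e).2 (h.add h')
  refine Lp.ext ?_
  filter_upwards [coeFn_mulL hs, coeFn_mulL h, coeFn_mulL h', e,
    Lp.coeFn_add (mulL f g) (mulL f' g)] with x h1 h2 h3 h4 h5
  rw [h1, h4, h5, Pi.add_apply, h2, h3]

theorem mulL_smul_left {Ω : Set Pt} {f g : L2 Ω} (c : ℝ)
    (h : MemLp (fun x => f x * g x) 2 (volume.restrict Ω)) :
    mulL (c • f) g = c • mulL f g := by
  have e : (fun x => (c • f : L2 Ω) x * g x) =ᵐ[volume.restrict Ω]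
      fun x => c • (f x * g x) := by
    filter_upwards [Lp.coeFn_smul c f] with x hx
    rw [hx, Pi.smul_apply, smul_mul_assoc]
  have hs : MemLp (fun x => (c • f : L2 Ω) x * g x) 2 (volume.restrict Ω) :=
    (memLp_congr_ae e).2 (h.const_smul c)
  refine Lp.ext ?_
  filter_upwards [coeFn_mulL hs, coeFn_mulL h, e, Lp.coeFn_smul c (mulL f g)] with x h1 h2 h4 h5
  rw [h1, h4, h5, Pi.smul_apply, h2]

theorem mulL_comm {Ω : Set Pt} (f g : L2 Ω) : mulL f g = mulL g f := by
  have e : (fun x => f x * g x) = fun x => g x * f x := funext fun x => mul_comm _ _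
  unfold mulL
  by_cases h : MemLp (fun x => f x * g x) 2 (volume.restrict Ω)
  · rw [dif_pos h, dif_pos (e ▸ h)]
    exact MemLp.toLp_congr _ _ (ae_of_all _ fun x => mul_comm _ _)
  · rw [dif_neg h, dif_neg (e ▸ h)]

theorem norm_mulL_le {Ω : Set Pt} {f g : L2 Ω} {c : ℝ} (hc : 0 ≤ c)
    (h : eLpNorm (fun x => f x * g x) 2 (volume.restrict Ω) ≤ ENNReal.ofReal c) :
    MemLp (fun x => f x * g x) 2 (volume.restrict Ω) ∧ ‖mulL f g‖ ≤ c := by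
  have hm : MemLp (fun x => f x * g x) 2 (volume.restrict Ω) :=
    ⟨(Lp.aestronglyMeasurable f).mul (Lp.aestronglyMeasurable g), h.trans_lt ENNReal.ofReal_lt_top⟩
  refine ⟨hm, ?_⟩
  unfold mulL
  rw [dif_pos hm, Lp.norm_toLp]
  exact ENNReal.toReal_le_of_le_ofReal hc h

/-- Allows the factors and the weights inside an integral of a product to be regrouped before the
Cauchy–Schwarz inequality is applied. -/
theorem abs_inner_le_of_ae {Ω : Set Pt} {F G A B : L2 Ω}
    (h : ∀ᵐ x ∂(volume.restrict Ω), ‖F x‖ * ‖G x‖ ≤ ‖A x‖ * ‖B x‖) :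
    |inner ℝ F G| ≤ ‖A‖ * ‖B‖ := by
  have hA := (Lp.memLp A).norm
  have hB := (Lp.memLp B).norm
  have e : inner ℝ hA.toLp hB.toLp = ∫ x in Ω, ‖A x‖ * ‖B x‖ := by
    rw [L2.inner_def]
    refine integral_congr_ae ?_
    filter_upwards [hA.coeFn_toLp, hB.coeFn_toLp] with x h1 h2
    rw [h1, h2]
    simp [mul_comm]
  have hi : Integrable (fun x => ‖A x‖ * ‖B x‖) (volume.restrict Ω) := hA.integrable_mul hB
  rw [L2.inner_def, ← Real.norm_eq_abs]
  calc _ ≤ ∫ x in Ω, ‖A x‖ * ‖B x‖ := by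
        refine norm_integral_le_of_norm_le hi ?_
        filter_upwards [h] with x hx
        exact (norm_inner_le_norm _ _).trans hx
    _ ≤ ‖hA.toLp‖ * ‖hB.toLp‖ := by rw [← e]; exact real_inner_le_norm _ _
    _ = _ := by rw [Lp.norm_toLp, Lp.norm_toLp, eLpNorm_norm, eLpNorm_norm, Lp.norm_def, Lp.norm_def]

/-! ### The Carleman weight as an operator -/

section theta

variable {b ξ d s ν lam : ℝ}

theorem ae_abs_cwf_le (hs : ξ < s) (hν : 0 ≤ ν) (hlam : 0 ≤ lam) :
    ∀ᵐ x ∂(volume.restrict (box b ξ d)),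
      |cwf s ν lam (x 2)| ≤ Real.exp (2 * lam * (s - ξ) ^ (-ν)) := by
  filter_upwards [ae_restrict_mem (measurableSet_box b ξ d)] with x hx
  rw [abs_of_pos (cwf_pos _ _ _ _)]
  exact cwf_le hν hlam (by linarith) (by linarith [hx.2.2.1])

/-- Multiplication by the weight `φ_λ` on `L²(Ω)`. -/
def theta (hs : ξ < s) (hν : 0 ≤ ν) (hlam : 0 ≤ lam) : L2 (box b ξ d) →L[ℝ] L2 (box b ξ d) :=
  mulOp (fun x => cwf s ν lam (x 2)) (measurable_cwf s ν lam).aestronglyMeasurable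
    (ae_abs_cwf_le hs hν hlam)

theorem coeFn_theta (hs : ξ < s) (hν : 0 ≤ ν) (hlam : 0 ≤ lam) (f : L2 (box b ξ d)) :
    theta hs hν hlam f =ᵐ[volume.restrict (box b ξ d)] fun x => cwf s ν lam (x 2) • f x :=
  coeFn_mulOp _ _ _ f

theorem norm_theta_sq (hs : ξ < s) (hν : 0 ≤ ν) (hlam : 0 ≤ lam) (f : L2 (box b ξ d)) :
    ‖theta hs hν hlam f‖ ^ 2 = ∫ x in box b ξ d, ‖f x‖ ^ 2 * cwf s ν lam (x 2) ^ 2 := by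
  rw [Lp_norm_sq_eq_integral]
  refine integral_congr_ae ?_
  filter_upwards [coeFn_theta hs hν hlam f] with x hx
  rw [hx, norm_smul, Real.norm_eq_abs, mul_pow, sq_abs, mul_comm]

theorem cwf_sq (s ν lam z : ℝ) : cwf s ν lam z ^ 2 = cwf s ν (2 * lam) z := by
  unfold cwf
  rw [← Real.exp_nat_mul]
  congr 1; push_cast; ring

theorem theta_mulL (hs : ξ < s) (hν : 0 ≤ ν) (hlam : 0 ≤ lam) {f g : L2 (box b ξ d)}
    (h : MemLp (fun x => f x * g x) 2 (volume.restrict (box b ξ d)))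
    (h' : MemLp (fun x => f x * theta hs hν hlam g x) 2 (volume.restrict (box b ξ d))) :
    theta hs hν hlam (mulL f g) = mulL f (theta hs hν hlam g) := by
  refine Lp.ext ?_
  filter_upwards [coeFn_theta hs hν hlam (mulL f g), coeFn_theta hs hν hlam g, coeFn_mulL h,
    coeFn_mulL h'] with x h1 h2 h3 h4
  rw [h1, h3, h4, h2, mul_smul_comm]

/-- The Carleman estimate with the weight `φ_λ²`. -/
theorem carleman_theta (hb : 0 < b) (hlt : -ξ < d) (hs : ξ < s) (hν : 0 < ν) :
    ∃ C : ℝ, 0 < C ∧ ∀ (lam : ℝ) (_ : 1 ≤ lam) (hlam : 0 ≤ lam) (m : ℕ) (_ : 2 ≤ m),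
      ∀ u ∈ Sob0 b ξ d m,
      C / lam * ∑ i, ∑ j, ‖theta hs hν.le hlam (wD2 u i j)‖ ^ 2 +
        C * lam * ∑ i, ‖theta hs hν.le hlam (wD1 u i)‖ ^ 2 +
        C * lam ^ 3 * ‖theta hs hν.le hlam (wD u 0)‖ ^ 2 ≤ ‖theta hs hν.le hlam (lap u)‖ ^ 2 := by
  obtain ⟨C, hC, H⟩ := carlemanEstimate_one (s := s) hb hlt hs hν
  refine ⟨C / 2, by positivity, fun lam h1 hlam m hm u hu => ?_⟩
  -- φ_λ² = φ_(2λ), so the estimate is used with the doubled parameter. The second derivative term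
  -- loses the factor 2, and the other terms only gain.
  have h := H (2 * lam) (by linarith) (incl hm u) (incl_mem_Sob0 le_rfl hm hu)
  have e1 : ∀ i, wD1 (incl hm u) i = wD1 u i := fun i =>
    wD_incl hm u (mem_multiIdx_single i (by norm_num))
  have e2 : ∀ i j, wD2 (incl hm u) i j = wD2 u i j := fun i j =>
    wD_incl hm u (mem_multiIdx_single_add_single i j le_rfl)
  have e0 : wD (incl hm u) 0 = wD u 0 := wD_incl hm u (zero_mem_multiIdx 2)
  have e3 : lap (incl hm u) = lap u := by simp only [lap, e2]
  simp only [e0, e1, e2, e3, ← cwf_sq] at h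
  simp only [norm_theta_sq]
  refine le_trans ?_ h
  have hnn : ∀ (v : L2 (box b ξ d)), 0 ≤ ∫ x in box b ξ d, ‖v x‖ ^ 2 * cwf s ν lam (x 2) ^ 2 :=
    fun v => integral_nonneg fun x => mul_nonneg (sq_nonneg _) (sq_nonneg _)
  have n2 := Finset.sum_nonneg fun i (_ : i ∈ Finset.univ) => hnn (wD1 u i)
  have l0 : 0 < lam := by linarith
  refine add_le_add (add_le_add (le_of_eq ?_) (mul_le_mul_of_nonneg_right ?_ n2))
    (mul_le_mul_of_nonneg_right ?_ (hnn _))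
  · congr 1; field_simp
  · nlinarith [mul_pos hC l0]
  · nlinarith [mul_pos hC (pow_pos l0 3)]

theorem isWeakDeriv_single {Ω : Set Pt} {i : Fin 3} {f g : L2 Ω} :
    IsWeakDeriv Ω (Pi.single i 1) f g ↔ ∀ φ : Pt → ℝ, IsTest φ → tsupport φ ⊆ Ω →
      ∫ x in Ω, pd i φ x • f x = -∫ x in Ω, φ x • g x := by
  unfold IsWeakDeriv
  simp only [pdMulti_single]
  simp

/-- The weight depends on z only, and its logarithmic derivative 2λψ' is O(λ) on Ω. -/
theorem exists_isWeakDeriv_theta (hs : ξ < s) (hν : 0 < ν) :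
    ∃ K : ℝ, 0 ≤ K ∧ ∀ (lam : ℝ) (hlam : 0 ≤ lam) (f : L2 (box b ξ d)) (g : Fin 3 → L2 (box b ξ d)),
      (∀ i, IsWeakDeriv (box b ξ d) (Pi.single i 1) f (g i)) →
      ∃ G : Fin 3 → L2 (box b ξ d),
        (∀ i, IsWeakDeriv (box b ξ d) (Pi.single i 1) (theta hs hν.le hlam f) (G i)) ∧
        ∀ i, ‖G i‖ ≤ ‖theta hs hν.le hlam (g i)‖ + K * lam * ‖theta hs hν.le hlam f‖ := by
  obtain ⟨ψ, hψs, hψ⟩ := exists_weight (s := s) (c := -ξ) hν (by linarith)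
  have hψ' : Continuous (deriv ψ) := hψs.continuous_deriv (by simp)
  obtain ⟨K, hK⟩ := isCompact_Icc.exists_bound_of_continuousOn (s := Icc (-ξ) d) hψ'.continuousOn
  have hK' : ∀ᵐ x ∂(volume.restrict (box b ξ d)), |deriv ψ (x 2)| ≤ |K| := by
    filter_upwards [ae_restrict_mem (measurableSet_box b ξ d)] with x hx
    exact (hK (x 2) ⟨hx.2.2.1.le, hx.2.2.2.le⟩).trans (le_abs_self _)
  have hm : AEStronglyMeasurable (fun x : Pt => deriv ψ (x 2)) (volume.restrict (box b ξ d)) :=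
    (hψ'.comp (continuous_apply 2)).aestronglyMeasurable
  refine ⟨2 * |K|, by positivity, fun lam hlam f g hfg => ?_⟩
  let D : L2 (box b ξ d) →L[ℝ] L2 (box b ξ d) := mulOp _ hm hK'
  have hD : ∀ v, ‖D v‖ ≤ |K| * ‖v‖ := fun v => by
    refine Lp.norm_le_mul_norm_of_ae_le_mul ?_
    filter_upwards [coeFn_mulOp _ hm hK' v, hK'] with x hx h
    rw [hx, norm_smul, Real.norm_eq_abs]
    exact mul_le_mul_of_nonneg_right h (norm_nonneg _)
  have h2 : IsWeakDeriv (box b ξ d) (Pi.single 2 1) (theta hs hν.le hlam f)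
      (theta hs hν.le hlam (g 2) + (2 * lam) • D (theta hs hν.le hlam f)) ∧
      ∀ i ≠ 2, IsWeakDeriv (box b ξ d) (Pi.single i 1) (theta hs hν.le hlam f)
        (theta hs hν.le hlam (g i)) := by
    set T : Pt → ℝ := fun x => Real.exp (2 * lam * ψ (x 2)) with hT
    have hexp : ContDiff ℝ ∞ fun z => Real.exp (2 * lam * ψ z) :=
      Real.contDiff_exp.comp (contDiff_const.mul hψs)
    have hTs : ContDiff ℝ ∞ T := hexp.comp (contDiff_apply ℝ ℝ 2)
    have hTw : ∀ x ∈ box b ξ d, T x = cwf s ν lam (x 2) := fun x hx => by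
      simp only [hT]; rw [(hψ _ hx.2.2.1.le).1, cwf]
    have hpdT : ∀ i, pd i T = fun x => if i = 2 then 2 * lam * deriv ψ (x 2) * T x else 0 := by
      intro i
      rw [hT, pd_comp_apply (hexp.differentiable (by simp)) i 2]
      funext x
      split_ifs
      · have h3 := ((hψs.differentiable (by simp) (x 2)).hasDerivAt.const_mul (2 * lam)).exp
        rw [h3.deriv]; ring
      · rfl
    have key : ∀ i φ, IsTest φ → tsupport φ ⊆ box b ξ d →
        ∫ x in box b ξ d, pd i φ x • theta hs hν.le hlam f x =
          -(∫ x in box b ξ d, φ x • theta hs hν.le hlam (g i) x) -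
            ∫ x in box b ξ d, (φ x * pd i T x) • f x := by
      intro i φ hφ hsupp
      have ht : IsTest (fun x => φ x * T x) := ⟨hφ.1.mul hTs, hφ.2.mul_right⟩
      have hts : tsupport (fun x => φ x * T x) ⊆ box b ξ d :=
        (tsupport_mul_subset_left (f := φ)).trans hsupp
      have ht2 : IsTest (fun x => φ x * pd i T x) :=
        ⟨hφ.1.mul (contDiff_pd hTs i), hφ.2.mul_right⟩
      -- The product rule in weak form: the smooth weight is absorbed into the test function, which
      -- keeps its support in Ω.
      have h1 := isWeakDeriv_single.1 (hfg i) _ ht hts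
      rw [pd_mul (differentiable_of_smooth hφ.1) (differentiable_of_smooth hTs)] at h1
      have ht3 : IsTest (fun x => pd i φ x * T x) := ⟨(hφ.pd i).1.mul hTs, (hφ.pd i).2.mul_right⟩
      simp only [add_smul] at h1
      rw [MeasureTheory.integral_add (ht3.integrable f) (ht2.integrable f)] at h1
      have e1 : ∫ x in box b ξ d, pd i φ x • theta hs hν.le hlam f x =
          ∫ x in box b ξ d, (pd i φ x * T x) • f x := by
        refine integral_congr_ae ?_
        filter_upwards [coeFn_theta hs hν.le hlam f, ae_restrict_mem (measurableSet_box b ξ d)]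
          with x hx hxb
        rw [hx, ← hTw x hxb, smul_smul]
      have e2 : ∫ x in box b ξ d, φ x • theta hs hν.le hlam (g i) x =
          ∫ x in box b ξ d, (φ x * T x) • g i x := by
        refine integral_congr_ae ?_
        filter_upwards [coeFn_theta hs hν.le hlam (g i), ae_restrict_mem (measurableSet_box b ξ d)]
          with x hx hxb
        rw [hx, ← hTw x hxb, smul_smul]
      rw [e1, e2, ← h1]; ring
    constructor
    · rw [isWeakDeriv_single]
      intro φ hφ hsupp
      rw [key 2 φ hφ hsupp, hφ.integral_add, IsTest.integral_smul, hpdT]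
      have e3 : ∫ x in box b ξ d, (φ x * if (2 : Fin 3) = 2 then 2 * lam * deriv ψ (x 2) * T x
          else 0) • f x = (2 * lam) • ∫ x in box b ξ d, φ x • D (theta hs hν.le hlam f) x := by
        rw [← MeasureTheory.integral_smul]
        refine integral_congr_ae ?_
        filter_upwards [coeFn_theta hs hν.le hlam f, ae_restrict_mem (measurableSet_box b ξ d),
          coeFn_mulOp _ hm hK' (theta hs hν.le hlam f)] with x hx hxb hx2
        change _ = (2 * lam) • φ x • (mulOp _ hm hK' (theta hs hν.le hlam f)) x
        rw [hx2, hx, ← hTw x hxb, if_pos rfl]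
        simp only [smul_smul]
        congr 1; ring
      rw [e3]; ring
    · intro i hi
      rw [isWeakDeriv_single]
      intro φ hφ hsupp
      rw [key i φ hφ hsupp, hpdT]
      simp [hi]
  refine ⟨fun i => if i = 2 then theta hs hν.le hlam (g i) + (2 * lam) • D (theta hs hν.le hlam f)
    else theta hs hν.le hlam (g i), fun i => ?_, fun i => ?_⟩
  · dsimp only
    split_ifs with h
    · subst h; exact h2.1
    · exact h2.2 i h
  · dsimp only
    split_ifs with h
    · refine (norm_add_le _ _).trans (add_le_add le_rfl ?_)
      rw [norm_smul, Real.norm_eq_abs, abs_of_nonneg (by positivity)]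
      have := mul_le_mul_of_nonneg_left (hD (theta hs hν.le hlam f)) (by positivity : 0 ≤ 2 * lam)
      linarith
    · have : 0 ≤ 2 * |K| * lam * ‖theta hs hν.le hlam f‖ := by positivity
      linarith

end theta


/-! ### Weighted estimates of products -/

section

variable {α : Type*} [MeasurableSpace α] {μ : Measure α}

theorem eLpNorm_mul_le_ofReal_twelve {f A : α → ℂ} (hf : AEStronglyMeasurable f μ)
    (hA : AEStronglyMeasurable A μ) {a y z : ℝ} (ha : 0 ≤ a) (hy : 0 ≤ y) (hz : 0 ≤ z)
    (h12 : eLpNorm f 12 μ ≤ ENNReal.ofReal a) (h2 : eLpNorm A 2 μ ≤ ENNReal.ofReal y)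
    (h6 : eLpNorm A 6 μ ≤ ENNReal.ofReal z) :
    eLpNorm (fun x => f x * A x) 2 μ ≤
      ENNReal.ofReal (a * (y ^ (3 / 4 : ℝ) * z ^ (1 / 4 : ℝ))) := by
  refine (eLpNorm_mul_le_twelve hf hA).trans ?_
  rw [ENNReal.ofReal_mul ha, ENNReal.ofReal_mul (by positivity),
    ← ENNReal.ofReal_rpow_of_nonneg hy (by norm_num),
    ← ENNReal.ofReal_rpow_of_nonneg hz (by norm_num)]
  exact mul_le_mul' h12 (mul_le_mul' (ENNReal.rpow_le_rpow h2 (by norm_num))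
    (ENNReal.rpow_le_rpow h6 (by norm_num)))

theorem eLpNorm_mul_le_ofReal_six {f A : α → ℂ} (hf : AEStronglyMeasurable f μ)
    (hA : AEStronglyMeasurable A μ) {a y z : ℝ} (ha : 0 ≤ a) (hy : 0 ≤ y) (hz : 0 ≤ z)
    (h12 : eLpNorm f 6 μ ≤ ENNReal.ofReal a) (h2 : eLpNorm A 2 μ ≤ ENNReal.ofReal y)
    (h6 : eLpNorm A 6 μ ≤ ENNReal.ofReal z) :
    eLpNorm (fun x => f x * A x) 2 μ ≤
      ENNReal.ofReal (a * (y ^ (1 / 2 : ℝ) * z ^ (1 / 2 : ℝ))) := by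
  refine (eLpNorm_mul_le_six hf hA).trans ?_
  rw [ENNReal.ofReal_mul ha, ENNReal.ofReal_mul (by positivity),
    ← ENNReal.ofReal_rpow_of_nonneg hy (by norm_num),
    ← ENNReal.ofReal_rpow_of_nonneg hz (by norm_num)]
  exact mul_le_mul' h12 (mul_le_mul' (ENNReal.rpow_le_rpow h2 (by norm_num))
    (ENNReal.rpow_le_rpow h6 (by norm_num)))

end

theorem eLpNorm_two_L2 {Ω : Set Pt} (v : L2 Ω) :
    eLpNorm v 2 (volume.restrict Ω) = ENNReal.ofReal ‖v‖ := by
  rw [Lp.norm_def, ENNReal.ofReal_toReal (Lp.eLpNorm_ne_top v)]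

/-- The exponents add up as (-1/2)(3/4) + (1/2)(1/4) = -1/4. -/
theorem rpow_interp_twelve {y lam : ℝ} (hy : 0 ≤ y) (hlam : 0 < lam) :
    (y * lam ^ (-1 / 2 : ℝ)) ^ (3 / 4 : ℝ) * (y * lam ^ (1 / 2 : ℝ)) ^ (1 / 4 : ℝ) =
      y * lam ^ (-1 / 4 : ℝ) := by
  rw [Real.mul_rpow hy (by positivity), Real.mul_rpow hy (by positivity), ← Real.rpow_mul hlam.le,
    ← Real.rpow_mul hlam.le, mul_mul_mul_comm, ← Real.rpow_add_of_nonneg hy (by norm_num)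
    (by norm_num), ← Real.rpow_add hlam]
  norm_num

theorem rpow_interp_six {y lam : ℝ} (hy : 0 ≤ y) (hlam : 0 < lam) :
    (y * lam ^ (-1 / 2 : ℝ)) ^ (1 / 2 : ℝ) * (y * lam ^ (1 / 2 : ℝ)) ^ (1 / 2 : ℝ) = y := by
  rw [Real.mul_rpow hy (by positivity), Real.mul_rpow hy (by positivity), ← Real.rpow_mul hlam.le,
    ← Real.rpow_mul hlam.le, mul_mul_mul_comm, ← Real.rpow_add_of_nonneg hy (by norm_num)
    (by norm_num), ← Real.rpow_add hlam]
  norm_num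

section

variable {b ξ d s ν : ℝ}

/-- The L² bound is the gradient term of the Carleman estimate. For L⁶ the Sobolev inequality is
applied to θ∇u, whose derivatives consist of θD²u and of the weight derivative times ∇u. -/
theorem theta_grad_bounds (hb : 0 < b) (hlt : -ξ < d) (hs : ξ < s) (hν : 0 < ν) :
    ∃ c : ℝ, 0 < c ∧ ∀ (lam : ℝ) (_ : 1 ≤ lam) (hlam : 0 ≤ lam) (m : ℕ) (_ : 2 ≤ m),
      ∀ u ∈ Sob0 b ξ d m, ∀ j,
      ‖theta hs hν.le hlam (wD1 u j)‖ ≤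
        c * ‖theta hs hν.le hlam (lap u)‖ * lam ^ (-1 / 2 : ℝ) ∧
      eLpNorm (theta hs hν.le hlam (wD1 u j)) 6 (volume.restrict (box b ξ d)) ≤
        ENNReal.ofReal (c * ‖theta hs hν.le hlam (lap u)‖ * lam ^ (1 / 2 : ℝ)) := by
  obtain ⟨C, hC, H⟩ := carleman_theta (s := s) hb hlt hs hν
  obtain ⟨K, hK, HK⟩ := exists_isWeakDeriv_theta (b := b) (d := d) hs hν
  obtain ⟨C6, HC6⟩ := sobolev_six hb hlt
  set q := √(1 / C) with hq
  have hq0 : 0 < q := Real.sqrt_pos.2 (by positivity)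
  have hqC : q ^ 2 * C = 1 := by rw [hq, Real.sq_sqrt (by positivity)]; field_simp
  refine ⟨q + C6 * (q * (4 + 3 * K)), by positivity, fun lam h1 hlam m hm u hu j => ?_⟩
  have l0 : 0 < lam := by linarith
  set x := ‖theta hs hν.le hlam (lap u)‖ with hx
  have hx0 : 0 ≤ x := norm_nonneg _
  have h := H lam h1 hlam m hm u hu
  set r := lam ^ (1 / 2 : ℝ) with hr
  have hr0 : 0 < r := Real.rpow_pos_of_pos l0 _
  have hr2 : r ^ 2 = lam := by
    rw [hr, ← Real.rpow_natCast, ← Real.rpow_mul hlam]; norm_num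
  have hr1 : 1 ≤ r := Real.one_le_rpow h1 (by norm_num)
  have hri : lam ^ (-1 / 2 : ℝ) = r⁻¹ := by
    rw [hr, ← Real.rpow_neg hlam]; norm_num
  have n0 : ∀ i, 0 ≤ ∑ j, ‖theta hs hν.le hlam (wD2 u i j)‖ ^ 2 := fun i =>
    Finset.sum_nonneg fun _ _ => sq_nonneg _
  have n1 : 0 ≤ ∑ i, ∑ j, ‖theta hs hν.le hlam (wD2 u i j)‖ ^ 2 :=
    Finset.sum_nonneg fun i _ => n0 i
  have n2 : 0 ≤ ∑ i, ‖theta hs hν.le hlam (wD1 u i)‖ ^ 2 :=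
    Finset.sum_nonneg fun _ _ => sq_nonneg _
  have n3 : 0 ≤ ‖theta hs hν.le hlam (wD u 0)‖ ^ 2 := sq_nonneg _
  have c1 : 0 ≤ C / lam := by positivity
  have c2 : 0 ≤ C * lam := by positivity
  have c3 : 0 ≤ C * lam ^ 3 := by positivity
  have p1 := mul_nonneg c1 n1
  have p2 := mul_nonneg c2 n2
  have p3 := mul_nonneg c3 n3
  have g1 : ∀ i, ‖theta hs hν.le hlam (wD1 u i)‖ ≤ q * x * r⁻¹ := by
    intro i
    refine le_of_sq_le_sq ?_ (by positivity)
    have e1 : C * lam * ‖theta hs hν.le hlam (wD1 u i)‖ ^ 2 ≤ x ^ 2 := by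
      have := Finset.single_le_sum (f := fun i => ‖theta hs hν.le hlam (wD1 u i)‖ ^ 2)
        (fun _ _ => sq_nonneg _) (Finset.mem_univ i)
      have := mul_le_mul_of_nonneg_left this c2
      linarith
    generalize ‖theta hs hν.le hlam (wD1 u i)‖ = y at e1 ⊢
    rw [← hr2] at e1
    have e2 : (q * x * r⁻¹) ^ 2 = q ^ 2 * x ^ 2 / r ^ 2 := by field_simp
    rw [e2, le_div_iff₀ (by positivity)]
    calc _ = q ^ 2 * (C * r ^ 2 * y ^ 2) := by
          linear_combination (-(r ^ 2 * y ^ 2)) * hqC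
      _ ≤ _ := mul_le_mul_of_nonneg_left e1 (sq_nonneg _)
  have g2 : ∀ i j, ‖theta hs hν.le hlam (wD2 u i j)‖ ≤ q * x * r := by
    intro i j
    refine le_of_sq_le_sq ?_ (by positivity)
    have e1 : C / lam * ‖theta hs hν.le hlam (wD2 u i j)‖ ^ 2 ≤ x ^ 2 := by
      have t1 := Finset.single_le_sum (f := fun j => ‖theta hs hν.le hlam (wD2 u i j)‖ ^ 2)
        (fun _ _ => sq_nonneg _) (Finset.mem_univ j)
      have t2 := Finset.single_le_sum (f := fun i => ∑ j, ‖theta hs hν.le hlam (wD2 u i j)‖ ^ 2)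
        (fun i _ => n0 i) (Finset.mem_univ i)
      have := mul_le_mul_of_nonneg_left (t1.trans t2) c1
      linarith
    generalize ‖theta hs hν.le hlam (wD2 u i j)‖ = y at e1 ⊢
    rw [← hr2, div_mul_eq_mul_div, div_le_iff₀ (by positivity)] at e1
    calc _ = q ^ 2 * (C * y ^ 2) := by
          linear_combination (-(y ^ 2)) * hqC
      _ ≤ q ^ 2 * (x ^ 2 * r ^ 2) := mul_le_mul_of_nonneg_left e1 (sq_nonneg _)
      _ = _ := by ring
  have hC6 : (0 : ℝ) ≤ C6 := C6.2
  constructor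
  · rw [hri]
    refine (g1 j).trans ?_
    have : 0 ≤ C6 * (q * (4 + 3 * K)) * x * r⁻¹ := by positivity
    nlinarith
  · obtain ⟨G, hG, hGn⟩ := HK lam hlam (wD1 u j) (fun i => wD2 u j i) fun i =>
      isWeakDeriv_wD_succ u (mem_multiIdx_single_add_single j i hm)
    refine (HC6 _ G hG).trans ?_
    rw [← ENNReal.ofReal_coe_nnreal, ← ENNReal.ofReal_mul hC6]
    refine ENNReal.ofReal_le_ofReal ?_
    have hGb : ∀ i, ‖G i‖ ≤ q * x * r * (1 + K) := by
      intro i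
      refine (hGn i).trans ?_
      -- The factor λ from the weight meets the gain λ^(-1/2) of the gradient and gives λ^(1/2), the
      -- same size as the second derivatives.
      have e1 : K * lam * ‖theta hs hν.le hlam (wD1 u j)‖ ≤ K * lam * (q * x * r⁻¹) :=
        mul_le_mul_of_nonneg_left (g1 j) (by positivity)
      have e2 : K * lam * (q * x * r⁻¹) = K * (q * x * r) := by
        rw [← hr2]; field_simp
      rw [e2] at e1
      linarith [g2 j i]
    have hr' : r⁻¹ ≤ r := (inv_le_one_of_one_le₀ hr1).trans hr1
    have e3 : ‖theta hs hν.le hlam (wD1 u j)‖ ≤ q * x * r :=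
      (g1 j).trans (mul_le_mul_of_nonneg_left hr' (by positivity))
    have e4 : ‖theta hs hν.le hlam (wD1 u j)‖ + ∑ i, ‖G i‖ ≤ q * x * r * (4 + 3 * K) := by
      have := Finset.sum_le_sum fun i (_ : i ∈ (Finset.univ : Finset (Fin 3))) => hGb i
      simp only [Finset.sum_const, Finset.card_univ, Fintype.card_fin, nsmul_eq_mul] at this
      push_cast at this
      linarith
    have e5 := mul_le_mul_of_nonneg_left e4 hC6
    have : 0 ≤ q * x * r := by positivity
    calc _ ≤ _ := e5
      _ ≤ _ := by nlinarith

/-- Products of first derivatives belong to `L²`. -/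
theorem exists_mul_grad_bound (hb : 0 < b) (hlt : -ξ < d) :
    ∃ K : ℝ, 0 ≤ K ∧ ∀ (a c : Sob (box b ξ d) 3) (i j : Fin 3),
      MemLp (fun x => wD1 a i x * wD1 c j x) 2 (volume.restrict (box b ξ d)) ∧
      ‖mulL (wD1 a i) (wD1 c j)‖ ≤ K * ‖a‖ * ‖c‖ := by
  obtain ⟨C6, H6⟩ := exists_eLpNorm_six_le (ξ := ξ) (d := d) hb hlt
  obtain ⟨C12, H12⟩ := exists_eLpNorm_twelve_le (ξ := ξ) (d := d) hb hlt
  have hC6 : (0 : ℝ) ≤ C6 := C6.2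
  have hC12 : (0 : ℝ) ≤ C12 := C12.2
  refine ⟨C12 * (1 + C6), by positivity, fun a c i j => norm_mulL_le (by positivity) ?_⟩
  have h12 := H12 3 a (Pi.single i 1) (by simp)
  have h6 := H6 3 c (Pi.single j 1) (by simp)
  rw [← ENNReal.ofReal_coe_nnreal, ← ENNReal.ofReal_mul hC6] at h6
  rw [← ENNReal.ofReal_coe_nnreal, ← ENNReal.ofReal_mul hC12] at h12
  have h2 : eLpNorm (wD1 c j) 2 (volume.restrict (box b ξ d)) ≤
      ENNReal.ofReal ((1 + C6) * ‖c‖) := by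
    rw [eLpNorm_two_L2]
    refine ENNReal.ofReal_le_ofReal ((norm_wD_le c _).trans ?_)
    nlinarith [norm_nonneg c]
  have h6' : eLpNorm (wD1 c j) 6 (volume.restrict (box b ξ d)) ≤
      ENNReal.ofReal ((1 + C6) * ‖c‖) :=
    h6.trans (ENNReal.ofReal_le_ofReal (by nlinarith [norm_nonneg c]))
  have hy : 0 ≤ (1 + C6) * ‖c‖ := by positivity
  have := eLpNorm_mul_le_ofReal_twelve (Lp.aestronglyMeasurable _) (Lp.aestronglyMeasurable _)
    (by positivity) hy hy h12 h2 h6'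
  rw [← Real.rpow_add_of_nonneg hy (by norm_num) (by norm_num)] at this
  norm_num at this
  refine this.trans (le_of_eq ?_)
  congr 1; ring

/-- The powers λ^(-1/2), λ^(-1/4) and λ^0 correspond to θ∇u alone, to its product with a first
derivative (L¹² times L^(12/5)), and to its product with a Laplacian (L⁶ times L³). -/
theorem exists_theta_mul_grad_bound (hb : 0 < b) (hlt : -ξ < d) (hs : ξ < s) (hν : 0 < ν) :
    ∃ K : ℝ, 0 < K ∧ ∀ (lam : ℝ) (_ : 1 ≤ lam) (hlam : 0 ≤ lam), ∀ u ∈ Sob0 b ξ d 3, ∀ j : Fin 3,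
      ‖theta hs hν.le hlam (wD1 u j)‖ ≤
        K * lam ^ (-1 / 2 : ℝ) * ‖theta hs hν.le hlam (lap u)‖ ∧
      (∀ (a : Sob (box b ξ d) 3) (i : Fin 3),
        MemLp (fun x => wD1 a i x * theta hs hν.le hlam (wD1 u j) x) 2
          (volume.restrict (box b ξ d)) ∧
        ‖mulL (wD1 a i) (theta hs hν.le hlam (wD1 u j))‖ ≤
          K * lam ^ (-1 / 4 : ℝ) * ‖a‖ * ‖theta hs hν.le hlam (lap u)‖) ∧
      ∀ (a : Sob (box b ξ d) 3),
        MemLp (fun x => lap a x * theta hs hν.le hlam (wD1 u j) x) 2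
          (volume.restrict (box b ξ d)) ∧
        ‖mulL (lap a) (theta hs hν.le hlam (wD1 u j))‖ ≤
          K * ‖a‖ * ‖theta hs hν.le hlam (lap u)‖ := by
  obtain ⟨c, hc, H⟩ := theta_grad_bounds (b := b) (d := d) hb hlt hs hν
  obtain ⟨C6, H6⟩ := exists_eLpNorm_six_le (ξ := ξ) (d := d) hb hlt
  obtain ⟨C12, H12⟩ := exists_eLpNorm_twelve_le (ξ := ξ) (d := d) hb hlt
  have hC6 : (0 : ℝ) ≤ C6 := C6.2
  have hC12 : (0 : ℝ) ≤ C12 := C12.2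
  refine ⟨c * (1 + C12 + 3 * C6), by positivity, fun lam h1 hlam u hu j => ?_⟩
  have l0 : 0 < lam := by linarith
  obtain ⟨g1, g2⟩ := H lam h1 hlam 3 (by norm_num) u hu j
  set x := ‖theta hs hν.le hlam (lap u)‖ with hx
  have hx0 : 0 ≤ x := norm_nonneg _
  have g1' : eLpNorm (theta hs hν.le hlam (wD1 u j)) 2 (volume.restrict (box b ξ d)) ≤
      ENNReal.ofReal (c * x * lam ^ (-1 / 2 : ℝ)) := by
    rw [eLpNorm_two_L2]; exact ENNReal.ofReal_le_ofReal g1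
  have hcx : 0 ≤ c * x := by positivity
  refine ⟨?_, fun a i => ?_, fun a => ?_⟩
  · refine g1.trans ?_
    have : 0 ≤ c * x * lam ^ (-1 / 2 : ℝ) * (C12 + 3 * C6) := by positivity
    nlinarith
  · refine norm_mulL_le (by positivity) ?_
    have h12 := H12 3 a (Pi.single i 1) (by simp)
    rw [← ENNReal.ofReal_coe_nnreal, ← ENNReal.ofReal_mul hC12] at h12
    have := eLpNorm_mul_le_ofReal_twelve (Lp.aestronglyMeasurable _) (Lp.aestronglyMeasurable _)
      (by positivity) (by positivity) (by positivity) h12 g1' g2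
    rw [rpow_interp_twelve hcx l0] at this
    refine this.trans (ENNReal.ofReal_le_ofReal ?_)
    have : 0 ≤ ‖a‖ * (c * x * lam ^ (-1 / 4 : ℝ)) * (1 + 3 * C6) := by positivity
    nlinarith
  · refine norm_mulL_le (by positivity) ?_
    have h6 : eLpNorm (lap a) 6 (volume.restrict (box b ξ d)) ≤
        ENNReal.ofReal (3 * C6 * ‖a‖) := by
      have h := fun i : Fin 3 => H6 3 a (Pi.single i 1 + Pi.single i 1)
        (by simp [Finset.sum_add_distrib])
      have e : eLpNorm (lap a) 6 (volume.restrict (box b ξ d)) ≤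
          ∑ i, eLpNorm (wD2 a i i) 6 (volume.restrict (box b ξ d)) := by
        have e1 : lap a =ᵐ[volume.restrict (box b ξ d)] ∑ i, (fun x => wD2 a i i x) := by
          filter_upwards [ae_lap_eq a] with x hx
          rw [hx, Finset.sum_apply]
        rw [eLpNorm_congr_ae e1]
        exact eLpNorm_sum_le (fun i _ => Lp.aestronglyMeasurable _) (by norm_num)
      refine e.trans ((Finset.sum_le_sum fun i _ => h i).trans (le_of_eq ?_))
      rw [← ENNReal.ofReal_coe_nnreal, ← ENNReal.ofReal_mul hC6]
      simp only [Finset.sum_const, Finset.card_univ, Fintype.card_fin, nsmul_eq_mul]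
      rw [show ((3 : ℕ) : ENNReal) = ENNReal.ofReal 3 by simp, ← ENNReal.ofReal_mul (by norm_num)]
      congr 1; ring
    have := eLpNorm_mul_le_ofReal_six (Lp.aestronglyMeasurable _) (Lp.aestronglyMeasurable _)
      (by positivity) (by positivity) (by positivity) h6 g1' g2
    rw [rpow_interp_six hcx l0] at this
    refine this.trans (ENNReal.ofReal_le_ofReal ?_)
    have : 0 ≤ ‖a‖ * (c * x) * (1 + C12) := by positivity
    nlinarith

end


/-! ### The tail function -/

/-- Coercivity makes `T` injective on `K` with closed range. By Pythagoras the minimum is attained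
exactly where the image of W is minus the projection of `T Q` onto that range. -/
theorem existsUnique_isMinOn_norm_sq {E Z : Type*} [NormedAddCommGroup E] [InnerProductSpace ℝ E]
    [NormedAddCommGroup Z] [InnerProductSpace ℝ Z] [CompleteSpace Z] (K : Submodule ℝ E)
    [CompleteSpace K] (T : E →L[ℝ] Z) {c : ℝ} (hc : 0 < c) (hT : ∀ u, c * ‖u‖ ≤ ‖T u‖) (Q : E) :
    ∃! W : K, IsMinOn (fun W : K => ‖T (W.1 + Q)‖ ^ 2) univ W := by
  let S : K →L[ℝ] Z := T.comp K.subtypeL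
  have hS : AntilipschitzWith ⟨c⁻¹, (inv_pos.2 hc).le⟩ S := by
    refine AddMonoidHomClass.antilipschitz_of_bound S fun u => ?_
    have := hT u.1
    change ‖u.1‖ ≤ c⁻¹ * ‖T u.1‖
    rw [← div_eq_inv_mul, le_div_iff₀ hc]; linarith
  have hcl : IsClosed (LinearMap.range S.toLinearMap : Set Z) := by
    rw [LinearMap.coe_range]
    exact hS.isClosed_range S.uniformContinuous
  have : CompleteSpace (LinearMap.range S.toLinearMap) := hcl.completeSpace_coe
  set P := (LinearMap.range S.toLinearMap).starProjection (T Q) with hP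
  have hPmem : P ∈ LinearMap.range S.toLinearMap := Submodule.starProjection_apply_mem _ _
  have key : ∀ W : K, ‖T (W.1 + Q)‖ ^ 2 = ‖S W + P‖ ^ 2 + ‖T Q - P‖ ^ 2 := by
    intro W
    have e : T (W.1 + Q) = (S W + P) + (T Q - P) := by
      rw [map_add]; change S W + T Q = _; abel
    have h0 : inner ℝ (S W + P) (T Q - P) = 0 := by
      have h1 : S W + P ∈ LinearMap.range S.toLinearMap :=
        Submodule.add_mem _ ⟨W, rfl⟩ hPmem
      exact (Submodule.sub_starProjection_mem_orthogonal (T Q)) _ h1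
    rw [e, sq, sq, sq, norm_add_sq_eq_norm_sq_add_norm_sq_real h0]
  obtain ⟨W₀, hW₀⟩ := hPmem
  have hW₀' : S (-W₀) + P = 0 := by rw [map_neg, ← hW₀]; exact neg_add_cancel _
  refine ⟨-W₀, fun W _ => ?_, fun W hW => ?_⟩
  · change ‖T ((-W₀).1 + Q)‖ ^ 2 ≤ ‖T (W.1 + Q)‖ ^ 2
    rw [key, key, hW₀', norm_zero]
    have := sq_nonneg ‖S W + P‖
    nlinarith
  · have h : ‖T (W.1 + Q)‖ ^ 2 ≤ ‖T ((-W₀).1 + Q)‖ ^ 2 := hW (mem_univ _)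
    rw [key, key, hW₀', norm_zero] at h
    have h2 : ‖S W + P‖ = 0 := by
      have := sq_nonneg ‖S W + P‖
      exact pow_eq_zero_iff (two_ne_zero) |>.1 (by linarith)
    have h3 : S W = S (-W₀) := by
      rw [norm_eq_zero] at h2
      exact add_right_cancel (h2.trans hW₀'.symm)
    exact hS.injective h3

section

variable {b ξ d s ν : ℝ}

theorem sub_mem_Sob0 {m : ℕ} {u v : Sob (box b ξ d) m} {g₀ g₁ : L2Gam b}
    (hu : HasBoundaryData b ξ d u g₀ g₁) (hv : HasBoundaryData b ξ d v g₀ g₁) :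
    u - v ∈ Sob0 b ξ d m := by
  have e : u - v = u + (-1 : ℝ) • v := by rw [neg_one_smul, sub_eq_add_neg]
  rw [e]
  refine ⟨fun φ hφ i => ?_, fun φ hφ hs => ?_⟩
  · have h1 := hu.1 φ hφ i
    have h2 := hv.1 φ hφ i
    simp only [gamInt_zero, neg_zero, ite_self, wD1] at h1 h2 ⊢
    rw [wD_add, wD_add, wD_smul, wD_smul, flux_add i hφ, flux_smul, h1, h2, neg_one_smul,
      add_neg_cancel]
  · have h1 := hu.2 φ hφ hs
    have h2 := hv.2 φ hφ hs
    simp only [gamInt_zero, neg_zero, wD1, wD2] at h1 h2 ⊢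
    rw [wD_add, wD_add, wD_smul, wD_smul, flux_add 2 hφ, flux_smul, h1, h2, neg_one_smul,
      add_neg_cancel]

theorem norm_lap_sq_le {Ω : Set Pt} {m : ℕ} (u : Sob Ω m) : ‖lap u‖ ^ 2 ≤ 9 * ‖u‖ ^ 2 := by
  have h : ‖lap u‖ ≤ 3 * ‖u‖ := by
    refine (norm_sum_le _ _).trans ?_
    refine (Finset.sum_le_sum fun i _ => norm_wD_le u (Pi.single i 1 + Pi.single i 1)).trans ?_
    simp
  calc ‖lap u‖ ^ 2 ≤ (3 * ‖u‖) ^ 2 := pow_le_pow_left₀ (norm_nonneg _) h 2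
    _ = _ := by ring

/-- The tail functional carries φ_μ, whereas the norm of θ carries the square of the weight; hence
the parameter μ/2. -/
theorem tailFunctional_eq {mu α : ℝ} (hs : ξ < s) (hν : 0 ≤ ν) (hmu : 0 ≤ mu / 2)
    (Q : Sob (box b ξ d) 3) (W : Sob0 b ξ d 3) :
    tailFunctional b ξ d s ν mu α Q W = Real.exp (-2 * mu * (s + d) ^ (-ν)) *
      ‖theta hs hν hmu (lap (W.1 + Q))‖ ^ 2 + α * ‖W.1 + Q‖ ^ 2 := by
  unfold tailFunctional
  rw [norm_theta_sq]
  congr 2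
  refine integral_congr_ae ?_
  have e : lap (W.1 + Q) = lap W.1 + lap Q := by
    rw [← lapL_apply, map_add, lapL_apply, lapL_apply]
  filter_upwards [Lp.coeFn_add (lap W.1) (lap Q)] with x hx
  rw [e, hx, Pi.add_apply, cwf_sq]
  congr 2; ring

theorem existsUnique_tail {mu α : ℝ} (hs : ξ < s) (hν : 0 ≤ ν) (hmu : 0 ≤ mu) (hα : 0 < α)
    (Q : Sob (box b ξ d) 3) :
    ∃! W : Sob0 b ξ d 3, IsMinOn (tailFunctional b ξ d s ν mu α Q) univ W := by
  have hmu2 : 0 ≤ mu / 2 := by positivity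
  set e := Real.exp (-2 * mu * (s + d) ^ (-ν)) with he
  have he0 : 0 < e := Real.exp_pos _
  let A : Sob (box b ξ d) 3 →L[ℝ] L2 (box b ξ d) := √e • (theta hs hν hmu2).comp (lapL _ 3)
  let B : Sob (box b ξ d) 3 →L[ℝ] Sob (box b ξ d) 3 := √α • ContinuousLinearMap.id ℝ _
  -- Both terms of the functional form one squared norm in the Hilbert sum of L² and H³; the
  -- regularization term makes `T` coercive.
  let T : Sob (box b ξ d) 3 →L[ℝ] WithLp 2 (L2 (box b ξ d) × Sob (box b ξ d) 3) :=
    (WithLp.prodContinuousLinearEquiv 2 ℝ _ _).symm.toContinuousLinearMap.comp (A.prod B)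
  have hT : ∀ u, ‖T u‖ ^ 2 = e * ‖theta hs hν hmu2 (lap u)‖ ^ 2 + α * ‖u‖ ^ 2 := by
    intro u
    rw [WithLp.prod_norm_sq_eq_of_L2]
    change ‖√e • theta hs hν hmu2 (lapL _ 3 u)‖ ^ 2 + ‖√α • u‖ ^ 2 = _
    rw [norm_smul, norm_smul, mul_pow, mul_pow, Real.norm_eq_abs, Real.norm_eq_abs, sq_abs, sq_abs,
      Real.sq_sqrt he0.le, Real.sq_sqrt hα.le, lapL_apply]
  have hTb : ∀ u, √α * ‖u‖ ≤ ‖T u‖ := by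
    intro u
    refine le_of_sq_le_sq ?_ (norm_nonneg _)
    rw [hT, mul_pow, Real.sq_sqrt hα.le]
    exact le_add_of_nonneg_left (by positivity)
  have h := existsUnique_isMinOn_norm_sq (Sob0 b ξ d 3) T (Real.sqrt_pos.2 hα) hTb Q
  have ef : (fun W : Sob0 b ξ d 3 => ‖T (W.1 + Q)‖ ^ 2) = tailFunctional b ξ d s ν mu α Q := by
    funext W
    rw [hT, tailFunctional_eq hs hν hmu2]
  rwa [ef] at h

theorem tnu_pos (hs : ξ < s) (hlt : -ξ < d) (hν : 0 < ν) : 0 < tnu ξ d s ν := by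
  unfold tnu
  rw [sub_pos]
  exact Real.rpow_lt_rpow_of_neg (by linarith) (by linarith) (by linarith)

theorem tail_mu_nonneg {δ : ℝ} (hs : ξ < s) (hlt : -ξ < d) (hν : 0 < ν) (h0 : 0 < δ) (h1 : δ < 1) :
    0 ≤ Real.log (δ ^ (-1 / (2 * tnu ξ d s ν))) := by
  have ht := tnu_pos hs hlt hν
  refine Real.log_nonneg (Real.one_le_rpow_of_pos_of_le_one_of_nonpos h0 h1.le ?_)
  exact div_nonpos_of_nonpos_of_nonneg (by norm_num) (by positivity)

/-- The competitor is V_* - Q_*: adding Q gives V_* + (Q - Q_*), whose Laplacian is Δ(Q - Q_*)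
because V_* is harmonic. Both terms of the functional are then O(δ), and division by α = δ bounds
the minimizer. -/
theorem norm_tail_sq_le {δ MV : ℝ} (hs : ξ < s) (hlt : -ξ < d) (hν : 0 < ν) (h0 : 0 < δ)
    (h1 : δ < 1) {Q Qs Vs : Sob (box b ξ d) 3} {g₀ g₁ : L2Gam b}
    (hQ : HasBoundaryData b ξ d Qs g₀ g₁) (hV : HasBoundaryData b ξ d Vs g₀ g₁)
    (hlap : lap Vs = 0) (hδ : ‖Q - Qs‖ < δ) (hMV : ‖Vs‖ ≤ MV) {W : Sob0 b ξ d 3}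
    (hW : IsTailMinimizer b ξ d s ν δ Q W) : ‖W.1 + Q‖ ^ 2 ≤ 9 + (MV + 1) ^ 2 := by
  have ht := tnu_pos (d := d) hs hlt hν
  have hmu := tail_mu_nonneg (d := d) hs hlt hν h0 h1
  set mu := Real.log (δ ^ (-1 / (2 * tnu ξ d s ν))) with hmu_def
  have hmu2 : 0 ≤ mu / 2 := by positivity
  have hmin := hW (mem_univ (⟨Vs - Qs, sub_mem_Sob0 hV hQ⟩ : Sob0 b ξ d 3))
  simp only [mem_ofPred_eq] at hmin
  rw [← hmu_def, tailFunctional_eq hs hν.le hmu2, tailFunctional_eq hs hν.le hmu2] at hmin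
  have e1 : (Vs - Qs) + Q = Vs + (Q - Qs) := by abel
  have e2 : lap (Vs + (Q - Qs)) = lap (Q - Qs) := by
    rw [← lapL_apply, map_add, lapL_apply, lapL_apply, hlap, zero_add]
  simp only [e1, e2] at hmin
  set M := Real.exp (2 * mu * (s - ξ) ^ (-ν)) with hM
  have hth : ‖theta hs hν.le hmu2 (lap (Q - Qs))‖ ^ 2 ≤ M * (9 * δ ^ 2) := by
    have h3 : ‖theta hs hν.le hmu2 (lap (Q - Qs))‖ ^ 2 ≤ M * ‖lap (Q - Qs)‖ ^ 2 := by
      rw [norm_theta_sq, Lp_norm_sq_eq_integral, ← integral_const_mul]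
      refine setIntegral_mono_on ?_ ?_ (measurableSet_box b ξ d) fun x hx => ?_
      · simp only [cwf_sq]
        exact integrable_mul_cwf hs hν.le (by positivity) (Lp.memLp _).norm.integrable_sq
      · exact (Lp.memLp _).norm.integrable_sq.const_mul _
      · rw [cwf_sq, mul_comm]
        refine mul_le_mul_of_nonneg_right ?_ (sq_nonneg _)
        have := cwf_le (s := s) (z := x 2) (c := s - ξ) hν.le (by positivity : 0 ≤ 2 * (mu / 2))
          (by linarith) (by linarith [hx.2.2.1])
        rwa [show 2 * (2 * (mu / 2)) = 2 * mu by ring] at this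
    refine h3.trans (mul_le_mul_of_nonneg_left ?_ (Real.exp_pos _).le)
    refine (norm_lap_sq_le _).trans ?_
    have := pow_le_pow_left₀ (norm_nonneg _) hδ.le 2
    linarith
  -- The choice of μ makes the normalized maximum of the weight, exp(2μ t_ν), equal to 1/δ.
  -- Multiplied by δ² from the data error this is of the order of α.
  have hEM : Real.exp (-2 * mu * (s + d) ^ (-ν)) * M = δ⁻¹ := by
    rw [hM, ← Real.exp_add]
    have e3 : -2 * mu * (s + d) ^ (-ν) + 2 * mu * (s - ξ) ^ (-ν) = 2 * tnu ξ d s ν * mu := by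
      unfold tnu; ring
    rw [e3, hmu_def, Real.log_rpow h0]
    have e4 : 2 * tnu ξ d s ν * (-1 / (2 * tnu ξ d s ν) * Real.log δ) = -Real.log δ := by
      field_simp
    rw [e4, Real.exp_neg, Real.exp_log h0]
  have hn : ‖Vs + (Q - Qs)‖ ^ 2 ≤ (MV + 1) ^ 2 :=
    pow_le_pow_left₀ (norm_nonneg _) ((norm_add_le _ _).trans (by linarith)) 2
  have h4 : δ * ‖W.1 + Q‖ ^ 2 ≤ δ * (9 + (MV + 1) ^ 2) := by
    have h5 : 0 ≤ Real.exp (-2 * mu * (s + d) ^ (-ν)) *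
        ‖theta hs hν.le hmu2 (lap (W.1 + Q))‖ ^ 2 := by positivity
    have h6 := mul_le_mul_of_nonneg_left hth (Real.exp_pos (-2 * mu * (s + d) ^ (-ν))).le
    have h7 : Real.exp (-2 * mu * (s + d) ^ (-ν)) * (M * (9 * δ ^ 2)) = 9 * δ := by
      rw [← mul_assoc, hEM]; field_simp
    have h8 := mul_le_mul_of_nonneg_left hn h0.le
    linarith
  exact le_of_mul_le_mul_left h4 h0

end


/-! ### The bilinear product of gradients -/

section

variable {b ξ d s ν : ℝ}

theorem mulL_add_right {Ω : Set Pt} {f f' g : L2 Ω}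
    (h : MemLp (fun x => g x * f x) 2 (volume.restrict Ω))
    (h' : MemLp (fun x => g x * f' x) 2 (volume.restrict Ω)) :
    mulL g (f + f') = mulL g f + mulL g f' := by
  rw [mulL_comm g, mulL_comm g, mulL_comm g, mulL_add_left]
  · simpa only [mul_comm] using h
  · simpa only [mul_comm] using h'

theorem mulL_smul_right {Ω : Set Pt} {f g : L2 Ω} (c : ℝ)
    (h : MemLp (fun x => g x * f x) 2 (volume.restrict Ω)) :
    mulL g (c • f) = c • mulL g f := by
  rw [mulL_comm g, mulL_comm g, mulL_smul_left]
  simpa only [mul_comm] using h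

/-- The product of gradients of H³ functions is in L² with a bilinear bound, which makes the
nonlinearity a continuous bilinear map. -/
theorem exists_gradMul (hb : 0 < b) (hlt : -ξ < d) :
    ∃ B : Sob (box b ξ d) 3 →L[ℝ] Sob (box b ξ d) 3 →L[ℝ] L2 (box b ξ d),
      ∀ u v, B u v = ∑ i, mulL (wD1 u i) (wD1 v i) := by
  obtain ⟨K, hK, H⟩ := exists_mul_grad_bound (ξ := ξ) (d := d) hb hlt
  refine ⟨LinearMap.mkContinuous₂ (LinearMap.mk₂ ℝ (fun u v => ∑ i, mulL (wD1 u i) (wD1 v i))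
    ?_ ?_ ?_ ?_) (3 * K) ?_, fun u v => rfl⟩
  · intro u u' v
    rw [← Finset.sum_add_distrib]
    refine Finset.sum_congr rfl fun i _ => ?_
    rw [← mulL_add_left (H u v i i).1 (H u' v i i).1, wD1, wD_add]; rfl
  · intro c u v
    rw [Finset.smul_sum]
    refine Finset.sum_congr rfl fun i _ => ?_
    rw [← mulL_smul_left c (H u v i i).1, wD1, wD_smul]; rfl
  · intro u v v'
    rw [← Finset.sum_add_distrib]
    refine Finset.sum_congr rfl fun i _ => ?_
    rw [← mulL_add_right (H u v i i).1 (H u v' i i).1, wD1, wD1, wD_add]; rfl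
  · intro c u v
    rw [Finset.smul_sum]
    refine Finset.sum_congr rfl fun i _ => ?_
    rw [← mulL_smul_right c (H u v i i).1, wD1, wD1, wD_smul]; rfl
  · intro u v
    refine (norm_sum_le _ _).trans ((Finset.sum_le_sum fun i _ => (H u v i i).2).trans
      (le_of_eq ?_))
    simp only [Finset.sum_const, Finset.card_univ, Fintype.card_fin, nsmul_eq_mul]
    push_cast; ring

/-- The operator `u ↦ i u_z`. -/
def imDz (Ω : Set Pt) (m : ℕ) : Sob Ω m →L[ℝ] L2 Ω :=
  ((Complex.I • ContinuousLinearMap.id ℂ (L2 Ω)).restrictScalars ℝ).comp (wDL Ω m (Pi.single 2 1))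

theorem imDz_apply {Ω : Set Pt} {m : ℕ} (u : Sob Ω m) : imDz Ω m u = Complex.I • wD1 u 2 := rfl

theorem norm_theta_I_smul {lam : ℝ} (hs : ξ < s) (hν : 0 ≤ ν) (hlam : 0 ≤ lam)
    (f : L2 (box b ξ d)) : ‖theta hs hν hlam (Complex.I • f)‖ = ‖theta hs hν hlam f‖ := by
  have h : ‖theta hs hν hlam (Complex.I • f)‖ ^ 2 = ‖theta hs hν hlam f‖ ^ 2 := by
    rw [norm_theta_sq, norm_theta_sq]
    refine integral_congr_ae ?_
    filter_upwards [Lp.coeFn_smul Complex.I f] with x hx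
    rw [hx, Pi.smul_apply, norm_smul, Complex.norm_I, one_mul]
  exact (pow_left_inj₀ (norm_nonneg _) (norm_nonneg _) two_ne_zero).1 h

/-- The background `f'` need not lie in H_0^3, so its weighted norm has no useful bound; its weight
is moved to `g`. Only the modulus of `f'` matters, which accommodates the factor i. -/
theorem abs_inner_theta_mulL_le {lam : ℝ} (hs : ξ < s) (hν : 0 ≤ ν) (hlam : 0 ≤ lam)
    {f f' g h : L2 (box b ξ d)} (hf : ∀ᵐ x ∂(volume.restrict (box b ξ d)), ‖f' x‖ = ‖f x‖)
    (h1 : MemLp (fun x => f x * theta hs hν hlam g x) 2 (volume.restrict (box b ξ d)))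
    (h2 : MemLp (fun x => g x * theta hs hν hlam h x) 2 (volume.restrict (box b ξ d))) :
    |inner ℝ (theta hs hν hlam f') (mulL g (theta hs hν hlam h))| ≤
      ‖mulL f (theta hs hν hlam g)‖ * ‖theta hs hν hlam h‖ := by
  refine abs_inner_le_of_ae ?_
  filter_upwards [hf, coeFn_mulL h1, coeFn_mulL h2, coeFn_theta hs hν hlam f',
    coeFn_theta hs hν hlam g] with x e1 e2 e3 e4 e5
  rw [e2, e3, e4, e5, norm_mul, norm_mul, norm_smul, norm_smul, e1]
  exact le_of_eq (by ring)

/-- The four factors are paired crosswise, so that each weighted increment is multiplied by one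
background factor. -/
theorem abs_inner_theta_mulL_mulL_le {lam : ℝ} (hs : ξ < s) (hν : 0 ≤ ν) (hlam : 0 ≤ lam)
    {f f' g h : L2 (box b ξ d)}
    (h0 : MemLp (fun x => f x * f' x) 2 (volume.restrict (box b ξ d)))
    (h1 : MemLp (fun x => f x * theta hs hν hlam g x) 2 (volume.restrict (box b ξ d)))
    (h3 : MemLp (fun x => f' x * theta hs hν hlam h x) 2 (volume.restrict (box b ξ d)))
    (h2 : MemLp (fun x => g x * theta hs hν hlam h x) 2 (volume.restrict (box b ξ d))) :
    |inner ℝ (theta hs hν hlam (mulL f f')) (mulL g (theta hs hν hlam h))| ≤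
      ‖mulL f (theta hs hν hlam g)‖ * ‖mulL f' (theta hs hν hlam h)‖ := by
  refine abs_inner_le_of_ae ?_
  filter_upwards [coeFn_mulL h0, coeFn_mulL h1, coeFn_mulL h2, coeFn_mulL h3,
    coeFn_theta hs hν hlam (mulL f f'), coeFn_theta hs hν hlam g] with x e0 e1 e2 e3 e4 e5
  rw [e1, e2, e3, e4, e0, e5]
  simp only [norm_mul, norm_smul]
  exact le_of_eq (by ring)

theorem abs_inner_sum_le {E : Type*} [NormedAddCommGroup E] [InnerProductSpace ℝ E] {ι : Type*}
    [Fintype ι] (f : E) (g : ι → E) {z : ℝ} (h : ∀ i, |inner ℝ f (g i)| ≤ z) :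
    |inner ℝ f (∑ i, g i)| ≤ Fintype.card ι * z := by
  rw [inner_sum]
  refine (Finset.abs_sum_le_sum_abs _ _).trans ((Finset.sum_le_sum fun i _ => h i).trans ?_)
  simp

theorem abs_sum_inner_le {E : Type*} [NormedAddCommGroup E] [InnerProductSpace ℝ E] {ι : Type*}
    [Fintype ι] (f : E) (g : ι → E) {z : ℝ} (h : ∀ i, |inner ℝ (g i) f| ≤ z) :
    |inner ℝ (∑ i, g i) f| ≤ Fintype.card ι * z := by
  rw [real_inner_comm]
  exact abs_inner_sum_le f g fun i => by rw [real_inner_comm]; exact h i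

/-- The weighted bounds of the linear, bilinear and quadrilinear expressions in the functional. -/
theorem exists_weighted_bounds (hb : 0 < b) (hlt : -ξ < d) (hs : ξ < s) (hν : 0 < ν)
    {B : Sob (box b ξ d) 3 →L[ℝ] Sob (box b ξ d) 3 →L[ℝ] L2 (box b ξ d)}
    (hB : ∀ u v, B u v = ∑ i, mulL (wD1 u i) (wD1 v i)) :
    ∃ K : ℝ, 0 < K ∧ ∀ (lam : ℝ) (_ : 1 ≤ lam) (hlam : 0 ≤ lam), ∀ u ∈ Sob0 b ξ d 3,
      ‖theta hs hν.le hlam (imDz _ 3 u)‖ ≤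
        K * lam ^ (-1 / 2 : ℝ) * ‖theta hs hν.le hlam (lapL _ 3 u)‖ ∧
      ∀ a : Sob (box b ξ d) 3, ‖theta hs hν.le hlam (B a u)‖ ≤
        K * lam ^ (-1 / 4 : ℝ) * ‖a‖ * ‖theta hs hν.le hlam (lapL _ 3 u)‖ ∧
      ∀ Q ∈ Sob0 b ξ d 3,
        |inner ℝ (theta hs hν.le hlam (lapL _ 3 a)) (theta hs hν.le hlam (B Q u))| ≤
          K * lam ^ (-1 / 2 : ℝ) * ‖a‖ * ‖theta hs hν.le hlam (lapL _ 3 Q)‖ *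
            ‖theta hs hν.le hlam (lapL _ 3 u)‖ ∧
        |inner ℝ (theta hs hν.le hlam (imDz _ 3 a)) (theta hs hν.le hlam (B Q u))| ≤
          K * lam ^ (-1 / 2 : ℝ) * ‖a‖ * ‖theta hs hν.le hlam (lapL _ 3 Q)‖ *
            ‖theta hs hν.le hlam (lapL _ 3 u)‖ ∧
        ∀ c : Sob (box b ξ d) 3,
        |inner ℝ (theta hs hν.le hlam (B a c)) (theta hs hν.le hlam (B Q u))| ≤
          K * lam ^ (-1 / 2 : ℝ) * ‖a‖ * ‖c‖ * ‖theta hs hν.le hlam (lapL _ 3 Q)‖ *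
            ‖theta hs hν.le hlam (lapL _ 3 u)‖ := by
  obtain ⟨K, hK, H⟩ := exists_theta_mul_grad_bound (b := b) (d := d) hb hlt hs hν
  obtain ⟨K', hK', H'⟩ := exists_mul_grad_bound (ξ := ξ) (d := d) hb hlt
  refine ⟨3 * K + 9 * K ^ 2, by positivity, fun lam h1 hlam u hu => ?_⟩
  have l0 : 0 < lam := by linarith
  have hG := fun j => H lam h1 hlam u hu j
  simp only [lapL_apply]
  set y := ‖theta hs hν.le hlam (lap u)‖ with hy
  have hy0 : 0 ≤ y := norm_nonneg _
  clear_value y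
  -- With t = λ^(-1/4) the three pairings below have the sizes 1 · t², t · t² and t · t; each is at
  -- most of order t².
  set t := lam ^ (-1 / 4 : ℝ) with ht
  have ht0 : 0 < t := Real.rpow_pos_of_pos l0 _
  have ht1 : t ≤ 1 := Real.rpow_le_one_of_one_le_of_nonpos h1 (by norm_num)
  have ht2 : lam ^ (-1 / 2 : ℝ) = t ^ 2 := by
    rw [ht, ← Real.rpow_natCast, ← Real.rpow_mul hlam]; norm_num
  rw [ht2] at hG ⊢
  have hthB : ∀ a : Sob (box b ξ d) 3, theta hs hν.le hlam (B a u) =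
      ∑ i, mulL (wD1 a i) (theta hs hν.le hlam (wD1 u i)) := fun a => by
    rw [hB, map_sum]
    exact Finset.sum_congr rfl fun i _ =>
      theta_mulL hs hν.le hlam (H' a u i i).1 ((hG i).2.1 a i).1
  have hsum3 : ∀ {f : Fin 3 → ℝ} {z : ℝ}, (∀ i, f i ≤ z) → ∑ i, f i ≤ 3 * z := fun {f z} h => by
    refine (Finset.sum_le_sum fun i _ => h i).trans (le_of_eq ?_)
    simp
  refine ⟨?_, fun a => ⟨?_, fun Q hQ => ?_⟩⟩
  · rw [imDz_apply, norm_theta_I_smul]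
    refine (hG 2).1.trans ?_
    have : 0 ≤ (2 * K + 9 * K ^ 2) * t ^ 2 * y := by positivity
    linarith
  · rw [hthB]
    refine (norm_sum_le _ _).trans ((hsum3 fun i => ((hG i).2.1 a i).2).trans ?_)
    have : 0 ≤ 9 * K ^ 2 * t * ‖a‖ * y := by positivity
    linarith
  · have hQ' := fun j => H lam h1 hlam Q hQ j
    set z := ‖theta hs hν.le hlam (lap Q)‖ with hz
    have hz0 : 0 ≤ z := norm_nonneg _
    have ha0 : 0 ≤ ‖a‖ := norm_nonneg _
    clear_value z
    rw [← ht] at hQ'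
    clear_value t
    rw [hthB]
    have hcard : ((Fintype.card (Fin 3) : ℕ) : ℝ) = 3 := by simp
    refine ⟨?_, ?_, fun c => ?_⟩
    · have hb1 : ∀ i, |inner ℝ (theta hs hν.le hlam (lap a))
          (mulL (wD1 Q i) (theta hs hν.le hlam (wD1 u i)))| ≤
            (K * ‖a‖ * z) * (K * t ^ 2 * y) := fun i =>
        (abs_inner_theta_mulL_le hs hν.le hlam (ae_of_all _ fun _ => rfl) ((hQ' i).2.2 a).1
          ((hG i).2.1 Q i).1).trans (mul_le_mul ((hQ' i).2.2 a).2 (hG i).1 (norm_nonneg _)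
            (by positivity))
      refine (abs_inner_sum_le _ _ hb1).trans ?_
      rw [hcard]
      have e1 : 0 ≤ K * t ^ 2 * ‖a‖ * z * y := by positivity
      have e2 : 0 ≤ K ^ 2 * t ^ 2 * ‖a‖ * z * y := by positivity
      linarith
    · have hI : ∀ᵐ x ∂(volume.restrict (box b ξ d)), ‖imDz _ 3 a x‖ = ‖wD1 a 2 x‖ := by
        rw [imDz_apply]
        filter_upwards [Lp.coeFn_smul Complex.I (wD1 a 2)] with x hx
        rw [hx, Pi.smul_apply, norm_smul, Complex.norm_I, one_mul]
      have hb1 : ∀ i, |inner ℝ (theta hs hν.le hlam (imDz _ 3 a))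
          (mulL (wD1 Q i) (theta hs hν.le hlam (wD1 u i)))| ≤
            (K * t * ‖a‖ * z) * (K * t ^ 2 * y) := fun i =>
        (abs_inner_theta_mulL_le hs hν.le hlam hI ((hQ' i).2.1 a 2).1
          ((hG i).2.1 Q i).1).trans (mul_le_mul ((hQ' i).2.1 a 2).2 (hG i).1 (norm_nonneg _)
            (by positivity))
      refine (abs_inner_sum_le _ _ hb1).trans ?_
      rw [hcard]
      have e1 : 0 ≤ K * t ^ 2 * ‖a‖ * z * y := by positivity
      have e2 : 0 ≤ K ^ 2 * t ^ 2 * ‖a‖ * z * y := by positivity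
      have e3 : t * (K ^ 2 * t ^ 2 * ‖a‖ * z * y) ≤ 1 * (K ^ 2 * t ^ 2 * ‖a‖ * z * y) :=
        mul_le_mul_of_nonneg_right ht1 e2
      linarith
    · rw [hB, map_sum]
      have hb1 : ∀ i j, |inner ℝ (theta hs hν.le hlam (mulL (wD1 a j) (wD1 c j)))
          (mulL (wD1 Q i) (theta hs hν.le hlam (wD1 u i)))| ≤
          (K * t * ‖a‖ * z) * (K * t * ‖c‖ * y) := fun i j =>
        (abs_inner_theta_mulL_mulL_le hs hν.le hlam (H' a c j j).1 ((hQ' i).2.1 a j).1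
          ((hG i).2.1 c j).1 ((hG i).2.1 Q i).1).trans (mul_le_mul ((hQ' i).2.1 a j).2
          ((hG i).2.1 c j).2 (norm_nonneg _) (by positivity))
      refine (abs_inner_sum_le _ _ fun i => abs_sum_inner_le _ _ (hb1 i)).trans ?_
      rw [hcard]
      have e1 : 0 ≤ K * t ^ 2 * ‖a‖ * ‖c‖ * z * y := by positivity
      linarith

end


/-! ### Square integrable functions of the wavenumber -/

section

variable {E L : Type*} [NormedAddCommGroup E] [NormedAddCommGroup L] {k₀ k₁ : ℝ}

theorem Lp_integrable (q : Lp E 2 (volume.restrict (Icc k₀ k₁))) :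
    Integrable q (volume.restrict (Icc k₀ k₁)) :=
  (Lp.memLp q).integrable one_le_two

theorem Lp_intervalIntegrable (q : Lp E 2 (volume.restrict (Icc k₀ k₁))) {k : ℝ}
    (hk : k ∈ Icc k₀ k₁) : IntervalIntegrable q volume k k₁ := by
  rw [intervalIntegrable_iff_integrableOn_Ioc_of_le hk.2]
  exact IntegrableOn.mono_set (Lp_integrable q) fun x hx => ⟨hk.1.trans hx.1.le, hx.2⟩

variable [InnerProductSpace ℝ E] [InnerProductSpace ℝ L]

/-- The Cauchy–Schwarz inequality in the wavenumber. -/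
theorem norm_primitive_le (q : Lp E 2 (volume.restrict (Icc k₀ k₁))) {k : ℝ}
    (hk : k ∈ Icc k₀ k₁) : ‖∫ κ in k..k₁, q κ‖ ≤ Real.sqrt (k₁ - k₀) * ‖q‖ := by
  have h01 : k₀ ≤ k₁ := hk.1.trans hk.2
  have h1 : ‖∫ κ in k..k₁, q κ‖ ≤ ∫ κ in Icc k₀ k₁, ‖q κ‖ := by
    rw [intervalIntegral.integral_of_le hk.2]
    refine (norm_integral_le_integral_norm _).trans ?_
    exact setIntegral_mono_set (Lp_integrable q).norm (ae_of_all _ fun _ => norm_nonneg _)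
      (ae_of_all _ fun x hx => ⟨hk.1.trans hx.1.le, hx.2⟩)
  refine h1.trans ?_
  have hH := integral_mul_le_Lp_mul_Lq_of_nonneg (μ := volume.restrict (Icc k₀ k₁))
    (p := 2) (q := 2) (f := fun _ => (1 : ℝ)) (g := fun κ => ‖q κ‖) ⟨by norm_num, by norm_num, by norm_num⟩
    (ae_of_all _ fun _ => zero_le_one) (ae_of_all _ fun _ => norm_nonneg _)
    (by exact memLp_const _) (by simpa using (Lp.memLp q).norm)
  simp only [one_mul] at hH
  refine hH.trans (le_of_eq ?_)
  have hq : ∫ κ in Icc k₀ k₁, ‖q κ‖ ^ (2 : ℝ) = ‖q‖ ^ 2 := by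
    rw [Lp_norm_sq_eq_integral]
    simp only [Real.rpow_two]
  rw [hq]
  simp [h01, Real.sqrt_eq_rpow]
  left
  rw [← Real.rpow_natCast, ← Real.rpow_mul (norm_nonneg _)]
  norm_num

theorem aestronglyMeasurable_primitive (q : Lp E 2 (volume.restrict (Icc k₀ k₁))) :
    AEStronglyMeasurable (fun k => ∫ κ in k..k₁, q κ) (volume.restrict (Icc k₀ k₁)) := by
  refine ContinuousOn.aestronglyMeasurable ?_ measurableSet_Icc
  have hq := Lp_integrable q
  generalize (q : ℝ → E) = f at hq ⊢
  rcases le_or_gt k₀ k₁ with h | h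
  · rw [← uIcc_of_le h] at hq ⊢
    exact intervalIntegral.continuousOn_primitive_interval_left hq
  · rw [Icc_eq_empty (not_le.2 h)]
    exact continuousOn_empty _

theorem memLp_primitive (q : Lp E 2 (volume.restrict (Icc k₀ k₁))) :
    MemLp (fun k => ∫ κ in k..k₁, q κ) 2 (volume.restrict (Icc k₀ k₁)) :=
  MemLp.of_bound (aestronglyMeasurable_primitive q) (Real.sqrt (k₁ - k₀) * ‖q‖)
    ((ae_restrict_iff' measurableSet_Icc).2 (ae_of_all _ fun _ hk => norm_primitive_le q hk))

theorem ae_mem_Icc : ∀ᵐ k ∂(volume.restrict (Icc k₀ k₁)), k ∈ Icc k₀ k₁ :=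
  ae_restrict_mem measurableSet_Icc

theorem primitive_congr {f g : ℝ → E} (h : f =ᵐ[volume.restrict (Icc k₀ k₁)] g) {k : ℝ}
    (hk : k ∈ Icc k₀ k₁) : ∫ κ in k..k₁, f κ = ∫ κ in k..k₁, g κ := by
  refine intervalIntegral.integral_congr_ae ?_
  rw [uIoc_of_le hk.2]
  rw [EventuallyEq, ae_restrict_iff' measurableSet_Icc] at h
  filter_upwards [h] with x hx hx'
  exact hx ⟨hk.1.trans hx'.1.le, hx'.2⟩

theorem primitive_add (q r : Lp E 2 (volume.restrict (Icc k₀ k₁))) {k : ℝ}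
    (hk : k ∈ Icc k₀ k₁) :
    ∫ κ in k..k₁, (q + r : Lp E 2 (volume.restrict (Icc k₀ k₁))) κ =
      (∫ κ in k..k₁, q κ) + ∫ κ in k..k₁, r κ := by
  rw [primitive_congr (Lp.coeFn_add q r) hk]
  exact intervalIntegral.integral_add (Lp_intervalIntegrable q hk) (Lp_intervalIntegrable r hk)

theorem primitive_smul (c : ℝ) (q : Lp E 2 (volume.restrict (Icc k₀ k₁))) {k : ℝ}
    (hk : k ∈ Icc k₀ k₁) :
    ∫ κ in k..k₁, (c • q : Lp E 2 (volume.restrict (Icc k₀ k₁))) κ =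
      c • ∫ κ in k..k₁, q κ := by
  rw [primitive_congr (Lp.coeFn_smul c q) hk]
  exact intervalIntegral.integral_smul _ _

/-- For a bilinear `B`, the map `(q, r) ↦ B (∫_k^{k₁} q dκ) (r k)`. -/
theorem exists_bilin (B : E →L[ℝ] E →L[ℝ] L) :
    ∃ b : Lp E 2 (volume.restrict (Icc k₀ k₁)) →L[ℝ] Lp E 2 (volume.restrict (Icc k₀ k₁)) →L[ℝ]
        Lp L 2 (volume.restrict (Icc k₀ k₁)),
      ∀ q r, ∀ᵐ k ∂(volume.restrict (Icc k₀ k₁)), b q r k = B (∫ κ in k..k₁, q κ) (r k) := by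
  have hle : ∀ q r : Lp E 2 (volume.restrict (Icc k₀ k₁)),
      ∀ᵐ k ∂(volume.restrict (Icc k₀ k₁)), ‖B (∫ κ in k..k₁, q κ) (r k)‖ ≤
        (‖B‖ * (Real.sqrt (k₁ - k₀) * ‖q‖)) * ‖r k‖ := fun q r => by
    filter_upwards [ae_mem_Icc] with k hk
    have hB : 0 ≤ ‖B‖ := B.opNorm_nonneg
    exact (B.le_opNorm₂ _ _).trans (mul_le_mul_of_nonneg_right (mul_le_mul_of_nonneg_left
      (norm_primitive_le q hk) hB) (norm_nonneg _))
  have hm : ∀ q r : Lp E 2 (volume.restrict (Icc k₀ k₁)),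
      MemLp (fun k => B (∫ κ in k..k₁, q κ) (r k)) 2 (volume.restrict (Icc k₀ k₁)) := fun q r =>
    (Lp.memLp r).of_le_mul (B.aestronglyMeasurable_comp₂ (aestronglyMeasurable_primitive q)
      (Lp.aestronglyMeasurable r)) (hle q r)
  have hc := fun q r => (hm q r).coeFn_toLp
  refine ⟨LinearMap.mkContinuous₂ (LinearMap.mk₂ ℝ (fun q r => (hm q r).toLp _) ?_ ?_ ?_ ?_)
    (‖B‖ * Real.sqrt (k₁ - k₀)) fun q r => ?_, fun q r => hc q r⟩
  · intro q q' r
    refine Lp.ext ?_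
    filter_upwards [hc (q + q') r, hc q r, hc q' r, ae_mem_Icc,
      Lp.coeFn_add ((hm q r).toLp _) ((hm q' r).toLp _)] with k e1 e2 e3 hk e4
    rw [e4, Pi.add_apply, e1, e2, e3, primitive_add q q' hk, map_add, add_apply]
  · intro c q r
    refine Lp.ext ?_
    filter_upwards [hc (c • q) r, hc q r, ae_mem_Icc,
      Lp.coeFn_smul c ((hm q r).toLp _)] with k e1 e2 hk e4
    rw [e4, Pi.smul_apply, e1, e2, primitive_smul c q hk, map_smul, smul_apply]
  · intro q r r'
    refine Lp.ext ?_
    filter_upwards [hc q (r + r'), hc q r, hc q r', Lp.coeFn_add r r',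
      Lp.coeFn_add ((hm q r).toLp _) ((hm q r').toLp _)] with k e1 e2 e3 e5 e4
    rw [e4, Pi.add_apply, e1, e2, e3, e5, Pi.add_apply, map_add]
  · intro c q r
    refine Lp.ext ?_
    filter_upwards [hc q (c • r), hc q r, Lp.coeFn_smul c r,
      Lp.coeFn_smul c ((hm q r).toLp _)] with k e1 e2 e5 e4
    rw [e4, Pi.smul_apply, e1, e2, e5, Pi.smul_apply, map_smul]
  · change ‖(hm q r).toLp _‖ ≤ _
    rw [mul_assoc ‖B‖]
    refine Lp.norm_le_mul_norm_of_ae_le_mul ?_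
    filter_upwards [hc q r, hle q r] with k e1 e2
    rw [e1]; exact e2

/-- The integral operator `q ↦ ∫_k^{k₁} q dκ`. -/
theorem exists_primitiveL :
    ∃ P : Lp E 2 (volume.restrict (Icc k₀ k₁)) →L[ℝ] Lp E 2 (volume.restrict (Icc k₀ k₁)),
      ∀ q, ∀ᵐ k ∂(volume.restrict (Icc k₀ k₁)), P q k = ∫ κ in k..k₁, q κ := by
  have hc := fun q : Lp E 2 (volume.restrict (Icc k₀ k₁)) => (memLp_primitive q).coeFn_toLp
  refine ⟨LinearMap.mkContinuous
    { toFun := fun q => (memLp_primitive q).toLp _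
      map_add' := fun q r => ?_
      map_smul' := fun c q => ?_ }
    (Real.sqrt ((volume.restrict (Icc k₀ k₁)).real univ) * Real.sqrt (k₁ - k₀)) fun q => ?_,
    fun q => hc q⟩
  · refine Lp.ext ?_
    filter_upwards [hc (q + r), hc q, hc r, ae_mem_Icc,
      Lp.coeFn_add ((memLp_primitive q).toLp _) ((memLp_primitive r).toLp _)] with k e1 e2 e3 hk e4
    rw [e4, Pi.add_apply, e1, e2, e3, primitive_add q r hk]
  · refine Lp.ext ?_
    filter_upwards [hc (c • q), hc q, ae_mem_Icc,
      Lp.coeFn_smul c ((memLp_primitive q).toLp _)] with k e1 e2 hk e4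
    rw [RingHom.id_apply, e4, Pi.smul_apply, e1, e2, primitive_smul c q hk]
  · change ‖(memLp_primitive q).toLp _‖ ≤ _
    rw [mul_assoc]
    refine le_of_sq_le_sq ?_ (by positivity)
    rw [Lp_norm_sq_eq_integral, mul_pow, Real.sq_sqrt measureReal_nonneg]
    have h1 : ∫ k in Icc k₀ k₁, ‖(memLp_primitive q).toLp _ k‖ ^ 2 ≤
        ∫ _ in Icc k₀ k₁, (Real.sqrt (k₁ - k₀) * ‖q‖) ^ 2 := by
      refine integral_mono_ae ((memLp_two_iff_integrable_sq_norm (Lp.aestronglyMeasurable _)).1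
        (Lp.memLp _)) (integrable_const _) ?_
      filter_upwards [hc q, ae_mem_Icc] with k e1 hk
      rw [e1]
      exact pow_le_pow_left₀ (norm_nonneg _) (norm_primitive_le q hk) 2
    refine h1.trans (le_of_eq ?_)
    rw [integral_const, smul_eq_mul]

variable [CompleteSpace E] [CompleteSpace L]

theorem primitive_comp (T : E →L[ℝ] L) (q : Lp E 2 (volume.restrict (Icc k₀ k₁))) {k : ℝ}
    (hk : k ∈ Icc k₀ k₁) : ∫ κ in k..k₁, T (q κ) = T (∫ κ in k..k₁, q κ) :=
  T.intervalIntegral_comp_comm (Lp_intervalIntegrable q hk)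

end


/-! ### Quadratic maps between Hilbert spaces -/

section

variable {X Y : Type*} [NormedAddCommGroup X] [InnerProductSpace ℝ X]
  [NormedAddCommGroup Y] [InnerProductSpace ℝ Y]

/-- The value `c₀ + ℓ q + β(q, q)` of a quadratic map. -/
def quadMap (c₀ : Y) (ℓ : X →L[ℝ] Y) (β : X →L[ℝ] X →L[ℝ] Y) (q : X) : Y := c₀ + ℓ q + β q q

theorem quadMap_add (c₀ : Y) (ℓ : X →L[ℝ] Y) (β : X →L[ℝ] X →L[ℝ] Y) (q h : X) :
    quadMap c₀ ℓ β (q + h) = quadMap c₀ ℓ β q + (ℓ h + β q h + β h q) + β h h := by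
  simp only [quadMap, map_add, add_apply]
  abel

theorem hasFDerivAt_quadMap (c₀ : Y) (ℓ : X →L[ℝ] Y) (β : X →L[ℝ] X →L[ℝ] Y) (q : X) :
    HasFDerivAt (quadMap c₀ ℓ β) (ℓ + β q + β.flip q) q := by
  have h1 := (ℓ.hasFDerivAt (x := q)).const_add c₀
  have h2 : HasFDerivAt (fun q => β q q) (β q + β.flip q) q := by
    have := β.isBoundedBilinearMap.hasFDerivAt (q, q)
    have h3 := HasFDerivAt.comp (f := fun q : X => (q, q)) q this
      ((hasFDerivAt_id q).prodMk (hasFDerivAt_id q))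
    refine h3.congr_fderiv ?_
    ext h
    simp
  have h4 := h1.add h2
  rw [← add_assoc] at h4
  exact h4

/-- The Fréchet derivative of a Tikhonov functional with a quadratic map, its Riesz representation,
and the remainder of the first order expansion. -/
theorem exists_gradient_quad (S : Submodule ℝ X) [CompleteSpace S] (Θ : Y →L[ℝ] Y)
    (c₀ : Y) (ℓ : X →L[ℝ] Y) (β : X →L[ℝ] X →L[ℝ] Y) (F : X) (c ρ : ℝ) {Φ : X → Y}
    (hΦ : Φ = quadMap c₀ ℓ β) {f : S → ℝ}
    (hf : ∀ p, f p = c * ‖Θ (Φ (p.1 + F))‖ ^ 2 + ρ * ‖p‖ ^ 2) :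
    ∃ f' : S → S, (∀ p, HasFDerivAt f (innerSL ℝ (f' p)) p) ∧
      ∀ p h, f (p + h) - f p - inner ℝ (f' p) h =
        c * (‖Θ (Φ (p.1 + F + h.1) - Φ (p.1 + F))‖ ^ 2 +
          2 * inner ℝ (Θ (Φ (p.1 + F))) (Θ (β h.1 h.1))) + ρ * ‖h‖ ^ 2 := by
  let T : S → S →L[ℝ] Y := fun p =>
    Θ.comp ((ℓ + β (p.1 + F) + β.flip (p.1 + F)).comp S.subtypeL)
  let Λ : S → S →L[ℝ] ℝ := fun p =>
    c • (2 • (innerSL ℝ (Θ (Φ (p.1 + F)))).comp (T p)) + ρ • (2 • innerSL ℝ p)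
  refine ⟨fun p => (InnerProductSpace.toDual ℝ S).symm (Λ p), fun p => ?_, fun p h => ?_⟩
  · have e : innerSL ℝ ((InnerProductSpace.toDual ℝ S).symm (Λ p)) = Λ p := by
      ext h
      rw [innerSL_apply_apply, InnerProductSpace.toDual_symm_apply]
    rw [e]
    have h0 : HasFDerivAt (fun p : S => p.1 + F) S.subtypeL p :=
      (S.subtypeL.hasFDerivAt (x := p)).add_const F
    have h1 : HasFDerivAt (fun p : S => Θ (Φ (p.1 + F))) (T p) p := by
      rw [hΦ]
      have h2 : HasFDerivAt (fun p : S => quadMap c₀ ℓ β (p.1 + F)) _ p :=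
        HasFDerivAt.comp (f := fun p : S => p.1 + F) p (hasFDerivAt_quadMap c₀ ℓ β (p.1 + F)) h0
      exact HasFDerivAt.comp p (Θ.hasFDerivAt (x := quadMap c₀ ℓ β (p.1 + F))) h2
    have h2 := (h1.norm_sq.const_mul c).add ((hasFDerivAt_id p).norm_sq.const_mul ρ)
    have h3 : f = fun p => c * ‖Θ (Φ (p.1 + F))‖ ^ 2 + ρ * ‖p‖ ^ 2 := funext hf
    rw [h3]
    exact h2
  · rw [InnerProductSpace.toDual_symm_apply, hf, hf]
    have e1 : Λ p h = c * (2 * inner ℝ (Θ (Φ (p.1 + F))) (T p h)) + ρ * (2 * inner ℝ p h) := by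
      simp [Λ]
    have e2 : (p + h).1 + F = p.1 + F + h.1 := by
      rw [Submodule.coe_add]; abel
    -- Φ is quadratic, so the expansion is exact and holds for increments of any size.
    have e3 : Θ (Φ (p.1 + F + h.1)) = Θ (Φ (p.1 + F)) + (T p h + Θ (β h.1 h.1)) := by
      rw [hΦ, quadMap_add, map_add, map_add, add_assoc]; rfl
    rw [e1, e2, map_sub, e3, add_sub_cancel_left, norm_add_sq_real, norm_add_sq_real p h,
      inner_add_right]
    ring

end

/-! ### The integro-differential operator as a quadratic map -/

section

variable {E L : Type*} [NormedAddCommGroup E] [InnerProductSpace ℝ E]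
  [NormedAddCommGroup L] [InnerProductSpace ℝ L] {k₀ k₁ : ℝ}

/-- The value at `k` of the abstract integro-differential operator at a function with the value `a`
at `k` and the integral `P` over `[k, k₁]`. -/
def opAt (D G : E →L[ℝ] L) (B : E →L[ℝ] E →L[ℝ] L) (V : E) (k : ℝ) (a P : E) : L :=
  D a + (2 * k) • B (V - P) (k • a + (V - P)) + (2 : ℝ) • G (k • a + (V - P))

/-- With A q = k q - ∫_k q, the bilinear term is 2k B(V - ∫_k q, A q + V); expanding it separates
the constant, linear and quadratic parts in q. -/
theorem exists_quadMap (D G : E →L[ℝ] L) (B : E →L[ℝ] E →L[ℝ] L) (V : E) :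
    ∃ (c₀ : Lp L 2 (volume.restrict (Icc k₀ k₁)))
      (ℓ : Lp E 2 (volume.restrict (Icc k₀ k₁)) →L[ℝ] Lp L 2 (volume.restrict (Icc k₀ k₁)))
      (β : Lp E 2 (volume.restrict (Icc k₀ k₁)) →L[ℝ] Lp E 2 (volume.restrict (Icc k₀ k₁)) →L[ℝ]
        Lp L 2 (volume.restrict (Icc k₀ k₁))),
      (∀ q, ∀ᵐ k ∂(volume.restrict (Icc k₀ k₁)),
        quadMap c₀ ℓ β q k = opAt D G B V k (q k) (∫ κ in k..k₁, q κ)) ∧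
      ∀ h, ∀ᵐ k ∂(volume.restrict (Icc k₀ k₁)),
        β h h k = -((2 * k) • B (∫ κ in k..k₁, h κ) (k • h k - ∫ κ in k..k₁, h κ)) := by
  obtain ⟨P, hP⟩ := exists_primitiveL (E := E) (k₀ := k₀) (k₁ := k₁)
  obtain ⟨bil, hbil⟩ := exists_bilin (k₀ := k₀) (k₁ := k₁) B
  have hM : ∀ᵐ k ∂(volume.restrict (Icc k₀ k₁)), |k| ≤ max |k₀| |k₁| := by
    filter_upwards [ae_mem_Icc] with k hk
    exact abs_le_max_abs_abs hk.1 hk.2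
  have hid : AEStronglyMeasurable (fun k : ℝ => k) (volume.restrict (Icc k₀ k₁)) :=
    aestronglyMeasurable_id
  let KE : Lp E 2 (volume.restrict (Icc k₀ k₁)) →L[ℝ] Lp E 2 (volume.restrict (Icc k₀ k₁)) :=
    mulOp (fun k => k) hid hM
  let KL : Lp L 2 (volume.restrict (Icc k₀ k₁)) →L[ℝ] Lp L 2 (volume.restrict (Icc k₀ k₁)) :=
    mulOp (fun k => k) hid hM
  have hKE : ∀ q, ∀ᵐ k ∂(volume.restrict (Icc k₀ k₁)), KE q k = k • q k := fun q =>
    coeFn_mulOp _ hid hM q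
  have hKL : ∀ q, ∀ᵐ k ∂(volume.restrict (Icc k₀ k₁)), KL q k = k • q k := fun q =>
    coeFn_mulOp _ hid hM q
  have hVm : MemLp (fun _ : ℝ => V) 2 (volume.restrict (Icc k₀ k₁)) := memLp_const V
  let Vc := hVm.toLp
  have hVc : ∀ᵐ k ∂(volume.restrict (Icc k₀ k₁)), Vc k = V := hVm.coeFn_toLp
  let A := KE - P
  have hA : ∀ q, ∀ᵐ k ∂(volume.restrict (Icc k₀ k₁)), A q k = k • q k - ∫ κ in k..k₁, q κ :=
    fun q => by
      filter_upwards [hKE q, hP q, Lp.coeFn_sub (KE q) (P q)] with k e1 e2 e3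
      rw [sub_apply, e3, Pi.sub_apply, e1, e2]
  let BV := (B V).compLpL 2 (volume.restrict (Icc k₀ k₁))
  let DL := D.compLpL 2 (volume.restrict (Icc k₀ k₁))
  let Gk := G.compLpL 2 (volume.restrict (Icc k₀ k₁))
  refine ⟨(2 : ℝ) • KL (BV Vc) + (2 : ℝ) • Gk Vc,
    DL + (2 : ℝ) • (KL.comp (BV.comp A)) - (2 : ℝ) • (KL.comp (bil.flip Vc)) +
      (2 : ℝ) • (Gk.comp A),
    -((2 : ℝ) • (ContinuousLinearMap.compL ℝ (Lp E 2 (volume.restrict (Icc k₀ k₁)))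
      (Lp L 2 (volume.restrict (Icc k₀ k₁))) (Lp L 2 (volume.restrict (Icc k₀ k₁))) KL).comp
        (bil.bilinearComp (ContinuousLinearMap.id ℝ _) A)), fun q => ?_, fun h => ?_⟩
  · have e : ∀ c1 c2 d1 d2 d3 d4 b1 : Lp L 2 (volume.restrict (Icc k₀ k₁)),
        ∀ᵐ k ∂(volume.restrict (Icc k₀ k₁)),
          ((2 : ℝ) • c1 + (2 : ℝ) • c2 + (d1 + (2 : ℝ) • d2 - (2 : ℝ) • d3 + (2 : ℝ) • d4) +
            -((2 : ℝ) • b1) : Lp L 2 (volume.restrict (Icc k₀ k₁))) k =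
          (2 : ℝ) • c1 k + (2 : ℝ) • c2 k + (d1 k + (2 : ℝ) • d2 k - (2 : ℝ) • d3 k +
            (2 : ℝ) • d4 k) + -((2 : ℝ) • b1 k) := by
      intro c1 c2 d1 d2 d3 d4 b1
      filter_upwards [Lp.coeFn_add ((2 : ℝ) • c1 + (2 : ℝ) • c2 +
          (d1 + (2 : ℝ) • d2 - (2 : ℝ) • d3 + (2 : ℝ) • d4)) (-((2 : ℝ) • b1)),
        Lp.coeFn_add ((2 : ℝ) • c1 + (2 : ℝ) • c2)
          (d1 + (2 : ℝ) • d2 - (2 : ℝ) • d3 + (2 : ℝ) • d4),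
        Lp.coeFn_add ((2 : ℝ) • c1) ((2 : ℝ) • c2), Lp.coeFn_neg ((2 : ℝ) • b1),
        Lp.coeFn_add (d1 + (2 : ℝ) • d2 - (2 : ℝ) • d3) ((2 : ℝ) • d4),
        Lp.coeFn_sub (d1 + (2 : ℝ) • d2) ((2 : ℝ) • d3), Lp.coeFn_add d1 ((2 : ℝ) • d2),
        Lp.coeFn_smul (2 : ℝ) c1, Lp.coeFn_smul (2 : ℝ) c2, Lp.coeFn_smul (2 : ℝ) d2,
        Lp.coeFn_smul (2 : ℝ) d3, Lp.coeFn_smul (2 : ℝ) d4, Lp.coeFn_smul (2 : ℝ) b1] with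
        k h1 h2 h3 h4 h5 h6 h7 h8 h9 h10 h11 h12 h13
      simp only [h1, h2, h3, h4, h5, h6, h7, h8, h9, h10, h11, h12, h13, Pi.add_apply, Pi.sub_apply,
        Pi.neg_apply, Pi.smul_apply]
    filter_upwards [e (KL (BV Vc)) (Gk Vc) (DL q) (KL (BV (A q))) (KL (bil q Vc)) (Gk (A q))
      (KL (bil q (A q))), hVc, hA q, hKL (BV Vc), (B V).coeFn_compLpL Vc, G.coeFn_compLpL Vc,
      D.coeFn_compLpL q, hKL (BV (A q)), (B V).coeFn_compLpL (A q), hKL (bil q Vc), hbil q Vc,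
      G.coeFn_compLpL (A q), hKL (bil q (A q)), hbil q (A q)] with
      k h0 h1 h2 h3 h4 h5 h6 h7 h8 h9 h10 h11 h12 h13
    refine Eq.trans h0 ?_
    rw [h3, h7, h9, h12, h10, h13]
    rw [show BV Vc k = B V (Vc k) from h4, show Gk Vc k = G (Vc k) from h5,
      show DL q k = D (q k) from h6, show BV (A q) k = B V (A q k) from h8,
      show Gk (A q) k = G (A q k) from h11, h1, h2]
    simp only [opAt, map_add, map_sub, map_smul, sub_apply, smul_sub, smul_add, mul_smul]
    abel
  · have e : ∀ b1 : Lp L 2 (volume.restrict (Icc k₀ k₁)), ∀ᵐ k ∂(volume.restrict (Icc k₀ k₁)),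
        (-((2 : ℝ) • b1) : Lp L 2 (volume.restrict (Icc k₀ k₁))) k = -((2 : ℝ) • b1 k) := by
      intro b1
      filter_upwards [Lp.coeFn_neg ((2 : ℝ) • b1), Lp.coeFn_smul (2 : ℝ) b1] with k h1 h2
      rw [h1, Pi.neg_apply, h2, Pi.smul_apply]
    filter_upwards [e (KL (bil h (A h))), hA h, hKL (bil h (A h)), hbil h (A h)] with k h0 h1 h2 h3
    refine Eq.trans h0 ?_
    rw [h2, h3, h1, mul_smul]

end


/-! ### Convexity of the weighted square of the integro-differential operator -/

/-- Keeps half of the principal part at the cost of subtracting the square of a small perturbation.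
-/
theorem half_norm_sq_sub_le {L : Type*} [SeminormedAddCommGroup L] (x z : L) : 1 / 2 * ‖x‖ ^ 2 - ‖z‖ ^ 2 ≤ ‖x + z‖ ^ 2 := by
  have h1 : ‖x‖ ≤ ‖x + z‖ + ‖z‖ := by
    have := norm_sub_le (x + z) z
    rwa [add_sub_cancel_right] at this
  have h2 := pow_le_pow_left₀ (norm_nonneg x) h1 2
  nlinarith [sq_nonneg (‖x + z‖ - ‖z‖)]

section

variable {E L : Type*} [NormedAddCommGroup E] [InnerProductSpace ℝ E]
  [NormedAddCommGroup L] [InnerProductSpace ℝ L] {k₀ k₁ : ℝ}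

theorem Lp_integrable_norm_sq {F : Type*} [NormedAddCommGroup F]
    (f : Lp F 2 (volume.restrict (Icc k₀ k₁))) :
    Integrable (fun k => ‖f k‖ ^ 2) (volume.restrict (Icc k₀ k₁)) :=
  (memLp_two_iff_integrable_sq_norm (Lp.aestronglyMeasurable f)).1 (Lp.memLp f)

/-- With the weight `θ`, the linear part `G` and the bilinear part `B` are small with respect to the
principal part `D` on `E₀`. -/
def WeightedBounds (E₀ : Submodule ℝ E) (D G : E →L[ℝ] L) (B : E →L[ℝ] E →L[ℝ] L) (θ : L →L[ℝ] L)
    (m ε : ℝ) : Prop :=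
  ∀ u ∈ E₀, ‖θ (G u)‖ ≤ m * ε ^ 2 * ‖θ (D u)‖ ∧
    ∀ a, ‖θ (B a u)‖ ≤ m * ε * ‖a‖ * ‖θ (D u)‖ ∧
      ∀ Q ∈ E₀, |inner ℝ (θ (D a)) (θ (B Q u))| ≤ m * ε ^ 2 * ‖a‖ * ‖θ (D Q)‖ * ‖θ (D u)‖ ∧
        |inner ℝ (θ (G a)) (θ (B Q u))| ≤ m * ε ^ 2 * ‖a‖ * ‖θ (D Q)‖ * ‖θ (D u)‖ ∧
        ∀ c, |inner ℝ (θ (B a c)) (θ (B Q u))| ≤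
          m * ε ^ 2 * ‖a‖ * ‖c‖ * ‖θ (D Q)‖ * ‖θ (D u)‖

theorem WeightedBounds.mono {E₀ : Submodule ℝ E} {D G : E →L[ℝ] L} {B : E →L[ℝ] E →L[ℝ] L}
    {θ : L →L[ℝ] L} {m m' ε : ℝ} (H : WeightedBounds E₀ D G B θ m ε) (hm : m ≤ m') (hε : 0 ≤ ε) :
    WeightedBounds E₀ D G B θ m' ε := by
  intro u hu
  obtain ⟨h1, h2⟩ := H u hu
  refine ⟨h1.trans (by gcongr), fun a => ?_⟩
  obtain ⟨h3, h4⟩ := h2 a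
  refine ⟨h3.trans (by gcongr), fun Q hQ => ?_⟩
  obtain ⟨h5, h6, h7⟩ := h4 Q hQ
  exact ⟨h5.trans (by gcongr), h6.trans (by gcongr), fun c => (h7 c).trans (by gcongr)⟩

/-- Apart from D h, every term contains B or G applied to k h - Q or to Q. These are elements to
which the weighted smallness applies when h and Q satisfy the homogeneous conditions. -/
theorem opAt_sub (D G : E →L[ℝ] L) {B : E →L[ℝ] E →L[ℝ] L} (hB : ∀ a c, B a c = B c a)
    (V : E) (k : ℝ) (a P h Q : E) :
    opAt D G B V k (a + h) (P + Q) - opAt D G B V k a P =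
      D h + ((2 * k) • (B (V - P) (k • h - Q) - B (k • a + (V - P)) Q - B Q (k • h - Q)) +
        (2 : ℝ) • G (k • h - Q)) := by
  rw [hB (k • a + (V - P)) Q]
  simp only [opAt, map_add, map_sub, map_smul, sub_apply, add_apply, smul_sub, smul_add]
  abel

/-- A pointwise estimate in k. The integral of h is not controlled by h(k), so its weighted norm
enters through the global quantity `Y`. The value `a` of the background is only square integrable in
k, so it is kept explicit and appears to the second power at most. -/
theorem opAt_lower_bound {E₀ : Submodule ℝ E} {D G : E →L[ℝ] L} {B : E →L[ℝ] E →L[ℝ] L}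
    (hB : ∀ a c, B a c = B c a) {θ : L →L[ℝ] L} {m ε : ℝ} (H : WeightedBounds E₀ D G B θ m ε)
    (hm : 1 ≤ m) (hε : 0 ≤ ε) (hε1 : ε ≤ 1) {k : ℝ} (hk : 0 ≤ k) (hkm : k ≤ m) {V a P h Q : E}
    {Y : ℝ} (hY : 0 ≤ Y) (hh : h ∈ E₀) (hQ : Q ∈ E₀) (hv : ‖V - P‖ ≤ m) (hQm : ‖Q‖ ≤ m)
    (hQY : ‖θ (D Q)‖ ≤ m * Y) :
    1 / 2 * ‖θ (D h)‖ ^ 2 - 252 * m ^ 8 * ε ^ 2 * (‖θ (D h)‖ ^ 2 + (1 + ‖a‖ ^ 2) * Y ^ 2) ≤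
      ‖θ (opAt D G B V k (a + h) (P + Q) - opAt D G B V k a P)‖ ^ 2 +
        2 * inner ℝ (θ (opAt D G B V k a P)) (θ (-((2 * k) • B Q (k • h - Q)))) := by
  have m0 : 0 ≤ m := by linarith
  have hu : k • h - Q ∈ E₀ := E₀.sub_mem (E₀.smul_mem k hh) hQ
  have hyu : ‖θ (D (k • h - Q))‖ ≤ m * (‖θ (D h)‖ + Y) := by
    rw [map_sub, map_sub, map_smul, map_smul]
    refine (norm_sub_le _ _).trans ?_
    rw [norm_smul, Real.norm_eq_abs, abs_of_nonneg hk, mul_add]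
    exact add_le_add (mul_le_mul_of_nonneg_right hkm (norm_nonneg _)) hQY
  have hw : ‖k • a + (V - P)‖ ≤ m * (1 + ‖a‖) := by
    refine (norm_add_le _ _).trans ?_
    rw [norm_smul, Real.norm_eq_abs, abs_of_nonneg hk]
    have := mul_le_mul_of_nonneg_right hkm (norm_nonneg a)
    linarith
  rw [opAt_sub D G hB]
  set u := k • h - Q with hud
  set v := V - P with hvd
  set w := k • a + v with hwd
  obtain ⟨b1, b2⟩ := H u hu
  obtain ⟨b3, -⟩ := b2 v
  obtain ⟨-, b4⟩ := b2 a
  obtain ⟨b4, -, -⟩ := b4 Q hQ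
  obtain ⟨-, b5⟩ := b2 w
  obtain ⟨-, b5, -⟩ := b5 Q hQ
  obtain ⟨-, b6⟩ := b2 v
  obtain ⟨-, -, b6⟩ := b6 Q hQ
  replace b6 := b6 w
  obtain ⟨b7, -⟩ := (H Q hQ).2 w
  obtain ⟨b8, -⟩ := b2 Q
  have e1 : opAt D G B V k a P = D a + (2 * k) • B v w + (2 : ℝ) • G w := rfl
  rw [e1]
  set y := ‖θ (D h)‖ with hy
  set yu := ‖θ (D u)‖ with hyud
  set yQ := ‖θ (D Q)‖ with hyQd
  have y0 : 0 ≤ y := norm_nonneg _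
  have yu0 : 0 ≤ yu := norm_nonneg _
  have yQ0 : 0 ≤ yQ := norm_nonneg _
  have a0 : 0 ≤ ‖a‖ := norm_nonneg _
  have v0 : 0 ≤ ‖v‖ := norm_nonneg _
  have w0 : 0 ≤ ‖w‖ := norm_nonneg _
  have Q0 : 0 ≤ ‖Q‖ := norm_nonneg _
  clear_value y yu yQ u v w
  have hT : 0 ≤ y + (1 + ‖a‖) * Y := by positivity
  -- the terms of first order
  have hZ : ‖θ ((2 * k) • (B v u - B w Q - B Q u) + (2 : ℝ) • G u)‖ ≤
      8 * m ^ 4 * ε * (y + (1 + ‖a‖) * Y) := by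
    have c1 : ‖θ (B v u)‖ ≤ m ^ 3 * ε * (y + Y) := by
      refine b3.trans ?_
      calc m * ε * ‖v‖ * yu ≤ m * ε * m * (m * (y + Y)) := by gcongr
        _ = _ := by ring
    have c2 : ‖θ (B w Q)‖ ≤ m ^ 3 * ε * ((1 + ‖a‖) * Y) := by
      refine b7.trans ?_
      calc m * ε * ‖w‖ * yQ ≤ m * ε * (m * (1 + ‖a‖)) * (m * Y) := by gcongr
        _ = _ := by ring
    have c3 : ‖θ (B Q u)‖ ≤ m ^ 3 * ε * (y + Y) := by
      refine b8.trans ?_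
      calc m * ε * ‖Q‖ * yu ≤ m * ε * m * (m * (y + Y)) := by gcongr
        _ = _ := by ring
    have c4 : ‖θ (G u)‖ ≤ m ^ 4 * ε * (y + Y) := by
      refine b1.trans ?_
      calc m * ε ^ 2 * yu ≤ m * ε ^ 2 * (m * (y + Y)) := by gcongr
        _ = (m ^ 2 * (ε * (y + Y))) * ε := by ring
        _ ≤ (m ^ 4 * (ε * (y + Y))) * 1 := by
          have : m ^ 2 ≤ m ^ 4 := pow_le_pow_right₀ hm (by norm_num)
          gcongr
        _ = _ := by ring
    have c5 : ‖θ (B v u - B w Q - B Q u)‖ ≤ m ^ 3 * ε * (2 * (y + Y) + (1 + ‖a‖) * Y) := by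
      rw [map_sub, map_sub]
      refine (norm_sub_le _ _).trans ((add_le_add_left (norm_sub_le _ _) _).trans ?_)
      linarith
    have c6 : y + Y ≤ y + (1 + ‖a‖) * Y := by
      have : 0 ≤ ‖a‖ * Y := by positivity
      linarith
    have c7 : (1 + ‖a‖) * Y ≤ y + (1 + ‖a‖) * Y := by linarith
    rw [map_add, map_smul, map_smul]
    refine (norm_add_le _ _).trans ?_
    rw [norm_smul, norm_smul, Real.norm_eq_abs, Real.norm_eq_abs, abs_of_nonneg (by positivity),
      abs_two]
    calc 2 * k * ‖θ (B v u - B w Q - B Q u)‖ + 2 * ‖θ (G u)‖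
        ≤ 2 * m * (m ^ 3 * ε * (2 * (y + Y) + (1 + ‖a‖) * Y)) + 2 * (m ^ 4 * ε * (y + Y)) := by
          gcongr
      _ = m ^ 4 * ε * (6 * (y + Y) + 2 * ((1 + ‖a‖) * Y)) := by ring
      _ ≤ m ^ 4 * ε * (6 * (y + (1 + ‖a‖) * Y) + 2 * (y + (1 + ‖a‖) * Y)) := by gcongr
      _ = _ := by ring
  -- the terms of second order
  have hN : |inner ℝ (θ (D a + (2 * k) • B v w + (2 : ℝ) • G w)) (θ (-((2 * k) • B Q u)))| ≤
      10 * m ^ 8 * ε ^ 2 * (y + (1 + ‖a‖) * Y) ^ 2 := by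
    have c1 : |inner ℝ (θ (D a)) (θ (B Q u))| ≤ m ^ 5 * ε ^ 2 * (1 + ‖a‖) * (yQ * yu) := by
      refine b4.trans ?_
      calc m * ε ^ 2 * ‖a‖ * yQ * yu = m * ε ^ 2 * ‖a‖ * (yQ * yu) := by ring
        _ ≤ m ^ 5 * ε ^ 2 * (1 + ‖a‖) * (yQ * yu) := by
          have : m ≤ m ^ 5 := le_self_pow₀ hm (by norm_num)
          have : ‖a‖ ≤ 1 + ‖a‖ := by linarith
          gcongr
    have c2 : |inner ℝ (θ (B v w)) (θ (B Q u))| ≤ m ^ 3 * ε ^ 2 * (1 + ‖a‖) * (yQ * yu) := by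
      refine b6.trans ?_
      calc m * ε ^ 2 * ‖v‖ * ‖w‖ * yQ * yu ≤ m * ε ^ 2 * m * (m * (1 + ‖a‖)) * yQ * yu := by
            gcongr
        _ = _ := by ring
    have c3 : |inner ℝ (θ (G w)) (θ (B Q u))| ≤ m ^ 5 * ε ^ 2 * (1 + ‖a‖) * (yQ * yu) := by
      refine b5.trans ?_
      calc m * ε ^ 2 * ‖w‖ * yQ * yu ≤ m * ε ^ 2 * (m * (1 + ‖a‖)) * yQ * yu := by gcongr
        _ = m ^ 2 * ε ^ 2 * (1 + ‖a‖) * (yQ * yu) := by ring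
        _ ≤ m ^ 5 * ε ^ 2 * (1 + ‖a‖) * (yQ * yu) := by
          have : m ^ 2 ≤ m ^ 5 := pow_le_pow_right₀ hm (by norm_num)
          gcongr
    have c4 : |inner ℝ (θ (D a + (2 * k) • B v w + (2 : ℝ) • G w)) (θ (B Q u))| ≤
        5 * m ^ 5 * ε ^ 2 * (1 + ‖a‖) * (yQ * yu) := by
      rw [map_add, map_add, map_smul, map_smul, inner_add_left, inner_add_left,
        real_inner_smul_left, real_inner_smul_left]
      refine (abs_add_le _ _).trans ((add_le_add_left (abs_add_le _ _) _).trans ?_)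
      rw [abs_mul (2 * k), abs_mul (2 : ℝ) (inner ℝ _ _), abs_of_nonneg (show 0 ≤ 2 * k by positivity),
        abs_two]
      have c5 : 2 * k * |inner ℝ (θ (B v w)) (θ (B Q u))| ≤
          2 * m ^ 5 * ε ^ 2 * (1 + ‖a‖) * (yQ * yu) :=
        calc 2 * k * |inner ℝ (θ (B v w)) (θ (B Q u))|
            ≤ 2 * m * (m ^ 3 * ε ^ 2 * (1 + ‖a‖) * (yQ * yu)) := by gcongr
          _ = 2 * m ^ 4 * ε ^ 2 * (1 + ‖a‖) * (yQ * yu) := by ring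
          _ ≤ 2 * m ^ 5 * ε ^ 2 * (1 + ‖a‖) * (yQ * yu) := by
            have : m ^ 4 ≤ m ^ 5 := pow_le_pow_right₀ hm (by norm_num)
            gcongr
      linarith
    rw [map_neg, map_smul, inner_neg_right, abs_neg, real_inner_smul_right, abs_mul,
      abs_of_nonneg (show 0 ≤ 2 * k by positivity)]
    have c6 : (1 + ‖a‖) * Y * (y + Y) ≤ (y + (1 + ‖a‖) * Y) ^ 2 := by
      have : y + Y ≤ y + (1 + ‖a‖) * Y := by
        have : 0 ≤ ‖a‖ * Y := by positivity
        linarith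
      have h2 : (1 + ‖a‖) * Y ≤ y + (1 + ‖a‖) * Y := by linarith
      rw [sq]
      gcongr
    have c7 := c4.trans (mul_le_mul_of_nonneg_left (mul_le_mul hQY hyu yu0 (mul_nonneg m0 hY))
      (show 0 ≤ 5 * m ^ 5 * ε ^ 2 * (1 + ‖a‖) by positivity))
    calc 2 * k * |inner ℝ (θ (D a + (2 * k) • B v w + (2 : ℝ) • G w)) (θ (B Q u))|
        ≤ 2 * m * (5 * m ^ 5 * ε ^ 2 * (1 + ‖a‖) * ((m * Y) * (m * (y + Y)))) :=
          mul_le_mul (by linarith) c7 (abs_nonneg _) (by positivity)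
      _ = 10 * m ^ 8 * ε ^ 2 * ((1 + ‖a‖) * Y * (y + Y)) := by ring
      _ ≤ _ := by gcongr
  have hsq : (y + (1 + ‖a‖) * Y) ^ 2 ≤ 3 * (y ^ 2 + (1 + ‖a‖ ^ 2) * Y ^ 2) := by
    linarith [sq_nonneg (y - Y), sq_nonneg (y - ‖a‖ * Y), sq_nonneg (Y - ‖a‖ * Y)]
  have hZ2 := pow_le_pow_left₀ (norm_nonneg _) hZ 2
  rw [map_add]
  have h1 := half_norm_sq_sub_le (θ (D h))
    (θ ((2 * k) • (B v u - B w Q - B Q u) + (2 : ℝ) • G u))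
  rw [← hy] at h1
  have h2 := (abs_le.1 hN).1
  -- 84 = 64 + 2 · 10 combines the squared first order terms with twice the second order pairing;
  -- the factor 3 from `hsq` makes 252.
  have h3 : 84 * m ^ 8 * ε ^ 2 * (y + (1 + ‖a‖) * Y) ^ 2 ≤
      84 * m ^ 8 * ε ^ 2 * (3 * (y ^ 2 + (1 + ‖a‖ ^ 2) * Y ^ 2)) := by gcongr
  have h4 : (8 * m ^ 4 * ε * (y + (1 + ‖a‖) * Y)) ^ 2 =
      64 * m ^ 8 * ε ^ 2 * (y + (1 + ‖a‖) * Y) ^ 2 := by ring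
  rw [h4] at hZ2
  linarith

/-- The lower bound of the remainder of the first order expansion of the weighted square norm. -/
theorem remainder_lower_bound [CompleteSpace E] [CompleteSpace L] {E₀ : Submodule ℝ E}
    {D G : E →L[ℝ] L} {B : E →L[ℝ] E →L[ℝ] L} (hB : ∀ a c, B a c = B c a) {θ : L →L[ℝ] L} {m ε : ℝ}
    (H : WeightedBounds E₀ D G B θ m ε) (hm : 1 ≤ m) (hε : 0 ≤ ε) (hk₀ : 0 ≤ k₀) (h01 : k₀ ≤ k₁)
    (hk₁ : k₁ ≤ m) (hkm : Real.sqrt (k₁ - k₀) ≤ m)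
    (hεm : 252 * m ^ 8 * ε ^ 2 * (1 + (k₁ - k₀) + m ^ 2) ≤ 1 / 4)
    {V : E} {q h : Lp E 2 (volume.restrict (Icc k₀ k₁))} {Φ : Lp E 2 (volume.restrict (Icc k₀ k₁)) →
      Lp L 2 (volume.restrict (Icc k₀ k₁))}
    (hΦ : ∀ q, ∀ᵐ k ∂(volume.restrict (Icc k₀ k₁)),
      Φ q k = opAt D G B V k (q k) (∫ κ in k..k₁, q κ))
    {N : Lp L 2 (volume.restrict (Icc k₀ k₁))}
    (hN : ∀ᵐ k ∂(volume.restrict (Icc k₀ k₁)),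
      N k = -((2 * k) • B (∫ κ in k..k₁, h κ) (k • h k - ∫ κ in k..k₁, h κ)))
    (hh : ∀ᵐ k ∂(volume.restrict (Icc k₀ k₁)), h k ∈ E₀)
    (hQ : ∀ᵐ k ∂(volume.restrict (Icc k₀ k₁)), ∫ κ in k..k₁, h κ ∈ E₀)
    (hq : ‖q‖ ≤ m) (hVq : ‖V‖ + Real.sqrt (k₁ - k₀) * ‖q‖ ≤ m)
    (hhm : Real.sqrt (k₁ - k₀) * ‖h‖ ≤ m) :
    1 / 4 * ‖(θ.comp D).compLpL 2 _ h‖ ^ 2 ≤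
      ‖θ.compLpL 2 _ (Φ (q + h) - Φ q)‖ ^ 2 +
        2 * inner ℝ (θ.compLpL 2 _ (Φ q)) (θ.compLpL 2 _ N) := by
  have m0 : 0 ≤ m := by linarith
  -- The smallness condition already implies ε ≤ 1, since its other factors are at least 1.
  have hε1 : ε ≤ 1 := by
    have h1 : 1 ≤ m ^ 8 := one_le_pow₀ hm
    have h2 : 1 ≤ 1 + (k₁ - k₀) + m ^ 2 := by nlinarith
    have h3 : (1 : ℝ) * ε ^ 2 * 1 ≤ 252 * m ^ 8 * ε ^ 2 * (1 + (k₁ - k₀) + m ^ 2) := by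
      gcongr
      linarith
    nlinarith
  set Dh := (θ.comp D).compLpL 2 (volume.restrict (Icc k₀ k₁)) h with hDh
  set Y := ‖Dh‖ with hYd
  have hY : 0 ≤ Y := norm_nonneg _
  have hDhk : ∀ᵐ k ∂(volume.restrict (Icc k₀ k₁)), Dh k = θ (D (h k)) :=
    (θ.comp D).coeFn_compLpL h
  have hY2 : Y ^ 2 = ∫ k in Icc k₀ k₁, ‖Dh k‖ ^ 2 := Lp_norm_sq_eq_integral _
  clear_value Y Dh
  have i4 : Integrable (fun k =>
      ‖θ.compLpL 2 (volume.restrict (Icc k₀ k₁)) (Φ (q + h) - Φ q) k‖ ^ 2)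
      (volume.restrict (Icc k₀ k₁)) := Lp_integrable_norm_sq _
  have i5 : Integrable (fun k => 2 * inner ℝ (θ.compLpL 2 (volume.restrict (Icc k₀ k₁)) (Φ q) k)
      (θ.compLpL 2 (volume.restrict (Icc k₀ k₁)) N k)) (volume.restrict (Icc k₀ k₁)) :=
    (L2.integrable_inner _ _).const_mul 2
  rw [Lp_norm_sq_eq_integral (θ.compLpL 2 _ _), L2.inner_def, ← integral_const_mul,
    ← integral_add i4 i5]
  have hlow : ∀ᵐ k ∂(volume.restrict (Icc k₀ k₁)),
      1 / 2 * ‖Dh k‖ ^ 2 - 252 * m ^ 8 * ε ^ 2 * (‖Dh k‖ ^ 2 + (1 + ‖q k‖ ^ 2) * Y ^ 2) ≤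
      ‖θ.compLpL 2 (volume.restrict (Icc k₀ k₁)) (Φ (q + h) - Φ q) k‖ ^ 2 +
        2 * inner ℝ (θ.compLpL 2 (volume.restrict (Icc k₀ k₁)) (Φ q) k)
          (θ.compLpL 2 (volume.restrict (Icc k₀ k₁)) N k) := by
    filter_upwards [hDhk, θ.coeFn_compLpL (Φ (q + h) - Φ q), Lp.coeFn_sub (Φ (q + h)) (Φ q),
      hΦ (q + h), hΦ q, θ.coeFn_compLpL (Φ q), θ.coeFn_compLpL N, hN, hh, hQ, Lp.coeFn_add q h,
      ae_mem_Icc] with k e1 e2 e3 e4 e5 e6 e7 e8 hhk hQk e9 hk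
    rw [e2, e3, Pi.sub_apply, e4, e5, e6, e5, e7, e8, e1, e9, Pi.add_apply, primitive_add q h hk]
    refine opAt_lower_bound hB H hm hε hε1 (hk₀.trans hk.1) (hk.2.trans hk₁) hY hhk hQk ?_ ?_ ?_
    · exact (norm_sub_le _ _).trans ((add_le_add_right (norm_primitive_le q hk) _).trans hVq)
    · exact (norm_primitive_le h hk).trans hhm
    -- θ and D do not involve k and commute with the integral. The weighted norm of D ∫_k h is thus
    -- at most √(k₁ - k₀) times the global weighted norm of D h.
    · have := norm_primitive_le Dh hk
      have e := primitive_comp (θ.comp D) h hk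
      simp only [ContinuousLinearMap.comp_apply] at e
      rw [primitive_congr hDhk hk, e, ← hYd] at this
      exact this.trans (mul_le_mul_of_nonneg_right hkm hY)
  have i1 : Integrable (fun k => 1 / 2 * ‖Dh k‖ ^ 2) (volume.restrict (Icc k₀ k₁)) :=
    (Lp_integrable_norm_sq Dh).const_mul _
  have i2 : Integrable (fun k => (1 + ‖q k‖ ^ 2) * Y ^ 2) (volume.restrict (Icc k₀ k₁)) :=
    ((integrable_const 1).add (Lp_integrable_norm_sq q)).mul_const _
  have i3 : Integrable (fun k => 252 * m ^ 8 * ε ^ 2 *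
      (‖Dh k‖ ^ 2 + (1 + ‖q k‖ ^ 2) * Y ^ 2)) (volume.restrict (Icc k₀ k₁)) :=
    ((Lp_integrable_norm_sq Dh).add i2).const_mul _
  have key := integral_mono_ae (i1.sub i3) (i4.add i5) hlow
  -- Integrating 1 + ‖q(k)‖² over k produces (k₁ - k₀) + ‖q‖², which explains the last factor in the
  -- smallness condition.
  have e : ∫ k in Icc k₀ k₁, (1 / 2 * ‖Dh k‖ ^ 2 - 252 * m ^ 8 * ε ^ 2 *
      (‖Dh k‖ ^ 2 + (1 + ‖q k‖ ^ 2) * Y ^ 2)) =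
      1 / 2 * Y ^ 2 - 252 * m ^ 8 * ε ^ 2 * (Y ^ 2 + ((k₁ - k₀) + ‖q‖ ^ 2) * Y ^ 2) := by
    rw [integral_sub i1 i3, integral_const_mul, integral_const_mul, integral_add (Lp_integrable_norm_sq Dh) i2,
      integral_mul_const, integral_add (integrable_const 1) (Lp_integrable_norm_sq q), ← hY2,
      ← Lp_norm_sq_eq_integral]
    simp [h01]
  refine le_trans (le_of_le_of_eq ?_ e.symm) key
  have h1 : ‖q‖ ^ 2 ≤ m ^ 2 := pow_le_pow_left₀ (norm_nonneg _) hq 2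
  have h2 : 252 * m ^ 8 * ε ^ 2 * (Y ^ 2 + ((k₁ - k₀) + ‖q‖ ^ 2) * Y ^ 2) ≤
      252 * m ^ 8 * ε ^ 2 * (Y ^ 2 + ((k₁ - k₀) + m ^ 2) * Y ^ 2) := by gcongr
  have h3 := mul_le_mul_of_nonneg_right hεm (sq_nonneg Y)
  linarith

end


/-! ### The functional as the weighted square norm of a quadratic map -/

section

variable {b ξ d s ν k₀ k₁ : ℝ}

/-- A weak derivative is a bounded operator on H³ and hence commutes with the integral over the
wavenumber. -/
theorem gradv_eq {Ω : Set Pt} (V : Sob Ω 3) (q : Hk Ω k₀ k₁ 3) {k : ℝ} (hk : k ∈ Icc k₀ k₁)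
    (i : Fin 3) : gradv V q k i = wD1 (V - ∫ κ in k..k₁, q κ) i := by
  have h := primitive_comp (wDL Ω 3 (Pi.single i 1)) q hk
  simp only [wDL_apply] at h
  have h2 := map_sub (wDL Ω 3 (Pi.single i 1)) V (∫ κ in k..k₁, q κ)
  simp only [wDL_apply] at h2
  rw [wD1, h2, ← h]
  rfl

theorem gradMul_ae_eq (hb : 0 < b) (hlt : -ξ < d)
    {B : Sob (box b ξ d) 3 →L[ℝ] Sob (box b ξ d) 3 →L[ℝ] L2 (box b ξ d)}
    (hB : ∀ u v, B u v = ∑ i, mulL (wD1 u i) (wD1 v i)) (u v : Sob (box b ξ d) 3) :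
    ∀ᵐ x ∂(volume.restrict (box b ξ d)), B u v x = ∑ i, wD1 u i x * wD1 v i x := by
  obtain ⟨K, -, H⟩ := exists_mul_grad_bound (ξ := ξ) (d := d) hb hlt
  have h := fun i => coeFn_mulL (H u v i i).1
  rw [hB, Fin.sum_univ_three]
  filter_upwards [h 0, h 1, h 2,
    Lp.coeFn_add (mulL (wD1 u 0) (wD1 v 0) + mulL (wD1 u 1) (wD1 v 1)) (mulL (wD1 u 2) (wD1 v 2)),
    Lp.coeFn_add (mulL (wD1 u 0) (wD1 v 0)) (mulL (wD1 u 1) (wD1 v 1))] with x h0 h1 h2 h3 h4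
  rw [h3, Pi.add_apply, h4, Pi.add_apply, h0, h1, h2, Fin.sum_univ_three]

theorem gradMul_comm {Ω : Set Pt} {B : Sob Ω 3 →L[ℝ] Sob Ω 3 →L[ℝ] L2 Ω}
    (hB : ∀ u v, B u v = ∑ i, mulL (wD1 u i) (wD1 v i)) (u v : Sob Ω 3) : B u v = B v u := by
  rw [hB, hB]
  exact Finset.sum_congr rfl fun i _ => mulL_comm _ _

theorem opL_ae_eq (hb : 0 < b) (hlt : -ξ < d)
    {B : Sob (box b ξ d) 3 →L[ℝ] Sob (box b ξ d) 3 →L[ℝ] L2 (box b ξ d)}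
    (hB : ∀ u v, B u v = ∑ i, mulL (wD1 u i) (wD1 v i)) (V : Sob (box b ξ d) 3)
    (q : Hk (box b ξ d) k₀ k₁ 3) {k : ℝ} (hk : k ∈ Icc k₀ k₁) :
    ∀ᵐ x ∂(volume.restrict (box b ξ d)), opL V q k x =
      opAt (lapL _ 3) (imDz _ 3) B V k (q k) (∫ κ in k..k₁, q κ) x := by
  set v := V - ∫ κ in k..k₁, q κ with hv
  have hw : ∀ i, wD1 (k • q k + v) i = k • wD1 (q k) i + wD1 v i := fun i => by
    rw [wD1, wD_add, wD_smul]; rfl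
  have hwx : ∀ i, ∀ᵐ x ∂(volume.restrict (box b ξ d)),
      wD1 (k • q k + v) i x = (k : ℂ) * wD1 (q k) i x + wD1 v i x := fun i => by
    rw [hw]
    filter_upwards [Lp.coeFn_add (k • wD1 (q k) i) (wD1 v i), Lp.coeFn_smul k (wD1 (q k) i)] with
      x h1 h2
    rw [h1, Pi.add_apply, h2, Pi.smul_apply, Complex.real_smul]
  unfold opAt
  rw [lapL_apply, imDz_apply, ← hv]
  filter_upwards [gradMul_ae_eq hb hlt hB v (k • q k + v), hwx 0, hwx 1, hwx 2,
    Lp.coeFn_add (lap (q k) + (2 * k) • B v (k • q k + v))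
      ((2 : ℝ) • (Complex.I • wD1 (k • q k + v) 2)),
    Lp.coeFn_add (lap (q k)) ((2 * k) • B v (k • q k + v)),
    Lp.coeFn_smul (2 * k) (B v (k • q k + v)),
    Lp.coeFn_smul (2 : ℝ) (Complex.I • wD1 (k • q k + v) 2),
    Lp.coeFn_smul Complex.I (wD1 (k • q k + v) 2)] with x h1 w0 w1 w2 h2 h3 h4 h5 h6
  rw [h2, Pi.add_apply, h3, Pi.add_apply, h4, Pi.smul_apply, h5, Pi.smul_apply, h6, Pi.smul_apply,
    h1, opL]
  simp only [gradv_eq V q hk, ← hv, Fin.sum_univ_three, w0, w1, w2, Complex.real_smul, smul_eq_mul]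
  push_cast
  ring

theorem integrable_theta_sq {lam : ℝ} (hs : ξ < s) (hν : 0 ≤ ν) (hlam : 0 ≤ lam)
    (f : L2 (box b ξ d)) :
    Integrable (fun x => ‖f x‖ ^ 2 * cwf s ν lam (x 2) ^ 2) (volume.restrict (box b ξ d)) := by
  have h := (memLp_two_iff_integrable_sq_norm (Lp.aestronglyMeasurable
    (theta hs hν hlam f))).1 (Lp.memLp _)
  refine h.congr ?_
  filter_upwards [coeFn_theta hs hν hlam f] with x hx
  rw [hx, norm_smul, Real.norm_eq_abs, mul_pow, sq_abs, mul_comm]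

/-- The pointwise expression for the operator agrees almost everywhere with an element of L² over k
with values in L²(Ω). Convergence of the double integral is therefore automatic. -/
theorem functional_eq (hb : 0 < b) (hlt : -ξ < d) (hs : ξ < s) (hν : 0 ≤ ν) {lam : ℝ}
    (hlam : 0 ≤ lam) {B : Sob (box b ξ d) 3 →L[ℝ] Sob (box b ξ d) 3 →L[ℝ] L2 (box b ξ d)}
    (hB : ∀ u v, B u v = ∑ i, mulL (wD1 u i) (wD1 v i)) (V : Sob (box b ξ d) 3)
    {Φ : Hk (box b ξ d) k₀ k₁ 3 → Lp (L2 (box b ξ d)) 2 (volume.restrict (Icc k₀ k₁))}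
    (hΦ : ∀ q, ∀ᵐ k ∂(volume.restrict (Icc k₀ k₁)),
      Φ q k = opAt (lapL _ 3) (imDz _ 3) B V k (q k) (∫ κ in k..k₁, q κ))
    (F : Hk (box b ξ d) k₀ k₁ 4) (p : Hk0 b ξ d k₀ k₁ 3) :
    IntegralConverges b ξ d s ν k₀ k₁ lam V F p ∧ ∀ ρ, J b ξ d s ν k₀ k₁ lam ρ V F p =
      Real.exp (-2 * lam * (s + d) ^ (-ν)) *
        ‖(theta hs hν hlam).compLpL 2 _ (Φ (p.1 + kincl (by norm_num) F))‖ ^ 2 + ρ * ‖p‖ ^ 2 := by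
  set q : Hk (box b ξ d) k₀ k₁ 3 := p.1 + kincl (by norm_num) F with hq
  have hae : ∀ᵐ k ∂(volume.restrict (Icc k₀ k₁)),
      integrandJ b ξ d s ν k₀ k₁ lam V F p k =ᵐ[volume.restrict (box b ξ d)]
        fun x => ‖Φ q k x‖ ^ 2 * cwf s ν lam (x 2) ^ 2 := by
    filter_upwards [hΦ q, ae_mem_Icc] with k h1 hk
    filter_upwards [opL_ae_eq hb hlt hB V q hk] with x hx
    rw [integrandJ, ← hq, hx, h1]
  have hin : ∀ᵐ k ∂(volume.restrict (Icc k₀ k₁)),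
      ∫ x in box b ξ d, integrandJ b ξ d s ν k₀ k₁ lam V F p k x =
        ‖(theta hs hν hlam).compLpL 2 (volume.restrict (Icc k₀ k₁)) (Φ q) k‖ ^ 2 := by
    filter_upwards [hae, (theta hs hν hlam).coeFn_compLpL (Φ q)] with k h1 h2
    rw [h2, integral_congr_ae h1, norm_theta_sq]
  refine ⟨⟨?_, ?_⟩, fun ρ => ?_⟩
  · filter_upwards [hae] with k h1
    exact (integrable_theta_sq hs hν hlam (Φ q k)).congr h1.symm
  · exact (Lp_integrable_norm_sq ((theta hs hν hlam).compLpL 2 _ (Φ q))).congr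
      (Filter.EventuallyEq.symm hin)
  · rw [J, integral_congr_ae hin, Lp_norm_sq_eq_integral]

/-! ### Lower bounds by unweighted norms -/

/-- On Ω, exp(-2λ(s + d)^(-ν)) φ_λ ≥ 1 because the weight is smallest at z = d, and the remaining
factor φ_λ is at least 1. -/
theorem norm_sq_le_theta {lam : ℝ} (hs : ξ < s) (hν : 0 ≤ ν) (hlam : 0 ≤ lam)
    (f : L2 (box b ξ d)) :
    ‖f‖ ^ 2 ≤ Real.exp (-2 * lam * (s + d) ^ (-ν)) * ‖theta hs hν hlam f‖ ^ 2 := by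
  rw [norm_theta_sq, Lp_norm_sq_eq_integral, ← integral_const_mul]
  refine integral_mono_ae (memLp_two_iff_integrable_sq_norm (Lp.aestronglyMeasurable f) |>.1
    (Lp.memLp f)) ((integrable_theta_sq hs hν hlam f).const_mul _) ?_
  filter_upwards [ae_restrict_mem (measurableSet_box b ξ d)] with x hx
  have hz : 0 < x 2 + s := by linarith [hx.2.2.1]
  have h1 : Real.exp (2 * lam * (s + d) ^ (-ν)) ≤ cwf s ν lam (x 2) :=
    le_cwf hν hlam hz (by linarith [hx.2.2.2])
  have h2 : 1 ≤ cwf s ν lam (x 2) := by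
    refine le_trans (Real.one_le_exp ?_) h1
    have : 0 ≤ (s + d) ^ (-ν) := Real.rpow_nonneg (by linarith [hx.2.2.1, hx.2.2.2]) _
    positivity
  have h3 : 1 ≤ Real.exp (-2 * lam * (s + d) ^ (-ν)) * cwf s ν lam (x 2) ^ 2 :=
    calc (1 : ℝ) = Real.exp (-2 * lam * (s + d) ^ (-ν)) *
          Real.exp (2 * lam * (s + d) ^ (-ν)) * 1 := by
          rw [← Real.exp_add]; simp
      _ ≤ Real.exp (-2 * lam * (s + d) ^ (-ν)) * cwf s ν lam (x 2) * cwf s ν lam (x 2) := by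
          gcongr
      _ = _ := by ring
  calc ‖f x‖ ^ 2 = ‖f x‖ ^ 2 * 1 := (mul_one _).symm
    _ ≤ ‖f x‖ ^ 2 * (Real.exp (-2 * lam * (s + d) ^ (-ν)) * cwf s ν lam (x 2) ^ 2) := by gcongr
    _ = _ := by ring

theorem multiIdx_one_cases {α : Fin 3 → ℕ} (h : α ∈ multiIdx 1) :
    α = 0 ∨ ∃ i, α = Pi.single i 1 := by
  revert α; decide +kernel

theorem multiIdx_two_cases {α : Fin 3 → ℕ} (h : α ∈ multiIdx 2) :
    α = 0 ∨ (∃ i, α = Pi.single i 1) ∨ ∃ i j, α = Pi.single i 1 + Pi.single j 1 := by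
  revert α; decide +kernel

theorem norm_incl_one_sq_le {Ω : Set Pt} {m : ℕ} (hm : 1 ≤ m) (u : Sob Ω m) :
    ‖incl hm u‖ ^ 2 ≤ (multiIdx 1).card * (∑ i, ‖wD1 u i‖ ^ 2 + ‖wD u 0‖ ^ 2) := by
  rw [sob_norm_sq, ← nsmul_eq_mul]
  refine Finset.sum_le_card_nsmul _ _ _ fun α hα => ?_
  rw [wD_incl hm u hα]
  have h1 : 0 ≤ ∑ i, ‖wD1 u i‖ ^ 2 := Finset.sum_nonneg fun i _ => sq_nonneg _
  rcases multiIdx_one_cases hα with rfl | ⟨i, rfl⟩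
  · linarith
  · have := Finset.single_le_sum (f := fun i => ‖wD1 u i‖ ^ 2) (fun _ _ => sq_nonneg _)
      (Finset.mem_univ i)
    simp only [wD1] at this h1 ⊢
    linarith [sq_nonneg ‖wD u 0‖]

theorem norm_incl_two_sq_le {Ω : Set Pt} {m : ℕ} (hm : 2 ≤ m) (u : Sob Ω m) :
    ‖incl hm u‖ ^ 2 ≤ (multiIdx 2).card *
      (∑ i, ∑ j, ‖wD2 u i j‖ ^ 2 + ∑ i, ‖wD1 u i‖ ^ 2 + ‖wD u 0‖ ^ 2) := by
  rw [sob_norm_sq, ← nsmul_eq_mul]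
  refine Finset.sum_le_card_nsmul _ _ _ fun α hα => ?_
  rw [wD_incl hm u hα]
  have h0 := sq_nonneg ‖wD u 0‖
  have h1 : 0 ≤ ∑ i, ‖wD1 u i‖ ^ 2 := Finset.sum_nonneg fun i _ => sq_nonneg _
  have h2 : 0 ≤ ∑ i, ∑ j, ‖wD2 u i j‖ ^ 2 :=
    Finset.sum_nonneg fun i _ => Finset.sum_nonneg fun j _ => sq_nonneg _
  rcases multiIdx_two_cases hα with rfl | ⟨i, rfl⟩ | ⟨i, j, rfl⟩
  · linarith
  · have := Finset.single_le_sum (f := fun i => ‖wD1 u i‖ ^ 2) (fun _ _ => sq_nonneg _)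
      (Finset.mem_univ i)
    simp only [wD1] at this h1 ⊢
    linarith
  · have h3 := Finset.single_le_sum (f := fun j => ‖wD2 u i j‖ ^ 2) (fun _ _ => sq_nonneg _)
      (Finset.mem_univ j)
    have h4 := Finset.single_le_sum (f := fun i => ∑ j, ‖wD2 u i j‖ ^ 2)
      (fun _ _ => Finset.sum_nonneg fun j _ => sq_nonneg _) (Finset.mem_univ i)
    simp only [wD2] at h2 h3 h4 ⊢
    linarith

theorem norm_kincl_sq_le {Ω : Set Pt} {m n : ℕ} (h : m ≤ n) (f : Hk Ω k₀ k₁ n) {c : ℝ}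
    {g : Lp (L2 Ω) 2 (volume.restrict (Icc k₀ k₁))}
    (H : ∀ᵐ k ∂(volume.restrict (Icc k₀ k₁)), ‖incl h (f k)‖ ^ 2 ≤ c * ‖g k‖ ^ 2) :
    ‖kincl h f‖ ^ 2 ≤ c * ‖g‖ ^ 2 := by
  rw [Lp_norm_sq_eq_integral, Lp_norm_sq_eq_integral, ← integral_const_mul]
  refine integral_mono_ae (Lp_integrable_norm_sq _) ((Lp_integrable_norm_sq g).const_mul c) ?_
  filter_upwards [H, (incl h).coeFn_compLpL (p := 2) (μ := volume.restrict (Icc k₀ k₁)) f] with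
    k h1 h2
  rw [kincl, h2]
  exact h1

theorem norm_kincl_le {Ω : Set Pt} {m n : ℕ} (h : m ≤ n) (f : Hk Ω k₀ k₁ n) :
    ‖kincl h f‖ ≤ ‖f‖ := by
  refine Lp.norm_le_norm_of_ae_le ?_
  filter_upwards [(incl h).coeFn_compLpL (p := 2) (μ := volume.restrict (Icc k₀ k₁)) f] with k h2
  rw [kincl, h2]
  exact norm_incl_le h _

/-- The weighted norm of the Laplacian bounds the unweighted norms of `H_2` and `H_1`. -/
theorem exists_norm_kincl_le (hb : 0 < b) (hlt : -ξ < d) (hs : ξ < s) (hν : 0 < ν) :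
    ∃ C : ℝ, 0 < C ∧ ∀ (lam : ℝ) (_ : 1 ≤ lam) (hlam : 0 ≤ lam) (k₀ k₁ : ℝ),
      ∀ h : Hk0 b ξ d k₀ k₁ 3,
      C / lam * ‖kincl (m := 2) (by norm_num) h.1‖ ^ 2 ≤
        Real.exp (-2 * lam * (s + d) ^ (-ν)) *
          ‖((theta hs hν.le hlam).comp (lapL _ 3)).compLpL 2 _ h.1‖ ^ 2 ∧
      C * ‖kincl (m := 1) (by norm_num) h.1‖ ^ 2 ≤
        Real.exp (-2 * lam * (s + d) ^ (-ν)) *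
          ‖((theta hs hν.le hlam).comp (lapL _ 3)).compLpL 2 _ h.1‖ ^ 2 := by
  obtain ⟨C, hC, H⟩ := carleman_theta (b := b) (d := d) hb hlt hs hν
  -- Counts the multi-indices of both embeddings, so that one constant serves the two bounds.
  set n : ℝ := (multiIdx 1).card + (multiIdx 2).card with hn
  have n1 : (0 : ℝ) < (multiIdx 1).card :=
    Nat.cast_pos.2 (Finset.card_pos.2 ⟨0, zero_mem_multiIdx 1⟩)
  have n2 : (0 : ℝ) ≤ (multiIdx 2).card := Nat.cast_nonneg _
  have n0 : 0 < n := by linarith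
  refine ⟨C / n, by positivity, fun lam h1 hlam k₀ k₁ h => ?_⟩
  have l0 : 0 < lam := by linarith
  set e := Real.exp (-2 * lam * (s + d) ^ (-ν)) with he
  have e0 : 0 < e := Real.exp_pos _
  have hpt : ∀ u ∈ Sob0 b ξ d 3,
      ‖incl (show 2 ≤ 3 by norm_num) u‖ ^ 2 ≤
        n * (lam / C) * e * ‖theta hs hν.le hlam (lap u)‖ ^ 2 ∧
      ‖incl (show 1 ≤ 3 by norm_num) u‖ ^ 2 ≤
        n * (1 / C) * e * ‖theta hs hν.le hlam (lap u)‖ ^ 2 := by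
    intro u hu
    have hc := mul_le_mul_of_nonneg_left (H lam h1 hlam 3 (by norm_num) u hu) e0.le
    have t2 : ∑ i, ∑ j, ‖wD2 u i j‖ ^ 2 ≤ e * ∑ i, ∑ j, ‖theta hs hν.le hlam (wD2 u i j)‖ ^ 2 := by
      rw [Finset.mul_sum]
      refine Finset.sum_le_sum fun i _ => ?_
      rw [Finset.mul_sum]
      exact Finset.sum_le_sum fun j _ => norm_sq_le_theta hs hν.le hlam _
    have t1 : ∑ i, ‖wD1 u i‖ ^ 2 ≤ e * ∑ i, ‖theta hs hν.le hlam (wD1 u i)‖ ^ 2 := by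
      rw [Finset.mul_sum]
      exact Finset.sum_le_sum fun j _ => norm_sq_le_theta hs hν.le hlam _
    have t0 : ‖wD u 0‖ ^ 2 ≤ e * ‖theta hs hν.le hlam (wD u 0)‖ ^ 2 :=
      norm_sq_le_theta hs hν.le hlam _
    have i2 := norm_incl_two_sq_le (show 2 ≤ 3 by norm_num) u
    have i1 := norm_incl_one_sq_le (show 1 ≤ 3 by norm_num) u
    have s2 : 0 ≤ ∑ i, ∑ j, ‖wD2 u i j‖ ^ 2 :=
      Finset.sum_nonneg fun i _ => Finset.sum_nonneg fun j _ => sq_nonneg _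
    have s1 : 0 ≤ ∑ i, ‖wD1 u i‖ ^ 2 := Finset.sum_nonneg fun i _ => sq_nonneg _
    have s0 := sq_nonneg ‖wD u 0‖
    generalize ∑ i, ∑ j, ‖theta hs hν.le hlam (wD2 u i j)‖ ^ 2 = T2 at hc t2
    generalize ∑ i, ‖theta hs hν.le hlam (wD1 u i)‖ ^ 2 = T1 at hc t1
    generalize ‖theta hs hν.le hlam (wD u 0)‖ ^ 2 = T0 at hc t0
    generalize ‖theta hs hν.le hlam (lap u)‖ ^ 2 = Y at hc ⊢
    generalize ∑ i, ∑ j, ‖wD2 u i j‖ ^ 2 = S2 at t2 i2 s2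
    generalize ∑ i, ‖wD1 u i‖ ^ 2 = S1 at t1 i2 i1 s1
    generalize ‖wD u 0‖ ^ 2 = S0 at t0 i2 i1 s0
    have hl : 1 / lam ≤ 1 := by rw [div_le_one l0]; exact h1
    have hl3 : 1 ≤ lam ^ 3 := one_le_pow₀ h1
    have k2 : C / lam * S2 ≤ e * (C / lam * T2) := by
      have := mul_le_mul_of_nonneg_left t2 (show 0 ≤ C / lam by positivity); linarith
    have k1 : C * lam * S1 ≤ e * (C * lam * T1) := by
      have := mul_le_mul_of_nonneg_left t1 (show 0 ≤ C * lam by positivity); linarith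
    have k0 : C * lam ^ 3 * S0 ≤ e * (C * lam ^ 3 * T0) := by
      have := mul_le_mul_of_nonneg_left t0 (show 0 ≤ C * lam ^ 3 by positivity); linarith
    have m1 : C * S1 ≤ C * lam * S1 := by
      have := mul_le_mul_of_nonneg_left h1 (mul_nonneg hC.le s1); linarith
    have m0 : C * S0 ≤ C * lam ^ 3 * S0 := by
      have := mul_le_mul_of_nonneg_left hl3 (mul_nonneg hC.le s0); linarith
    have m1' : C / lam * S1 ≤ C * S1 := by
      have := mul_le_mul_of_nonneg_left hl (mul_nonneg hC.le s1)
      calc C / lam * S1 = C * S1 * (1 / lam) := by ring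
        _ ≤ _ := by linarith
    have m0' : C / lam * S0 ≤ C * S0 := by
      have := mul_le_mul_of_nonneg_left hl (mul_nonneg hC.le s0)
      calc C / lam * S0 = C * S0 * (1 / lam) := by ring
        _ ≤ _ := by linarith
    -- The second derivatives carry 1/λ in the Carleman estimate, and this weakest coefficient
    -- governs the H² bound. For H¹ the coefficients λ and λ³ are at least 1, so no λ is lost.
    have r2 : S2 + S1 + S0 ≤ lam / C * (e * Y) := by
      have : C / lam * (S2 + S1 + S0) ≤ e * Y := by linarith
      calc S2 + S1 + S0 = lam / C * (C / lam * (S2 + S1 + S0)) := by field_simp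
        _ ≤ _ := by gcongr
    have r1 : S1 + S0 ≤ 1 / C * (e * Y) := by
      have k2' : 0 ≤ C / lam * S2 := by positivity
      have : C * (S1 + S0) ≤ e * Y := by linarith
      calc S1 + S0 = 1 / C * (C * (S1 + S0)) := by field_simp
        _ ≤ _ := by gcongr
    constructor
    · refine i2.trans ?_
      calc _ ≤ n * (S2 + S1 + S0) := mul_le_mul_of_nonneg_right (by linarith) (by positivity)
        _ ≤ n * (lam / C * (e * Y)) := by gcongr
        _ = _ := by ring
    · refine i1.trans ?_
      calc _ ≤ n * (S1 + S0) := mul_le_mul_of_nonneg_right (by linarith) (by positivity)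
        _ ≤ n * (1 / C * (e * Y)) := by gcongr
        _ = _ := by ring
  have hg : ∀ᵐ k ∂(volume.restrict (Icc k₀ k₁)),
      ((theta hs hν.le hlam).comp (lapL _ 3)).compLpL 2 (volume.restrict (Icc k₀ k₁)) h.1 k =
        theta hs hν.le hlam (lap (h.1 k)) := by
    filter_upwards [((theta hs hν.le hlam).comp (lapL (box b ξ d) 3)).coeFn_compLpL (p := 2)
      (μ := volume.restrict (Icc k₀ k₁)) h.1] with k hk
    rw [hk, ContinuousLinearMap.comp_apply, lapL_apply]
  have hh : ∀ᵐ k ∂(volume.restrict (Icc k₀ k₁)), h.1 k ∈ Sob0 b ξ d 3 := h.2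
  have f2 := norm_kincl_sq_le (show 2 ≤ 3 by norm_num) h.1
    (c := n * (lam / C) * e)
    (g := ((theta hs hν.le hlam).comp (lapL _ 3)).compLpL 2 (volume.restrict (Icc k₀ k₁)) h.1) (by
      filter_upwards [hg, hh] with k h3 h4
      rw [h3]; exact (hpt _ h4).1)
  have f1 := norm_kincl_sq_le (show 1 ≤ 3 by norm_num) h.1
    (c := n * (1 / C) * e)
    (g := ((theta hs hν.le hlam).comp (lapL _ 3)).compLpL 2 (volume.restrict (Icc k₀ k₁)) h.1) (by
      filter_upwards [hg, hh] with k h3 h4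
      rw [h3]; exact (hpt _ h4).2)
  generalize ‖((theta hs hν.le hlam).comp (lapL _ 3)).compLpL 2
    (volume.restrict (Icc k₀ k₁)) h.1‖ ^ 2 = Y at f1 f2 ⊢
  constructor
  · calc _ ≤ C / n / lam * (n * (lam / C) * e * Y) :=
          mul_le_mul_of_nonneg_left f2 (by positivity)
      _ = _ := by field_simp
  · calc _ ≤ C / n * (n * (1 / C) * e * Y) := mul_le_mul_of_nonneg_left f1 (by positivity)
      _ = _ := by field_simp

end


/-! ### Strict convexity -/

section

variable {b ξ d s ν k₀ k₁ : ℝ}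

/-- The graph lies strictly above its tangent plane at the intermediate point. In the convex
combination of the two inequalities the linear terms cancel. -/
theorem strictConvexOn_of_gradient {X : Type*} [NormedAddCommGroup X] [InnerProductSpace ℝ X]
    {S : Set X} (hS : Convex ℝ S) {f : X → ℝ} {f' : X → X}
    (h : ∀ x ∈ S, ∀ y ∈ S, x ≠ y → 0 < f y - f x - inner ℝ (f' x) (y - x)) :
    StrictConvexOn ℝ S f := by
  refine ⟨hS, fun x hx y hy hxy a c ha hc hac => ?_⟩
  have hz : a • x + c • y ∈ S := hS hx hy ha.le hc.le hac
  obtain rfl : a = 1 - c := by linarith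
  have ex : x - ((1 - c) • x + c • y) = c • (x - y) := by module
  have ey : y - ((1 - c) • x + c • y) = -((1 - c) • (x - y)) := by module
  have hne : x - y ≠ 0 := sub_ne_zero.2 hxy
  have h1 := h _ hz x hx fun e => (smul_ne_zero hc.ne' hne) (by rw [← ex, e, sub_self])
  have h2 := h _ hz y hy fun e => (smul_ne_zero ha.ne' hne) (by
    rw [← neg_eq_zero, ← ey, e, sub_self])
  rw [ex, real_inner_smul_right] at h1
  rw [ey, inner_neg_right, real_inner_smul_right] at h2
  simp only [smul_eq_mul]
  nlinarith [mul_pos ha h1, mul_pos hc h2]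

theorem primitive_mem_Sob0 (h : Hk0 b ξ d k₀ k₁ 3) {k : ℝ} (hk : k ∈ Icc k₀ k₁) :
    ∫ κ in k..k₁, h.1 κ ∈ Sob0 b ξ d 3 := by
  have hh : ∀ᵐ k ∂(volume.restrict (Icc k₀ k₁)), h.1 k ∈ Sob0 b ξ d 3 := h.2
  have hsub : Ioc k k₁ ⊆ Icc k₀ k₁ := fun x hx => ⟨hk.1.trans hx.1.le, hx.2⟩
  rw [intervalIntegral.integral_of_le hk.2]
  exact integral_mem_Sob0 (IntegrableOn.mono_set (Lp_integrable h.1) hsub)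
    (ae_restrict_of_ae_restrict_of_subset hsub hh)

/-- The parameters of the strict convexity estimate. -/
theorem exists_param_bound (A : ℝ) :
    ∃ lam₁ : ℝ, 1 ≤ lam₁ ∧ ∀ lam, lam₁ ≤ lam → A * (lam ^ (-1 / 4 : ℝ)) ^ 2 ≤ 1 / 4 := by
  refine ⟨max 1 ((4 * A) ^ 2), le_max_left _ _, fun lam h => ?_⟩
  have h1 : 1 ≤ lam := (le_max_left _ _).trans h
  have l0 : 0 < lam := by linarith
  have h2 : 4 * A ≤ √lam := Real.le_sqrt_of_sq_le ((le_max_right _ _).trans h)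
  have e : (lam ^ (-1 / 4 : ℝ)) ^ 2 = (√lam)⁻¹ := by
    rw [← Real.rpow_natCast, ← Real.rpow_mul l0.le, Real.sqrt_eq_rpow, ← Real.rpow_neg l0.le]
    norm_num
  have hs : 0 < √lam := Real.sqrt_pos.2 l0
  rw [e, ← div_eq_mul_inv, div_le_iff₀ hs]
  linarith

theorem exists_weightedBounds (hb : 0 < b) (hlt : -ξ < d) (hs : ξ < s) (hν : 0 < ν)
    {B : Sob (box b ξ d) 3 →L[ℝ] Sob (box b ξ d) 3 →L[ℝ] L2 (box b ξ d)}
    (hB : ∀ u v, B u v = ∑ i, mulL (wD1 u i) (wD1 v i)) :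
    ∃ K : ℝ, 0 < K ∧ ∀ (lam : ℝ) (_ : 1 ≤ lam) (hlam : 0 ≤ lam),
      WeightedBounds (Sob0 b ξ d 3) (lapL _ 3) (imDz _ 3) B (theta hs hν.le hlam) K
        (lam ^ (-1 / 4 : ℝ)) := by
  obtain ⟨K, hK, H⟩ := exists_weighted_bounds hb hlt hs hν hB
  refine ⟨K, hK, fun lam h1 hlam u hu => ?_⟩
  have e : (lam ^ (-1 / 4 : ℝ)) ^ 2 = lam ^ (-1 / 2 : ℝ) := by
    rw [← Real.rpow_natCast, ← Real.rpow_mul hlam]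
    norm_num
  rw [e]
  exact H lam h1 hlam u hu

/-- The derivative of the weighted functional and its strict convexity on bounded sets of tails,
data and arguments. -/
theorem exists_convexity (hb : 0 < b) (hlt : -ξ < d) (hs : ξ < s) (hν : 0 < ν) (hk₀ : 0 ≤ k₀)
    (h01 : k₀ ≤ k₁) {R MF MV : ℝ} (hR : 0 ≤ R) (hMF : 0 ≤ MF) (hMV : 0 ≤ MV) :
    ∃ lam₁ C₁ : ℝ, 1 ≤ lam₁ ∧ 0 < C₁ ∧ ∀ (V : Sob (box b ξ d) 3) (F : Hk (box b ξ d) k₀ k₁ 4),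
      ‖V‖ ≤ MV → ‖F‖ ≤ MF → ∀ lam ρ : ℝ, 0 < lam → 0 < ρ →
      (∀ p, IntegralConverges b ξ d s ν k₀ k₁ lam V F p) ∧
      ∃ J' : Hk0 b ξ d k₀ k₁ 3 → Hk0 b ξ d k₀ k₁ 3,
        (∀ p, HasFDerivAt (J b ξ d s ν k₀ k₁ lam ρ V F) (innerSL ℝ (J' p)) p) ∧
        (lam₁ ≤ lam → ∀ p₁ ∈ Metric.closedBall (0 : Hk0 b ξ d k₀ k₁ 3) R,
          ∀ p₂ ∈ Metric.closedBall (0 : Hk0 b ξ d k₀ k₁ 3) R,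
          C₁ / lam * ‖kincl (m := 2) (by norm_num) (p₂ - p₁).1‖ ^ 2 + ρ * ‖p₂ - p₁‖ ^ 2 ≤
            J b ξ d s ν k₀ k₁ lam ρ V F p₂ - J b ξ d s ν k₀ k₁ lam ρ V F p₁ -
              inner ℝ (J' p₁) (p₂ - p₁) ∧
          C₁ * ‖kincl (m := 1) (by norm_num) (p₂ - p₁).1‖ ^ 2 + ρ * ‖p₂ - p₁‖ ^ 2 ≤
            J b ξ d s ν k₀ k₁ lam ρ V F p₂ - J b ξ d s ν k₀ k₁ lam ρ V F p₁ -
              inner ℝ (J' p₁) (p₂ - p₁)) := by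
  obtain ⟨B, hB⟩ := exists_gradMul (ξ := ξ) (d := d) hb hlt
  obtain ⟨K, hK, HK⟩ := exists_weightedBounds hb hlt hs hν hB
  obtain ⟨C, hC, HC⟩ := exists_norm_kincl_le (b := b) (d := d) hb hlt hs hν
  set r := √(k₁ - k₀) with hr
  have r0 : 0 ≤ r := Real.sqrt_nonneg _
  have k10 : 0 ≤ k₁ := hk₀.trans h01
  set m := 1 + K + k₁ + r + (R + MF) + MV + r * (R + MF) + r * (2 * R) with hm
  have p1 : 0 ≤ r * (R + MF) := by positivity
  have p2 : 0 ≤ r * (2 * R) := by positivity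
  have hKm : K ≤ m := by linarith
  clear_value m
  obtain ⟨lam₁, hlam₁, Hlam₁⟩ :=
    -- The only largeness requirement on λ beyond λ ≥ 1: it makes the perturbation at most a
    -- quarter, which leaves 1/2 - 1/4 of the principal part and hence the constant `C / 4`.
    exists_param_bound (252 * m ^ 8 * (1 + (k₁ - k₀) + m ^ 2))
  refine ⟨lam₁, C / 4, hlam₁, by positivity, fun V F hV hF lam ρ hlam hρ => ?_⟩
  obtain ⟨c₀, ℓ, β, hΦ, hβ⟩ := exists_quadMap (k₀ := k₀) (k₁ := k₁) (lapL (box b ξ d) 3)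
    (imDz (box b ξ d) 3) B V
  refine ⟨fun p => (functional_eq hb hlt hs hν.le hlam.le hB V hΦ F p).1, ?_⟩
  obtain ⟨J', hJ', hrem⟩ := exists_gradient_quad (Hk0 b ξ d k₀ k₁ 3)
    ((theta hs hν.le hlam.le).compLpL 2 (volume.restrict (Icc k₀ k₁))) c₀ ℓ β
    (kincl (by norm_num) F) (Real.exp (-2 * lam * (s + d) ^ (-ν))) ρ rfl
    (f := J b ξ d s ν k₀ k₁ lam ρ V F)
    (fun p => (functional_eq hb hlt hs hν.le hlam.le hB V hΦ F p).2 ρ)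
  refine ⟨J', hJ', fun hl p₁ hp₁ p₂ hp₂ => ?_⟩
  have h1 : 1 ≤ lam := hlam₁.trans hl
  have hp₁' : ‖p₁.1‖ ≤ R := mem_closedBall_zero_iff.1 hp₁
  have hp₂' : ‖p₂.1‖ ≤ R := mem_closedBall_zero_iff.1 hp₂
  have hrem' := hrem p₁ (p₂ - p₁)
  rw [add_sub_cancel] at hrem'
  have hq : ‖p₁.1 + kincl (show 3 ≤ 4 by norm_num) F‖ ≤ R + MF :=
    (norm_add_le _ _).trans (add_le_add hp₁' ((norm_kincl_le _ F).trans hF))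
  have hh : ‖(p₂ - p₁).1‖ ≤ 2 * R := by
    rw [Submodule.coe_sub]
    refine (norm_sub_le _ _).trans ?_
    linarith
  have hε : 252 * m ^ 8 * (lam ^ (-1 / 4 : ℝ)) ^ 2 * (1 + (k₁ - k₀) + m ^ 2) ≤ 1 / 4 := by
    refine le_of_eq_of_le ?_ (Hlam₁ lam hl)
    ring
  have hq2 := mul_le_mul_of_nonneg_left hq r0
  have hh2 := mul_le_mul_of_nonneg_left hh r0
  have low := remainder_lower_bound (gradMul_comm hB) ((HK lam h1 hlam.le).mono hKm
    (Real.rpow_nonneg hlam.le _)) (by linarith) (Real.rpow_nonneg hlam.le _) hk₀ h01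
    (by linarith) (by linarith) hε hΦ (hβ (p₂ - p₁).1) (p₂ - p₁).2
    (by filter_upwards [ae_mem_Icc] with k hk using primitive_mem_Sob0 (p₂ - p₁) hk)
    (hq.trans (by linarith)) (by linarith) (by linarith)
  have e0 : 0 < Real.exp (-2 * lam * (s + d) ^ (-ν)) := Real.exp_pos _
  have low2 := mul_le_mul_of_nonneg_left low e0.le
  obtain ⟨f2, f1⟩ := HC lam h1 hlam.le k₀ k₁ (p₂ - p₁)
  rw [hrem']
  clear hrem hrem' hΦ hβ low
  constructor
  · refine add_le_add_left (le_trans ?_ low2) _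
    calc _ = 1 / 4 * (C / lam * ‖kincl (show 2 ≤ 3 by norm_num) (p₂ - p₁).1‖ ^ 2) := by ring
      _ ≤ 1 / 4 * _ := mul_le_mul_of_nonneg_left f2 (by norm_num)
      _ = _ := by ring
  · refine add_le_add_left (le_trans ?_ low2) _
    calc _ = 1 / 4 * (C * ‖kincl (show 1 ≤ 3 by norm_num) (p₂ - p₁).1‖ ^ 2) := by ring
      _ ≤ 1 / 4 * _ := mul_le_mul_of_nonneg_left f1 (by norm_num)
      _ = _ := by ring

end

end ConvexInverseScattering

end

theorem theorem4p3 (b ξ d s : ℝ) (hb : 0 < b) (hξ : 0 < ξ) (hd : 0 < d) (hs : ξ < s) :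
    ∃ ν₀ lam₀ : ℝ, 1 ≤ ν₀ ∧ 1 ≤ lam₀ ∧
    ∀ ν : ℝ, ν₀ ≤ ν →
    CarlemanEstimate b ξ d s ν lam₀ ∧
    ∀ (k₀ k₁ : ℝ), 0 < k₀ → k₀ < k₁ → ∀ R : ℝ, 0 < R → ∀ MF MV : ℝ,
    ∃ lam₁ C₁ : ℝ, lam₀ ≤ lam₁ ∧ 0 < C₁ ∧
    ∀ δ : ℝ, 0 < δ → δ < 1 →
    -- the noisy and the exact data of the tail problem
    ∀ (ψ₀ ψ₁ ψ₀s ψ₁s : L2Gam b)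
      (Q Qs Vs : Sob (box b ξ d) 3),
    HasBoundaryData b ξ d Q ψ₀ ψ₁ →
    HasBoundaryData b ξ d Qs ψ₀s ψ₁s →
    HasBoundaryData b ξ d Vs ψ₀s ψ₁s →
    lap Vs = 0 →
    ‖Q - Qs‖ < δ → ‖Vs‖ ≤ MV →
    -- the noisy and the exact data of the integro-differential equation
    ∀ (φ₀ φ₁ φ₀s φ₁s : ℝ → L2Gam b)
      (F Fs : Hk (box b ξ d) k₀ k₁ 4),
    (∀ᵐ k ∂(volume.restrict (Icc k₀ k₁)),
      HasBoundaryData b ξ d (F k) (φ₀ k) (φ₁ k)) →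
    (∀ᵐ k ∂(volume.restrict (Icc k₀ k₁)),
      HasBoundaryData b ξ d (Fs k) (φ₀s k) (φ₁s k)) →
    ‖F - Fs‖ < δ → ‖Fs‖ ≤ MF →
    -- the regularized tail is well defined, and it is the tail in the functional
    (∃! W, IsTailMinimizer b ξ d s ν δ Q W) ∧
    ∀ W, IsTailMinimizer b ξ d s ν δ Q W →
    ∀ lam ρ : ℝ, 0 < lam → 0 < ρ →
    (∀ p, IntegralConverges b ξ d s ν k₀ k₁ lam (W.1 + Q) F p) ∧
    ∃ J' : Hk0 b ξ d k₀ k₁ 3 → Hk0 b ξ d k₀ k₁ 3,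
      (∀ p, HasFDerivAt (J b ξ d s ν k₀ k₁ lam ρ (W.1 + Q) F)
        (innerSL ℝ (J' p)) p) ∧
      (lam₁ ≤ lam →
        StrictConvexOn ℝ (Metric.closedBall 0 R)
          (J b ξ d s ν k₀ k₁ lam ρ (W.1 + Q) F) ∧
        ∀ p₁ ∈ Metric.closedBall (0 : Hk0 b ξ d k₀ k₁ 3) R,
        ∀ p₂ ∈ Metric.closedBall (0 : Hk0 b ξ d k₀ k₁ 3) R,
          C₁ / lam * ‖kincl (m := 2) (by norm_num) (p₂ - p₁).1‖ ^ 2 +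
              ρ * ‖p₂ - p₁‖ ^ 2 ≤
            J b ξ d s ν k₀ k₁ lam ρ (W.1 + Q) F p₂ -
              J b ξ d s ν k₀ k₁ lam ρ (W.1 + Q) F p₁ -
              inner ℝ (J' p₁) (p₂ - p₁) ∧
          C₁ * ‖kincl (m := 1) (by norm_num) (p₂ - p₁).1‖ ^ 2 +
              ρ * ‖p₂ - p₁‖ ^ 2 ≤
            J b ξ d s ν k₀ k₁ lam ρ (W.1 + Q) F p₂ -
              J b ξ d s ν k₀ k₁ lam ρ (W.1 + Q) F p₁ -
              inner ℝ (J' p₁) (p₂ - p₁)) := by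
  have hlt : -ξ < d := by linarith
  -- The Carleman estimate has been proved for every ν > 0 and every λ ≥ 1, so both thresholds can
  -- be 1.
  refine ⟨1, 1, le_rfl, le_rfl, fun ν hν1 => ?_⟩
  have hν : 0 < ν := by linarith
  refine ⟨carlemanEstimate_one hb hlt hs hν, fun k₀ k₁ hk₀ h01 R hR MF MV => ?_⟩
  -- The noise level is below 1, so ‖F‖ exceeds ‖F_*‖ by less than 1. The square root is the
  -- δ-independent bound of the tail.
  obtain ⟨lam₁, C₁, hl, hC, H⟩ := exists_convexity (b := b) (d := d) hb hlt hs hν hk₀.le h01.le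
    hR.le (show 0 ≤ |MF| + 1 by positivity) (Real.sqrt_nonneg (9 + (MV + 1) ^ 2))
  refine ⟨lam₁, C₁, hl, hC, fun δ hδ hδ1 ψ₀ ψ₁ ψ₀s ψ₁s Q Qs Vs _ hQs hVs hlap hQ hMV φ₀ φ₁ φ₀s φ₁s
    F Fs _ _ hF hMF => ⟨existsUnique_tail hs hν.le (tail_mu_nonneg hs hlt hν hδ hδ1) hδ Q,
      fun W hW lam ρ hlam hρ => ?_⟩⟩
  have hV : ‖W.1 + Q‖ ≤ √(9 + (MV + 1) ^ 2) :=
    Real.le_sqrt_of_sq_le (norm_tail_sq_le hs hlt hν hδ hδ1 hQs hVs hlap hQ hMV hW)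
  have hFn : ‖F‖ ≤ |MF| + 1 := by
    have h1 := norm_add_le (F - Fs) Fs
    rw [sub_add_cancel] at h1
    linarith [le_abs_self MF]
  obtain ⟨hconv, J', hJ', hlow⟩ := H (W.1 + Q) F hV hFn lam ρ hlam hρ
  -- Strict convexity follows from the lower bound: the regularization term ρ ‖p₂ - p₁‖² is already
  -- positive for distinct points.
  refine ⟨hconv, J', hJ', fun hl1 => ⟨strictConvexOn_of_gradient (f' := J')
    (convex_closedBall _ _) fun p₁ hp₁ p₂ hp₂ hne => ?_, hlow hl1⟩⟩
  have h2 := (hlow hl1 p₁ hp₁ p₂ hp₂).2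
  have h3 : 0 < ρ * ‖p₂ - p₁‖ ^ 2 := by
    have : 0 < ‖p₂ - p₁‖ := norm_pos_iff.2 (sub_ne_zero.2 hne.symm)
    positivity
  have h4 : 0 ≤ C₁ * ‖kincl (show 1 ≤ 3 by norm_num) (p₂ - p₁).1‖ ^ 2 := by positivity
  linarith
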